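/- **Theorem (local monotonicity formula).** Let $(M,g)$ be a closed (compact, without boundary) smooth Riemannian manifold of dimension $n$ whose injectivity radius is greater than $1$. Fix a test function $\phi\in C^\infty(\mathbb{R}^n)$ with support contained in the unit ball $B_1(0)$ and with $\phi=1$ on $B_{1/2}(0)$. Then there is a constant $C>0$, depending only on $(M,g)$ and on the fixed function $\phi$, such that the following holds. Let $J(t)$, $t\in[0,T)$, be a smooth solution on $M\times[0,T)$ of the harmonic heat flow $$\partial_t J=\Delta_g J-J\nabla_pJ\nabla_pJ,\qquad (J\nabla_pJ\nabla_pJ)_j^k=g^{pq}J_j^a\nabla_pJ_a^b\nabla_qJ_b^k,$$ where $\Delta_g$ is the rough Laplacian and $J(0)$ is an almost complex structure compatible with $g$ (that is, $J(0)^2=-\mathrm{id}$ and $g(J(0)\cdot,J(0)\cdot)=g$), and let $E_0=\int_M|\nabla J(0)|^2\,dv$ be its initial energy. Let $y\in M$, let $x=(x_1,\dots,x_n)$ be normal coordinates centred at $y$, which identify the geodesic ball $B_1(y)\subset M$ with $B_1(0)\subset\mathbb{R}^n$, and let $0<T_0\le T$. For $t<T_0$ set $$Z(t)=(T_0-t)\int_{\mathbb{R}^n}|\nabla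 J(t)|^2\,G\,\phi^2\sqrt{|g|}\,dx,\qquad G(x,t)=\frac{1}{(4\pi(T_0-t))^{n/2}}\exp\Big(-\frac{|x|^2}{4(T_0-t)}\Big),$$ where $|\nabla J|^2$ (the norm being taken with respect to $g$) and $|g|=\det(g_{ij})$ are expressed in the coordinates $x$, and let $$f(t)=-(T_0-t)\ln^2(T_0-t)+2(T_0-t)\ln(T_0-t)-3(T_0-t).$$ Then for all $t_1,t_2$ with $T_0-\min\{T_0,1\}<t_1\le t_2<T_0$ and all $N>1$, $$Z(t_2)\le e^{C(f(t_2)-f(t_1))}Z(t_1)+C\Big(N^{n/2}\big(E_0+\sqrt{E_0}\big)+\frac{1}{\ln^2N}\Big)(t_2-t_1).$$ -/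

import Mathlib

open scoped Manifold ContDiff
open Set MeasureTheory

noncomputable section

/-! ### Tensor calculus in local coordinates

A Riemannian metric on (an open part of) `ℝⁿ` is given by its Gram matrix `h x i j = g_{ij}(x)`, and a
field of endomorphisms by its matrix `A x k j = A_j^k(x)` (upper index `k`, lower index `j`, so
that `A ∂_j = ∑ k, A_j^k ∂_k`). All formulas use the Levi-Civita connection of `h`. -/

namespace Coord

variable {n : ℕ}

/-- The partial derivative `∂f/∂x_i`. -/
def partialDeriv (i : Fin n) (f : EuclideanSpace ℝ (Fin n) → ℝ) (x : EuclideanSpace ℝ (Fin n)) : ℝ :=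
  fderiv ℝ f x (EuclideanSpace.single i 1)

/-- The Christoffel symbol
`Γ^k_{ij} = ½ g^{kl} (∂_i g_{jl} + ∂_j g_{il} - ∂_l g_{ij})`. -/
def christoffel (h : EuclideanSpace ℝ (Fin n) → Matrix (Fin n) (Fin n) ℝ)
    (x : EuclideanSpace ℝ (Fin n)) (k i j : Fin n) : ℝ :=
  (1 / 2 : ℝ) * ∑ l, (h x)⁻¹ k l *
    (partialDeriv i (fun z => h z j l) x + partialDeriv j (fun z => h z i l) x
      - partialDeriv l (fun z => h z i j) x)

/-- The covariant derivative `∇_p A_j^k = ∂_p A_j^k + Γ^k_{lp} A_j^l - Γ^l_{jp} A_l^k`. -/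
def covDeriv (h A : EuclideanSpace ℝ (Fin n) → Matrix (Fin n) (Fin n) ℝ)
    (x : EuclideanSpace ℝ (Fin n)) (p k j : Fin n) : ℝ :=
  partialDeriv p (fun z => A z k j) x
    + ∑ l, christoffel h x k l p * A x l j
    - ∑ l, christoffel h x l j p * A x k l

/-- The second covariant derivative `∇_p ∇_q A_j^k`, i.e. the covariant derivative in the
direction `∂_p` of the tensor `∇_q A_j^k`. -/
def covDeriv₂ (h A : EuclideanSpace ℝ (Fin n) → Matrix (Fin n) (Fin n) ℝ)
    (x : EuclideanSpace ℝ (Fin n)) (p q k j : Fin n) : ℝ :=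
  partialDeriv p (fun z => covDeriv h A z q k j) x
    + ∑ l, christoffel h x k l p * covDeriv h A x q l j
    - ∑ l, christoffel h x l j p * covDeriv h A x q k l
    - ∑ l, christoffel h x l q p * covDeriv h A x l k j

/-- The rough Laplacian `(Δ_g A)_j^k = g^{pq} ∇_p ∇_q A_j^k`. -/
def roughLaplacian (h A : EuclideanSpace ℝ (Fin n) → Matrix (Fin n) (Fin n) ℝ)
    (x : EuclideanSpace ℝ (Fin n)) (k j : Fin n) : ℝ :=
  ∑ p, ∑ q, (h x)⁻¹ p q * covDeriv₂ h A x p q k j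

/-- The cubic term `(A ∇_p A ∇_p A)_j^k = g^{pq} A_j^a ∇_p A_a^b ∇_q A_b^k`. -/
def cubicTerm (h A : EuclideanSpace ℝ (Fin n) → Matrix (Fin n) (Fin n) ℝ)
    (x : EuclideanSpace ℝ (Fin n)) (k j : Fin n) : ℝ :=
  ∑ p, ∑ q, ∑ a, ∑ b, (h x)⁻¹ p q * A x a j * covDeriv h A x p b a * covDeriv h A x q k b

/-- `|∇A|² = g_{i₁i₂} g^{j₁j₂} g^{k₁k₂} ∇_{k₁} A_{j₁}^{i₁} ∇_{k₂} A_{j₂}^{i₂}`. -/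
def gradNormSq (h A : EuclideanSpace ℝ (Fin n) → Matrix (Fin n) (Fin n) ℝ)
    (x : EuclideanSpace ℝ (Fin n)) : ℝ :=
  ∑ i₁, ∑ i₂, ∑ j₁, ∑ j₂, ∑ k₁, ∑ k₂, h x i₁ i₂ * (h x)⁻¹ j₁ j₂ * (h x)⁻¹ k₁ k₂ *
    covDeriv h A x k₁ i₁ j₁ * covDeriv h A x k₂ i₂ j₂

/-- The geodesic equation `c̈^k + Γ^k_{ij}(c) ċ^i ċ^j = 0` for a curve, at the time `s`. -/
def GeodesicEqAt (h : EuclideanSpace ℝ (Fin n) → Matrix (Fin n) (Fin n) ℝ)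
    (c : ℝ → EuclideanSpace ℝ (Fin n)) (s : ℝ) : Prop :=
  ∀ k, deriv (deriv c) s k
    + ∑ i, ∑ j, christoffel h (c s) k i j * deriv c s i * deriv c s j = 0

end Coord

/-! ### Riemannian manifolds -/

section Manifold

variable {n : ℕ} {M : Type*} [TopologicalSpace M] [ChartedSpace (EuclideanSpace ℝ (Fin n)) M]
  [IsManifold (𝓡 n) ∞ M]

/-- A smooth Riemannian metric on the `n`-manifold `M`. -/
abbrev RiemMetric (n : ℕ) (M : Type*) [TopologicalSpace M]
    [ChartedSpace (EuclideanSpace ℝ (Fin n)) M] [IsManifold (𝓡 n) ∞ M] :=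
  Bundle.ContMDiffRiemannianMetric (𝓡 n) ∞ (EuclideanSpace ℝ (Fin n))
    (TangentSpace (𝓡 n) : M → Type _)

/-- A field of endomorphisms of the tangent bundle (no regularity). -/
abbrev EndoField (n : ℕ) (M : Type*) [TopologicalSpace M]
    [ChartedSpace (EuclideanSpace ℝ (Fin n)) M] :=
  (q : M) → TangentSpace (𝓡 n) q →L[ℝ] TangentSpace (𝓡 n) q

/-- The coordinate vector field `∂_i` of the chart `e`, at the point with coordinates `x`. -/
def coordVec (e : OpenPartialHomeomorph M (EuclideanSpace ℝ (Fin n)))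
    (x : EuclideanSpace ℝ (Fin n)) (i : Fin n) : TangentSpace (𝓡 n) (e.symm x) :=
  mfderiv (𝓡 n) (𝓡 n) e.symm x (EuclideanSpace.single i (1 : ℝ) : EuclideanSpace ℝ (Fin n))

/-- The components `g_{ij}(x) = g(∂_i, ∂_j)` of the metric in the chart `e`. -/
def metricCoord (g : RiemMetric n M) (e : OpenPartialHomeomorph M (EuclideanSpace ℝ (Fin n)))
    (x : EuclideanSpace ℝ (Fin n)) : Matrix (Fin n) (Fin n) ℝ :=
  fun i j => g.inner (e.symm x) (coordVec e x i) (coordVec e x j)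

/-- The components `J_j^k(x) = dx_k(J ∂_j)` of an endomorphism field in the chart `e`
(row `k`, column `j`). -/
def endoCoord (J : EndoField n M) (e : OpenPartialHomeomorph M (EuclideanSpace ℝ (Fin n)))
    (x : EuclideanSpace ℝ (Fin n)) : Matrix (Fin n) (Fin n) ℝ :=
  fun k j => (show EuclideanSpace ℝ (Fin n) from
    mfderiv (𝓡 n) (𝓡 n) e (e.symm x) (J (e.symm x) (coordVec e x j))) k

/-- The function `|∇J|²` on `M`, computed at each point in the preferred chart there. -/
def gradNormSq (g : RiemMetric n M) (J : EndoField n M) (q : M) : ℝ :=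
  Coord.gradNormSq (metricCoord g (chartAt (EuclideanSpace ℝ (Fin n)) q))
    (endoCoord J (chartAt (EuclideanSpace ℝ (Fin n)) q))
    (chartAt (EuclideanSpace ℝ (Fin n)) q q)

/-- The measure `√|g| dx` of the chart `e`, as a measure on `M` carried by the domain of `e`. -/
def chartVolume [MeasurableSpace M] (g : RiemMetric n M)
    (e : OpenPartialHomeomorph M (EuclideanSpace ℝ (Fin n))) : Measure M :=
  ((volume.restrict e.target).withDensity
    (fun x => ENNReal.ofReal (Real.sqrt (metricCoord g e x).det))).map e.symm

/-- The Riemannian volume measure `dv`. The measures `√|g| dx` of the charts agree on the overlaps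
of the charts, and their supremum in the lattice of measures is the measure glued from them. -/
def riemVolume [MeasurableSpace M] (g : RiemMetric n M) : Measure M :=
  ⨆ q : M, chartVolume g (chartAt (EuclideanSpace ℝ (Fin n)) q)

/-- The energy `E(J) = ∫_M |∇J|² dv`. -/
def energy [MeasurableSpace M] (g : RiemMetric n M) (J : EndoField n M) : ℝ :=
  ∫ q, gradNormSq g J q ∂(riemVolume g)

/-- `e` is a (geodesic) normal coordinate system centred at `y`, defined on a geodesic ball of
radius `r`: a smooth chart onto the Euclidean ball `B_r(0)` mapping `y` to `0`, such that
`g_{ij}(0) = δ_{ij}` and the rays `s ↦ s v` are geodesics. Equivalently, the inverse of `e` is the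
exponential map at `y`, composed with a linear isometry `ℝⁿ ≅ T_y M`, and it is a diffeomorphism
from `B_r(0)` onto its image. -/
structure IsNormalCoordinates (g : RiemMetric n M) (y : M) (r : ℝ)
    (e : OpenPartialHomeomorph M (EuclideanSpace ℝ (Fin n))) : Prop where
  mem_maximalAtlas : e ∈ IsManifold.maximalAtlas (𝓡 n) ∞ M
  target_eq : e.target = Metric.ball 0 r
  mem_source : y ∈ e.source
  map_center : e y = 0
  metric_center : metricCoord g e 0 = 1
  geodesic : ∀ (v : EuclideanSpace ℝ (Fin n)) (s : ℝ), s • v ∈ Metric.ball 0 r →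
    Coord.GeodesicEqAt (metricCoord g e) (fun u => u • v) s

/-- The injectivity radius at `y`: the supremum of the radii `r` such that the exponential map at
`y` is a diffeomorphism from the ball of radius `r` onto its image. -/
def injectivityRadiusAt (g : RiemMetric n M) (y : M) : ENNReal :=
  sSup {ρ | ∃ (r : ℝ) (e : OpenPartialHomeomorph M (EuclideanSpace ℝ (Fin n))),
    IsNormalCoordinates g y r e ∧ ρ = ENNReal.ofReal r}

/-- The injectivity radius of `(M, g)`. -/
def injectivityRadius (g : RiemMetric n M) : ENNReal :=
  ⨅ y : M, injectivityRadiusAt g y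

/-- `J` is an almost complex structure compatible with `g`: `J² = -id` and `g(J, J) = g`. -/
structure IsCompatibleACS (g : RiemMetric n M) (J : EndoField n M) : Prop where
  sq_eq_neg : ∀ (q : M) (v : TangentSpace (𝓡 n) q), J q (J q v) = -v
  isometry : ∀ (q : M) (v w : TangentSpace (𝓡 n) q),
    g.inner q (J q v) (J q w) = g.inner q v w

/-- `J(t)`, `t ∈ [0, T)`, is a smooth solution on `M × [0, T)` of the harmonic heat flow
`∂_t J = Δ_g J - J ∇_p J ∇_p J`, starting from an almost complex structure `J(0)` compatible
with `g`. -/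
structure IsHarmonicHeatFlow (g : RiemMetric n M) (T : ℝ) (J : ℝ → EndoField n M) : Prop where
  smooth : ∀ e ∈ IsManifold.maximalAtlas (𝓡 n) ∞ M, ∀ k j,
    ContDiffOn ℝ ∞ (fun z : EuclideanSpace ℝ (Fin n) × ℝ => endoCoord (J z.2) e z.1 k j)
      (e.target ×ˢ Ico 0 T)
  initial : IsCompatibleACS g (J 0)
  flow : ∀ e ∈ IsManifold.maximalAtlas (𝓡 n) ∞ M, ∀ x ∈ e.target, ∀ t ∈ Ico 0 T, ∀ k j,
    HasDerivWithinAt (fun s => endoCoord (J s) e x k j)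
      (Coord.roughLaplacian (metricCoord g e) (endoCoord (J t) e) x k j
        - Coord.cubicTerm (metricCoord g e) (endoCoord (J t) e) x k j)
      (Ico 0 T) t

/-- The Euclidean backward heat kernel `G = (4π(T₀ - t))^{-n/2} exp(-|x|² / (4(T₀ - t)))`. -/
def backwardHeatKernel (T₀ t : ℝ) (x : EuclideanSpace ℝ (Fin n)) : ℝ :=
  1 / (4 * Real.pi * (T₀ - t)) ^ ((n : ℝ) / 2) * Real.exp (-‖x‖ ^ 2 / (4 * (T₀ - t)))

/-- `Z(t) = (T₀ - t) ∫_{ℝⁿ} |∇J(t)|² G φ² √|g| dx`, computed in the coordinates `e`; the integrand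
is zero outside the support of `φ`. -/
def localZ (g : RiemMetric n M) (J : ℝ → EndoField n M)
    (e : OpenPartialHomeomorph M (EuclideanSpace ℝ (Fin n)))
    (φ : EuclideanSpace ℝ (Fin n) → ℝ) (T₀ t : ℝ) : ℝ :=
  (T₀ - t) * ∫ x, Coord.gradNormSq (metricCoord g e) (endoCoord (J t) e) x
    * backwardHeatKernel T₀ t x * φ x ^ 2 * Real.sqrt (metricCoord g e x).det

end Manifold

/-- `f(t) = -(T₀ - t) ln²(T₀ - t) + 2 (T₀ - t) ln(T₀ - t) - 3 (T₀ - t)`. -/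
def monotonicityWeight (T₀ t : ℝ) : ℝ :=
  -(T₀ - t) * Real.log (T₀ - t) ^ 2 + 2 * (T₀ - t) * Real.log (T₀ - t) - 3 * (T₀ - t)

end

/-!
The quantity `Z` is differentiated in a fixed normal chart, and the derivative is estimated so that
Gronwall's inequality applies with the integrating factor `exp (-C f)`, where
`f' = 1 + ln² (T₀ - t)`.

Write `τ = T₀ - t`, `D_p = ∇_p J`, `V = ∂_t J`, `X = x^q D_q` and `e = |∇J|²`. In normal coordinates
the Gauss lemma `g_{pq} x^q = x_p` turns the derivative of the Euclidean heat kernel into the radial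
derivative `X`. Adding to `∂_t (τ e G φ²)` the divergences of `⟨V, D⟩ G φ²`, of `⟨X, D⟩ G φ²` and of
the radial field `x e G φ²` completes the square (`ComplexFlowOn.deriv_localized_eq`): the main term
is `-2 τ |V - X / (2 τ)|² G φ²`, and there remain terms with derivatives of `φ`, a curvature term of
size `|x| √e`, and terms of size `|x|² e` which measure the failure of `g` to be Euclidean. This
requires `⟨X, ΔJ⟩ = ⟨X, V⟩`, i.e. that the cubic term is orthogonal to the endomorphisms
anticommuting with `J`; hence `J(t)` has to be a compatible almost complex structure for all times.
The defects `J² + 1` and `J + J^*` solve linear parabolic systems, and the maximum principle on the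
compact manifold (`TimeScalar.nonpos`) shows that they stay zero.

The errors are bounded by a constant which depends only on `(M, g)` and `φ`. The curvature is bounded
on `M` (`exists_curvature_bound`). In normal coordinates the radial connection matrix
`P^k_p = Γ^k_{pl} x^l` satisfies the Riccati equation `x^l ∂_l P = -P - P² - R(·, x) x`; comparison
along rays gives `|P| ≤ C |x|²` (`IsNormal.abs_vpair_radConn_le`), and thereby all the bounds of the
metric that are used. No compactness of the family of normal charts is needed.

The terms with derivatives of `φ` live where `|x| ≥ 1/2`, so that `G` is bounded, and are controlled
by the energy, which is nonincreasing (`IsHarmonicHeatFlow.energy_le`; the boundary terms of a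
partition of unity cancel). Next, `|x|² G ≤ n τ (1 + ln² τ) G + 1`, because `G ≤ 1` where `|x|²`
exceeds `n τ (1 + ln² τ)`. Finally `|x| √e` is split according to `τ ≤ 1/N` or `τ ≥ 1/N`
(`setIntegral_norm_mul_sqrt_le`): in the first case it is at most
`(τ ln² τ e + |x|² / (τ ln² τ)) / 2`, whose second part has the integral `O(1 / ln² N)` against `G`;
in the second case `G ≤ N^{n/2}`, and the Cauchy–Schwarz inequality gives `N^{n/2} √E₀`.

A tensor is encoded by the matrix-valued function of its components in a chart; objects on the
manifold are families of such functions over the maximal atlas that are compatible with changes of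
coordinates (`ChartInvariant`).
-/

noncomputable section

/-! ### Matrix-valued functions and the Levi-Civita connection in coordinates -/

/-- Euclidean coordinate space. -/
abbrev Eu (n : ℕ) := EuclideanSpace ℝ (Fin n)

/-- Real square matrices. -/
abbrev Mat (n : ℕ) := Matrix (Fin n) (Fin n) ℝ

namespace Coord

section Calculus

variable {n : ℕ} {x : Eu n} {f g : Eu n → ℝ} {Ω : Set (Eu n)}

lemma partialDeriv_add (p : Fin n) (hf : DifferentiableAt ℝ f x) (hg : DifferentiableAt ℝ g x) :
    partialDeriv p (fun z => f z + g z) x = partialDeriv p f x + partialDeriv p g x := by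
  simp [partialDeriv, fderiv_fun_add hf hg]

lemma partialDeriv_sub (p : Fin n) (hf : DifferentiableAt ℝ f x) (hg : DifferentiableAt ℝ g x) :
    partialDeriv p (fun z => f z - g z) x = partialDeriv p f x - partialDeriv p g x := by
  simp [partialDeriv, fderiv_fun_sub hf hg]

lemma partialDeriv_mul (p : Fin n) (hf : DifferentiableAt ℝ f x) (hg : DifferentiableAt ℝ g x) :
    partialDeriv p (fun z => f z * g z) x
      = partialDeriv p f x * g x + f x * partialDeriv p g x := by
  simp [partialDeriv, fderiv_fun_mul hf hg]
  ring

lemma partialDeriv_neg (p : Fin n) :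
    partialDeriv p (fun z => -f z) x = -partialDeriv p f x := by
  simp [partialDeriv, fderiv_fun_neg]

lemma partialDeriv_const (p : Fin n) (c : ℝ) : partialDeriv p (fun _ => c) x = 0 := by
  simp [partialDeriv]

lemma partialDeriv_sum {ι : Type*} (s : Finset ι) (F : ι → Eu n → ℝ) (p : Fin n)
    (hF : ∀ i ∈ s, DifferentiableAt ℝ (F i) x) :
    partialDeriv p (fun z => ∑ i ∈ s, F i z) x = ∑ i ∈ s, partialDeriv p (F i) x := by
  simp [partialDeriv, fderiv_fun_sum hF]

lemma partialDeriv_congr (p : Fin n) (h : f =ᶠ[nhds x] g) :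
    partialDeriv p f x = partialDeriv p g x := by
  simp [partialDeriv, h.fderiv_eq]

lemma partialDeriv_coord (p k : Fin n) :
    partialDeriv p (fun z : Eu n => z k) x = if k = p then 1 else 0 := by
  have : HasFDerivAt (fun z : Eu n => z k) (EuclideanSpace.proj k : Eu n →L[ℝ] ℝ) x :=
    (EuclideanSpace.proj k : Eu n →L[ℝ] ℝ).hasFDerivAt
  simp [partialDeriv, this.fderiv]

lemma fderiv_eq_sum_partialDeriv (f : Eu n → ℝ) (x v : Eu n) :
    fderiv ℝ f x v = ∑ p, v p * partialDeriv p f x := by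
  have hv : v = ∑ p, v p • EuclideanSpace.single p (1 : ℝ) := by
    ext i
    simp [Pi.single_apply]
  conv_lhs => rw [hv]
  simp [partialDeriv]

lemma contDiffOn_partialDeriv (hΩ : IsOpen Ω) (hf : ContDiffOn ℝ ∞ f Ω) (p : Fin n) :
    ContDiffOn ℝ ∞ (partialDeriv p f) Ω :=
  (hf.fderiv_of_isOpen hΩ (m := ∞) (by simp)).clm_apply contDiffOn_const

lemma partialDeriv_comm (hΩ : IsOpen Ω) (hf : ContDiffOn ℝ ∞ f Ω) (hx : x ∈ Ω) (p q : Fin n) :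
    partialDeriv p (partialDeriv q f) x = partialDeriv q (partialDeriv p f) x := by
  have hc : ContDiffAt ℝ ∞ f x := hf.contDiffAt (hΩ.mem_nhds hx)
  have hd : DifferentiableAt ℝ (fderiv ℝ f) x :=
    (hc.fderiv_right (m := 1) (by norm_cast)).differentiableAt (by norm_num)
  have hsymm : IsSymmSndFDerivAt ℝ f x := hc.isSymmSndFDerivAt (by simpa using ENat.LEInfty.out)
  have key : ∀ a b : Fin n, partialDeriv a (partialDeriv b f) x
      = fderiv ℝ (fderiv ℝ f) x (EuclideanSpace.single a 1) (EuclideanSpace.single b 1) := by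
    intro a b
    unfold partialDeriv
    rw [fderiv_clm_apply hd (differentiableAt_const _)]
    simp
  rw [key, key]
  exact hsymm _ _

/-- Entrywise differentiability of a matrix-valued function. -/
def MatDiffAt (A : Eu n → Mat n) (x : Eu n) : Prop :=
  ∀ i j, DifferentiableAt ℝ (fun z => A z i j) x

/-- Entrywise smoothness of a matrix-valued function. -/
def MatSmoothOn (A : Eu n → Mat n) (Ω : Set (Eu n)) : Prop :=
  ∀ i j, ContDiffOn ℝ ∞ (fun z => A z i j) Ω

/-- The entrywise partial derivative of a matrix-valued function. -/
def pd (p : Fin n) (A : Eu n → Mat n) (x : Eu n) : Mat n :=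
  Matrix.of fun i j => partialDeriv p (fun z => A z i j) x

lemma pd_apply (p : Fin n) (A : Eu n → Mat n) (x : Eu n) (i j : Fin n) :
    pd p A x i j = partialDeriv p (fun z => A z i j) x := rfl

variable {A B : Eu n → Mat n}

lemma MatSmoothOn.matDiffAt (hA : MatSmoothOn A Ω) (hΩ : IsOpen Ω) (hx : x ∈ Ω) :
    MatDiffAt A x := fun i j =>
  ((hA i j).contDiffAt (hΩ.mem_nhds hx)).differentiableAt (by simp)

lemma MatSmoothOn.add (hA : MatSmoothOn A Ω) (hB : MatSmoothOn B Ω) :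
    MatSmoothOn (fun z => A z + B z) Ω := fun i j => (hA i j).add (hB i j)

lemma MatSmoothOn.sub (hA : MatSmoothOn A Ω) (hB : MatSmoothOn B Ω) :
    MatSmoothOn (fun z => A z - B z) Ω := fun i j => (hA i j).sub (hB i j)

lemma MatSmoothOn.transpose (hA : MatSmoothOn A Ω) :
    MatSmoothOn (fun z => (A z).transpose) Ω := fun i j => hA j i

lemma MatSmoothOn.mul (hA : MatSmoothOn A Ω) (hB : MatSmoothOn B Ω) :
    MatSmoothOn (fun z => A z * B z) Ω := fun i j => by
  simp only [Matrix.mul_apply]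
  exact ContDiffOn.sum fun l _ => (hA i l).mul (hB l j)

lemma MatSmoothOn.smul (hf : ContDiffOn ℝ ∞ f Ω) (hB : MatSmoothOn B Ω) :
    MatSmoothOn (fun z => f z • B z) Ω := fun i j => by
  simp only [Matrix.smul_apply, smul_eq_mul]
  exact hf.mul (hB i j)

lemma MatSmoothOn.sum {ι : Type*} (s : Finset ι) (F : ι → Eu n → Mat n)
    (hF : ∀ i ∈ s, MatSmoothOn (F i) Ω) : MatSmoothOn (fun z => ∑ i ∈ s, F i z) Ω := fun i j => by
  simp only [Matrix.sum_apply]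
  exact ContDiffOn.sum fun l hl => hF l hl i j

lemma matSmoothOn_const (C : Mat n) : MatSmoothOn (fun _ => C) Ω := fun _ _ => contDiffOn_const

lemma MatSmoothOn.pd (hΩ : IsOpen Ω) (hA : MatSmoothOn A Ω) (p : Fin n) :
    MatSmoothOn (pd p A) Ω := fun i j => contDiffOn_partialDeriv hΩ (hA i j) p

lemma MatSmoothOn.trace (hA : MatSmoothOn A Ω) :
    ContDiffOn ℝ ∞ (fun z => (A z).trace) Ω := by
  simp only [Matrix.trace, Matrix.diag_apply]
  exact ContDiffOn.sum fun l _ => hA l l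

lemma MatSmoothOn.det (hA : MatSmoothOn A Ω) :
    ContDiffOn ℝ ∞ (fun z => (A z).det) Ω := by
  simp only [Matrix.det_apply']
  exact ContDiffOn.sum fun σ _ => contDiffOn_const.mul (contDiffOn_prod fun i _ => hA (σ i) i)

lemma MatSmoothOn.inv (hA : MatSmoothOn A Ω) (hdet : ∀ z ∈ Ω, (A z).det ≠ 0) :
    MatSmoothOn (fun z => (A z)⁻¹) Ω := fun i j => by
  simp only [Matrix.inv_def, Matrix.smul_apply, smul_eq_mul, Ring.inverse_eq_inv',
    Matrix.adjugate_apply]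
  refine (hA.det.inv hdet).mul (MatSmoothOn.det (A := fun z => (A z).updateRow j (Pi.single i 1)) ?_)
  intro a b
  by_cases ha : a = j
  · subst ha
    simp only [Matrix.updateRow_self]
    exact contDiffOn_const
  · simp only [Matrix.updateRow_ne ha]
    exact hA a b

lemma pd_add (p : Fin n) (hA : MatDiffAt A x) (hB : MatDiffAt B x) :
    pd p (fun z => A z + B z) x = pd p A x + pd p B x := by
  ext i j
  exact partialDeriv_add p (hA i j) (hB i j)

lemma pd_sub (p : Fin n) (hA : MatDiffAt A x) (hB : MatDiffAt B x) :
    pd p (fun z => A z - B z) x = pd p A x - pd p B x := by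
  ext i j
  exact partialDeriv_sub p (hA i j) (hB i j)

lemma pd_neg (p : Fin n) : pd p (fun z => -A z) x = -pd p A x := by
  ext i j
  exact partialDeriv_neg p

lemma pd_const (p : Fin n) (C : Mat n) : pd p (fun _ => C) x = 0 := by
  ext i j
  exact partialDeriv_const p _

lemma pd_transpose (p : Fin n) :
    pd p (fun z => (A z).transpose) x = (pd p A x).transpose := rfl

lemma pd_mul (p : Fin n) (hA : MatDiffAt A x) (hB : MatDiffAt B x) :
    pd p (fun z => A z * B z) x = pd p A x * B x + A x * pd p B x := by
  ext i j
  simp only [pd_apply, Matrix.mul_apply, Matrix.add_apply]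
  rw [partialDeriv_sum Finset.univ (fun l z => A z i l * B z l j) p
    fun l _ => (hA i l).mul (hB l j), ← Finset.sum_add_distrib]
  exact Finset.sum_congr rfl fun l _ => partialDeriv_mul p (hA i l) (hB l j)

lemma pd_smul (p : Fin n) (hf : DifferentiableAt ℝ f x) (hB : MatDiffAt B x) :
    pd p (fun z => f z • B z) x = partialDeriv p f x • B x + f x • pd p B x := by
  ext i j
  exact partialDeriv_mul p hf (hB i j)

lemma pd_sum {ι : Type*} (s : Finset ι) (F : ι → Eu n → Mat n) (p : Fin n)
    (hF : ∀ i ∈ s, MatDiffAt (F i) x) :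
    pd p (fun z => ∑ i ∈ s, F i z) x = ∑ i ∈ s, pd p (F i) x := by
  ext i j
  simp only [pd_apply, Matrix.sum_apply]
  exact partialDeriv_sum _ _ _ fun l hl => hF l hl i j

lemma pd_congr (p : Fin n) (h : A =ᶠ[nhds x] B) : pd p A x = pd p B x := by
  ext i j
  exact partialDeriv_congr p (h.fun_comp fun M => M i j)

lemma partialDeriv_trace (p : Fin n) (hA : MatDiffAt A x) :
    partialDeriv p (fun z => (A z).trace) x = (pd p A x).trace := by
  simp only [Matrix.trace, Matrix.diag_apply]
  exact partialDeriv_sum _ _ _ fun l _ => hA l l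

lemma pd_comm (hΩ : IsOpen Ω) (hA : MatSmoothOn A Ω) (hx : x ∈ Ω) (p q : Fin n) :
    pd p (pd q A) x = pd q (pd p A) x := by
  ext i j
  exact partialDeriv_comm hΩ (hA i j) hx p q

lemma MatDiffAt.mul (hA : MatDiffAt A x) (hB : MatDiffAt B x) :
    MatDiffAt (fun z => A z * B z) x := fun i j => by
  simp only [Matrix.mul_apply]
  exact DifferentiableAt.fun_sum fun l _ => (hA i l).mul (hB l j)

/-- Differentiation of `A⁻¹ * A = 1`. -/
lemma pd_inv (hΩ : IsOpen Ω) (hA : MatSmoothOn A Ω) (hdet : ∀ z ∈ Ω, (A z).det ≠ 0) (hx : x ∈ Ω)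
    (p : Fin n) : pd p (fun z => (A z)⁻¹) x = -((A x)⁻¹ * pd p A x * (A x)⁻¹) := by
  have hI := hA.inv hdet
  have h1 : pd p (fun z => (A z)⁻¹ * A z) x = 0 := by
    rw [← pd_const (x := x) p (1 : Mat n)]
    apply pd_congr
    filter_upwards [hΩ.mem_nhds hx] with z hz
    exact Matrix.nonsing_inv_mul _ (isUnit_iff_ne_zero.2 (hdet z hz))
  rw [pd_mul p (hI.matDiffAt hΩ hx) (hA.matDiffAt hΩ hx)] at h1
  have hu := isUnit_iff_ne_zero.2 (hdet x hx)
  have h2 := congrArg (fun M => M * (A x)⁻¹) h1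
  simp only [Matrix.add_mul, Matrix.zero_mul, Matrix.mul_assoc] at h2
  rw [Matrix.mul_nonsing_inv _ hu, Matrix.mul_one] at h2
  rw [Matrix.mul_assoc]
  exact eq_neg_of_add_eq_zero_left h2

/-- **Jacobi's formula** for the derivative of a determinant. -/
lemma partialDeriv_det (p : Fin n) (hA : MatDiffAt A x) :
    partialDeriv p (fun z => (A z).det) x = ((A x).adjugate * pd p A x).trace := by
  have hP := fun σ : Equiv.Perm (Fin n) => HasFDerivAt.finsetProd (u := Finset.univ) (x := x)
    (g := fun i z => A z (σ i) i) fun i _ => (hA (σ i) i).hasFDerivAt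
  have h1 : ∀ σ : Equiv.Perm (Fin n), partialDeriv p (fun z => ∏ i, A z (σ i) i) x
      = ∑ i, ∏ j, (A x).updateCol i (fun k => pd p A x k i) (σ j) j := by
    intro σ
    rw [partialDeriv, (hP σ).fderiv]
    simp only [_root_.sum_apply, _root_.smul_apply, smul_eq_mul]
    refine Finset.sum_congr rfl fun i _ => ?_
    rw [← Finset.mul_prod_erase _ _ (Finset.mem_univ i), mul_comm, Matrix.updateCol_self]
    congr 1
    refine Finset.prod_congr rfl fun j hj => ?_
    rw [Matrix.updateCol_ne (Finset.ne_of_mem_erase hj)]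
  have h2 : partialDeriv p (fun z => (A z).det) x
      = ∑ i, ((A x).updateCol i (fun k => pd p A x k i)).det := by
    simp only [Matrix.det_apply']
    rw [partialDeriv_sum]
    · rw [Finset.sum_comm]
      refine Finset.sum_congr rfl fun σ _ => ?_
      rw [partialDeriv_mul p (differentiableAt_const _), partialDeriv_const, zero_mul, zero_add, h1,
        Finset.mul_sum]
      exact (hP σ).differentiableAt
    · intro σ _
      exact (differentiableAt_const _).mul (hP σ).differentiableAt
  rw [h2]
  refine Finset.sum_congr rfl fun i _ => ?_
  rw [← Matrix.cramer_apply, Matrix.cramer_eq_adjugate_mulVec]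
  simp [Matrix.mul_apply, Matrix.mulVec, dotProduct]

end Calculus

section Metric

variable {n : ℕ} {Ω : Set (Eu n)} {h A B : Eu n → Mat n} {x : Eu n}

/-- The Gram matrix of a smooth Riemannian metric on the open set `Ω`. -/
structure IsMetricOn (h : Eu n → Mat n) (Ω : Set (Eu n)) : Prop where
  isOpen : IsOpen Ω
  smooth : MatSmoothOn h Ω
  symm : ∀ z i j, h z i j = h z j i
  posDef : ∀ z ∈ Ω, (h z).PosDef

lemma IsMetricOn.transpose_eq (H : IsMetricOn h Ω) (x : Eu n) : (h x).transpose = h x := by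
  ext i j
  exact H.symm x j i

lemma IsMetricOn.inv_transpose (H : IsMetricOn h Ω) (x : Eu n) : ((h x)⁻¹).transpose = (h x)⁻¹ := by
  rw [Matrix.transpose_nonsing_inv, H.transpose_eq]

lemma IsMetricOn.inv_symm (H : IsMetricOn h Ω) (x : Eu n) (i j : Fin n) :
    (h x)⁻¹ i j = (h x)⁻¹ j i := by
  conv_lhs => rw [← H.inv_transpose x, Matrix.transpose_apply]

lemma IsMetricOn.det_ne_zero (H : IsMetricOn h Ω) : ∀ z ∈ Ω, (h z).det ≠ 0 :=
  fun z hz => (H.posDef z hz).det_pos.ne'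

lemma IsMetricOn.mul_inv (H : IsMetricOn h Ω) (hx : x ∈ Ω) : h x * (h x)⁻¹ = 1 :=
  Matrix.mul_nonsing_inv _ (isUnit_iff_ne_zero.2 (H.det_ne_zero x hx))

lemma IsMetricOn.inv_mul (H : IsMetricOn h Ω) (hx : x ∈ Ω) : (h x)⁻¹ * h x = 1 :=
  Matrix.nonsing_inv_mul _ (isUnit_iff_ne_zero.2 (H.det_ne_zero x hx))

lemma IsMetricOn.inv_smooth (H : IsMetricOn h Ω) : MatSmoothOn (fun z => (h z)⁻¹) Ω :=
  H.smooth.inv H.det_ne_zero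

/-- The connection matrix `(Γ_p)_{kl} = Γ^k_{lp}` of the Levi-Civita connection. -/
def connMat (h : Eu n → Mat n) (p : Fin n) (x : Eu n) : Mat n :=
  Matrix.of fun k l => christoffel h x k l p

/-- The covariant derivative `∇_p A` as a matrix-valued function; iterating it does not include
the Christoffel term of the covariant index. -/
def cd (h : Eu n → Mat n) (p : Fin n) (A : Eu n → Mat n) (x : Eu n) : Mat n :=
  Matrix.of fun k j => covDeriv h A x p k j

lemma cd_eq (h : Eu n → Mat n) (p : Fin n) (A : Eu n → Mat n) (x : Eu n) :
    cd h p A x = pd p A x + connMat h p x * A x - A x * connMat h p x := by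
  ext k j
  simp [cd, covDeriv, pd, connMat, Matrix.mul_apply, mul_comm]

lemma connMat_symm (H : IsMetricOn h Ω) (p k l : Fin n) :
    connMat h p x k l = connMat h l x k p := by
  simp only [connMat, Matrix.of_apply, christoffel, show ∀ i j, (fun z => h z i j) = fun z => h z j i
    from fun i j => funext fun z => H.symm z i j]
  congr 1
  refine Finset.sum_congr rfl fun m _ => ?_
  ring

lemma metric_mul_connMat (H : IsMetricOn h Ω) (hx : x ∈ Ω) (p j l : Fin n) :
    (h x * connMat h p x) j l = (1 / 2 : ℝ) * (partialDeriv l (fun z => h z p j) x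
      + partialDeriv p (fun z => h z l j) x - partialDeriv j (fun z => h z l p) x) := by
  have : connMat h p x = (h x)⁻¹ * Matrix.of (fun m l => (1 / 2 : ℝ) *
      (partialDeriv l (fun z => h z p m) x + partialDeriv p (fun z => h z l m) x
        - partialDeriv m (fun z => h z l p) x)) := by
    ext k l
    simp only [connMat, christoffel, Matrix.of_apply, Matrix.mul_apply, Finset.mul_sum]
    exact Finset.sum_congr rfl fun m _ => by ring
  rw [this, ← Matrix.mul_assoc, H.mul_inv hx, Matrix.one_mul, Matrix.of_apply]

/-- The Levi-Civita connection is metric. -/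
lemma pd_metric (H : IsMetricOn h Ω) (hx : x ∈ Ω) (p : Fin n) :
    pd p h x = h x * connMat h p x + (connMat h p x).transpose * h x := by
  have h2 : (connMat h p x).transpose * h x = (h x * connMat h p x).transpose := by
    rw [Matrix.transpose_mul, H.transpose_eq]
  rw [h2]
  ext j l
  have hs : ∀ i j, (fun z => h z i j) = fun z => h z j i :=
    fun i j => funext fun z => H.symm z i j
  rw [Matrix.add_apply, Matrix.transpose_apply, metric_mul_connMat H hx, metric_mul_connMat H hx,
    pd_apply, hs p j, hs l j, hs l p, hs j p]
  ring

/-- Uniqueness of the Levi-Civita connection: a torsion-free metric connection has the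
Christoffel symbols as its coefficients. -/
lemma connMat_unique (H : IsMetricOn h Ω) (hx : x ∈ Ω) (Θ : Fin n → Mat n)
    (hsymm : ∀ p k l, Θ p k l = Θ l k p)
    (hmet : ∀ p, pd p h x = h x * Θ p + (Θ p).transpose * h x) (p : Fin n) :
    Θ p = connMat h p x := by
  have hs : ∀ i j, (fun z => h z i j) = fun z => h z j i :=
    fun i j => funext fun z => H.symm z i j
  have hm : ∀ p j l, partialDeriv p (fun z => h z j l) x = (h x * Θ p) j l + (h x * Θ p) l j := by
    intro p j l
    have := congrFun (congrFun (hmet p) j) l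
    rw [pd_apply] at this
    rw [this, Matrix.add_apply, ← Matrix.transpose_apply (h x * Θ p) j l, Matrix.transpose_mul,
      H.transpose_eq]
  have hsy : ∀ p j l, (h x * Θ p) j l = (h x * Θ l) j p := by
    intro p j l
    simp only [Matrix.mul_apply]
    exact Finset.sum_congr rfl fun k _ => by rw [hsymm]
  have h1 : h x * Θ p = h x * connMat h p x := by
    ext j l
    rw [metric_mul_connMat H hx, hm, hm, hm, hsy l p j, hsy l j p, hsy p l j]
    ring
  have h2 := congrArg (fun M => (h x)⁻¹ * M) h1
  simpa only [← Matrix.mul_assoc, H.inv_mul hx, Matrix.one_mul] using h2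

lemma contDiffOn_christoffel (H : IsMetricOn h Ω) (k i j : Fin n) :
    ContDiffOn ℝ ∞ (fun z => christoffel h z k i j) Ω := by
  have hp := fun a b c => contDiffOn_partialDeriv H.isOpen (H.smooth a b) c
  exact contDiffOn_const.mul (ContDiffOn.sum fun l _ =>
    (H.inv_smooth k l).mul (((hp j l i).add (hp i l j)).sub (hp i j l)))

lemma connMat_smooth (H : IsMetricOn h Ω) (p : Fin n) : MatSmoothOn (connMat h p) Ω :=
  fun k l => contDiffOn_christoffel H k l p

lemma cd_smooth (H : IsMetricOn h Ω) (hA : MatSmoothOn A Ω) (p : Fin n) :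
    MatSmoothOn (cd h p A) Ω := by
  rw [show cd h p A = fun x => pd p A x + connMat h p x * A x - A x * connMat h p x
    from funext fun x => cd_eq h p A x]
  exact ((hA.pd H.isOpen p).add ((connMat_smooth H p).mul hA)).sub (hA.mul (connMat_smooth H p))

lemma cd_congr (p : Fin n) (hAB : A =ᶠ[nhds x] B) : cd h p A x = cd h p B x := by
  rw [cd_eq, cd_eq, pd_congr p hAB, hAB.self_of_nhds]

lemma cd_add (p : Fin n) (hA : MatDiffAt A x) (hB : MatDiffAt B x) :
    cd h p (fun z => A z + B z) x = cd h p A x + cd h p B x := by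
  simp only [cd_eq, pd_add p hA hB]
  noncomm_ring

lemma cd_neg (p : Fin n) : cd h p (fun z => -A z) x = -cd h p A x := by
  simp only [cd_eq, pd_neg]
  noncomm_ring

lemma cd_one (p : Fin n) : cd h p (fun _ => (1 : Mat n)) x = 0 := by
  simp [cd_eq, pd_const]

lemma cd_zero (p : Fin n) : cd h p (fun _ => (0 : Mat n)) x = 0 := by
  simp [cd_eq, pd_const]

lemma cd_mul (p : Fin n) (hA : MatDiffAt A x) (hB : MatDiffAt B x) :
    cd h p (fun z => A z * B z) x = cd h p A x * B x + A x * cd h p B x := by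
  simp only [cd_eq, pd_mul p hA hB]
  noncomm_ring

lemma cd_smul {f : Eu n → ℝ} (p : Fin n) (hf : DifferentiableAt ℝ f x) (hB : MatDiffAt B x) :
    cd h p (fun z => f z • B z) x = partialDeriv p f x • B x + f x • cd h p B x := by
  simp only [cd_eq, pd_smul p hf hB, Matrix.mul_smul, Matrix.smul_mul]
  module

lemma cd_sum {ι : Type*} (s : Finset ι) (F : ι → Eu n → Mat n) (p : Fin n)
    (hF : ∀ i ∈ s, MatDiffAt (F i) x) :
    cd h p (fun z => ∑ i ∈ s, F i z) x = ∑ i ∈ s, cd h p (F i) x := by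
  simp only [cd_eq, pd_sum s F p hF, Finset.mul_sum, Finset.sum_mul, Finset.sum_sub_distrib,
    Finset.sum_add_distrib]

lemma partialDeriv_trace_eq (p : Fin n) (hA : MatDiffAt A x) :
    partialDeriv p (fun z => (A z).trace) x = (cd h p A x).trace := by
  rw [partialDeriv_trace p hA, cd_eq, Matrix.trace_sub, Matrix.trace_add,
    Matrix.trace_mul_comm (connMat h p x)]
  ring

/-- The adjoint of an endomorphism with respect to the metric `h`. -/
def adj (h A : Eu n → Mat n) (x : Eu n) : Mat n := (h x)⁻¹ * (A x).transpose * h x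

lemma adj_smooth (H : IsMetricOn h Ω) (hA : MatSmoothOn A Ω) : MatSmoothOn (adj h A) Ω :=
  (H.inv_smooth.mul hA.transpose).mul H.smooth

/-- The covariant derivative commutes with taking adjoints. -/
lemma cd_adj (H : IsMetricOn h Ω) (hA : MatSmoothOn A Ω) (hx : x ∈ Ω) (p : Fin n) :
    cd h p (adj h A) x = adj h (cd h p A) x := by
  have dI := H.inv_smooth.matDiffAt H.isOpen hx
  have dA := hA.matDiffAt H.isOpen hx
  have dh := H.smooth.matDiffAt H.isOpen hx
  have dT : MatDiffAt (fun z => (A z).transpose) x := hA.transpose.matDiffAt H.isOpen hx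
  rw [cd_eq]
  unfold adj
  rw [pd_mul p (dI.mul dT) dh, pd_mul p dI dT, pd_inv H.isOpen H.smooth H.det_ne_zero hx,
    pd_metric H hx, pd_transpose, cd_eq]
  have e1 := H.inv_mul hx
  have e2 := H.mul_inv hx
  set G := (h x)⁻¹
  set k := h x
  set C := connMat h p x
  have e3 : ∀ M : Mat n, G * (k * M) = M := fun M => by rw [← Matrix.mul_assoc, e1, Matrix.one_mul]
  simp only [Matrix.transpose_sub, Matrix.transpose_add, Matrix.transpose_mul, Matrix.mul_add,
    Matrix.add_mul, Matrix.mul_sub, Matrix.sub_mul, Matrix.mul_assoc, e3, e2, Matrix.mul_one,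
    Matrix.neg_mul]
  abel

/-- The derivative of the volume density. -/
lemma partialDeriv_sqrt_det (H : IsMetricOn h Ω) (hx : x ∈ Ω) (p : Fin n) :
    partialDeriv p (fun z => Real.sqrt (h z).det) x
      = Real.sqrt (h x).det * (connMat h p x).trace := by
  have hpos := (H.posDef x hx).det_pos
  have hd : DifferentiableAt ℝ (fun z => (h z).det) x :=
    (H.smooth.det.contDiffAt (H.isOpen.mem_nhds hx)).differentiableAt (by simp)
  have h1 : partialDeriv p (fun z => Real.sqrt (h z).det) x
      = 1 / (2 * Real.sqrt (h x).det) * partialDeriv p (fun z => (h z).det) x := by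
    unfold partialDeriv
    rw [(hd.hasFDerivAt.sqrt hpos.ne').fderiv]
    simp
  have h2 : (h x).adjugate = (h x).det • (h x)⁻¹ := by
    rw [Matrix.inv_def, Ring.inverse_eq_inv', smul_smul, mul_inv_cancel₀ hpos.ne', one_smul]
  have h3 : ((h x)⁻¹ * pd p h x).trace = 2 * (connMat h p x).trace := by
    rw [pd_metric H hx, Matrix.mul_add, Matrix.trace_add, ← Matrix.mul_assoc, H.inv_mul hx,
      Matrix.one_mul, Matrix.trace_mul_comm, Matrix.mul_assoc, H.mul_inv hx, Matrix.mul_one,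
      Matrix.trace_transpose]
    ring
  rw [h1, partialDeriv_det p (H.smooth.matDiffAt H.isOpen hx), h2, Matrix.smul_mul,
    Matrix.trace_smul, h3, smul_eq_mul]
  have h4 : Real.sqrt (h x).det ≠ 0 := (Real.sqrt_pos.2 hpos).ne'
  field_simp
  rw [Real.sq_sqrt hpos.le]

/-- The derivative of the inverse metric. -/
lemma pd_metric_inv (H : IsMetricOn h Ω) (hx : x ∈ Ω) (p : Fin n) :
    pd p (fun z => (h z)⁻¹) x
      = -(connMat h p x * (h x)⁻¹ + (h x)⁻¹ * (connMat h p x).transpose) := by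
  rw [pd_inv H.isOpen H.smooth H.det_ne_zero hx, pd_metric H hx, Matrix.mul_add, ← Matrix.mul_assoc,
    H.inv_mul hx, Matrix.one_mul, Matrix.add_mul, Matrix.mul_assoc, Matrix.mul_assoc, H.mul_inv hx,
    Matrix.mul_one]

/-- The curvature `F_{pq} = ∂_p Γ_q - ∂_q Γ_p + [Γ_p, Γ_q]` of the Levi-Civita connection. -/
def curv (h : Eu n → Mat n) (p q : Fin n) (x : Eu n) : Mat n :=
  pd p (connMat h q) x - pd q (connMat h p) x
    + (connMat h p x * connMat h q x - connMat h q x * connMat h p x)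

lemma curv_smooth (H : IsMetricOn h Ω) (p q : Fin n) : MatSmoothOn (curv h p q) Ω :=
  (((connMat_smooth H q).pd H.isOpen p).sub ((connMat_smooth H p).pd H.isOpen q)).add
    (((connMat_smooth H p).mul (connMat_smooth H q)).sub
      ((connMat_smooth H q).mul (connMat_smooth H p)))

/-- The Ricci identity. -/
lemma cd_comm (H : IsMetricOn h Ω) (hA : MatSmoothOn A Ω) (hx : x ∈ Ω) (p q : Fin n) :
    cd h p (cd h q A) x - cd h q (cd h p A) x = curv h p q x * A x - A x * curv h p q x := by
  have key : ∀ a b : Fin n, cd h a (cd h b A) x = pd a (pd b A) x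
      + (pd a (connMat h b) x * A x + connMat h b x * pd a A x)
      - (pd a A x * connMat h b x + A x * pd a (connMat h b) x)
      + connMat h a x * cd h b A x - cd h b A x * connMat h a x := by
    intro a b
    have dA := hA.matDiffAt H.isOpen hx
    have dC := (connMat_smooth H b).matDiffAt H.isOpen hx
    have dP := (hA.pd H.isOpen b).matDiffAt H.isOpen hx
    have h1 := ((connMat_smooth H b).mul hA)
    have h2 := hA.mul (connMat_smooth H b)
    rw [cd_eq, show cd h b A = fun x => pd b A x + connMat h b x * A x - A x * connMat h b x
      from funext fun x => cd_eq h b A x,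
      pd_sub a (((hA.pd H.isOpen b).add h1).matDiffAt H.isOpen hx) (h2.matDiffAt H.isOpen hx),
      pd_add a dP (h1.matDiffAt H.isOpen hx), pd_mul a dC dA, pd_mul a dA dC]
  rw [key, key, cd_eq, cd_eq, curv, pd_comm H.isOpen hA hx p q]
  noncomm_ring

end Metric

end Coord

/-! ### Inner products of endomorphisms and of endomorphism-valued forms -/

namespace Coord

section Pairing

variable {n : ℕ} {k : Mat n}

open Matrix in
/-- A frame in which the inner product `k` is the standard one. -/
lemma exists_frame (hk : k.PosDef) :
    ∃ R : Mat n, IsUnit R.det ∧ k⁻¹ = R * Rᵀ ∧ k = (R⁻¹)ᵀ * R⁻¹ := by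
  open scoped MatrixOrder in
  obtain ⟨B, hB, hkB⟩ := CStarAlgebra.isStrictlyPositive_iff_eq_star_mul_self.1
    hk.isStrictlyPositive
  have hBd : IsUnit B.det := (Matrix.isUnit_iff_isUnit_det B).1 hB
  have hkB' : k = Bᵀ * B := by
    rw [hkB, Matrix.star_eq_conjTranspose, Matrix.conjTranspose_eq_transpose_of_trivial]
  refine ⟨B⁻¹, by rw [Matrix.det_nonsing_inv]; exact hBd.ringInverse, ?_, ?_⟩
  · rw [hkB', Matrix.mul_inv_rev, Matrix.transpose_nonsing_inv]
  · rw [Matrix.nonsing_inv_nonsing_inv _ hBd, hkB']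

/-- The value of the bilinear form `k` on two vectors. -/
def vpair (k : Mat n) (v w : Fin n → ℝ) : ℝ := ∑ i, ∑ j, k i j * v i * w j

/-- The inner product of endomorphisms `tr (X Y^*)` induced by the inner product `k`. -/
def tpair (k X Y : Mat n) : ℝ := (X * k⁻¹ * Y.transpose * k).trace

/-- The contraction of a covariant `2`-tensor with the inverse of `k`. -/
def contr (k T : Mat n) : ℝ := ∑ p, ∑ q, k⁻¹ p q * T p q

/-- The inner product of endomorphism-valued `1`-forms. -/
def fpair (k : Mat n) (D D' : Fin n → Mat n) : ℝ :=
  contr k (Matrix.of fun p q => tpair k (D p) (D' q))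

lemma tpair_add_left (X Y Z : Mat n) : tpair k (X + Y) Z = tpair k X Z + tpair k Y Z := by
  simp [tpair, Matrix.add_mul]

lemma tpair_add_right (X Y Z : Mat n) : tpair k X (Y + Z) = tpair k X Y + tpair k X Z := by
  simp [tpair, Matrix.add_mul, Matrix.mul_add]

lemma tpair_smul_left (c : ℝ) (X Z : Mat n) : tpair k (c • X) Z = c * tpair k X Z := by
  simp [tpair]

lemma tpair_smul_right (c : ℝ) (X Z : Mat n) : tpair k X (c • Z) = c * tpair k X Z := by
  simp [tpair]

lemma tpair_neg_left (X Z : Mat n) : tpair k (-X) Z = -tpair k X Z := by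
  simp [tpair]

lemma tpair_sub_left (X Y Z : Mat n) : tpair k (X - Y) Z = tpair k X Z - tpair k Y Z := by
  simp [tpair, Matrix.sub_mul]

lemma tpair_sub_right (X Y Z : Mat n) : tpair k X (Y - Z) = tpair k X Y - tpair k X Z := by
  simp [tpair, Matrix.sub_mul, Matrix.mul_sub]

lemma tpair_sum_left {ι : Type*} (s : Finset ι) (F : ι → Mat n) (Z : Mat n) :
    tpair k (∑ i ∈ s, F i) Z = ∑ i ∈ s, tpair k (F i) Z := by
  simp [tpair, Finset.sum_mul, Matrix.trace_sum]

lemma tpair_sum_right {ι : Type*} (s : Finset ι) (F : ι → Mat n) (Z : Mat n) :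
    tpair k Z (∑ i ∈ s, F i) = ∑ i ∈ s, tpair k Z (F i) := by
  simp [tpair, Finset.sum_mul, Matrix.trace_sum, Matrix.transpose_sum, Finset.mul_sum]

lemma vpair_eq_dotProduct (v w : Fin n → ℝ) : vpair k v w = v ⬝ᵥ (k.mulVec w) := by
  simp only [vpair, dotProduct, Matrix.mulVec, Finset.mul_sum]
  exact Finset.sum_congr rfl fun i _ => Finset.sum_congr rfl fun j _ => by ring

open Matrix in
lemma vpair_frame {R : Mat n} (h2 : k = (R⁻¹)ᵀ * R⁻¹) (v w : Fin n → ℝ) :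
    vpair k v w = ∑ c, (R⁻¹ *ᵥ v) c * (R⁻¹ *ᵥ w) c := by
  rw [vpair_eq_dotProduct, h2, ← Matrix.mulVec_mulVec, Matrix.dotProduct_mulVec,
    Matrix.vecMul_transpose]
  rfl

open Matrix in
lemma tpair_frame {R : Mat n} (h1 : k⁻¹ = R * Rᵀ) (h2 : k = (R⁻¹)ᵀ * R⁻¹)
    (X Y : Mat n) :
    tpair k X Y = ∑ i, ∑ j, (R⁻¹ * X * R) i j * (R⁻¹ * Y * R) i j := by
  have : tpair k X Y = ((R⁻¹ * X * R) * (R⁻¹ * Y * R)ᵀ).trace := by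
    rw [tpair, h1]
    nth_rewrite 1 [h2]
    rw [← Matrix.mul_assoc, Matrix.trace_mul_comm]
    simp only [Matrix.transpose_mul, Matrix.mul_assoc]
  rw [this]
  rfl

open Matrix in
lemma contr_frame {R : Mat n} (h1 : k⁻¹ = R * Rᵀ) (T : Mat n) :
    contr k T = ∑ c, ∑ p, ∑ q, R p c * R q c * T p q := by
  simp only [contr, h1, Matrix.mul_apply, Matrix.transpose_apply, Finset.sum_mul]
  rw [Finset.sum_comm]
  rw [Finset.sum_congr rfl fun q _ => Finset.sum_comm]
  rw [Finset.sum_comm]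
  exact Finset.sum_congr rfl fun c _ => Finset.sum_comm

/-- The components of a `1`-form in the frame `R`. -/
def frameForm (R : Mat n) (D : Fin n → Mat n) (c : Fin n) : Mat n := ∑ p, R p c • D p

open Matrix in
lemma fpair_frame {R : Mat n} (h1 : k⁻¹ = R * Rᵀ) (D D' : Fin n → Mat n) :
    fpair k D D' = ∑ c, tpair k (frameForm R D c) (frameForm R D' c) := by
  rw [fpair, contr_frame h1]
  refine Finset.sum_congr rfl fun c _ => ?_
  rw [frameForm, frameForm, tpair_sum_left]
  refine Finset.sum_congr rfl fun p _ => ?_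
  rw [tpair_sum_right]
  refine Finset.sum_congr rfl fun q _ => ?_
  rw [tpair_smul_left, tpair_smul_right, Matrix.of_apply]
  ring

lemma tpair_comm (hk : k.PosDef) (X Y : Mat n) : tpair k X Y = tpair k Y X := by
  obtain ⟨R, -, h1, h2⟩ := exists_frame hk
  simp only [tpair_frame h1 h2, mul_comm]

lemma tpair_self_nonneg (hk : k.PosDef) (X : Mat n) : 0 ≤ tpair k X X := by
  obtain ⟨R, -, h1, h2⟩ := exists_frame hk
  rw [tpair_frame h1 h2]
  exact Finset.sum_nonneg fun i _ => Finset.sum_nonneg fun j _ => mul_self_nonneg _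

lemma eq_zero_of_tpair_self (hk : k.PosDef) {X : Mat n} (hX : tpair k X X = 0) : X = 0 := by
  obtain ⟨R, hR, h1, h2⟩ := exists_frame hk
  rw [tpair_frame h1 h2] at hX
  have h3 : R⁻¹ * X * R = 0 := by
    ext i j
    have h4 := (Finset.sum_eq_zero_iff_of_nonneg fun i _ =>
      Finset.sum_nonneg fun j _ => mul_self_nonneg _).1 hX i (Finset.mem_univ i)
    have h5 := (Finset.sum_eq_zero_iff_of_nonneg fun j _ => mul_self_nonneg _).1 h4 j
      (Finset.mem_univ j)
    exact mul_self_eq_zero.1 h5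
  have h6 := congrArg (fun M => R * M * R⁻¹) h3
  simpa [← Matrix.mul_assoc, Matrix.mul_nonsing_inv _ hR, Matrix.mul_nonsing_inv_cancel_right _ _ hR]
    using h6

lemma fpair_self_nonneg (hk : k.PosDef) (D : Fin n → Mat n) : 0 ≤ fpair k D D := by
  obtain ⟨R, -, h1, -⟩ := exists_frame hk
  rw [fpair_frame h1]
  exact Finset.sum_nonneg fun i _ => tpair_self_nonneg hk _

/-- Cauchy–Schwarz for a nonnegative symmetric form, from the nonnegativity of
`t ↦ a t² + 2 b t + c`. -/
lemma sq_le_mul_of_forall_quadratic_nonneg {a b c : ℝ} (h : ∀ t : ℝ, 0 ≤ a * t ^ 2 + 2 * b * t + c) :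
    b ^ 2 ≤ a * c := by
  have := discrim_le_zero (a := a) (b := 2 * b) (c := c) fun t => by
    have := h t
    nlinarith
  rw [discrim] at this
  nlinarith

lemma tpair_sq_le (hk : k.PosDef) (X Y : Mat n) :
    tpair k X Y ^ 2 ≤ tpair k X X * tpair k Y Y := by
  apply sq_le_mul_of_forall_quadratic_nonneg
  intro t
  have := tpair_self_nonneg hk (t • X + Y)
  simp only [tpair_add_left, tpair_add_right, tpair_smul_left, tpair_smul_right,
    tpair_comm hk Y X] at this
  linarith

lemma fpair_sq_le (hk : k.PosDef) (D E : Fin n → Mat n) :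
    fpair k D E ^ 2 ≤ fpair k D D * fpair k E E := by
  apply sq_le_mul_of_forall_quadratic_nonneg
  intro t
  obtain ⟨R, -, h1, -⟩ := exists_frame hk
  have key : ∀ c, 0 ≤ tpair k (frameForm R D c) (frameForm R D c) * t ^ 2
      + 2 * tpair k (frameForm R D c) (frameForm R E c) * t
      + tpair k (frameForm R E c) (frameForm R E c) := by
    intro c
    have := tpair_self_nonneg hk (t • frameForm R D c + frameForm R E c)
    simp only [tpair_add_left, tpair_add_right, tpair_smul_left, tpair_smul_right,
      tpair_comm hk (frameForm R E c) (frameForm R D c)] at this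
    linarith
  have := Finset.sum_nonneg fun c (_ : c ∈ Finset.univ) => key c
  simp only [Finset.sum_add_distrib, ← Finset.sum_mul, ← Finset.mul_sum, ← fpair_frame h1] at this
  exact this

/-- Duality between vectors and covectors: `(v · d)² ≤ k(v, v) k⁻¹(d, d)`. -/
lemma sq_sum_mul_le (hk : k.PosDef) (v d : Fin n → ℝ) :
    (∑ p, v p * d p) ^ 2 ≤ vpair k v v * vpair k⁻¹ d d := by
  obtain ⟨R, hR, h1, h2⟩ := exists_frame hk
  have e1 : vpair k⁻¹ d d = ∑ c, (R.transpose.mulVec d c) ^ 2 := by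
    rw [vpair_eq_dotProduct, h1, ← Matrix.mulVec_mulVec, Matrix.dotProduct_mulVec,
      ← Matrix.mulVec_transpose]
    exact Finset.sum_congr rfl fun c _ => by rw [sq]
  have e2 : ∑ p, v p * d p = ∑ c, (R⁻¹.mulVec v) c * (R.transpose.mulVec d c) := by
    change v ⬝ᵥ d = (R⁻¹.mulVec v) ⬝ᵥ (R.transpose.mulVec d)
    rw [Matrix.mulVec_transpose, dotProduct_comm _ (Matrix.vecMul d R), ← Matrix.dotProduct_mulVec,
      Matrix.mulVec_mulVec, Matrix.mul_nonsing_inv _ hR, Matrix.one_mulVec, dotProduct_comm]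
  rw [vpair_frame h2, e1, e2]
  simp only [← sq]
  exact Finset.sum_mul_sq_le_sq_mul_sq _ _ _

lemma vpair_self_nonneg (hk : k.PosDef) (v : Fin n → ℝ) : 0 ≤ vpair k v v := by
  obtain ⟨R, -, -, h2⟩ := exists_frame hk
  rw [vpair_frame h2]
  exact Finset.sum_nonneg fun c _ => mul_self_nonneg _

lemma vpair_self_pos (hk : k.PosDef) {v : Fin n → ℝ} (hv : v ≠ 0) : 0 < vpair k v v := by
  rw [vpair_eq_dotProduct]
  simpa using hk.dotProduct_mulVec_pos hv

/-- A contravariant form bounded by `c k⁻¹` has a contraction with a pair of endomorphism-valued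
`1`-forms bounded by `c |D|²`. -/
lemma sum_mul_tpair_le (hk : k.PosDef) (m : Mat n) (c : ℝ)
    (hm : ∀ d : Fin n → ℝ, vpair m d d ≤ c * vpair k⁻¹ d d) (D : Fin n → Mat n) :
    ∑ p, ∑ q, m p q * tpair k (D p) (D q) ≤ c * fpair k D D := by
  obtain ⟨R, -, h1, h2⟩ := exists_frame hk
  have key : ∀ m' : Mat n, ∑ p, ∑ q, m' p q * tpair k (D p) (D q)
      = ∑ i, ∑ j, vpair m' (fun p => (R⁻¹ * D p * R) i j) (fun p => (R⁻¹ * D p * R) i j) := by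
    intro m'
    simp only [tpair_frame h1 h2, vpair, Finset.mul_sum]
    rw [Finset.sum_congr rfl fun p _ => Finset.sum_comm, Finset.sum_comm]
    refine Finset.sum_congr rfl fun i _ => ?_
    rw [Finset.sum_congr rfl fun p _ => Finset.sum_congr rfl fun q _ => Finset.sum_congr rfl
      fun j _ => (mul_assoc (m' p q) _ _).symm]
    rw [Finset.sum_congr rfl fun p _ => Finset.sum_comm, Finset.sum_comm]
  have e : fpair k D D = ∑ p, ∑ q, k⁻¹ p q * tpair k (D p) (D q) := rfl
  rw [e, key m, key k⁻¹, Finset.mul_sum]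
  refine Finset.sum_le_sum fun i _ => ?_
  rw [Finset.mul_sum]
  exact Finset.sum_le_sum fun j _ => hm _

/-- `|D_v|² ≤ |v|² |D|²`. -/
lemma tpair_sum_smul_le (hk : k.PosDef) (v : Fin n → ℝ) (D : Fin n → Mat n) :
    tpair k (∑ p, v p • D p) (∑ p, v p • D p) ≤ vpair k v v * fpair k D D := by
  have h := sum_mul_tpair_le hk (Matrix.of fun p q => v p * v q) (vpair k v v) ?_ D
  · refine le_trans (le_of_eq ?_) h
    rw [tpair_sum_left]
    refine Finset.sum_congr rfl fun p _ => ?_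
    rw [tpair_sum_right]
    refine Finset.sum_congr rfl fun q _ => ?_
    rw [tpair_smul_left, tpair_smul_right, Matrix.of_apply]
    ring
  · intro d
    refine le_trans (le_of_eq ?_) (sq_sum_mul_le hk v d)
    rw [sq, Finset.sum_mul_sum, vpair]
    exact Finset.sum_congr rfl fun p _ => Finset.sum_congr rfl fun q _ => by
      simp only [Matrix.of_apply]; ring

/-- The operator norm of an endomorphism is at most its Hilbert–Schmidt norm. -/
lemma vpair_mulVec_sq_le (hk : k.PosDef) (X : Mat n) (v w : Fin n → ℝ) :
    vpair k (X.mulVec v) w ^ 2 ≤ tpair k X X * (vpair k v v * vpair k w w) := by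
  obtain ⟨R, hR, h1, h2⟩ := exists_frame hk
  have e : R⁻¹.mulVec (X.mulVec v) = (R⁻¹ * X * R).mulVec (R⁻¹.mulVec v) := by
    simp only [Matrix.mulVec_mulVec, Matrix.mul_assoc, Matrix.mul_nonsing_inv _ hR, Matrix.mul_one]
  rw [tpair_frame h1 h2, vpair_frame h2, vpair_frame h2, vpair_frame h2, e]
  set Y := R⁻¹ * X * R
  set a := R⁻¹.mulVec v
  set b := R⁻¹.mulVec w
  simp only [← sq]
  have s1 : (∑ c, Y.mulVec a c * b c) ^ 2 ≤ (∑ c, (Y.mulVec a c) ^ 2) * ∑ c, b c ^ 2 :=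
    Finset.sum_mul_sq_le_sq_mul_sq _ _ _
  have s2 : ∑ c, (Y.mulVec a c) ^ 2 ≤ (∑ i, ∑ j, Y i j ^ 2) * ∑ c, a c ^ 2 := by
    rw [Finset.sum_mul]
    exact Finset.sum_le_sum fun i _ =>
      Finset.sum_mul_sq_le_sq_mul_sq Finset.univ (fun j => Y i j) a
  calc _ ≤ _ := s1
    _ ≤ ((∑ i, ∑ j, Y i j ^ 2) * ∑ c, a c ^ 2) * ∑ c, b c ^ 2 :=
      mul_le_mul_of_nonneg_right s2 (Finset.sum_nonneg fun _ _ => sq_nonneg _)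
    _ = _ := by ring

/-- The Hilbert–Schmidt norm is submultiplicative. -/
lemma tpair_mul_self_le (hk : k.PosDef) (X Y : Mat n) :
    tpair k (X * Y) (X * Y) ≤ tpair k X X * tpair k Y Y := by
  obtain ⟨R, hR, h1, h2⟩ := exists_frame hk
  have e : R⁻¹ * (X * Y) * R = (R⁻¹ * X * R) * (R⁻¹ * Y * R) := by
    simp only [Matrix.mul_assoc, Matrix.mul_nonsing_inv_cancel_left _ _ hR]
  simp only [tpair_frame h1 h2, e, ← sq]
  set X' := R⁻¹ * X * R
  set Y' := R⁻¹ * Y * R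
  rw [Finset.sum_mul]
  refine Finset.sum_le_sum fun i _ => ?_
  rw [Finset.sum_comm (f := fun i j => Y' i j ^ 2), Finset.mul_sum]
  exact Finset.sum_le_sum fun j _ =>
    Finset.sum_mul_sq_le_sq_mul_sq Finset.univ (fun l => X' i l) fun l => Y' l j

/-- `m ↦ tr (k⁻¹ m)` is bounded by `n c` on forms bounded by `c k`. -/
lemma contr_le (hk : k.PosDef) (m : Mat n) (c : ℝ)
    (hm : ∀ v : Fin n → ℝ, vpair m v v ≤ c * vpair k v v) : contr k m ≤ n * c := by
  obtain ⟨R, hR, h1, h2⟩ := exists_frame hk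
  rw [contr_frame h1]
  have : ∀ a, ∑ p, ∑ q, R p a * R q a * m p q ≤ c := by
    intro a
    have h3 := hm fun p => R p a
    have h4 : R⁻¹.mulVec (fun p => R p a) = fun c => if c = a then 1 else 0 := by
      ext c
      have := congrFun (congrFun (Matrix.nonsing_inv_mul _ hR) c) a
      rw [Matrix.mul_apply, Matrix.one_apply] at this
      exact this
    rw [vpair_frame h2, h4] at h3
    simp only [mul_ite, mul_one, mul_zero, Finset.sum_ite_eq', Finset.mem_univ, if_true] at h3
    refine le_trans (le_of_eq ?_) h3
    exact Finset.sum_congr rfl fun p _ => Finset.sum_congr rfl fun q _ => by ring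
  calc _ ≤ ∑ _a : Fin n, c := Finset.sum_le_sum fun a _ => this a
    _ = n * c := by simp

/-- The squared norm of a curvature-type tensor: an endomorphism-valued form with two indices. -/
def curvNormSq (k : Mat n) (F : Fin n → Fin n → Mat n) : ℝ :=
  contr k (Matrix.of fun p q => fpair k (F p) (F q))

lemma frameForm_apply_sum (R : Mat n) (F : Fin n → Fin n → Mat n) (v : Fin n → ℝ) (c : Fin n) :
    frameForm R (fun p => ∑ q, v q • F p q) c = ∑ q, v q • ∑ p, R p c • F p q := by
  simp only [frameForm, Finset.smul_sum]
  rw [Finset.sum_comm]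
  exact Finset.sum_congr rfl fun q _ => Finset.sum_congr rfl fun p _ => smul_comm _ _ _

lemma fpair_add_left (D E D' : Fin n → Mat n) :
    fpair k (fun p => D p + E p) D' = fpair k D D' + fpair k E D' := by
  simp [fpair, contr, tpair_add_left, mul_add, Finset.sum_add_distrib]

lemma fpair_sum_left {ι : Type*} (s : Finset ι) (D : ι → Fin n → Mat n) (D' : Fin n → Mat n) :
    fpair k (fun p => ∑ i ∈ s, D i p) D' = ∑ i ∈ s, fpair k (D i) D' := by
  simp only [fpair, contr, tpair_sum_left, Matrix.of_apply, Finset.mul_sum]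
  rw [Finset.sum_congr rfl fun p _ => Finset.sum_comm, Finset.sum_comm]

lemma fpair_sum_right {ι : Type*} (s : Finset ι) (D : ι → Fin n → Mat n) (D' : Fin n → Mat n) :
    fpair k D' (fun p => ∑ i ∈ s, D i p) = ∑ i ∈ s, fpair k D' (D i) := by
  simp only [fpair, contr, tpair_sum_right, Matrix.of_apply, Finset.mul_sum]
  rw [Finset.sum_congr rfl fun p _ => Finset.sum_comm, Finset.sum_comm]

lemma fpair_smul_left (c : ℝ) (D D' : Fin n → Mat n) :
    fpair k (fun p => c • D p) D' = c * fpair k D D' := by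
  simp only [fpair, contr, tpair_smul_left, Matrix.of_apply, Finset.mul_sum]
  exact Finset.sum_congr rfl fun p _ => Finset.sum_congr rfl fun q _ => by ring

lemma fpair_smul_right (c : ℝ) (D D' : Fin n → Mat n) :
    fpair k D' (fun p => c • D p) = c * fpair k D' D := by
  simp only [fpair, contr, tpair_smul_right, Matrix.of_apply, Finset.mul_sum]
  exact Finset.sum_congr rfl fun p _ => Finset.sum_congr rfl fun q _ => by ring

open Matrix in
lemma curvNormSq_frame {R : Mat n} (h1 : k⁻¹ = R * Rᵀ) (F : Fin n → Fin n → Mat n) :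
    curvNormSq k F
      = ∑ c, fpair k (fun q => ∑ p, R p c • F p q) (fun q => ∑ p, R p c • F p q) := by
  rw [curvNormSq, contr_frame h1]
  refine Finset.sum_congr rfl fun c _ => ?_
  rw [fpair_sum_left]
  refine Finset.sum_congr rfl fun p _ => ?_
  rw [fpair_sum_right]
  refine Finset.sum_congr rfl fun q _ => ?_
  rw [fpair_smul_left, fpair_smul_right, Matrix.of_apply]
  ring

/-- `|F(·, v)|² ≤ |v|² |F|²`. -/
lemma fpair_contract_le (hk : k.PosDef) (v : Fin n → ℝ) (F : Fin n → Fin n → Mat n) :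
    fpair k (fun p => ∑ q, v q • F p q) (fun p => ∑ q, v q • F p q)
      ≤ vpair k v v * curvNormSq k F := by
  obtain ⟨R, -, h1, h2⟩ := exists_frame hk
  rw [fpair_frame h1, curvNormSq_frame h1, Finset.mul_sum]
  refine Finset.sum_le_sum fun c _ => ?_
  rw [frameForm_apply_sum]
  exact tpair_sum_smul_le hk v _

end Pairing

end Coord

/-! ### Behaviour under changes of coordinates -/

namespace Coord

section Invariance

variable {n : ℕ} {k k' L : Mat n}

/-- `A` and `A'` are the matrices of one endomorphism in two bases related by `L`. -/
def Similar (L A A' : Mat n) : Prop := L * A = A' * L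

lemma Similar.eq (hL : IsUnit L.det) {A A' : Mat n} (h : Similar L A A') : A = L⁻¹ * A' * L := by
  rw [Matrix.mul_assoc, ← show L * A = A' * L from h, ← Matrix.mul_assoc,
    Matrix.nonsing_inv_mul _ hL, Matrix.one_mul]

lemma Similar.mul {A A' B B' : Mat n} (hA : Similar L A A') (hB : Similar L B B') :
    Similar L (A * B) (A' * B') := by
  unfold Similar at *
  rw [← Matrix.mul_assoc, hA, Matrix.mul_assoc, hB, Matrix.mul_assoc]

lemma Similar.add {A A' B B' : Mat n} (hA : Similar L A A') (hB : Similar L B B') :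
    Similar L (A + B) (A' + B') := by
  unfold Similar at *
  rw [Matrix.mul_add, hA, hB, Matrix.add_mul]

lemma similar_one : Similar L (1 : Mat n) 1 := by simp [Similar]

open Matrix in
lemma inv_congr (hk : k = Lᵀ * k' * L) :
    k⁻¹ = L⁻¹ * k'⁻¹ * (L⁻¹)ᵀ := by
  rw [hk, Matrix.mul_inv_rev, Matrix.mul_inv_rev, Matrix.transpose_nonsing_inv, Matrix.mul_assoc]

open Matrix in
lemma tpair_congr (hL : IsUnit L.det) (hk : k = Lᵀ * k' * L) {A A' B B' : Mat n}
    (hA : Similar L A A') (hB : Similar L B B') : tpair k A B = tpair k' A' B' := by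
  have e1 : ∀ M : Mat n, L * (L⁻¹ * M) = M := fun M => Matrix.mul_nonsing_inv_cancel_left L M hL
  have e2 : ∀ M : Mat n, (L⁻¹)ᵀ * (Lᵀ * M) = M := fun M => by
    rw [← Matrix.mul_assoc, ← Matrix.transpose_mul, Matrix.mul_nonsing_inv _ hL,
      Matrix.transpose_one, Matrix.one_mul]
  unfold tpair
  rw [inv_congr hk, hA.eq hL, hB.eq hL]
  nth_rewrite 1 [hk]
  simp only [Matrix.transpose_mul, Matrix.mul_assoc, e1, e2]
  rw [Matrix.trace_mul_comm]
  simp only [Matrix.mul_assoc, Matrix.mul_nonsing_inv _ hL, Matrix.mul_one]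

open Matrix in
lemma contr_congr (hL : IsUnit L.det) (hk : k = Lᵀ * k' * L) (T' : Mat n) :
    contr k (Lᵀ * T' * L) = contr k' T' := by
  have e : ∀ a b : Mat n, contr a b = (a⁻¹ * bᵀ).trace := fun a b => by
    simp [contr, Matrix.trace, Matrix.mul_apply]
  have e2 : ∀ M : Mat n, (L⁻¹)ᵀ * (Lᵀ * M) = M := fun M => by
    rw [← Matrix.mul_assoc, ← Matrix.transpose_mul, Matrix.mul_nonsing_inv _ hL,
      Matrix.transpose_one, Matrix.one_mul]
  rw [e, e, inv_congr hk, Matrix.transpose_mul, Matrix.transpose_mul, Matrix.transpose_transpose]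
  simp only [Matrix.mul_assoc, e2]
  rw [Matrix.trace_mul_comm]
  simp only [Matrix.mul_assoc, Matrix.mul_nonsing_inv _ hL, Matrix.mul_one]

/-- The transformation rule of endomorphism-valued `1`-forms. -/
def SimilarForm (L : Mat n) (D D' : Fin n → Mat n) : Prop :=
  ∀ p, Similar L (D p) (∑ a, L a p • D' a)

lemma fpair_congr (hL : IsUnit L.det) (hk : k = L.transpose * k' * L) {D D' E E' : Fin n → Mat n}
    (hD : SimilarForm L D D') (hE : SimilarForm L E E') : fpair k D E = fpair k' D' E' := by
  unfold fpair
  rw [← contr_congr hL hk]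
  congr 1
  ext p q
  rw [Matrix.of_apply, tpair_congr hL hk (hD p) (hE q), tpair_sum_left]
  simp only [tpair_sum_right, tpair_smul_left, tpair_smul_right, Matrix.mul_apply,
    Matrix.transpose_apply, Matrix.of_apply, Finset.sum_mul]
  rw [Finset.sum_comm]
  exact Finset.sum_congr rfl fun a _ => Finset.sum_congr rfl fun b _ => by ring

lemma curvNormSq_congr (hL : IsUnit L.det) (hk : k = L.transpose * k' * L)
    {F F' : Fin n → Fin n → Mat n}
    (hF : ∀ p q, Similar L (F p q) (∑ a, ∑ b, (L a p * L b q) • F' a b)) :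
    curvNormSq k F = curvNormSq k' F' := by
  have hF2 : ∀ p, SimilarForm L (F p) (fun b => ∑ a, L a p • F' a b) := by
    intro p q
    have := hF p q
    rw [Finset.sum_comm] at this
    simp only [Finset.smul_sum, smul_smul]
    simpa only [mul_comm] using this
  unfold curvNormSq
  rw [← contr_congr hL hk]
  congr 1
  ext p q
  rw [Matrix.of_apply, fpair_congr hL hk (hF2 p) (hF2 q), fpair_sum_left]
  simp only [fpair_sum_right, fpair_smul_left, fpair_smul_right, Matrix.mul_apply,
    Matrix.transpose_apply, Matrix.of_apply, Finset.sum_mul]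
  rw [Finset.sum_comm]
  exact Finset.sum_congr rfl fun a _ => Finset.sum_congr rfl fun b _ => by ring

end Invariance

section Transition

variable {n : ℕ} {ψ : Eu n → Eu n} {Ω Ω' : Set (Eu n)} {h h' : Eu n → Mat n} {x : Eu n}

/-- The Jacobian matrix of a map of Euclidean space. -/
def jac (ψ : Eu n → Eu n) (z : Eu n) : Mat n :=
  Matrix.of fun a i => partialDeriv i (fun y => ψ y a) z

/-- `ψ : Ω → Ω'` is a smooth map pulling the metric `h'` back to the metric `h`. -/
structure CoordChange (h h' : Eu n → Mat n) (Ω Ω' : Set (Eu n)) (ψ : Eu n → Eu n) : Prop where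
  metric : IsMetricOn h Ω
  metric' : IsMetricOn h' Ω'
  maps : ∀ z ∈ Ω, ψ z ∈ Ω'
  smooth : ∀ a, ContDiffOn ℝ ∞ (fun z => ψ z a) Ω
  pullback : ∀ z ∈ Ω, h z = (jac ψ z).transpose * h' (ψ z) * jac ψ z

namespace CoordChange

variable (Ψ : CoordChange h h' Ω Ω' ψ)
include Ψ

lemma isUnit_jac (hx : x ∈ Ω) : IsUnit (jac ψ x).det := by
  rw [isUnit_iff_ne_zero]
  intro h0
  have := Ψ.metric.det_ne_zero x hx
  rw [Ψ.pullback x hx, Matrix.det_mul, h0, mul_zero] at this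
  exact this rfl

lemma jac_smooth : MatSmoothOn (jac ψ) Ω :=
  fun a i => contDiffOn_partialDeriv Ψ.metric.isOpen (Ψ.smooth a) i

lemma differentiableAt (hx : x ∈ Ω) : DifferentiableAt ℝ ψ x := by
  rw [differentiableAt_euclidean]
  exact fun a => ((Ψ.smooth a).contDiffAt (Ψ.metric.isOpen.mem_nhds hx)).differentiableAt (by simp)

lemma contDiffOn : ContDiffOn ℝ ∞ ψ Ω := by
  rw [contDiffOn_euclidean]
  exact Ψ.smooth

lemma partialDeriv_comp (hx : x ∈ Ω) {f : Eu n → ℝ} (hf : DifferentiableAt ℝ f (ψ x)) (p : Fin n) :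
    partialDeriv p (fun z => f (ψ z)) x = ∑ a, jac ψ x a p * partialDeriv a f (ψ x) := by
  have hd := Ψ.differentiableAt hx
  have h1 : partialDeriv p (fun z => f (ψ z)) x
      = fderiv ℝ f (ψ x) (fderiv ℝ ψ x (EuclideanSpace.single p 1)) := by
    unfold partialDeriv
    rw [show (fun z => f (ψ z)) = f ∘ ψ from rfl, fderiv_comp x hf hd]
    rfl
  rw [h1, fderiv_eq_sum_partialDeriv]
  refine Finset.sum_congr rfl fun a _ => ?_
  congr 1
  have h2 : HasFDerivAt (fun y => ψ y a)
      ((EuclideanSpace.proj a : Eu n →L[ℝ] ℝ).comp (fderiv ℝ ψ x)) x :=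
    (EuclideanSpace.proj a : Eu n →L[ℝ] ℝ).hasFDerivAt.comp x hd.hasFDerivAt
  simp [jac, partialDeriv, h2.fderiv]

lemma pd_comp (hx : x ∈ Ω) {A' : Eu n → Mat n} (hA : MatDiffAt A' (ψ x)) (p : Fin n) :
    pd p (fun z => A' (ψ z)) x = ∑ a, jac ψ x a p • pd a A' (ψ x) := by
  ext i j
  rw [pd_apply, Ψ.partialDeriv_comp hx (f := fun z => A' z i j) (hA i j)]
  simp [Matrix.sum_apply, pd_apply]

lemma matSmoothOn_comp {A' : Eu n → Mat n} (hA : MatSmoothOn A' Ω') :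
    MatSmoothOn (fun z => A' (ψ z)) Ω := fun i j =>
  (hA i j).comp Ψ.contDiffOn Ψ.maps

lemma pd_jac_symm (hx : x ∈ Ω) (p l a : Fin n) : pd p (jac ψ) x a l = pd l (jac ψ) x a p :=
  partialDeriv_comm Ψ.metric.isOpen (Ψ.smooth a) hx p l

/-- The connection form pulled back along `ψ`. -/
def _root_.Coord.pullConn (h' : Eu n → Mat n) (ψ : Eu n → Eu n) (p : Fin n) (x : Eu n) : Mat n :=
  ∑ a, jac ψ x a p • connMat h' a (ψ x)

/-- The transformation rule of the Christoffel symbols. -/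
lemma jac_mul_connMat (hx : x ∈ Ω) (p : Fin n) :
    jac ψ x * connMat h p x = pullConn h' ψ p x * jac ψ x + pd p (jac ψ) x := by
  have hL := Ψ.isUnit_jac hx
  have hy := Ψ.maps x hx
  set L := jac ψ x with hLdef
  have dL := Ψ.jac_smooth.matDiffAt Ψ.metric.isOpen hx
  have dh := Ψ.metric'.smooth.matDiffAt Ψ.metric'.isOpen hy
  have key : (fun p => L⁻¹ * (pullConn h' ψ p x * L + pd p (jac ψ) x)) p = connMat h p x := by
    refine connMat_unique Ψ.metric hx
      (fun p => L⁻¹ * (pullConn h' ψ p x * L + pd p (jac ψ) x)) ?_ ?_ p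
    · intro p m l
      simp only [Matrix.mul_apply, Matrix.add_apply]
      refine Finset.sum_congr rfl fun c _ => ?_
      rw [Ψ.pd_jac_symm hx p l c]
      congr 2
      simp only [pullConn, Matrix.sum_apply, Matrix.smul_apply, smul_eq_mul, Finset.sum_mul,
        ← hLdef]
      rw [Finset.sum_comm]
      refine Finset.sum_congr rfl fun a _ => Finset.sum_congr rfl fun b _ => ?_
      rw [connMat_symm Ψ.metric' b c a]
      ring
    · intro p
      have e1 : h x * L⁻¹ = L.transpose * h' (ψ x) := by
        rw [Ψ.pullback x hx, Matrix.mul_assoc, ← hLdef, Matrix.mul_nonsing_inv _ hL, Matrix.mul_one]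
      have e2 : (L⁻¹).transpose * h x = h' (ψ x) * L := by
        rw [Ψ.pullback x hx, ← hLdef, ← Matrix.mul_assoc, ← Matrix.mul_assoc,
          ← Matrix.transpose_mul, Matrix.mul_nonsing_inv _ hL, Matrix.transpose_one, Matrix.one_mul]
      have e3 : pd p h x = pd p (fun z => (jac ψ z).transpose * h' (ψ z) * jac ψ z) x := by
        apply pd_congr
        filter_upwards [Ψ.metric.isOpen.mem_nhds hx] with z hz
        exact Ψ.pullback z hz
      have dh' : MatDiffAt (fun z => h' (ψ z)) x :=
        (Ψ.matSmoothOn_comp Ψ.metric'.smooth).matDiffAt Ψ.metric.isOpen hx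
      have dLT : MatDiffAt (fun z => (jac ψ z).transpose) x := fun i j => dL j i
      have e4 : pd p (fun z => h' (ψ z)) x = h' (ψ x) * pullConn h' ψ p x
          + (pullConn h' ψ p x).transpose * h' (ψ x) := by
        rw [Ψ.pd_comp hx dh]
        simp only [pullConn, pd_metric Ψ.metric' hy, smul_add, Finset.sum_add_distrib,
          Finset.mul_sum, Finset.sum_mul, Matrix.transpose_sum, Matrix.transpose_smul,
          Matrix.mul_smul, Matrix.smul_mul]
      rw [e3, pd_mul p (dLT.mul dh') dL, pd_mul p dLT dh', pd_transpose, e4, ← hLdef]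
      rw [Matrix.transpose_mul, ← Matrix.mul_assoc (h x), e1, Matrix.mul_assoc _ (L⁻¹).transpose, e2]
      simp only [Matrix.transpose_add, Matrix.transpose_mul]
      noncomm_ring
  rw [← key, ← Matrix.mul_assoc, Matrix.mul_nonsing_inv _ hL, Matrix.one_mul]

/-- The covariant derivative of an endomorphism field is a tensor. -/
lemma similarForm_cd (hx : x ∈ Ω) {A A' : Eu n → Mat n} (hA : MatSmoothOn A Ω)
    (hA' : MatSmoothOn A' Ω') (hs : ∀ z ∈ Ω, Similar (jac ψ z) (A z) (A' (ψ z))) :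
    SimilarForm (jac ψ x) (fun p => cd h p A x) (fun a => cd h' a A' (ψ x)) := by
  intro p
  have hy := Ψ.maps x hx
  have dL := Ψ.jac_smooth.matDiffAt Ψ.metric.isOpen hx
  have dA := hA.matDiffAt Ψ.metric.isOpen hx
  have dA' := (Ψ.matSmoothOn_comp hA').matDiffAt Ψ.metric.isOpen hx
  have e1 : pd p (fun z => jac ψ z * A z) x = pd p (fun z => A' (ψ z) * jac ψ z) x := by
    apply pd_congr
    filter_upwards [Ψ.metric.isOpen.mem_nhds hx] with z hz
    exact hs z hz
  rw [pd_mul p dL dA, pd_mul p dA' dL, Ψ.pd_comp hx (hA'.matDiffAt Ψ.metric'.isOpen hy)] at e1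
  have e2 : ∑ a, jac ψ x a p • cd h' a A' (ψ x)
      = ∑ a, jac ψ x a p • pd a A' (ψ x) + pullConn h' ψ p x * A' (ψ x)
        - A' (ψ x) * pullConn h' ψ p x := by
    simp only [cd_eq, pullConn, smul_sub, smul_add, Finset.sum_add_distrib, Finset.sum_sub_distrib,
      Finset.mul_sum, Finset.sum_mul, Matrix.mul_smul, Matrix.smul_mul]
  have e3 := Ψ.jac_mul_connMat hx p
  have e4 : jac ψ x * A x = A' (ψ x) * jac ψ x := hs x hx
  unfold Similar
  beta_reduce
  rw [e2, cd_eq]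
  set L := jac ψ x
  set C := connMat h p x
  set a := pullConn h' ψ p x
  set S := ∑ a, jac ψ x a p • pd a A' (ψ x)
  have e5 : L * (pd p A x + C * A x - A x * C)
      = (pd p (jac ψ) x * A x + L * pd p A x) + L * C * A x - L * A x * C
        - pd p (jac ψ) x * A x := by noncomm_ring
  rw [e5, e1, e3, e4, Matrix.mul_assoc (A' (ψ x)) L C, e3, Matrix.add_mul, Matrix.mul_assoc a L, e4]
  noncomm_ring

/-- The curvature is a tensor. -/
lemma similar_curv (hx : x ∈ Ω) (p q : Fin n) :
    Similar (jac ψ x) (curv h p q x)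
      (∑ a, ∑ b, (jac ψ x a p * jac ψ x b q) • curv h' a b (ψ x)) := by
  have hy := Ψ.maps x hx
  have hO := Ψ.metric.isOpen
  have dL := Ψ.jac_smooth.matDiffAt hO hx
  have dC := fun b => (connMat_smooth Ψ.metric b).matDiffAt hO hx
  have sC' := fun b => Ψ.matSmoothOn_comp (connMat_smooth Ψ.metric' b)
  have sP : ∀ b, MatSmoothOn (pullConn h' ψ b) Ω := fun b =>
    MatSmoothOn.sum _ (fun a z => jac ψ z a b • connMat h' a (ψ z))
      fun a _ => MatSmoothOn.smul (Ψ.jac_smooth a b) (sC' a)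
  -- derivative of the transformation rule of the connection
  have e1 : ∀ a b, pd a (jac ψ) x * connMat h b x + jac ψ x * pd a (connMat h b) x
      = (pd a (pullConn h' ψ b) x * jac ψ x + pullConn h' ψ b x * pd a (jac ψ) x)
        + pd a (pd b (jac ψ)) x := by
    intro a b
    rw [← pd_mul a dL (dC b), ← pd_mul a ((sP b).matDiffAt hO hx) dL,
      ← pd_add a (((sP b).mul Ψ.jac_smooth).matDiffAt hO hx)
        ((Ψ.jac_smooth.pd hO b).matDiffAt hO hx)]
    apply pd_congr
    filter_upwards [hO.mem_nhds hx] with z hz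
    exact Ψ.jac_mul_connMat hz b
  -- derivative of the pulled-back connection
  have e2 : ∀ a b, pd a (pullConn h' ψ b) x
      = ∑ c, pd a (jac ψ) x c b • connMat h' c (ψ x)
        + ∑ c, ∑ d, (jac ψ x c b * jac ψ x d a) • pd d (connMat h' c) (ψ x) := by
    intro a b
    rw [show pullConn h' ψ b = fun z => ∑ c, jac ψ z c b • connMat h' c (ψ z) from rfl,
      pd_sum Finset.univ (fun c z => jac ψ z c b • connMat h' c (ψ z)) a
        fun c _ => (MatSmoothOn.smul (Ψ.jac_smooth c b) (sC' c)).matDiffAt hO hx,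
      ← Finset.sum_add_distrib]
    refine Finset.sum_congr rfl fun c _ => ?_
    rw [pd_smul a (dL c b) ((sC' c).matDiffAt hO hx),
      Ψ.pd_comp hx ((connMat_smooth Ψ.metric' c).matDiffAt Ψ.metric'.isOpen hy), Finset.smul_sum]
    simp only [smul_smul]
    rfl
  have e3 : ∑ a, ∑ b, (jac ψ x a p * jac ψ x b q) • curv h' a b (ψ x)
      = pd p (pullConn h' ψ q) x - pd q (pullConn h' ψ p) x
        + (pullConn h' ψ p x * pullConn h' ψ q x - pullConn h' ψ q x * pullConn h' ψ p x) := by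
    have c1 : ∑ a, ∑ b, (jac ψ x a p * jac ψ x b q) • pd a (connMat h' b) (ψ x)
        = ∑ c, ∑ d, (jac ψ x c q * jac ψ x d p) • pd d (connMat h' c) (ψ x) := by
      rw [Finset.sum_comm]
      simp only [mul_comm]
    have c2 : ∑ a, ∑ b, (jac ψ x a p * jac ψ x b q) • (connMat h' a (ψ x) * connMat h' b (ψ x))
        = pullConn h' ψ p x * pullConn h' ψ q x := by
      simp only [pullConn, Finset.sum_mul, Finset.mul_sum, Matrix.smul_mul, Matrix.mul_smul,
        smul_smul]
      refine Finset.sum_comm.trans (Finset.sum_congr rfl fun a _ => Finset.sum_congr rfl fun b _ => ?_)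
      rw [mul_comm]
    have c3 : ∑ a, ∑ b, (jac ψ x a p * jac ψ x b q) • (connMat h' b (ψ x) * connMat h' a (ψ x))
        = pullConn h' ψ q x * pullConn h' ψ p x := by
      simp only [pullConn, Finset.sum_mul, Finset.mul_sum, Matrix.smul_mul, Matrix.mul_smul,
        smul_smul]
    have c4 : ∑ c, pd p (jac ψ) x c q • connMat h' c (ψ x)
        = ∑ c, pd q (jac ψ) x c p • connMat h' c (ψ x) :=
      Finset.sum_congr rfl fun c _ => by rw [Ψ.pd_jac_symm hx p q c]
    rw [e2, e2, c4]
    simp only [curv, smul_sub, smul_add, Finset.sum_add_distrib, Finset.sum_sub_distrib]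
    rw [c1, c2, c3]
    abel
  have e4 := Ψ.jac_mul_connMat hx p
  have e5 := Ψ.jac_mul_connMat hx q
  have e6 := e1 p q
  have e7 := e1 q p
  rw [pd_comm hO Ψ.jac_smooth hx q p] at e7
  unfold Similar
  rw [e3, curv]
  set L := jac ψ x
  set P := pullConn h' ψ p x
  set Q := pullConn h' ψ q x
  set C := connMat h p x
  set D := connMat h q x
  have f1 : pd p (jac ψ) x = L * C - P * L := by rw [e4]; abel
  have f2 : pd q (jac ψ) x = L * D - Q * L := by rw [e5]; abel
  rw [f1] at e6
  rw [f2] at e7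
  have f3 : L * pd p (connMat h q) x - L * pd q (connMat h p) x
      = ((L * C - P * L) * D + L * pd p (connMat h q) x)
        - ((L * D - Q * L) * C + L * pd q (connMat h p) x)
        - (L * C - P * L) * D + (L * D - Q * L) * C := by abel
  rw [Matrix.mul_add, Matrix.mul_sub, f3, e6, e7]
  noncomm_ring

end CoordChange

end Transition

end Coord

/-! ### Charts of a Riemannian manifold -/

section ManifoldCharts

open Coord

variable {n : ℕ} {M : Type*} [TopologicalSpace M] [ChartedSpace (EuclideanSpace ℝ (Fin n)) M]
  [IsManifold (𝓡 n) ∞ M] {e e' : OpenPartialHomeomorph M (EuclideanSpace ℝ (Fin n))}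
  {g : RiemMetric n M}

/-- The differential of the chart `e`, with the tangent spaces of `M` identified with `ℝⁿ` by
definitional unfolding. -/
def dChart (e : OpenPartialHomeomorph M (Eu n)) (q : M) : Eu n →L[ℝ] Eu n :=
  mfderiv (𝓡 n) (𝓡 n) e q

/-- The differential of the inverse of the chart `e`. -/
def dSymm (e : OpenPartialHomeomorph M (Eu n)) (x : Eu n) : Eu n →L[ℝ] Eu n :=
  mfderiv (𝓡 n) (𝓡 n) e.symm x

/-- The metric as a bilinear form on `ℝⁿ` at each point. -/
def gBil (g : RiemMetric n M) (q : M) : Eu n →L[ℝ] Eu n →L[ℝ] ℝ := g.inner q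

/-- An endomorphism field as an endomorphism of `ℝⁿ` at each point. -/
def endoLin (J : EndoField n M) (q : M) : Eu n →L[ℝ] Eu n := J q

/-- The coordinate vectors of `ℝⁿ`. -/
abbrev basisVec (i : Fin n) : Eu n := EuclideanSpace.single i (1 : ℝ)

lemma metricCoord_eq (x : Eu n) (i j : Fin n) :
    metricCoord g e x i j
      = gBil g (e.symm x) (dSymm e x (basisVec i)) (dSymm e x (basisVec j)) := rfl

omit [IsManifold (𝓡 n) ∞ M] in
lemma endoCoord_eq (J : EndoField n M) (x : Eu n) (i j : Fin n) :
    endoCoord J e x i j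
      = dChart e (e.symm x) (endoLin J (e.symm x) (dSymm e x (basisVec j))) i := rfl

lemma eq_sum_basisVec (v : Eu n) : v = ∑ p, v p • basisVec p := by
  ext i
  simp [Pi.single_apply]

omit [IsManifold (𝓡 n) ∞ M] in
lemma mdifferentiableAt_chart (he : e ∈ IsManifold.maximalAtlas (𝓡 n) ∞ M) {q : M}
    (hq : q ∈ e.source) : MDifferentiableAt (𝓡 n) (𝓡 n) e q :=
  (contMDiffAt_of_mem_maximalAtlas he hq).mdifferentiableAt (by simp)

omit [IsManifold (𝓡 n) ∞ M] in
lemma mdifferentiableAt_chart_symm (he : e ∈ IsManifold.maximalAtlas (𝓡 n) ∞ M) {x : Eu n}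
    (hx : x ∈ e.target) : MDifferentiableAt (𝓡 n) (𝓡 n) e.symm x :=
  (contMDiffAt_symm_of_mem_maximalAtlas he hx).mdifferentiableAt (by simp)

omit [IsManifold (𝓡 n) ∞ M] in
lemma dChart_dSymm (he : e ∈ IsManifold.maximalAtlas (𝓡 n) ∞ M) {x : Eu n} (hx : x ∈ e.target)
    (v : Eu n) : dChart e (e.symm x) (dSymm e x v) = v := by
  have h1 : mfderiv (𝓡 n) (𝓡 n) (e ∘ e.symm) x = (mfderiv (𝓡 n) (𝓡 n) e (e.symm x)).comp
      (mfderiv (𝓡 n) (𝓡 n) e.symm x) :=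
    mfderiv_comp x (mdifferentiableAt_chart he (e.map_target hx)) (mdifferentiableAt_chart_symm he hx)
  have h2 : mfderiv (𝓡 n) (𝓡 n) (e ∘ e.symm) x = mfderiv (𝓡 n) (𝓡 n) (id : Eu n → Eu n) x := by
    apply Filter.EventuallyEq.mfderiv_eq
    filter_upwards [e.open_target.mem_nhds hx] with z hz
    exact e.right_inv hz
  rw [mfderiv_id] at h2
  have h3 := h1.symm.trans h2
  exact DFunLike.congr_fun h3 v

omit [IsManifold (𝓡 n) ∞ M] in
lemma dSymm_dChart (he : e ∈ IsManifold.maximalAtlas (𝓡 n) ∞ M) {x : Eu n} (hx : x ∈ e.target)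
    (v : Eu n) : dSymm e x (dChart e (e.symm x) v) = v := by
  have hi : Function.Injective (dChart e (e.symm x)) := by
    have hs : Function.Surjective (dChart e (e.symm x)) := fun v => ⟨_, dChart_dSymm he hx v⟩
    exact (LinearMap.injective_iff_surjective (f := (dChart e (e.symm x)).toLinearMap)).2 hs
  exact hi (dChart_dSymm he hx _)

lemma gBil_pos (q : M) {v : Eu n} (hv : v ≠ 0) : 0 < gBil g q v v := g.pos q v hv

lemma gBil_dSymm (x : Eu n) (v w : Eu n) :
    gBil g (e.symm x) (dSymm e x v) (dSymm e x w)
      = ∑ i, ∑ j, v i * w j * metricCoord g e x i j := by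
  conv_lhs => rw [eq_sum_basisVec v, eq_sum_basisVec w]
  simp only [map_sum, map_smul, _root_.sum_apply, _root_.smul_apply, smul_eq_mul, metricCoord_eq,
    Finset.mul_sum]
  rw [Finset.sum_comm]
  exact Finset.sum_congr rfl fun i _ => Finset.sum_congr rfl fun j _ => by ring

lemma metricCoord_symm (x : Eu n) (i j : Fin n) :
    metricCoord g e x i j = metricCoord g e x j i := g.symm _ _ _

lemma metricCoord_posDef (he : e ∈ IsManifold.maximalAtlas (𝓡 n) ∞ M) {x : Eu n}
    (hx : x ∈ e.target) : (metricCoord g e x).PosDef := by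
  rw [Matrix.posDef_iff_dotProduct_mulVec]
  refine ⟨?_, fun v hv => ?_⟩
  · ext i j
    exact metricCoord_symm x j i
  · set w : Eu n := WithLp.toLp 2 v
    have hw : dSymm e x w ≠ 0 := by
      intro h0
      have := dChart_dSymm he hx w
      rw [h0, map_zero] at this
      apply hv
      ext i
      exact (congrArg (fun u : Eu n => u i) this).symm
    have := gBil_pos (g := g) (e.symm x) hw
    rw [gBil_dSymm] at this
    simpa only [star_trivial, dotProduct, Matrix.mulVec, Finset.mul_sum, ← mul_assoc,
      mul_right_comm _ (metricCoord g e x _ _)] using this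

lemma metricCoord_smooth (he : e ∈ IsManifold.maximalAtlas (𝓡 n) ∞ M) :
    MatSmoothOn (metricCoord g e) e.target := by
  have hsec : ∀ i : Fin n, ContMDiffOn (𝓡 n) (𝓡 n).tangent ∞
      (fun x : Eu n => (⟨e.symm x, coordVec e x i⟩ : TangentBundle (𝓡 n) M)) e.target := by
    intro i
    have hc : ContMDiffOn (𝓡 n) (𝓡 n).tangent ∞
        (fun x : Eu n => (⟨x, basisVec i⟩ : TangentBundle (𝓡 n) (Eu n))) e.target :=
      contMDiffOn_vectorSpace_iff_contDiffOn.2 contDiffOn_const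
    have ht := (contMDiffOn_symm_of_mem_maximalAtlas he).contMDiffOn_tangentMapWithin (m := ∞)
      (by simp) e.open_target.uniqueMDiffOn
    have := ht.comp hc fun x hx => hx
    refine this.congr fun x hx => ?_
    simp only [Function.comp, tangentMapWithin, mfderivWithin_of_isOpen e.open_target hx]
    rfl
  intro i j
  have hb : ContMDiffOn (𝓡 n) (𝓡 n) ∞ e.symm e.target := contMDiffOn_symm_of_mem_maximalAtlas he
  have : ContMDiffOn (𝓡 n) ((𝓡 n).prod 𝓘(ℝ)) ∞
      (fun x => Bundle.TotalSpace.mk' ℝ (E := Bundle.Trivial M ℝ) (e.symm x)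
        (g.inner (e.symm x) (coordVec e x i) (coordVec e x j))) e.target :=
    ContMDiffOn.clm_bundle_apply₂ (F₁ := Eu n) (F₂ := Eu n)
      (g.contMDiff.comp_contMDiffOn hb) (hsec i) (hsec j)
  intro x hx
  have h2 := this x hx
  rw [Bundle.contMDiffWithinAt_totalSpace] at h2
  exact h2.2.contDiffWithinAt

lemma isMetricOn_metricCoord (he : e ∈ IsManifold.maximalAtlas (𝓡 n) ∞ M) :
    IsMetricOn (metricCoord g e) e.target where
  isOpen := e.open_target
  smooth := metricCoord_smooth he
  symm := metricCoord_symm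
  posDef := fun _ hx => metricCoord_posDef he hx

lemma Coord.IsMetricOn.mono {h : Eu n → Mat n} {Ω Ω' : Set (Eu n)} (H : IsMetricOn h Ω)
    (hs : Ω' ⊆ Ω) (ho : IsOpen Ω') : IsMetricOn h Ω' where
  isOpen := ho
  smooth := fun i j => (H.smooth i j).mono hs
  symm := H.symm
  posDef := fun z hz => H.posDef z (hs hz)

/-- The transition map between two charts. -/
def chartTrans (e e' : OpenPartialHomeomorph M (Eu n)) (x : Eu n) : Eu n := e' (e.symm x)

/-- The domain of the transition map between two charts. -/
def chartTransDom (e e' : OpenPartialHomeomorph M (Eu n)) : Set (Eu n) := (e.symm.trans e').source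

omit [IsManifold (𝓡 n) ∞ M] [ChartedSpace (EuclideanSpace ℝ (Fin n)) M] in
lemma mem_chartTransDom {x : Eu n} :
    x ∈ chartTransDom e e' ↔ x ∈ e.target ∧ e.symm x ∈ e'.source := by
  simp [chartTransDom]

omit [IsManifold (𝓡 n) ∞ M] [ChartedSpace (EuclideanSpace ℝ (Fin n)) M] in
lemma isOpen_chartTransDom : IsOpen (chartTransDom e e') := (e.symm.trans e').open_source

omit [IsManifold (𝓡 n) ∞ M] in
lemma contDiffOn_trans (he : e ∈ IsManifold.maximalAtlas (𝓡 n) ∞ M)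
    (he' : e' ∈ IsManifold.maximalAtlas (𝓡 n) ∞ M) : ContDiffOn ℝ ∞ (chartTrans e e') (chartTransDom e e') := by
  have h1 : ContMDiffOn (𝓡 n) (𝓡 n) ∞ (e' ∘ e.symm) (chartTransDom e e') :=
    (contMDiffOn_of_mem_maximalAtlas he').comp
      ((contMDiffOn_symm_of_mem_maximalAtlas he).mono fun x hx => (mem_chartTransDom.1 hx).1)
      fun x hx => (mem_chartTransDom.1 hx).2
  exact h1.contDiffOn

omit [IsManifold (𝓡 n) ∞ M] in
lemma fderiv_trans (he : e ∈ IsManifold.maximalAtlas (𝓡 n) ∞ M)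
    (he' : e' ∈ IsManifold.maximalAtlas (𝓡 n) ∞ M) {x : Eu n} (hx : x ∈ chartTransDom e e') (v : Eu n) :
    fderiv ℝ (chartTrans e e') x v = dChart e' (e.symm x) (dSymm e x v) := by
  have h1 : mfderiv (𝓡 n) (𝓡 n) (e' ∘ e.symm) x = (mfderiv (𝓡 n) (𝓡 n) e' (e.symm x)).comp
      (mfderiv (𝓡 n) (𝓡 n) e.symm x) :=
    mfderiv_comp x (mdifferentiableAt_chart he' (mem_chartTransDom.1 hx).2)
      (mdifferentiableAt_chart_symm he (mem_chartTransDom.1 hx).1)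
  rw [mfderiv_eq_fderiv] at h1
  exact DFunLike.congr_fun h1 v

omit [IsManifold (𝓡 n) ∞ M] in
lemma jac_trans (he : e ∈ IsManifold.maximalAtlas (𝓡 n) ∞ M)
    (he' : e' ∈ IsManifold.maximalAtlas (𝓡 n) ∞ M) {x : Eu n} (hx : x ∈ chartTransDom e e')
    (a i : Fin n) :
    jac (chartTrans e e') x a i = dChart e' (e.symm x) (dSymm e x (basisVec i)) a := by
  have hd : DifferentiableAt ℝ (chartTrans e e') x :=
    ((contDiffOn_trans he he').contDiffAt (isOpen_chartTransDom.mem_nhds hx)).differentiableAt (by simp)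
  have h2 : HasFDerivAt (fun y => chartTrans e e' y a)
      ((EuclideanSpace.proj a : Eu n →L[ℝ] ℝ).comp (fderiv ℝ (chartTrans e e') x)) x :=
    (EuclideanSpace.proj a : Eu n →L[ℝ] ℝ).hasFDerivAt.comp x hd.hasFDerivAt
  rw [← fderiv_trans he he' hx]
  simp [jac, partialDeriv, h2.fderiv]

omit [ChartedSpace (EuclideanSpace ℝ (Fin n)) M] [IsManifold (𝓡 n) ∞ M] in
lemma symm_trans_eq {x : Eu n} (hx : x ∈ chartTransDom e e') : e'.symm (chartTrans e e' x) = e.symm x :=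
  e'.left_inv (mem_chartTransDom.1 hx).2

omit [ChartedSpace (EuclideanSpace ℝ (Fin n)) M] [IsManifold (𝓡 n) ∞ M] in
lemma trans_mem_target {x : Eu n} (hx : x ∈ chartTransDom e e') : chartTrans e e' x ∈ e'.target :=
  e'.map_source (mem_chartTransDom.1 hx).2

omit [IsManifold (𝓡 n) ∞ M] in
lemma dSymm_trans (he : e ∈ IsManifold.maximalAtlas (𝓡 n) ∞ M)
    (he' : e' ∈ IsManifold.maximalAtlas (𝓡 n) ∞ M) {x : Eu n} (hx : x ∈ chartTransDom e e') (v : Eu n) :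
    dSymm e x v = dSymm e' (chartTrans e e' x) (fderiv ℝ (chartTrans e e') x v) := by
  rw [fderiv_trans he he' hx]
  have := dSymm_dChart he' (trans_mem_target hx) (dSymm e x v)
  rw [symm_trans_eq hx] at this
  exact this.symm

lemma coordChange_trans (he : e ∈ IsManifold.maximalAtlas (𝓡 n) ∞ M)
    (he' : e' ∈ IsManifold.maximalAtlas (𝓡 n) ∞ M) :
    CoordChange (metricCoord g e) (metricCoord g e') (chartTransDom e e') e'.target (chartTrans e e') where
  metric := (isMetricOn_metricCoord he).mono (fun _ hx => (mem_chartTransDom.1 hx).1) isOpen_chartTransDom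
  metric' := isMetricOn_metricCoord he'
  maps := fun _ hz => trans_mem_target hz
  smooth := contDiffOn_euclidean.1 (contDiffOn_trans he he')
  pullback := by
    intro z hz
    ext i j
    rw [metricCoord_eq, dSymm_trans he he' hz, dSymm_trans he he' hz, ← symm_trans_eq hz,
      gBil_dSymm]
    simp only [Matrix.mul_apply, Matrix.transpose_apply, jac_trans he he' hz, fderiv_trans he he' hz,
      Finset.sum_mul]
    rw [Finset.sum_comm]
    exact Finset.sum_congr rfl fun a _ => Finset.sum_congr rfl fun b _ => by ring

omit [IsManifold (𝓡 n) ∞ M] in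
lemma similar_endoCoord (he : e ∈ IsManifold.maximalAtlas (𝓡 n) ∞ M)
    (he' : e' ∈ IsManifold.maximalAtlas (𝓡 n) ∞ M) (J : EndoField n M) {x : Eu n}
    (hx : x ∈ chartTransDom e e') :
    Similar (jac (chartTrans e e') x) (endoCoord J e x) (endoCoord J e' (chartTrans e e' x)) := by
  have hx1 := (mem_chartTransDom.1 hx).1
  ext a j
  have hL : ∀ v : Eu n, dChart e' (e.symm x) (dSymm e x v) a
      = ∑ k, jac (chartTrans e e') x a k * v k := by
    intro v
    conv_lhs => rw [eq_sum_basisVec v]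
    simp only [map_sum, map_smul, jac_trans he he' hx]
    simp [mul_comm]
  have h1 : (jac (chartTrans e e') x * endoCoord J e x) a j
      = dChart e' (e.symm x) (endoLin J (e.symm x) (dSymm e x (basisVec j))) a := by
    rw [← dSymm_dChart he hx1 (endoLin J (e.symm x) (dSymm e x (basisVec j))), hL]
    simp only [Matrix.mul_apply, endoCoord_eq]
  rw [h1, Matrix.mul_apply]
  conv_lhs => rw [dSymm_trans he he' hx, eq_sum_basisVec (fderiv ℝ (chartTrans e e') x (basisVec j))]
  simp only [map_sum, map_smul, endoCoord_eq, symm_trans_eq hx, fderiv_trans he he' hx,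
    jac_trans he he' hx]
  simp [mul_comm]

lemma endoCoord_mul_self (he : e ∈ IsManifold.maximalAtlas (𝓡 n) ∞ M) {J : EndoField n M}
    (hJ : IsCompatibleACS g J) {x : Eu n} (hx : x ∈ e.target) :
    endoCoord J e x * endoCoord J e x = -1 := by
  ext a j
  have hv : ∀ v : Eu n, dChart e (e.symm x) (endoLin J (e.symm x) (dSymm e x v)) a
      = ∑ k, endoCoord J e x a k * v k := by
    intro v
    conv_lhs => rw [eq_sum_basisVec v]
    simp only [map_sum, map_smul, endoCoord_eq]
    simp [mul_comm]
  have h1 : endoLin J (e.symm x) (endoLin J (e.symm x) (dSymm e x (basisVec j)))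
      = -dSymm e x (basisVec j) := hJ.sq_eq_neg _ _
  have h2 := hv (dChart e (e.symm x) (endoLin J (e.symm x) (dSymm e x (basisVec j))))
  rw [dSymm_dChart he hx, h1, map_neg, dChart_dSymm he hx] at h2
  rw [Matrix.mul_apply]
  simp only [endoCoord_eq (j := j)]
  rw [← h2]
  simp [Matrix.one_apply]

lemma endoCoord_isometry (he : e ∈ IsManifold.maximalAtlas (𝓡 n) ∞ M) {J : EndoField n M}
    (hJ : IsCompatibleACS g J) {x : Eu n} (hx : x ∈ e.target) :
    (endoCoord J e x).transpose * metricCoord g e x * endoCoord J e x = metricCoord g e x := by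
  ext i j
  have h1 : gBil g (e.symm x) (endoLin J (e.symm x) (dSymm e x (basisVec i)))
      (endoLin J (e.symm x) (dSymm e x (basisVec j)))
      = gBil g (e.symm x) (dSymm e x (basisVec i)) (dSymm e x (basisVec j)) := hJ.isometry _ _ _
  rw [metricCoord_eq, ← h1, ← dSymm_dChart he hx (endoLin J (e.symm x) (dSymm e x (basisVec i))),
    ← dSymm_dChart he hx (endoLin J (e.symm x) (dSymm e x (basisVec j))), gBil_dSymm]
  simp only [Matrix.mul_apply, Matrix.transpose_apply, Finset.sum_mul, endoCoord_eq]
  rw [Finset.sum_comm]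
  exact Finset.sum_congr rfl fun a _ => Finset.sum_congr rfl fun b _ => by ring

lemma endoCoord_skew (he : e ∈ IsManifold.maximalAtlas (𝓡 n) ∞ M) {J : EndoField n M}
    (hJ : IsCompatibleACS g J) {x : Eu n} (hx : x ∈ e.target) :
    metricCoord g e x * endoCoord J e x + (endoCoord J e x).transpose * metricCoord g e x = 0 := by
  have h1 := endoCoord_isometry he hJ hx
  have h2 := endoCoord_mul_self he hJ hx
  have h3 := congrArg (fun X => X * endoCoord J e x) h1
  simp only [Matrix.mul_assoc, h2] at h3
  rw [← h3]
  simp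

end ManifoldCharts

/-! ### Riccati comparison, and the Gauss lemma in normal coordinates -/

namespace Coord

section Riccati

variable {p p' : ℝ → ℝ} {K S : ℝ}

/-- A supersolution of the Riccati equation `s p' + p + p² + K s² = 0` starting from `0` stays
above `-K s²` for a short time. -/
lemma riccati_lower (hK : 0 ≤ K) (hS : 2 * (K * S ^ 2) ≤ 1)
    (hd : ∀ s ∈ Ioo 0 S, HasDerivAt p (p' s) s)
    (hr : ∀ s ∈ Ioo 0 S, -p s - p s ^ 2 - K * s ^ 2 ≤ s * p' s)
    (h0 : Filter.Tendsto p (nhdsWithin 0 (Ioi 0)) (nhds 0)) {s : ℝ} (hs : s ∈ Ioo 0 S) :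
    -(K * s ^ 2) ≤ p s := by
  apply le_of_forall_pos_le_add
  intro δ' hδ'
  -- with `δ ≤ 1/4` the barrier `B = K u² + δ` satisfies `B < 1`, so that `B² < B` where `-p = B`
  set δ := min δ' (1 / 4) with hδ
  have hδ0 : 0 < δ := lt_min hδ' (by norm_num)
  have hδ4 : δ ≤ 1 / 4 := min_le_right _ _
  obtain ⟨ε, hε1, hε2⟩ : ∃ ε, -p ε < δ ∧ ε ∈ Ioo 0 s := by
    have h1 : ∀ᶠ ε in nhdsWithin (0 : ℝ) (Ioi 0), -δ < p ε := h0.eventually_const_lt (by linarith)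
    have h2 : ∀ᶠ ε in nhdsWithin (0 : ℝ) (Ioi 0), ε ∈ Ioo 0 s := Ioo_mem_nhdsGT hs.1
    obtain ⟨ε, h3, h4⟩ := (h1.and h2).exists
    exact ⟨ε, by linarith, h4⟩
  have hsub : ∀ u ∈ Icc ε s, u ∈ Ioo 0 S := fun u hu =>
    ⟨lt_of_lt_of_le hε2.1 hu.1, lt_of_le_of_lt hu.2 hs.2⟩
  have key := image_le_of_deriv_right_lt_deriv_boundary (f := fun u => -p u) (f' := fun u => -p' u)
    (a := ε) (b := s) (B := fun u => K * u ^ 2 + δ) (B' := fun u => K * (2 * u))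
    (fun u hu => (hd u (hsub u hu)).neg.continuousAt.continuousWithinAt)
    (fun u hu => (hd u (hsub u (Ico_subset_Icc_self hu))).neg.hasDerivWithinAt)
    (by nlinarith [mul_nonneg hK (sq_nonneg ε)])
    (fun u => by simpa using ((hasDerivAt_pow 2 u).const_mul K).add_const δ)
    (fun u hu hB => by
      have hu' := hsub u (Ico_subset_Icc_self hu)
      have h1 := hr u hu'
      have hKu : K * u ^ 2 ≤ 1 / 2 := by
        have : K * u ^ 2 ≤ K * S ^ 2 :=
          mul_le_mul_of_nonneg_left (pow_le_pow_left₀ hu'.1.le hu'.2.le 2) hK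
        linarith
      have hKu0 : 0 ≤ K * u ^ 2 := mul_nonneg hK (sq_nonneg u)
      have hp : p u = -(K * u ^ 2 + δ) := by linarith
      rw [hp] at h1
      set B := K * u ^ 2 + δ with hBdef
      have hBpos : 0 < B := by positivity
      have hBlt : B < 1 := by linarith
      have h2 : u * (-p' u) < u * (K * (2 * u)) := by nlinarith
      exact lt_of_mul_lt_mul_left h2 hu'.1.le)
    ⟨hε2.2.le, le_refl s⟩
  have := min_le_left δ' (1 / 4 : ℝ)
  linarith

/-- A subsolution of the Riccati equation `s p' + p + p² - K s² = 0` starting from `0` stays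
below `K s²`. -/
lemma riccati_upper (hK : 0 ≤ K) (hd : ∀ s ∈ Ioo 0 S, HasDerivAt p (p' s) s)
    (hr : ∀ s ∈ Ioo 0 S, s * p' s ≤ -p s - p s ^ 2 + K * s ^ 2)
    (h0 : Filter.Tendsto p (nhdsWithin 0 (Ioi 0)) (nhds 0)) {s : ℝ} (hs : s ∈ Ioo 0 S) :
    p s ≤ K * s ^ 2 := by
  apply le_of_forall_pos_le_add
  intro δ hδ0
  obtain ⟨ε, hε1, hε2⟩ : ∃ ε, p ε < δ ∧ ε ∈ Ioo 0 s := by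
    have h1 : ∀ᶠ ε in nhdsWithin (0 : ℝ) (Ioi 0), p ε < δ := h0.eventually_lt_const hδ0
    have h2 : ∀ᶠ ε in nhdsWithin (0 : ℝ) (Ioi 0), ε ∈ Ioo 0 s := Ioo_mem_nhdsGT hs.1
    exact (h1.and h2).exists
  have hsub : ∀ u ∈ Icc ε s, u ∈ Ioo 0 S := fun u hu =>
    ⟨lt_of_lt_of_le hε2.1 hu.1, lt_of_le_of_lt hu.2 hs.2⟩
  exact image_le_of_deriv_right_lt_deriv_boundary (f := p) (f' := p')
    (a := ε) (b := s) (B := fun u => K * u ^ 2 + δ) (B' := fun u => K * (2 * u))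
    (fun u hu => (hd u (hsub u hu)).continuousAt.continuousWithinAt)
    (fun u hu => (hd u (hsub u (Ico_subset_Icc_self hu))).hasDerivWithinAt)
    (by nlinarith [mul_nonneg hK (sq_nonneg ε)])
    (fun u => by simpa using ((hasDerivAt_pow 2 u).const_mul K).add_const δ)
    (fun u hu hB => by
      have hu' := hsub u (Ico_subset_Icc_self hu)
      have h1 := hr u hu'
      have hKu0 : 0 ≤ K * u ^ 2 := mul_nonneg hK (sq_nonneg u)
      rw [hB] at h1
      have h2 : u * p' u < u * (K * (2 * u)) := by
        nlinarith [sq_nonneg (K * u ^ 2 + δ)]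
      exact lt_of_mul_lt_mul_left h2 hu'.1.le)
    ⟨hε2.2.le, le_refl s⟩

/-- A subsolution of `q' = K - q²` that is very negative blows up before time `1`: this is how
the absence of conjugate points in the unit ball is used. -/
lemma riccati_blowup {q q' : ℝ → ℝ} {r : ℝ} (hK : 0 ≤ K) (hr1 : r < 1)
    (hd : ∀ s ∈ Ioo (0 : ℝ) 1, HasDerivAt q (q' s) s)
    (hq : ∀ s ∈ Ioo (0 : ℝ) 1, q' s ≤ K - q s ^ 2) {s : ℝ} (hs0 : 0 < s) (hsr : s ≤ r) :
    -(K + 1 + 2 / (1 - r)) ≤ q s := by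
  by_contra! hlt
  set l := -q s with hl
  have hr' : 0 < 1 - r := by linarith
  have h2r : 0 < 2 / (1 - r) := by positivity
  have hlK : K + 1 < l := by linarith
  have hlr : 2 / (1 - r) < l := by linarith
  have hl0 : 0 < l := by linarith
  -- as long as `q ≤ -l`, `q⁻¹` grows with slope at least `1/2`; from `-1/l` it would reach `0` at
  -- the time `s + 2/l < 1`
  set t := s + 2 / l with ht
  have hst : s < t := by
    have : 0 < 2 / l := by positivity
    linarith
  have ht1 : t < 1 := by
    have : 2 / l < 1 - r := by
      rw [div_lt_iff₀ hr'] at hlr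
      rw [div_lt_iff₀ hl0]
      linarith
    linarith
  have hsub : ∀ u ∈ Icc s t, u ∈ Ioo (0 : ℝ) 1 := fun u hu =>
    ⟨lt_of_lt_of_le hs0 hu.1, lt_of_le_of_lt hu.2 ht1⟩
  have hKl : 2 * K ≤ l ^ 2 := by nlinarith
  have hle : ∀ u ∈ Icc s t, q u ≤ -l := by
    intro u hu
    refine image_le_of_deriv_right_lt_deriv_boundary (f := q) (f' := q')
      (a := s) (b := t) (B := fun _ => -l) (B' := fun _ => 0)
      (fun u hu => (hd u (hsub u hu)).continuousAt.continuousWithinAt)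
      (fun u hu => (hd u (hsub u (Ico_subset_Icc_self hu))).hasDerivWithinAt)
      (by simp [hl]) (fun u => hasDerivAt_const _ _) (fun u hu hB => ?_) hu
    have := hq u (hsub u (Ico_subset_Icc_self hu))
    rw [hB] at this
    nlinarith
  have hmono : MonotoneOn (fun u => (q u)⁻¹ - u / 2) (Icc s t) := by
    have hdg : ∀ u ∈ Icc s t, HasDerivAt (fun u => (q u)⁻¹ - u / 2) (-q' u / q u ^ 2 - 1 / 2) u :=
      fun u hu => ((hd u (hsub u hu)).fun_inv (by linarith [hle u hu])).sub
        ((hasDerivAt_id u).div_const 2)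
    apply monotoneOn_of_deriv_nonneg (convex_Icc s t)
    · exact fun u hu => (hdg u hu).continuousAt.continuousWithinAt
    · intro u hu
      rw [interior_Icc] at hu
      exact (hdg u (Ioo_subset_Icc_self hu)).differentiableAt.differentiableWithinAt
    · intro u hu
      rw [interior_Icc] at hu
      have hu' := Ioo_subset_Icc_self hu
      rw [(hdg u hu').deriv]
      have h1 := hq u (hsub u hu')
      have h2 := hle u hu'
      have h3 : l ^ 2 ≤ q u ^ 2 := by nlinarith
      have h4 : 0 < q u ^ 2 := by nlinarith
      rw [sub_nonneg, le_div_iff₀ h4]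
      linarith
  have h1 := hmono ⟨le_refl s, hst.le⟩ ⟨hst.le, le_refl t⟩ hst.le
  have h2 : q s = -l := by rw [hl]; ring
  have h3 : (q t)⁻¹ < 0 := inv_lt_zero.2 (by linarith [hle t ⟨hst.le, le_refl t⟩])
  have h4 : t / 2 - s / 2 = l⁻¹ := by
    rw [ht]
    field_simp
    ring
  simp only [h2, inv_neg] at h1
  linarith

end Riccati

section Normal

variable {n : ℕ} {h : Eu n → Mat n} {x : Eu n}

/-- The metric `h` on the unit ball is written in normal coordinates. -/
structure IsNormal (h : Eu n → Mat n) : Prop where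
  metric : IsMetricOn h (Metric.ball 0 1)
  center : h 0 = 1
  geodesic : ∀ z ∈ Metric.ball (0 : Eu n) 1, ∀ k, ∑ i, ∑ j, christoffel h z k i j * z i * z j = 0

/-- The radial derivative `∑ x_l ∂_l`. -/
def rad (A : Eu n → Mat n) (x : Eu n) : Mat n := ∑ l, x l • pd l A x

/-- The connection matrix in the radial direction, `P^k_p = Γ^k_{pl} x^l`. It is the deviation of
the Hessian of `|x|² / 2` from the identity. -/
def radConn (h : Eu n → Mat n) (x : Eu n) : Mat n := ∑ l, x l • connMat h l x

lemma smul_mem_ball {v : Eu n} (hv : ‖v‖ ≤ 1) {s : ℝ} (hs : s ∈ Ico (0 : ℝ) 1) :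
    s • v ∈ Metric.ball (0 : Eu n) 1 := by
  rw [mem_ball_zero_iff, norm_smul, Real.norm_of_nonneg hs.1]
  calc s * ‖v‖ ≤ s * 1 := mul_le_mul_of_nonneg_left hv hs.1
    _ < 1 := by linarith [hs.2]

lemma hasDerivAt_ray {f : Eu n → ℝ} {v : Eu n} {s : ℝ} (hf : DifferentiableAt ℝ f (s • v)) :
    HasDerivAt (fun u : ℝ => f (u • v)) (∑ p, v p * partialDeriv p f (s • v)) s := by
  have h1 : HasDerivAt (fun u : ℝ => u • v) v s := by
    simpa using (hasDerivAt_id s).smul_const v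
  have := hf.hasFDerivAt.comp_hasDerivAt s h1
  rwa [fderiv_eq_sum_partialDeriv] at this

/-- A function with vanishing radial derivative takes its value at the centre. -/
lemma eq_of_ray_deriv_zero {u : ℝ → ℝ} (hd : ∀ s ∈ Ioc (0 : ℝ) 1, HasDerivAt u 0 s)
    (hc : ContinuousAt u 0) : u 1 = u 0 := by
  have h1 : ∀ ε ∈ Ioc (0 : ℝ) 1, u ε = u 1 := by
    intro ε hε
    have := constant_of_has_deriv_right_zero (f := u) (a := ε) (b := 1)
      (fun s hs => (hd s ⟨lt_of_lt_of_le hε.1 hs.1, hs.2⟩).continuousAt.continuousWithinAt)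
      (fun s hs => (hd s ⟨lt_of_lt_of_le hε.1 hs.1, hs.2.le⟩).hasDerivWithinAt)
    exact (this 1 ⟨hε.2, le_refl _⟩).symm
  have h2 : Filter.Tendsto u (nhdsWithin 0 (Ioi 0)) (nhds (u 0)) :=
    hc.tendsto.mono_left nhdsWithin_le_nhds
  have h3 : Filter.Tendsto u (nhdsWithin 0 (Ioi 0)) (nhds (u 1)) := by
    apply Filter.Tendsto.congr' _ tendsto_const_nhds
    filter_upwards [Ioc_mem_nhdsGT (zero_lt_one (α := ℝ))] with ε hε
    exact (h1 ε hε).symm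
  exact tendsto_nhds_unique h3 h2

lemma sum_smul_partialDeriv {f : Eu n → ℝ} {v : Eu n} {s : ℝ} :
    ∑ p, (s • v) p * partialDeriv p f (s • v) = s * ∑ p, v p * partialDeriv p f (s • v) := by
  rw [Finset.mul_sum]
  exact Finset.sum_congr rfl fun p _ => by simp [mul_assoc]

namespace IsNormal

variable (N : IsNormal h)
include N

lemma differentiableAt (hx : x ∈ Metric.ball (0 : Eu n) 1) (i j : Fin n) :
    DifferentiableAt ℝ (fun z => h z i j) x :=
  N.metric.smooth.matDiffAt N.metric.isOpen hx i j

/-- The geodesic equation of the rays, with the index lowered. -/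
lemma geodesic_lower (hx : x ∈ Metric.ball (0 : Eu n) 1) (m : Fin n) :
    ∑ l, ∑ p, x l * x p * partialDeriv l (fun z => h z p m) x
      = (1 / 2) * ∑ l, ∑ p, x l * x p * partialDeriv m (fun z => h z l p) x := by
  have h1 : ∑ l, ∑ p, x l * x p * (h x * connMat h p x) m l = 0 := by
    simp only [Matrix.mul_apply, connMat, Matrix.of_apply, Finset.mul_sum]
    rw [Finset.sum_congr rfl fun l _ => Finset.sum_comm, Finset.sum_comm]
    apply Finset.sum_eq_zero
    intro k _
    have := N.geodesic x hx k
    calc _ = h x m k * ∑ i, ∑ j, christoffel h x k i j * x i * x j := by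
          rw [Finset.mul_sum]
          refine Finset.sum_congr rfl fun i _ => ?_
          rw [Finset.mul_sum]
          exact Finset.sum_congr rfl fun j _ => by ring
      _ = 0 := by rw [this, mul_zero]
  simp only [metric_mul_connMat N.metric hx] at h1
  have h2 : ∑ l, ∑ p, x l * x p * partialDeriv p (fun z => h z l m) x
      = ∑ l, ∑ p, x l * x p * partialDeriv l (fun z => h z p m) x := by
    rw [Finset.sum_comm]
    exact Finset.sum_congr rfl fun l _ => Finset.sum_congr rfl fun p _ => by ring
  have h3 : ∑ l, ∑ p, x l * x p * (1 / 2 * (partialDeriv l (fun z => h z p m) x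
      + partialDeriv p (fun z => h z l m) x - partialDeriv m (fun z => h z l p) x))
      = 1 / 2 * (∑ l, ∑ p, x l * x p * partialDeriv l (fun z => h z p m) x)
        + 1 / 2 * (∑ l, ∑ p, x l * x p * partialDeriv p (fun z => h z l m) x)
        - 1 / 2 * ∑ l, ∑ p, x l * x p * partialDeriv m (fun z => h z l p) x := by
    simp only [Finset.mul_sum, ← Finset.sum_add_distrib, ← Finset.sum_sub_distrib]
    exact Finset.sum_congr rfl fun l _ => Finset.sum_congr rfl fun p _ => by ring
  rw [h3, h2] at h1
  linarith

/-- Contracting the lowered geodesic equation once more with `x` equates the radial derivative of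
`h(w, w)`, for fixed `w = x`, with half of itself; so `h(w, w)` is constant along the ray. -/
lemma vpair_self (hx : x ∈ Metric.ball (0 : Eu n) 1) : vpair (h x) x x = ∑ i, x i ^ 2 := by
  have hmem : ∀ s ∈ Icc (0 : ℝ) 1, s • x ∈ Metric.ball (0 : Eu n) 1 := by
    intro s hs
    rw [mem_ball_zero_iff] at *
    rw [norm_smul, Real.norm_of_nonneg hs.1]
    nlinarith [hs.1, hs.2, norm_nonneg x]
  have hdf : ∀ s ∈ Icc (0 : ℝ) 1,
      DifferentiableAt ℝ (fun z => vpair (h z) x x) (s • x) := by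
    intro s hs
    unfold vpair
    exact DifferentiableAt.fun_sum fun i _ => DifferentiableAt.fun_sum fun j _ =>
      ((N.differentiableAt (hmem s hs) i j).mul_const _).mul_const _
  have hpd : ∀ s ∈ Icc (0 : ℝ) 1, ∀ p, partialDeriv p (fun z => vpair (h z) x x) (s • x)
      = ∑ i, ∑ j, x i * x j * partialDeriv p (fun z => h z i j) (s • x) := by
    intro s hs p
    have hd := N.differentiableAt (hmem s hs)
    unfold vpair
    rw [partialDeriv_sum _ (fun i z => ∑ j, h z i j * x i * x j) p fun i _ =>
      DifferentiableAt.fun_sum fun j _ => ((hd i j).mul_const _).mul_const _]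
    refine Finset.sum_congr rfl fun i _ => ?_
    rw [partialDeriv_sum _ (fun j z => h z i j * x i * x j) p fun j _ =>
      ((hd i j).mul_const _).mul_const _]
    refine Finset.sum_congr rfl fun j _ => ?_
    rw [show (fun z => h z i j * x i * x j) = fun z => h z i j * (x i * x j) from
      funext fun z => by ring, partialDeriv_mul p (hd i j) (differentiableAt_const _),
      partialDeriv_const]
    ring
  have key := eq_of_ray_deriv_zero (u := fun s : ℝ => vpair (h (s • x)) x x) ?_ ?_
  · simp only [one_smul, zero_smul, N.center] at key
    rw [key]
    simp [vpair, Matrix.one_apply, sq]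
  · intro s hs
    have hs' : s ∈ Icc (0 : ℝ) 1 := Ioc_subset_Icc_self hs
    have h1 := hasDerivAt_ray (hdf s hs')
    have h0 : ∑ p, x p * partialDeriv p (fun z => vpair (h z) x x) (s • x) = 0 := by
      have h2 : ∑ m, (s • x) m * (∑ l, ∑ p, (s • x) l * (s • x) p *
            partialDeriv l (fun z => h z p m) (s • x))
          = ∑ m, (s • x) m * ((1 / 2) * ∑ l, ∑ p, (s • x) l * (s • x) p *
            partialDeriv m (fun z => h z l p) (s • x)) :=
        Finset.sum_congr rfl fun m _ => by rw [N.geodesic_lower (hmem s hs') m]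
      have h3 : ∑ m, (s • x) m * (∑ l, ∑ p, (s • x) l * (s • x) p *
            partialDeriv l (fun z => h z p m) (s • x))
          = ∑ m, (s • x) m * (∑ l, ∑ p, (s • x) l * (s • x) p *
            partialDeriv m (fun z => h z l p) (s • x)) := by
        simp only [Finset.mul_sum]
        rw [Finset.sum_comm]
        refine Finset.sum_congr rfl fun l _ => ?_
        rw [Finset.sum_comm]
        exact Finset.sum_congr rfl fun m _ => Finset.sum_congr rfl fun p _ => by ring
      have h4 : ∑ m, (s • x) m * (∑ l, ∑ p, (s • x) l * (s • x) p *
            partialDeriv m (fun z => h z l p) (s • x))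
          = s ^ 3 * ∑ p, x p * partialDeriv p (fun z => vpair (h z) x x) (s • x) := by
        rw [Finset.mul_sum]
        refine Finset.sum_congr rfl fun m _ => ?_
        rw [hpd s hs' m]
        simp only [PiLp.smul_apply, smul_eq_mul, Finset.mul_sum]
        exact Finset.sum_congr rfl fun i _ => Finset.sum_congr rfl fun j _ => by ring
      have h5 : ∑ m, (s • x) m * ((1 / 2) * ∑ l, ∑ p, (s • x) l * (s • x) p *
            partialDeriv m (fun z => h z l p) (s • x))
          = (1 / 2) * ∑ m, (s • x) m * (∑ l, ∑ p, (s • x) l * (s • x) p *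
            partialDeriv m (fun z => h z l p) (s • x)) := by
        rw [Finset.mul_sum]
        exact Finset.sum_congr rfl fun m _ => by ring
      rw [h5, h3, h4] at h2
      have h6 : s ^ 3 * ∑ p, x p * partialDeriv p (fun z => vpair (h z) x x) (s • x) = 0 := by
        linarith
      exact (mul_eq_zero.1 h6).resolve_left (pow_ne_zero 3 hs.1.ne')
    rwa [h0] at h1
  · exact (hasDerivAt_ray (hdf 0 ⟨le_refl _, zero_le_one⟩)).continuousAt

/-- The derivative of `h_{ij} x^i x^j = |x|²`. -/
lemma partialDeriv_vpair_self (hx : x ∈ Metric.ball (0 : Eu n) 1) (l : Fin n) :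
    ∑ i, ∑ j, x i * x j * partialDeriv l (fun z => h z i j) x + 2 * ∑ j, h x l j * x j
      = 2 * x l := by
  have hco : ∀ i, DifferentiableAt ℝ (fun z : Eu n => z i) x := fun i =>
    (EuclideanSpace.proj i : Eu n →L[ℝ] ℝ).differentiableAt
  have hd := N.differentiableAt hx
  have h1 : partialDeriv l (fun z => vpair (h z) z z) x
      = partialDeriv l (fun z : Eu n => ∑ i, z i * z i) x := by
    apply partialDeriv_congr
    filter_upwards [Metric.isOpen_ball.mem_nhds hx] with z hz
    rw [N.vpair_self hz]
    exact Finset.sum_congr rfl fun i _ => sq _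
  rw [partialDeriv_sum _ (fun i (z : Eu n) => z i * z i) l fun i _ => (hco i).mul (hco i)] at h1
  unfold vpair at h1
  rw [partialDeriv_sum _ (fun i (z : Eu n) => ∑ j, h z i j * z i * z j) l fun i _ =>
    DifferentiableAt.fun_sum fun j _ => ((hd i j).mul (hco i)).mul (hco j)] at h1
  have h2 : ∀ i, partialDeriv l (fun z : Eu n => ∑ j, h z i j * z i * z j) x
      = ∑ j, (x i * x j * partialDeriv l (fun z => h z i j) x
        + (if i = l then h x i j * x j else 0) + (if j = l then h x i j * x i else 0)) := by
    intro i
    rw [partialDeriv_sum _ (fun j (z : Eu n) => h z i j * z i * z j) l fun j _ =>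
      ((hd i j).mul (hco i)).mul (hco j)]
    refine Finset.sum_congr rfl fun j _ => ?_
    rw [partialDeriv_mul l ((hd i j).fun_mul (hco i)) (hco j), partialDeriv_mul l (hd i j) (hco i),
      partialDeriv_coord, partialDeriv_coord]
    split_ifs <;> ring
  simp only [h2, Finset.sum_add_distrib] at h1
  have h3 : ∑ i, ∑ j, (if i = l then h x i j * x j else 0) = ∑ j, h x l j * x j := by
    rw [Finset.sum_comm]
    simp
  have h4 : ∑ i, ∑ j, (if j = l then h x i j * x i else 0) = ∑ j, h x l j * x j := by
    simp only [Finset.sum_ite_eq', Finset.mem_univ, if_true]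
    exact Finset.sum_congr rfl fun i _ => by rw [N.metric.symm]
  have h5 : ∀ i, partialDeriv l (fun z : Eu n => z i * z i) x = if i = l then 2 * x i else 0 := by
    intro i
    rw [partialDeriv_mul l (hco i) (hco i), partialDeriv_coord]
    split_ifs <;> ring
  rw [h3, h4] at h1
  simp only [h5, Finset.sum_ite_eq', Finset.mem_univ, if_true] at h1
  linarith

/-- The derivative of a component of `h x`. -/
lemma partialDeriv_mulVec (hx : x ∈ Metric.ball (0 : Eu n) 1) (l j : Fin n) :
    partialDeriv l (fun z : Eu n => ∑ p, h z j p * z p) x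
      = ∑ p, partialDeriv l (fun z => h z j p) x * x p + h x j l := by
  have hco : ∀ i, DifferentiableAt ℝ (fun z : Eu n => z i) x := fun i =>
    (EuclideanSpace.proj i : Eu n →L[ℝ] ℝ).differentiableAt
  have hd := N.differentiableAt hx
  rw [partialDeriv_sum _ (fun p (z : Eu n) => h z j p * z p) l fun p _ => (hd j p).mul (hco p)]
  have : ∀ p, partialDeriv l (fun z : Eu n => h z j p * z p) x
      = partialDeriv l (fun z => h z j p) x * x p + if p = l then h x j p else 0 := by
    intro p
    rw [partialDeriv_mul l (hd j p) (hco p), partialDeriv_coord]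
    split_ifs <;> ring
  simp [this, Finset.sum_add_distrib]

/-- The **Gauss lemma**: the radial vector is its own gradient direction, `h_{jp} x^p = x^j`. -/
lemma gauss (hx : x ∈ Metric.ball (0 : Eu n) 1) (j : Fin n) : ∑ p, h x j p * x p = x j := by
  have hmem : ∀ s ∈ Icc (0 : ℝ) 1, s • x ∈ Metric.ball (0 : Eu n) 1 := by
    intro s hs
    rw [mem_ball_zero_iff] at *
    rw [norm_smul, Real.norm_of_nonneg hs.1]
    nlinarith [hs.1, hs.2, norm_nonneg x]
  have hco : ∀ i (y : Eu n), DifferentiableAt ℝ (fun z : Eu n => z i) y := fun i _ =>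
    (EuclideanSpace.proj i : Eu n →L[ℝ] ℝ).differentiableAt
  set f : Eu n → ℝ := fun z => ∑ p, h z j p * z p - z j with hf
  have hsum : ∀ y ∈ Metric.ball (0 : Eu n) 1,
      DifferentiableAt ℝ (fun z : Eu n => ∑ p, h z j p * z p) y := fun y hy =>
    DifferentiableAt.fun_sum fun p _ => (N.differentiableAt hy j p).mul (hco p y)
  have hdf : ∀ s ∈ Icc (0 : ℝ) 1, DifferentiableAt ℝ f (s • x) := fun s hs =>
    (hsum _ (hmem s hs)).sub (hco j _)
  -- the covector `h x - x` has vanishing derivative along the rays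
  have hrad : ∀ y ∈ Metric.ball (0 : Eu n) 1, ∑ l, y l * partialDeriv l f y = 0 := by
    intro y hy
    have h1 : ∀ l, partialDeriv l f y = ∑ p, partialDeriv l (fun z => h z j p) y * y p + h y j l
        - if j = l then 1 else 0 := by
      intro l
      rw [hf, partialDeriv_sub l (hsum y hy) (hco j y), N.partialDeriv_mulVec hy, partialDeriv_coord]
    simp only [h1, mul_sub, mul_add, Finset.sum_add_distrib, Finset.sum_sub_distrib, mul_ite, mul_one,
      mul_zero, Finset.sum_ite_eq, Finset.mem_univ, if_true]
    have h2 := N.geodesic_lower hy j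
    have h3 := N.partialDeriv_vpair_self hy j
    have h4 : ∑ l, y l * ∑ p, partialDeriv l (fun z => h z j p) y * y p
        = ∑ l, ∑ p, y l * y p * partialDeriv l (fun z => h z p j) y := by
      refine Finset.sum_congr rfl fun l _ => ?_
      rw [Finset.mul_sum]
      refine Finset.sum_congr rfl fun p _ => ?_
      rw [show (fun z => h z j p) = fun z => h z p j from funext fun z => N.metric.symm z j p]
      ring
    have h5 : ∑ l, y l * h y j l = ∑ l, h y j l * y l :=
      Finset.sum_congr rfl fun l _ => mul_comm _ _
    rw [h4, h2, h5]
    linarith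
  have key := eq_of_ray_deriv_zero (u := fun s : ℝ => f (s • x)) ?_ ?_
  · simp only [one_smul, zero_smul, hf] at key
    simp at key
    linarith
  · intro s hs
    have hs' : s ∈ Icc (0 : ℝ) 1 := Ioc_subset_Icc_self hs
    have h1 := hasDerivAt_ray (hdf s hs')
    have h2 := hrad (s • x) (hmem s hs')
    rw [sum_smul_partialDeriv] at h2
    rwa [(mul_eq_zero.1 h2).resolve_left hs.1.ne'] at h1
  · exact (hasDerivAt_ray (hdf 0 ⟨le_refl _, zero_le_one⟩)).continuousAt

/-- `h P` is symmetric: up to the radial derivative of `h`, the derivative of the Gauss lemma shows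
that its antisymmetric part vanishes. -/
lemma metric_mul_radConn (hx : x ∈ Metric.ball (0 : Eu n) 1) :
    (h x * radConn h x).transpose = h x * radConn h x := by
  have hs : ∀ i j, (fun z => h z i j) = fun z => h z j i :=
    fun i j => funext fun z => N.metric.symm z i j
  have hg : ∀ l j, ∑ p, x p * partialDeriv l (fun z => h z p j) x
      = (if j = l then 1 else 0) - h x j l := by
    intro l j
    have h1 := N.partialDeriv_mulVec hx l j
    have h2 : partialDeriv l (fun z : Eu n => ∑ p, h z j p * z p) x
        = partialDeriv l (fun z : Eu n => z j) x := by
      apply partialDeriv_congr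
      filter_upwards [Metric.isOpen_ball.mem_nhds hx] with z hz
      exact N.gauss hz j
    rw [h2, partialDeriv_coord] at h1
    rw [h1, add_sub_cancel_right]
    exact Finset.sum_congr rfl fun p _ => by rw [hs p j]; ring
  have e : ∀ j l, (h x * radConn h x) j l = 1 / 2 * (∑ p, x p * partialDeriv l (fun z => h z p j) x
      + ∑ p, x p * partialDeriv p (fun z => h z l j) x
      - ∑ p, x p * partialDeriv j (fun z => h z p l) x) := by
    intro j l
    rw [radConn, Finset.mul_sum, Matrix.sum_apply]
    simp only [Matrix.mul_smul, Matrix.smul_apply, smul_eq_mul, metric_mul_connMat N.metric hx,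
      ← Finset.sum_add_distrib, ← Finset.sum_sub_distrib, Finset.mul_sum]
    refine Finset.sum_congr rfl fun p _ => ?_
    rw [hs l p]
    ring
  ext j l
  rw [Matrix.transpose_apply, e, e, hg, hg, hs j l, N.metric.symm x j l]
  simp only [eq_comm (a := j) (b := l)]

lemma radConn_transpose_mul (hx : x ∈ Metric.ball (0 : Eu n) 1) :
    (radConn h x).transpose * h x = h x * radConn h x := by
  rw [← N.metric_mul_radConn hx, Matrix.transpose_mul, N.metric.transpose_eq]

/-- The radial derivative of the metric. -/
lemma rad_metric (hx : x ∈ Metric.ball (0 : Eu n) 1) :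
    rad h x = (2 : ℝ) • (h x * radConn h x) := by
  have : rad h x = h x * radConn h x + (radConn h x).transpose * h x := by
    simp only [rad, radConn, pd_metric N.metric hx, smul_add, Finset.sum_add_distrib, Finset.mul_sum,
      Finset.sum_mul, Matrix.transpose_sum, Matrix.transpose_smul, Matrix.mul_smul, Matrix.smul_mul]
  rw [this, N.radConn_transpose_mul hx, two_smul]

/-- The Jacobi operator `R(·, x) x`. -/
def _root_.Coord.jacobiOp (h : Eu n → Mat n) (x : Eu n) : Mat n :=
  Matrix.of fun k p => ∑ i, ∑ j, x i * x j * curv h p i x k j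

/-- The Riccati equation of the Hessian of `|x|² / 2` along the rays. -/
lemma rad_radConn (hx : x ∈ Metric.ball (0 : Eu n) 1) :
    rad (radConn h) x = -radConn h x - radConn h x * radConn h x - jacobiOp h x := by
  have hO := N.metric.isOpen
  have dC : ∀ i, MatDiffAt (connMat h i) x := fun i =>
    (connMat_smooth N.metric i).matDiffAt hO hx
  have hco : ∀ i, DifferentiableAt ℝ (fun z : Eu n => z i) x := fun i =>
    (EuclideanSpace.proj i : Eu n →L[ℝ] ℝ).differentiableAt
  -- derivative of the geodesic equation
  have ha : ∀ k p, ∑ i, ∑ j, x i * x j * pd p (connMat h i) x k j = -2 * radConn h x k p := by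
    intro k p
    have h1 : partialDeriv p (fun z : Eu n => ∑ i, ∑ j, z i * z j * connMat h i z k j) x = 0 := by
      rw [← partialDeriv_const (x := x) p 0]
      apply partialDeriv_congr
      filter_upwards [Metric.isOpen_ball.mem_nhds hx] with z hz
      rw [← N.geodesic z hz k, Finset.sum_comm]
      exact Finset.sum_congr rfl fun i _ => Finset.sum_congr rfl fun j _ => by
        simp only [connMat, Matrix.of_apply]; ring
    rw [partialDeriv_sum _ (fun i (z : Eu n) => ∑ j, z i * z j * connMat h i z k j) p fun i _ =>
      DifferentiableAt.fun_sum fun j _ => ((hco i).mul (hco j)).mul (dC i k j)] at h1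
    have h2 : ∀ i, partialDeriv p (fun z : Eu n => ∑ j, z i * z j * connMat h i z k j) x
        = ∑ j, (x i * x j * pd p (connMat h i) x k j
          + (if i = p then x j * connMat h i x k j else 0)
          + (if j = p then x i * connMat h i x k j else 0)) := by
      intro i
      rw [partialDeriv_sum _ (fun j (z : Eu n) => z i * z j * connMat h i z k j) p fun j _ =>
        ((hco i).mul (hco j)).mul (dC i k j)]
      refine Finset.sum_congr rfl fun j _ => ?_
      rw [partialDeriv_mul p ((hco i).fun_mul (hco j)) (dC i k j), partialDeriv_mul p (hco i) (hco j),
        partialDeriv_coord, partialDeriv_coord, pd_apply]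
      split_ifs <;> ring
    simp only [h2, Finset.sum_add_distrib] at h1
    have h3 : ∑ i, ∑ j, (if i = p then x j * connMat h i x k j else 0) = radConn h x k p := by
      rw [Finset.sum_comm]
      simp only [Finset.sum_ite_eq', Finset.mem_univ, if_true, radConn, Matrix.sum_apply,
        Matrix.smul_apply, smul_eq_mul]
      exact Finset.sum_congr rfl fun j _ => by rw [connMat_symm N.metric]
    have h4 : ∑ i, ∑ j, (if j = p then x i * connMat h i x k j else 0) = radConn h x k p := by
      simp [radConn, Matrix.sum_apply]
    rw [h3, h4] at h1
    linarith
  have hPapp : ∀ k p, radConn h x k p = ∑ j, x j * connMat h p x k j := by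
    intro k p
    simp only [radConn, Matrix.sum_apply, Matrix.smul_apply, smul_eq_mul]
    exact Finset.sum_congr rfl fun j _ => by rw [connMat_symm N.metric]
  -- the derivative of the factor `x^j` in `P^k_p = x^j Γ^k_{pj}` contributes another `P`
  have hb : ∀ k p, rad (radConn h) x k p
      = ∑ i, ∑ j, x i * x j * pd i (connMat h p) x k j + radConn h x k p := by
    intro k p
    simp only [rad, Matrix.sum_apply, Matrix.smul_apply, smul_eq_mul]
    have h1 : ∀ i, pd i (radConn h) x k p
        = ∑ j, x j * pd i (connMat h p) x k j + connMat h i x k p := by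
      intro i
      rw [pd_apply, show (fun z => radConn h z k p) = fun z : Eu n => ∑ j, z j * connMat h p z k j
        from funext fun z => by
          simp only [radConn, Matrix.sum_apply, Matrix.smul_apply, smul_eq_mul]
          exact Finset.sum_congr rfl fun j _ => by rw [connMat_symm N.metric],
        partialDeriv_sum _ (fun j (z : Eu n) => z j * connMat h p z k j) i
          fun j _ => (hco j).mul (dC p k j)]
      have : ∀ j, partialDeriv i (fun z : Eu n => z j * connMat h p z k j) x
          = x j * pd i (connMat h p) x k j + if j = i then connMat h p x k j else 0 := by
        intro j
        rw [partialDeriv_mul i (hco j) (dC p k j), partialDeriv_coord, pd_apply]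
        split_ifs <;> ring
      simp only [this, Finset.sum_add_distrib, Finset.sum_ite_eq', Finset.mem_univ, if_true]
      rw [connMat_symm N.metric p]
    simp only [h1, mul_add, Finset.sum_add_distrib, Finset.mul_sum]
    congr 1
    · exact Finset.sum_congr rfl fun i _ => Finset.sum_congr rfl fun j _ => by ring
    · simp [radConn, Matrix.sum_apply]
  -- by the geodesic equation, one of the two products in the curvature contracts to zero
  have hc : ∀ k p, ∑ i, ∑ j, x i * x j * (connMat h p x * connMat h i x) k j = 0 := by
    intro k p
    simp only [Matrix.mul_apply, Finset.mul_sum]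
    rw [Finset.sum_congr rfl fun l _ => Finset.sum_comm, Finset.sum_comm]
    apply Finset.sum_eq_zero
    intro l _
    calc _ = connMat h p x k l * ∑ i, ∑ j, christoffel h x l i j * x i * x j := by
          rw [Finset.sum_comm, Finset.mul_sum]
          refine Finset.sum_congr rfl fun i _ => ?_
          rw [Finset.mul_sum]
          exact Finset.sum_congr rfl fun j _ => by simp only [connMat, Matrix.of_apply]; ring
      _ = 0 := by rw [N.geodesic x hx l, mul_zero]
  have hd : ∀ k p, ∑ i, ∑ j, x i * x j * (connMat h i x * connMat h p x) k j
      = (radConn h x * radConn h x) k p := by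
    intro k p
    rw [Matrix.mul_apply]
    simp only [Matrix.mul_apply, Finset.mul_sum]
    rw [Finset.sum_congr rfl fun l _ => Finset.sum_comm, Finset.sum_comm]
    refine Finset.sum_congr rfl fun l _ => ?_
    rw [hPapp l p, radConn, Matrix.sum_apply, Finset.sum_mul_sum]
    exact Finset.sum_congr rfl fun i _ => Finset.sum_congr rfl fun j _ => by
      simp only [Matrix.smul_apply, smul_eq_mul]; ring
  ext k p
  have hR : jacobiOp h x k p = ∑ i, ∑ j, x i * x j * pd p (connMat h i) x k j
      - ∑ i, ∑ j, x i * x j * pd i (connMat h p) x k j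
      + (∑ i, ∑ j, x i * x j * (connMat h p x * connMat h i x) k j
        - ∑ i, ∑ j, x i * x j * (connMat h i x * connMat h p x) k j) := by
    simp only [jacobiOp, Matrix.of_apply, curv, Matrix.add_apply, Matrix.sub_apply,
      ← Finset.sum_sub_distrib, ← Finset.sum_add_distrib]
    exact Finset.sum_congr rfl fun i _ => Finset.sum_congr rfl fun j _ => by ring
  rw [Matrix.sub_apply, Matrix.sub_apply, Matrix.neg_apply, hR, ha, hc, hd, hb]
  ring

end IsNormal

end Normal

end Coord

/-! ### Bounds of the metric in normal coordinates -/

namespace Coord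

section NormalBounds

variable {n : ℕ} {h : Eu n → Mat n} {x : Eu n} {K : ℝ}

lemma vpair_smul_mat (c : ℝ) (A : Mat n) (v w : Fin n → ℝ) :
    vpair (c • A) v w = c * vpair A v w := by
  simp [vpair, Finset.mul_sum, mul_assoc]

lemma vpair_sub_mat (A B : Mat n) (v w : Fin n → ℝ) :
    vpair (A - B) v w = vpair A v w - vpair B v w := by
  simp [vpair, sub_mul, Finset.sum_sub_distrib]

lemma vpair_neg_mat (A : Mat n) (v w : Fin n → ℝ) : vpair (-A) v w = -vpair A v w := by
  simp [vpair]

lemma vpair_mul_mat (k X : Mat n) (v w : Fin n → ℝ) :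
    vpair (k * X) v w = vpair k v (X.mulVec w) := by
  rw [vpair_eq_dotProduct, vpair_eq_dotProduct, Matrix.mulVec_mulVec]

lemma vpair_sq_le {k : Mat n} (hk : k.PosDef) (v w : Fin n → ℝ) :
    vpair k v w ^ 2 ≤ vpair k v v * vpair k w w := by
  obtain ⟨R, -, -, h2⟩ := exists_frame hk
  simp only [vpair_frame h2, ← sq]
  exact Finset.sum_mul_sq_le_sq_mul_sq _ _ _

lemma vpair_comm_of_symm {k : Mat n} (hk : ∀ i j, k i j = k j i) (v w : Fin n → ℝ) :
    vpair k v w = vpair k w v := by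
  unfold vpair
  rw [Finset.sum_comm]
  exact Finset.sum_congr rfl fun i _ => Finset.sum_congr rfl fun j _ => by rw [hk]; ring

lemma hasDerivAt_ray_vpair {A : Eu n → Mat n} {v : Eu n} {s : ℝ} (hA : MatDiffAt A (s • v))
    (w : Fin n → ℝ) :
    HasDerivAt (fun u : ℝ => vpair (A (u • v)) w w)
      (vpair (∑ l, v l • pd l A (s • v)) w w) s := by
  have h1 : ∀ i j, HasDerivAt (fun u : ℝ => A (u • v) i j * w i * w j)
      ((∑ l, v l * partialDeriv l (fun z => A z i j) (s • v)) * w i * w j) s := fun i j =>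
    ((hasDerivAt_ray (f := fun z => A z i j) (hA i j)).mul_const _).mul_const _
  have h2 := HasDerivAt.fun_sum fun i (_ : i ∈ Finset.univ) =>
    HasDerivAt.fun_sum fun j (_ : j ∈ Finset.univ) => h1 i j
  refine HasDerivAt.congr_deriv (f := fun u : ℝ => vpair (A (u • v)) w w) h2 ?_
  simp only [vpair, Matrix.sum_apply, Matrix.smul_apply, pd_apply, smul_eq_mul]

lemma smul_vpair_rad (A : Eu n → Mat n) (v : Eu n) (s : ℝ) (w : Fin n → ℝ) :
    s * vpair (∑ l, v l • pd l A (s • v)) w w = vpair (rad A (s • v)) w w := by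
  have : rad A (s • v) = s • ∑ l, v l • pd l A (s • v) := by
    rw [rad, Finset.smul_sum]
    exact Finset.sum_congr rfl fun l _ => by rw [smul_smul]; rfl
  rw [this, vpair_smul_mat]

lemma rad_mul {A B : Eu n → Mat n} (hA : MatDiffAt A x) (hB : MatDiffAt B x) :
    rad (fun z => A z * B z) x = rad A x * B x + A x * rad B x := by
  simp only [rad, pd_mul _ hA hB, smul_add, Finset.sum_add_distrib, Finset.sum_mul, Finset.mul_sum,
    Matrix.smul_mul, Matrix.mul_smul]

lemma mem_ball_of_norm_le {v : Eu n} (hv : ‖v‖ = 1) {s : ℝ} (hs : s ∈ Ico (0 : ℝ) 1) :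
    s • v ∈ Metric.ball (0 : Eu n) 1 := smul_mem_ball hv.le hs

namespace IsNormal

variable (N : IsNormal h)
include N

lemma vpair_eq_norm (hx : x ∈ Metric.ball (0 : Eu n) 1) : vpair (h x) x x = ‖x‖ ^ 2 := by
  rw [N.vpair_self hx, EuclideanSpace.norm_sq_eq]
  simp

lemma radConn_smooth : MatSmoothOn (radConn h) (Metric.ball 0 1) :=
  MatSmoothOn.sum _ (fun l z => z l • connMat h l z) fun l _ =>
    MatSmoothOn.smul (EuclideanSpace.proj l : Eu n →L[ℝ] ℝ).contDiff.contDiffOn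
      (connMat_smooth N.metric l)

lemma vpair_radConn_sq (hx : x ∈ Metric.ball (0 : Eu n) 1) (w : Fin n → ℝ) :
    vpair (h x * radConn h x) w w ^ 2
      ≤ vpair (h x * radConn h x * radConn h x) w w * vpair (h x) w w := by
  have h1 : vpair (h x * radConn h x * radConn h x) w w
      = vpair (h x) ((radConn h x).mulVec w) ((radConn h x).mulVec w) := by
    rw [vpair_mul_mat, vpair_comm_of_symm (k := h x * radConn h x), vpair_mul_mat]
    intro i j
    rw [← Matrix.transpose_apply (h x * radConn h x), N.metric_mul_radConn hx]
  rw [h1, vpair_mul_mat, mul_comm]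
  exact vpair_sq_le (N.metric.posDef x hx) _ _

/-- The curvature bound controls the Jacobi operator. -/
lemma abs_vpair_jacobiOp_le (hK0 : 0 ≤ K) (hx : x ∈ Metric.ball (0 : Eu n) 1)
    (hK : curvNormSq (h x) (fun p q => curv h p q x) ≤ K ^ 2) (w : Fin n → ℝ) :
    |vpair (h x * jacobiOp h x) w w| ≤ K * ‖x‖ ^ 2 * vpair (h x) w w := by
  have hk := N.metric.posDef x hx
  set X : Mat n := ∑ p, w p • ∑ i, x i • curv h p i x with hX
  have h1 : (jacobiOp h x).mulVec w = X.mulVec x := by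
    ext k
    simp only [hX, jacobiOp, Matrix.mulVec, dotProduct, Matrix.of_apply, Matrix.sum_apply,
      Matrix.smul_apply, smul_eq_mul, Finset.sum_mul, Finset.mul_sum]
    rw [Finset.sum_congr rfl fun p _ => Finset.sum_comm, Finset.sum_comm]
    exact Finset.sum_congr rfl fun j _ => Finset.sum_congr rfl fun p _ =>
      Finset.sum_congr rfl fun i _ => by ring
  have hw0 := vpair_self_nonneg hk w
  have h2 : vpair (h x * jacobiOp h x) w w ^ 2 ≤ (K * ‖x‖ ^ 2 * vpair (h x) w w) ^ 2 := by
    rw [vpair_mul_mat, h1, vpair_comm_of_symm (N.metric.symm x)]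
    have s1 := vpair_mulVec_sq_le hk X x w
    have s2 : tpair (h x) X X ≤ vpair (h x) w w * (‖x‖ ^ 2 * K ^ 2) := by
      refine (tpair_sum_smul_le hk w _).trans (mul_le_mul_of_nonneg_left ?_ hw0)
      refine (fpair_contract_le hk x _).trans ?_
      rw [N.vpair_eq_norm hx]
      exact mul_le_mul_of_nonneg_left hK (sq_nonneg _)
    rw [N.vpair_eq_norm hx] at s1
    refine s1.trans ((mul_le_mul_of_nonneg_right s2
      (mul_nonneg (sq_nonneg _) hw0)).trans (le_of_eq ?_))
    ring
  exact abs_le_of_sq_le_sq h2 (by positivity)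

/-- Along a ray, the quotient `h(Pw, w) / h(w, w)` for a constant vector `w` satisfies a Riccati
inequality (the second variation of the length of a Jacobi field). -/
lemma riccati_vector (hK0 : 0 ≤ K) {v : Eu n} (hv : ‖v‖ = 1)
    (hK : ∀ z ∈ Metric.ball (0 : Eu n) 1, curvNormSq (h z) (fun p q => curv h p q z) ≤ K ^ 2)
    {w : Fin n → ℝ} (hw : w ≠ 0) :
    ∃ p' : ℝ → ℝ, ∀ s ∈ Ico (0 : ℝ) 1,
      HasDerivAt (fun s : ℝ => vpair (h (s • v) * radConn h (s • v)) w w / vpair (h (s • v)) w w)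
        (p' s) s ∧
      -(vpair (h (s • v) * radConn h (s • v)) w w / vpair (h (s • v)) w w)
        - (vpair (h (s • v) * radConn h (s • v)) w w / vpair (h (s • v)) w w) ^ 2 - K * s ^ 2
        ≤ s * p' s := by
  set a : ℝ → ℝ := fun s => vpair (h (s • v)) w w with ha
  set b : ℝ → ℝ := fun s => vpair (h (s • v) * radConn h (s • v)) w w with hb
  set a' : ℝ → ℝ := fun s => vpair (∑ l, v l • pd l h (s • v)) w w with ha'
  set b' : ℝ → ℝ := fun s =>
    vpair (∑ l, v l • pd l (fun z => h z * radConn h z) (s • v)) w w with hb'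
  refine ⟨fun s => (b' s * a s - b s * a' s) / a s ^ 2, fun s hs => ?_⟩
  have hx := mem_ball_of_norm_le hv hs
  have hO := N.metric.isOpen
  have dh := N.metric.smooth.matDiffAt hO hx
  have dP := N.radConn_smooth.matDiffAt hO hx
  have apos : 0 < a s := vpair_self_pos (N.metric.posDef _ hx) hw
  refine ⟨(hasDerivAt_ray_vpair (dh.mul dP) w).fun_div (hasDerivAt_ray_vpair dh w) apos.ne', ?_⟩
  have e1 : s * a' s = 2 * b s := by
    rw [ha', smul_vpair_rad, N.rad_metric hx, vpair_smul_mat]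
  set c := vpair (h (s • v) * radConn h (s • v) * radConn h (s • v)) w w with hc
  set r := vpair (h (s • v) * jacobiOp h (s • v)) w w with hr
  have e2 : s * b' s = c - b s - r := by
    simp only [hb', smul_vpair_rad, rad_mul dh dP, N.rad_metric hx, N.rad_radConn hx, hc, hb, hr]
    rw [← vpair_sub_mat, ← vpair_sub_mat]
    congr 1
    simp only [Matrix.mul_sub, two_smul, Matrix.add_mul, Matrix.mul_neg, ← Matrix.mul_assoc]
    abel
  have e3 : b s ^ 2 ≤ c * a s := N.vpair_radConn_sq hx w
  have e4 : r ≤ K * s ^ 2 * a s := by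
    have := (le_abs_self _).trans (N.abs_vpair_jacobiOp_le hK0 hx (hK _ hx) w)
    rwa [norm_smul, hv, mul_one, Real.norm_of_nonneg hs.1] at this
  have e5 : s * ((b' s * a s - b s * a' s) / a s ^ 2)
      = (c - b s - r) / a s - 2 * (b s / a s) ^ 2 := by
    rw [← e2]
    have : s * ((b' s * a s - b s * a' s) / a s ^ 2)
        = (s * b' s * a s - b s * (s * a' s)) / a s ^ 2 := by ring
    rw [this, e1]
    field_simp
  change -(b s / a s) - (b s / a s) ^ 2 - K * s ^ 2 ≤ s * ((b' s * a s - b s * a' s) / a s ^ 2)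
  rw [e5]
  have e6 : (b s / a s) ^ 2 ≤ c / a s := by
    rw [div_pow, div_le_div_iff₀ (by positivity) apos]
    nlinarith
  have e7 : r / a s ≤ K * s ^ 2 := by rwa [div_le_iff₀ apos]
  have e8 : (c - b s - r) / a s = c / a s - b s / a s - r / a s := by ring
  rw [e8]
  linarith

/-- The dual Riccati inequality along a ray, for a constant covector `α`: with `z = h⁻¹ α`, the
quotient `h(Pz, z) / h(z, z)` is a subsolution. -/
lemma riccati_covector (hK0 : 0 ≤ K) {v : Eu n} (hv : ‖v‖ = 1)
    (hK : ∀ z ∈ Metric.ball (0 : Eu n) 1, curvNormSq (h z) (fun p q => curv h p q z) ≤ K ^ 2)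
    {α : Fin n → ℝ} (hα : α ≠ 0) :
    ∃ p' : ℝ → ℝ, ∀ s ∈ Ico (0 : ℝ) 1,
      HasDerivAt (fun s : ℝ => vpair (radConn h (s • v) * (h (s • v))⁻¹) α α
        / vpair (h (s • v))⁻¹ α α) (p' s) s ∧
      s * p' s ≤ -(vpair (radConn h (s • v) * (h (s • v))⁻¹) α α / vpair (h (s • v))⁻¹ α α)
        - (vpair (radConn h (s • v) * (h (s • v))⁻¹) α α / vpair (h (s • v))⁻¹ α α) ^ 2
        + K * s ^ 2 := by
  set G : Eu n → Mat n := fun z => (h z)⁻¹ with hG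
  set a : ℝ → ℝ := fun s => vpair (G (s • v)) α α with ha
  set b : ℝ → ℝ := fun s => vpair (radConn h (s • v) * G (s • v)) α α with hb
  set a' : ℝ → ℝ := fun s => vpair (∑ l, v l • pd l G (s • v)) α α with ha'
  set b' : ℝ → ℝ := fun s =>
    vpair (∑ l, v l • pd l (fun z => radConn h z * G z) (s • v)) α α with hb'
  refine ⟨fun s => (b' s * a s - b s * a' s) / a s ^ 2, fun s hs => ?_⟩
  have hx := mem_ball_of_norm_le hv hs
  have hO := N.metric.isOpen
  have hk := N.metric.posDef _ hx
  have dG : MatDiffAt G (s • v) := N.metric.inv_smooth.matDiffAt hO hx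
  have dP := N.radConn_smooth.matDiffAt hO hx
  have apos : 0 < a s := vpair_self_pos hk.inv hα
  refine ⟨(hasDerivAt_ray_vpair (dP.mul dG) α).fun_div (hasDerivAt_ray_vpair dG α) apos.ne', ?_⟩
  set k := h (s • v) with hkdef
  set P := radConn h (s • v) with hP
  set R := jacobiOp h (s • v) with hR
  have hradG : rad G (s • v) = -((2 : ℝ) • (P * k⁻¹)) := by
    have h1 : rad G (s • v) = -(k⁻¹ * rad h (s • v) * k⁻¹) := by
      simp only [rad, hG, pd_inv hO N.metric.smooth N.metric.det_ne_zero hx, Finset.mul_sum,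
        Finset.sum_mul, Matrix.mul_smul, Matrix.smul_mul, smul_neg, Finset.sum_neg_distrib]
      rfl
    rw [h1, N.rad_metric hx, Matrix.mul_smul, Matrix.smul_mul, ← Matrix.mul_assoc,
      N.metric.inv_mul hx, Matrix.one_mul]
  -- quadratic forms in `α` are quadratic forms in `z`
  set z : Fin n → ℝ := k⁻¹.mulVec α with hz
  have hαz : k.mulVec z = α := by
    rw [hz, Matrix.mulVec_mulVec, N.metric.mul_inv hx, Matrix.one_mulVec]
  have hconv : ∀ X : Mat n, vpair (X * k⁻¹) α α = vpair (k * X) z z := by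
    intro X
    rw [vpair_mul_mat, vpair_mul_mat, vpair_eq_dotProduct]
    change α ⬝ᵥ X.mulVec z = _
    rw [vpair_comm_of_symm (N.metric.symm _), vpair_eq_dotProduct, hαz, dotProduct_comm]
  have ha2 : a s = vpair k z z := by
    have := hconv 1
    rwa [Matrix.one_mul, Matrix.mul_one] at this
  set c := vpair (k * P * P) z z with hc
  set r := vpair (k * R) z z with hr
  have hb2 : b s = vpair (k * P) z z := hconv P
  have e1 : s * a' s = -(2 * b s) := by
    rw [ha', smul_vpair_rad, hradG, vpair_neg_mat, vpair_smul_mat]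
  have e2 : s * b' s = -3 * c - b s - r := by
    have h1 : rad (fun z => radConn h z * G z) (s • v)
        = (-P - P * P - R - (2 : ℝ) • (P * P)) * k⁻¹ := by
      rw [rad_mul dP dG, hradG, N.rad_radConn hx]
      simp only [Matrix.sub_mul, Matrix.smul_mul, Matrix.mul_smul, Matrix.mul_neg, Matrix.mul_assoc,
        Matrix.neg_mul, ← hP, hG, ← hkdef]
      abel
    rw [hb', smul_vpair_rad, h1, hconv, hb2]
    simp only [Matrix.mul_sub, Matrix.mul_smul, Matrix.mul_neg, vpair_sub_mat, vpair_smul_mat,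
      vpair_neg_mat, ← Matrix.mul_assoc, ← hc, ← hr]
    ring
  have e3 : b s ^ 2 ≤ c * a s := by
    rw [hb2, ha2]
    exact N.vpair_radConn_sq hx z
  have e4 : -r ≤ K * s ^ 2 * a s := by
    have := (neg_le_abs _).trans (N.abs_vpair_jacobiOp_le hK0 hx (hK _ hx) z)
    rw [norm_smul, hv, mul_one, Real.norm_of_nonneg hs.1] at this
    rw [ha2]
    exact this
  have e5 : s * ((b' s * a s - b s * a' s) / a s ^ 2)
      = (-3 * c - b s - r) / a s + 2 * (b s / a s) ^ 2 := by
    rw [← e2]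
    have : s * ((b' s * a s - b s * a' s) / a s ^ 2)
        = (s * b' s * a s - b s * (s * a' s)) / a s ^ 2 := by ring
    rw [this, e1]
    field_simp
    ring
  change s * ((b' s * a s - b s * a' s) / a s ^ 2) ≤ -(b s / a s) - (b s / a s) ^ 2 + K * s ^ 2
  rw [e5]
  have e6 : (b s / a s) ^ 2 ≤ c / a s := by
    rw [div_pow, div_le_div_iff₀ (by positivity) apos]
    nlinarith
  have e7 : -r / a s ≤ K * s ^ 2 := by rwa [div_le_iff₀ apos]
  have e8 : (-3 * c - b s - r) / a s = -3 * (c / a s) - b s / a s + -r / a s := by ring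
  rw [e8]
  linarith

/-- The quadratic bound of the radial connection matrix away from the boundary of the ball. -/
lemma abs_vpair_radConn_le (hK0 : 0 ≤ K) {r : ℝ} (hr1 : r < 1)
    (hK : ∀ z ∈ Metric.ball (0 : Eu n) 1, curvNormSq (h z) (fun p q => curv h p q z) ≤ K ^ 2)
    (hxr : ‖x‖ ≤ r) (w : Fin n → ℝ) :
    |vpair (h x * radConn h x) w w|
      ≤ (K + (K + 2 + 2 / (1 - r)) * (4 * K)) * ‖x‖ ^ 2 * vpair (h x) w w := by
  rcases eq_or_ne x 0 with rfl | hx0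
  · simp [radConn, vpair]
  rcases eq_or_ne w 0 with rfl | hw
  · simp [vpair]
  have hr' : 0 < 1 - r := by linarith
  have hL : 0 ≤ 2 / (1 - r) := by positivity
  set s := ‖x‖ with hs
  have hs0 : 0 < s := norm_pos_iff.2 hx0
  have hs1 : s ∈ Ioo (0 : ℝ) 1 := ⟨hs0, by linarith⟩
  set v : Eu n := s⁻¹ • x with hv
  have hv1 : ‖v‖ = 1 := by rw [hv, norm_smul, norm_inv, norm_norm, inv_mul_cancel₀ hs0.ne']
  have hsv : s • v = x := by rw [hv, smul_smul, mul_inv_cancel₀ hs0.ne', one_smul]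
  have hx := mem_ball_of_norm_le hv1 (Ioo_subset_Ico_self hs1)
  rw [hsv] at hx
  have hk := N.metric.posDef x hx
  have apos := vpair_self_pos hk hw
  set p := vpair (h x * radConn h x) w w / vpair (h x) w w with hp
  -- the upper bound and the rough lower bound come from the covector `h w`
  have hupper : p ≤ K * s ^ 2 ∧ -(K + 2 + 2 / (1 - r)) ≤ p := by
    set α : Fin n → ℝ := (h x).mulVec w with hα
    have hwα : (h x)⁻¹.mulVec α = w := by
      rw [hα, Matrix.mulVec_mulVec, N.metric.inv_mul hx, Matrix.one_mulVec]
    have hα0 : α ≠ 0 := by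
      intro h0
      rw [h0, Matrix.mulVec_zero] at hwα
      exact hw hwα.symm
    obtain ⟨p', hp'⟩ := N.riccati_covector hK0 hv1 hK hα0
    set f : ℝ → ℝ := fun s => vpair (radConn h (s • v) * (h (s • v))⁻¹) α α
        / vpair (h (s • v))⁻¹ α α with hf
    have hfs : f s = p := by
      have h1 : ∀ X : Mat n, vpair (X * (h x)⁻¹) α α = vpair (h x * X) w w := by
        intro X
        rw [vpair_mul_mat, hwα, vpair_mul_mat, vpair_comm_of_symm (N.metric.symm _),
          vpair_eq_dotProduct, vpair_eq_dotProduct, ← hα, dotProduct_comm]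
      have h2 := h1 1
      rw [Matrix.one_mul, Matrix.mul_one] at h2
      simp only [hf, hsv]
      rw [h1, h2]
    have hf0 : Filter.Tendsto f (nhdsWithin 0 (Ioi 0)) (nhds 0) := by
      have h1 : ContinuousAt f 0 := (hp' 0 ⟨le_refl _, zero_lt_one⟩).1.continuousAt
      have h2 : f 0 = 0 := by simp [hf, radConn, vpair]
      have := h1.tendsto.mono_left (nhdsWithin_le_nhds (s := Ioi 0))
      rwa [h2] at this
    constructor
    · rw [← hfs]
      exact riccati_upper hK0 (fun u hu => (hp' u (Ioo_subset_Ico_self hu)).1)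
        (fun u hu => (hp' u (Ioo_subset_Ico_self hu)).2) hf0 hs1
    -- `q = (1 + f) / u` is the quadratic form of the Hessian of the distance, and its derivative is
    -- at most `K - q²`
    · have hq := riccati_blowup (q := fun u => (1 + f u) / u)
        (q' := fun u => (p' u * u - (1 + f u) * 1) / u ^ 2) hK0 hr1 (fun u hu =>
          (((hp' u (Ioo_subset_Ico_self hu)).1).const_add 1).fun_div (hasDerivAt_id' u) hu.1.ne')
        (fun u hu => by
          have h1 := (hp' u (Ioo_subset_Ico_self hu)).2
          have h2 : 0 < u ^ 2 := pow_pos hu.1 2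
          rw [div_le_iff₀ h2, sub_mul, div_pow, div_mul_cancel₀ _ h2.ne']
          change u * p' u ≤ -f u - f u ^ 2 + K * u ^ 2 at h1
          linarith) hs0 hxr
      simp only [hfs] at hq
      rw [le_div_iff₀ hs0] at hq
      have : s * (K + 1 + 2 / (1 - r)) ≤ 1 * (K + 1 + 2 / (1 - r)) :=
        mul_le_mul_of_nonneg_right hs1.2.le (by linarith)
      linarith
  -- the sharp lower bound, near the centre, comes from the vector `w`; the comparison needs an
  -- interval slightly longer than `[0, s]`, on which still `2 K u² ≤ 1`
  have hlower : 2 * (K * (2 * s ^ 2)) ≤ 1 → -(K * s ^ 2) ≤ p := by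
    intro hsmall
    obtain ⟨p', hp'⟩ := N.riccati_vector hK0 hv1 hK hw
    set f : ℝ → ℝ := fun s => vpair (h (s • v) * radConn h (s • v)) w w
        / vpair (h (s • v)) w w with hf
    have hfs : f s = p := by simp only [hf, hsv, hp]
    have hf0 : Filter.Tendsto f (nhdsWithin 0 (Ioi 0)) (nhds 0) := by
      have h1 : ContinuousAt f 0 := (hp' 0 ⟨le_refl _, zero_lt_one⟩).1.continuousAt
      have h2 : f 0 = 0 := by simp [hf, radConn, vpair]
      have := h1.tendsto.mono_left (nhdsWithin_le_nhds (s := Ioi 0))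
      rwa [h2] at this
    set S := min 1 (Real.sqrt 2 * s) with hS
    have hS1 : S ≤ 1 := min_le_left _ _
    have hsS : s < S := lt_min hs1.2 (by
      have : 1 < Real.sqrt 2 := by
        rw [Real.lt_sqrt] <;> norm_num
      nlinarith)
    have hS2 : S ^ 2 ≤ 2 * s ^ 2 := by
      calc S ^ 2 ≤ (Real.sqrt 2 * s) ^ 2 := pow_le_pow_left₀ (by linarith) (min_le_right _ _) 2
        _ = 2 * s ^ 2 := by rw [mul_pow, Real.sq_sqrt (by norm_num)]
    have hsub : ∀ u ∈ Ioo (0 : ℝ) S, u ∈ Ico (0 : ℝ) 1 := fun u hu =>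
      ⟨hu.1.le, lt_of_lt_of_le hu.2 hS1⟩
    rw [← hfs]
    refine riccati_lower hK0 ?_ (fun u hu => (hp' u (hsub u hu)).1)
      (fun u hu => (hp' u (hsub u hu)).2) hf0 ⟨hs0, hsS⟩
    exact le_trans (by gcongr) hsmall
  -- where `4 K s² > 1`, the rough lower bound `-L` is above `-4 K L s²`
  set L := K + 2 + 2 / (1 - r) with hLdef
  have hL0 : 0 ≤ L := by linarith
  have habs : |p| ≤ (K + L * (4 * K)) * s ^ 2 := by
    have hs2 : 0 ≤ s ^ 2 := sq_nonneg s
    rw [abs_le]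
    constructor
    · by_cases hsmall : 2 * (K * (2 * s ^ 2)) ≤ 1
      · have := hlower hsmall
        have : 0 ≤ L * (4 * K) * s ^ 2 := by positivity
        linarith
      · push Not at hsmall
        have h1 : L * 1 ≤ L * (4 * K * s ^ 2) := mul_le_mul_of_nonneg_left (by linarith) hL0
        have h2 : 0 ≤ K * s ^ 2 := by positivity
        linarith [hupper.2]
    · have : 0 ≤ L * (4 * K) * s ^ 2 := by positivity
      linarith [hupper.1]
  have : vpair (h x * radConn h x) w w = p * vpair (h x) w w := by
    rw [hp, div_mul_cancel₀ _ apos.ne']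
  rw [this, abs_mul, abs_of_pos apos]
  exact mul_le_mul_of_nonneg_right habs apos.le

/-- Comparison of the metric with the Euclidean one away from the boundary of the ball. -/
lemma vpair_metric_bounds {r C : ℝ} (hr1 : r < 1) (hC : 0 ≤ C)
    (hb : ∀ z : Eu n, ‖z‖ ≤ r → ∀ w : Fin n → ℝ,
      |vpair (h z * radConn h z) w w| ≤ C * ‖z‖ ^ 2 * vpair (h z) w w)
    (hxr : ‖x‖ ≤ r) (w : Fin n → ℝ) :
    Real.exp (-C) * ∑ i, w i ^ 2 ≤ vpair (h x) w w ∧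
      vpair (h x) w w ≤ Real.exp C * ∑ i, w i ^ 2 := by
  have h0 : vpair (h 0) w w = ∑ i, w i ^ 2 := by
    rw [N.center]
    simp [vpair, Matrix.one_apply, sq]
  have hmem : ∀ s ∈ Icc (0 : ℝ) 1, ‖s • x‖ ≤ r := by
    intro s hs
    rw [norm_smul, Real.norm_of_nonneg hs.1]
    nlinarith [hs.2, norm_nonneg x]
  have hball : ∀ s ∈ Icc (0 : ℝ) 1, s • x ∈ Metric.ball (0 : Eu n) 1 := fun s hs => by
    rw [mem_ball_zero_iff]
    linarith [hmem s hs]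
  set a : ℝ → ℝ := fun s => vpair (h (s • x)) w w with ha
  set a' : ℝ → ℝ := fun s => vpair (∑ l, x l • pd l h (s • x)) w w with ha'
  have hd : ∀ s ∈ Icc (0 : ℝ) 1, HasDerivAt a (a' s) s := fun s hs =>
    hasDerivAt_ray_vpair (N.metric.smooth.matDiffAt N.metric.isOpen (hball s hs)) w
  have hbd : ∀ s ∈ Ioo (0 : ℝ) 1, |a' s| ≤ 2 * C * s * a s := by
    intro s hs
    have hs' := Ioo_subset_Icc_self hs
    have h1 : s * a' s = 2 * vpair (h (s • x) * radConn h (s • x)) w w := by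
      rw [ha', smul_vpair_rad, N.rad_metric (hball s hs'), vpair_smul_mat]
    have h2 := hb (s • x) (hmem s hs') w
    have apos : 0 ≤ a s := vpair_self_nonneg (N.metric.posDef _ (hball s hs')) w
    have h3 : ‖s • x‖ ^ 2 ≤ s ^ 2 := by
      rw [norm_smul, Real.norm_of_nonneg hs.1.le]
      have : s * ‖x‖ ≤ s * 1 := mul_le_mul_of_nonneg_left (by linarith) hs.1.le
      rw [mul_one] at this
      exact pow_le_pow_left₀ (mul_nonneg hs.1.le (norm_nonneg x)) this 2
    have h4 : s * |a' s| ≤ s * (2 * C * s * a s) := by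
      calc s * |a' s| = |s * a' s| := by rw [abs_mul, abs_of_pos hs.1]
        _ = 2 * |vpair (h (s • x) * radConn h (s • x)) w w| := by
          rw [h1, abs_mul, abs_of_pos (zero_lt_two (α := ℝ))]
        _ ≤ 2 * (C * ‖s • x‖ ^ 2 * a s) := by linarith
        _ ≤ 2 * (C * s ^ 2 * a s) := by gcongr
        _ = s * (2 * C * s * a s) := by ring
    exact le_of_mul_le_mul_left h4 hs.1
  have hint : interior (Icc (0 : ℝ) 1) = Ioo 0 1 := interior_Icc
  have hexp : ∀ c s : ℝ, HasDerivAt (fun s : ℝ => Real.exp (c * s ^ 2))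
      (Real.exp (c * s ^ 2) * (c * (2 * s))) s := fun c s => by
    simpa using (((hasDerivAt_pow 2 s).const_mul c)).exp
  have hde : ∀ c, ∀ s ∈ Icc (0 : ℝ) 1, HasDerivAt (fun s => Real.exp (c * s ^ 2) * a s)
      (Real.exp (c * s ^ 2) * (c * (2 * s)) * a s + Real.exp (c * s ^ 2) * a' s) s :=
    fun c s hs => (hexp c s).mul (hd s hs)
  -- `exp (C s²) a` increases and `exp (-C s²) a` decreases along the ray
  have hmono : MonotoneOn (fun s => Real.exp (C * s ^ 2) * a s) (Icc 0 1) := by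
    apply monotoneOn_of_deriv_nonneg (convex_Icc 0 1)
    · exact fun s hs => (hde C s hs).continuousAt.continuousWithinAt
    · intro s hs
      exact (hde C s (interior_subset hs)).differentiableAt.differentiableWithinAt
    · intro s hs
      rw [(hde C s (interior_subset hs)).deriv]
      rw [hint] at hs
      have := (abs_le.1 (hbd s hs)).1
      have he := Real.exp_pos (C * s ^ 2)
      have : 0 ≤ Real.exp (C * s ^ 2) * (2 * C * s * a s + a' s) :=
        mul_nonneg he.le (by linarith)
      linarith
  have hanti : AntitoneOn (fun s => Real.exp (-C * s ^ 2) * a s) (Icc 0 1) := by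
    apply antitoneOn_of_deriv_nonpos (convex_Icc 0 1)
    · exact fun s hs => (hde (-C) s hs).continuousAt.continuousWithinAt
    · intro s hs
      exact (hde (-C) s (interior_subset hs)).differentiableAt.differentiableWithinAt
    · intro s hs
      rw [(hde (-C) s (interior_subset hs)).deriv]
      rw [hint] at hs
      have := (abs_le.1 (hbd s hs)).2
      have he := Real.exp_pos (-C * s ^ 2)
      have : 0 ≤ Real.exp (-C * s ^ 2) * (2 * C * s * a s - a' s) :=
        mul_nonneg he.le (by linarith)
      linarith
  have m1 := hmono (left_mem_Icc.2 zero_le_one) (right_mem_Icc.2 zero_le_one) zero_le_one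
  have m2 := hanti (left_mem_Icc.2 zero_le_one) (right_mem_Icc.2 zero_le_one) zero_le_one
  simp only [ha, zero_smul, one_smul, h0] at m1 m2
  norm_num at m1 m2
  constructor
  · rw [Real.exp_neg, inv_mul_le_iff₀ (Real.exp_pos C)]
    exact m1
  · rw [Real.exp_neg, inv_mul_le_iff₀ (Real.exp_pos C)] at m2
    exact m2

end IsNormal

end NormalBounds

end Coord

/-! ### Scalars defined in all charts, and the Riemannian volume -/

namespace Coord

variable {n : ℕ} {h A B : Eu n → Mat n} {Ω : Set (Eu n)}

lemma MatSmoothOn.contr (hk : MatSmoothOn (fun z => (h z)⁻¹) Ω) {T : Eu n → Mat n}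
    (hT : MatSmoothOn T Ω) : ContDiffOn ℝ ∞ (fun z => contr (h z) (T z)) Ω :=
  ContDiffOn.sum fun p _ => ContDiffOn.sum fun q _ => (hk p q).mul (hT p q)

lemma IsMetricOn.tpair_smooth (H : IsMetricOn h Ω) (hA : MatSmoothOn A Ω) (hB : MatSmoothOn B Ω) :
    ContDiffOn ℝ ∞ (fun z => tpair (h z) (A z) (B z)) Ω :=
  (((hA.mul H.inv_smooth).mul hB.transpose).mul H.smooth).trace

lemma IsMetricOn.fpair_smooth (H : IsMetricOn h Ω) {D E : Fin n → Eu n → Mat n}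
    (hD : ∀ p, MatSmoothOn (D p) Ω) (hE : ∀ p, MatSmoothOn (E p) Ω) :
    ContDiffOn ℝ ∞ (fun z => fpair (h z) (fun p => D p z) (fun p => E p z)) Ω :=
  MatSmoothOn.contr H.inv_smooth fun p q => H.tpair_smooth (hD p) (hE q)

lemma IsMetricOn.curvNormSq_smooth (H : IsMetricOn h Ω) :
    ContDiffOn ℝ ∞ (fun z => curvNormSq (h z) fun p q => curv h p q z) Ω :=
  MatSmoothOn.contr H.inv_smooth fun p q =>
    H.fpair_smooth (fun r => curv_smooth H p r) fun r => curv_smooth H q r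

/-- The squared norm of the covariant derivative in terms of the inner product of
endomorphism-valued forms. -/
lemma gradNormSq_eq_fpair (h A : Eu n → Mat n) (x : Eu n) (hs : ∀ i j, h x i j = h x j i) :
    gradNormSq h A x = fpair (h x) (fun p => cd h p A x) (fun p => cd h p A x) := by
  have key : ∀ X Y : Mat n, tpair (h x) X Y
      = ∑ i₁, ∑ i₂, ∑ j₁, ∑ j₂, h x i₁ i₂ * (h x)⁻¹ j₁ j₂ * X i₁ j₁ * Y i₂ j₂ := by
    intro X Y
    simp only [tpair, Matrix.trace, Matrix.diag_apply, Matrix.mul_apply, Finset.sum_mul,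
      Matrix.transpose_apply]
    refine Finset.sum_congr rfl fun i₁ _ => Finset.sum_congr rfl fun i₂ _ => ?_
    rw [Finset.sum_comm]
    refine Finset.sum_congr rfl fun j₁ _ => Finset.sum_congr rfl fun j₂ _ => ?_
    rw [hs i₁ i₂]
    ring
  simp only [gradNormSq, fpair, contr, Matrix.of_apply, key, Finset.mul_sum]
  have e1 : ∀ G : Fin n → Fin n → Fin n → Fin n → Fin n → Fin n → ℝ,
      ∑ i₁, ∑ i₂, ∑ j₁, ∑ j₂, ∑ k₁, ∑ k₂, G i₁ i₂ j₁ j₂ k₁ k₂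
        = ∑ k₁, ∑ k₂, ∑ i₁, ∑ i₂, ∑ j₁, ∑ j₂, G i₁ i₂ j₁ j₂ k₁ k₂ := by
    intro G
    simp only [← Fintype.sum_prod_type']
    exact Fintype.sum_equiv ⟨fun a => (a.2.2.2.2.1, a.2.2.2.2.2, a.1, a.2.1, a.2.2.1, a.2.2.2.1),
      fun b => (b.2.2.1, b.2.2.2.1, b.2.2.2.2.1, b.2.2.2.2.2, b.1, b.2.1), fun _ => rfl,
      fun _ => rfl⟩ _ _ fun _ => rfl
  rw [e1]
  refine Finset.sum_congr rfl fun _ _ => Finset.sum_congr rfl fun _ _ => Finset.sum_congr rfl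
    fun _ _ => Finset.sum_congr rfl fun _ _ => Finset.sum_congr rfl fun _ _ =>
    Finset.sum_congr rfl fun _ _ => ?_
  simp only [cd, Matrix.of_apply]
  ring

end Coord

section ChartInvariants

open Coord

variable {n : ℕ} {M : Type*} [TopologicalSpace M] [ChartedSpace (EuclideanSpace ℝ (Fin n)) M]
  [IsManifold (𝓡 n) ∞ M] {e e' : OpenPartialHomeomorph M (EuclideanSpace ℝ (Fin n))}
  {g : RiemMetric n M}

/-- A scalar defined in every chart of the maximal atlas, with values compatible with the
transition maps. -/
def ChartInvariant (F : OpenPartialHomeomorph M (Eu n) → Eu n → ℝ) : Prop :=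
  ∀ e ∈ IsManifold.maximalAtlas (𝓡 n) ∞ M, ∀ e' ∈ IsManifold.maximalAtlas (𝓡 n) ∞ M,
    ∀ x ∈ chartTransDom e e', F e x = F e' (chartTrans e e' x)

/-- The function on the manifold given by a chart-invariant scalar. -/
def chartGlue (F : OpenPartialHomeomorph M (Eu n) → Eu n → ℝ) (q : M) : ℝ :=
  F (chartAt (EuclideanSpace ℝ (Fin n)) q) (chartAt (EuclideanSpace ℝ (Fin n)) q q)

lemma ChartInvariant.glue_eq {F : OpenPartialHomeomorph M (Eu n) → Eu n → ℝ} (hF : ChartInvariant F)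
    (he : e ∈ IsManifold.maximalAtlas (𝓡 n) ∞ M) {q : M} (hq : q ∈ e.source) :
    chartGlue F q = F e (e q) := by
  have := hF e he _ (IsManifold.chart_mem_maximalAtlas (I := 𝓡 n) (n := ∞) q) (e q)
    (mem_chartTransDom.2 ⟨e.map_source hq, by rw [e.left_inv hq]; exact mem_chart_source _ q⟩)
  rw [this, chartTrans, e.left_inv hq, chartGlue]

lemma ChartInvariant.glue_symm {F : OpenPartialHomeomorph M (Eu n) → Eu n → ℝ}
    (hF : ChartInvariant F) (he : e ∈ IsManifold.maximalAtlas (𝓡 n) ∞ M) {x : Eu n}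
    (hx : x ∈ e.target) : chartGlue F (e.symm x) = F e x := by
  rw [hF.glue_eq he (e.map_target hx), e.right_inv hx]

lemma ChartInvariant.continuous_glue {F : OpenPartialHomeomorph M (Eu n) → Eu n → ℝ}
    (hF : ChartInvariant F)
    (hc : ∀ e ∈ IsManifold.maximalAtlas (𝓡 n) ∞ M, ContinuousOn (F e) e.target) :
    Continuous (chartGlue F) := by
  rw [continuous_iff_continuousAt]
  intro q
  have he := IsManifold.chart_mem_maximalAtlas (I := 𝓡 n) (n := ∞) q
  set e := chartAt (EuclideanSpace ℝ (Fin n)) q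
  have hq : q ∈ e.source := mem_chart_source _ q
  have h1 : ContinuousAt (fun p => F e (e p)) q :=
    ((hc e he).continuousAt (e.open_target.mem_nhds (e.map_source hq))).comp (e.continuousAt hq)
  exact h1.congr (Filter.eventually_of_mem (e.open_source.mem_nhds hq) fun p hp =>
    (hF.glue_eq he hp).symm)

lemma chartInvariant_curvNormSq (g : RiemMetric n M) :
    ChartInvariant (M := M) fun e x => curvNormSq (metricCoord g e x)
      fun p q => curv (metricCoord g e) p q x := by
  intro e he e' he' x hx
  have Ψ := coordChange_trans (g := g) he he'
  exact curvNormSq_congr (Ψ.isUnit_jac hx) (Ψ.pullback x hx) (Ψ.similar_curv hx)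

/-- On a compact Riemannian manifold the curvature is bounded, uniformly in all charts. -/
lemma exists_curvature_bound [CompactSpace M] (g : RiemMetric n M) :
    ∃ K : ℝ, 0 ≤ K ∧ ∀ e ∈ IsManifold.maximalAtlas (𝓡 n) ∞ M, ∀ x ∈ e.target,
      curvNormSq (metricCoord g e x) (fun p q => curv (metricCoord g e) p q x) ≤ K ^ 2 := by
  have hF := chartInvariant_curvNormSq g
  have hc := hF.continuous_glue fun e he => (isMetricOn_metricCoord he).curvNormSq_smooth.continuousOn
  obtain ⟨B, hB⟩ := isCompact_univ.bddAbove_image hc.continuousOn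
  refine ⟨|B| + 1, by positivity, fun e he x hx => ?_⟩
  rw [← hF.glue_symm he hx]
  have := hB ⟨e.symm x, mem_univ _, rfl⟩
  nlinarith [le_abs_self B, abs_nonneg B]

lemma IsNormalCoordinates.isNormal {y : M} (h : IsNormalCoordinates g y 1 e) :
    IsNormal (metricCoord g e) where
  metric := h.target_eq ▸ isMetricOn_metricCoord h.mem_maximalAtlas
  center := h.metric_center
  geodesic := fun z hz k => by
    have h1 := h.geodesic z 1 (by simpa using hz) k
    have hd : deriv (fun u : ℝ => u • z) = fun _ => z := by
      funext u
      simpa using ((hasDerivAt_id u).smul_const z).deriv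
    simpa [hd] using h1

end ChartInvariants

section Volume

open Coord

variable {n : ℕ} {M : Type*} [TopologicalSpace M] [ChartedSpace (EuclideanSpace ℝ (Fin n)) M]
  [IsManifold (𝓡 n) ∞ M] {e e' : OpenPartialHomeomorph M (EuclideanSpace ℝ (Fin n))}
  {g : RiemMetric n M} [MeasurableSpace M] [BorelSpace M]

omit [IsManifold (𝓡 n) ∞ M] [ChartedSpace (EuclideanSpace ℝ (Fin n)) M] in
lemma aemeasurable_chart_symm (e : OpenPartialHomeomorph M (Eu n)) :
    AEMeasurable e.symm (volume.restrict e.target) :=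
  e.continuousOn_symm.aemeasurable e.open_target.measurableSet

omit [MeasurableSpace M] [BorelSpace M] in
lemma continuousOn_volDensity (he : e ∈ IsManifold.maximalAtlas (𝓡 n) ∞ M) :
    ContinuousOn (fun x => Real.sqrt (metricCoord g e x).det) e.target :=
  (isMetricOn_metricCoord he).smooth.det.continuousOn.sqrt

omit [MeasurableSpace M] [BorelSpace M] in
lemma aemeasurable_volDensity (he : e ∈ IsManifold.maximalAtlas (𝓡 n) ∞ M) :
    AEMeasurable (fun x => ENNReal.ofReal (Real.sqrt (metricCoord g e x).det))
      (volume.restrict e.target) :=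
  ((continuousOn_volDensity he).aemeasurable e.open_target.measurableSet).ennreal_ofReal

lemma aemeasurable_symm_withDensity :
    AEMeasurable e.symm ((volume.restrict e.target).withDensity
      (fun x => ENNReal.ofReal (Real.sqrt (metricCoord g e x).det))) :=
  (aemeasurable_chart_symm e).mono_ac (withDensity_absolutelyContinuous _ _)

lemma lintegral_chartVolume (he : e ∈ IsManifold.maximalAtlas (𝓡 n) ∞ M) {F : M → ENNReal}
    (hF : Measurable F) :
    ∫⁻ q, F q ∂(chartVolume g e)
      = ∫⁻ x in e.target, ENNReal.ofReal (Real.sqrt (metricCoord g e x).det) * F (e.symm x) := by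
  have hm := aemeasurable_symm_withDensity (g := g) (e := e)
  rw [chartVolume, lintegral_map' hF.aemeasurable hm]
  exact lintegral_withDensity_eq_lintegral_mul₀' (aemeasurable_volDensity he)
    (hF.comp_aemeasurable hm)

lemma det_fderiv_eq_det_jac {ψ : Eu n → Eu n} {x : Eu n} (hψ : DifferentiableAt ℝ ψ x) :
    (fderiv ℝ ψ x).det = (jac ψ x).det := by
  rw [ContinuousLinearMap.det,
    ← LinearMap.det_toMatrix (EuclideanSpace.basisFun (Fin n) ℝ).toBasis]
  congr 1
  ext i j
  rw [LinearMap.toMatrix_apply, jac, Matrix.of_apply, partialDeriv]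
  have : HasFDerivAt (fun y => ψ y i) ((EuclideanSpace.proj i : Eu n →L[ℝ] ℝ).comp (fderiv ℝ ψ x)) x :=
    (EuclideanSpace.proj i : Eu n →L[ℝ] ℝ).hasFDerivAt.comp x hψ.hasFDerivAt
  rw [this.fderiv]
  simp

/-- The Riemannian measures of two charts agree on the overlap of the charts: by the formula for the
change of variables, since `√det` of the metric scales with the Jacobian determinant. -/
lemma lintegral_chartVolume_congr (he : e ∈ IsManifold.maximalAtlas (𝓡 n) ∞ M)
    (he' : e' ∈ IsManifold.maximalAtlas (𝓡 n) ∞ M) {F : M → ENNReal} (hF : Measurable F)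
    (h0 : ∀ q, q ∉ e.source ∩ e'.source → F q = 0) :
    ∫⁻ q, F q ∂(chartVolume g e) = ∫⁻ q, F q ∂(chartVolume g e') := by
  have restr : ∀ e₁ e₂ : OpenPartialHomeomorph M (Eu n),
      (∀ q, q ∉ e₁.source ∩ e₂.source → F q = 0) → ∀ w : Eu n → ENNReal,
      ∫⁻ x in e₁.target, w x * F (e₁.symm x) = ∫⁻ x in chartTransDom e₁ e₂, w x * F (e₁.symm x) := by
    intro e₁ e₂ h0 w
    rw [← lintegral_indicator e₁.open_target.measurableSet,
      ← lintegral_indicator isOpen_chartTransDom.measurableSet]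
    congr 1
    funext x
    by_cases h1 : x ∈ e₁.target
    · by_cases h2 : e₁.symm x ∈ e₂.source
      · rw [indicator_of_mem h1, indicator_of_mem (mem_chartTransDom.2 ⟨h1, h2⟩)]
      · rw [indicator_of_mem h1, indicator_of_notMem fun h => h2 (mem_chartTransDom.1 h).2,
          h0 _ fun h => h2 h.2, mul_zero]
    · rw [indicator_of_notMem h1, indicator_of_notMem fun h => h1 (mem_chartTransDom.1 h).1]
  rw [lintegral_chartVolume he hF, lintegral_chartVolume he' hF, restr e e' h0,
    restr e' e (fun q hq => h0 q fun h => hq h.symm)]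
  have Ψ := coordChange_trans (g := g) he he'
  have himg : chartTrans e e' '' chartTransDom e e' = chartTransDom e' e := by
    ext z
    constructor
    · rintro ⟨x, hx, rfl⟩
      refine mem_chartTransDom.2 ⟨trans_mem_target hx, ?_⟩
      rw [symm_trans_eq hx]
      exact e.map_target (mem_chartTransDom.1 hx).1
    · intro hz
      obtain ⟨h1, h2⟩ := mem_chartTransDom.1 hz
      refine ⟨chartTrans e' e z, mem_chartTransDom.2 ⟨trans_mem_target hz, ?_⟩, ?_⟩
      · rw [symm_trans_eq hz]
        exact e'.map_target h1
      · rw [chartTrans, symm_trans_eq hz, e'.right_inv h1]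
  have hinj : InjOn (chartTrans e e') (chartTransDom e e') := by
    intro x hx z hz hxz
    have := congrArg e'.symm hxz
    rw [symm_trans_eq hx, symm_trans_eq hz] at this
    exact e.symm.injOn (mem_chartTransDom.1 hx).1 (mem_chartTransDom.1 hz).1 this
  rw [← himg, lintegral_image_eq_lintegral_abs_det_fderiv_mul volume
    isOpen_chartTransDom.measurableSet
    (fun x hx => (Ψ.differentiableAt hx).hasFDerivAt.hasFDerivWithinAt) hinj]
  refine setLIntegral_congr_fun isOpen_chartTransDom.measurableSet fun x hx => ?_
  rw [symm_trans_eq hx, det_fderiv_eq_det_jac (Ψ.differentiableAt hx), ← mul_assoc,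
    ← ENNReal.ofReal_mul (abs_nonneg _), Ψ.pullback x hx, Matrix.det_mul, Matrix.det_mul,
    Matrix.det_transpose, mul_right_comm, ← sq,
    Real.sqrt_mul (sq_nonneg _), Real.sqrt_sq_eq_abs]

lemma chartVolume_apply_congr (he : e ∈ IsManifold.maximalAtlas (𝓡 n) ∞ M)
    (he' : e' ∈ IsManifold.maximalAtlas (𝓡 n) ∞ M) {B : Set M} (hB : MeasurableSet B)
    (h0 : B ⊆ e.source ∩ e'.source) : chartVolume g e B = chartVolume g e' B := by
  rw [← lintegral_indicator_one hB, ← lintegral_indicator_one hB]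
  exact lintegral_chartVolume_congr he he' (measurable_one.indicator hB)
    fun q hq => indicator_of_notMem (fun h => hq (h0 h)) _

lemma chartVolume_inter_source (he : e ∈ IsManifold.maximalAtlas (𝓡 n) ∞ M) {B : Set M}
    (hB : MeasurableSet B) : chartVolume g e B = chartVolume g e (B ∩ e.source) := by
  have hB' := hB.inter e.open_source.measurableSet
  rw [← lintegral_indicator_one hB, ← lintegral_indicator_one hB',
    lintegral_chartVolume he (measurable_one.indicator hB),
    lintegral_chartVolume he (measurable_one.indicator hB')]
  refine setLIntegral_congr_fun e.open_target.measurableSet fun x hx => ?_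
  have : e.symm x ∈ B ∩ e.source ↔ e.symm x ∈ B := and_iff_left (e.map_target hx)
  by_cases hB : e.symm x ∈ B
  · rw [indicator_of_mem hB, indicator_of_mem (this.2 hB)]
  · rw [indicator_of_notMem hB, indicator_of_notMem (this.not.2 hB)]

/-- The Riemannian volume restricts to the measure of any chart of the maximal atlas. Finitely many
preferred charts cover the manifold; the measure glued from them along a disjoint decomposition
agrees with every chart measure, hence with the supremum of these which defines the volume. -/
lemma riemVolume_restrict_source [CompactSpace M] (he : e ∈ IsManifold.maximalAtlas (𝓡 n) ∞ M) :
    (riemVolume g).restrict e.source = chartVolume g e := by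
  rcases isEmpty_or_nonempty M with hM | hM
  · exact Measure.ext fun s _ => by simp [Set.eq_empty_of_isEmpty s]
  obtain ⟨t, ht⟩ := CompactSpace.elim_nhds_subcover
    (fun q : M => (chartAt (EuclideanSpace ℝ (Fin n)) q).source) fun q => chart_source_mem_nhds _ q
  obtain ⟨c, hc⟩ : ∃ c : ℕ → M, ∀ q : M, ∃ i, q ∈ (chartAt (EuclideanSpace ℝ (Fin n)) (c i)).source := by
    have q₀ : M := Classical.arbitrary M
    refine ⟨fun i => t.toList.getD i q₀, fun q => ?_⟩
    have hq : q ∈ ⋃ x ∈ t, (chartAt (EuclideanSpace ℝ (Fin n)) x).source := by rw [ht]; trivial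
    simp only [mem_iUnion] at hq
    obtain ⟨x, hx, hqx⟩ := hq
    obtain ⟨i, hi, rfl⟩ := List.getElem_of_mem (Finset.mem_toList.2 hx)
    exact ⟨i, by simpa only [List.getD_eq_getElem _ _ hi] using hqx⟩
  set f : ℕ → OpenPartialHomeomorph M (Eu n) := fun i => chartAt (EuclideanSpace ℝ (Fin n)) (c i)
  have hf : ∀ i, f i ∈ IsManifold.maximalAtlas (𝓡 n) ∞ M := fun i =>
    IsManifold.chart_mem_maximalAtlas _
  set P : ℕ → Set M := disjointed fun i => (f i).source
  have hPm : ∀ i, MeasurableSet (P i) := MeasurableSet.disjointed fun i => (f i).open_source.measurableSet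
  have hPs : ∀ i, P i ⊆ (f i).source := fun i => disjointed_subset _ _
  have hPd : Pairwise (Function.onFun Disjoint P) := disjoint_disjointed _
  have hPu : ⋃ i, P i = univ := by
    rw [iUnion_disjointed, eq_univ_iff_forall]
    exact fun q => mem_iUnion.2 (hc q)
  have split : ∀ (μ : Measure M) (B : Set M), MeasurableSet B → μ B = ∑' i, μ (B ∩ P i) := by
    intro μ B hB
    rw [← measure_iUnion (fun i j hij => (hPd hij).mono inter_subset_right inter_subset_right)
      fun i => hB.inter (hPm i), ← inter_iUnion, hPu, inter_univ]
  set μ : Measure M := Measure.sum fun i => (chartVolume g (f i)).restrict (P i) with hμ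
  have hμa : ∀ B, MeasurableSet B → μ B = ∑' i, chartVolume g (f i) (B ∩ P i) := by
    intro B hB
    rw [hμ, Measure.sum_apply _ hB]
    exact tsum_congr fun i => Measure.restrict_apply hB
  have hcv : ∀ e ∈ IsManifold.maximalAtlas (𝓡 n) ∞ M, ∀ B, MeasurableSet B →
      chartVolume g e B = μ (B ∩ e.source) := by
    intro e he B hB
    have hBs := hB.inter e.open_source.measurableSet
    rw [chartVolume_inter_source he hB, split _ _ hBs, hμa _ hBs]
    exact tsum_congr fun i => chartVolume_apply_congr he (hf i) (hBs.inter (hPm i))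
      fun q hq => ⟨hq.1.2, hPs i hq.2⟩
  have hle : riemVolume g ≤ μ := iSup_le fun q => Measure.le_intro fun B hB _ => by
    rw [hcv _ (IsManifold.chart_mem_maximalAtlas q) B hB]
    exact measure_mono inter_subset_left
  have hge : μ ≤ riemVolume g := Measure.le_intro fun B hB _ => by
    rw [hμa B hB, split _ B hB]
    exact ENNReal.tsum_le_tsum fun i => (le_iSup (fun q : M => chartVolume g
      (chartAt (EuclideanSpace ℝ (Fin n)) q)) (c i)) _
  rw [le_antisymm hle hge]
  exact Measure.ext fun B hB => by rw [Measure.restrict_apply hB, hcv e he B hB]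

lemma isFiniteMeasure_riemVolume [CompactSpace M] (g : RiemMetric n M) :
    IsFiniteMeasure (riemVolume g) := by
  have : IsLocallyFiniteMeasure (riemVolume g) := ⟨fun q => by
    have he := IsManifold.chart_mem_maximalAtlas (I := 𝓡 n) (n := ∞) q
    set e := chartAt (EuclideanSpace ℝ (Fin n)) q
    have hq : q ∈ e.source := mem_chart_source _ q
    obtain ⟨r, hr, hrs⟩ := Metric.isOpen_iff.1 e.open_target _ (e.map_source hq)
    have hsub : Metric.closedBall (e q) (r / 2) ⊆ e.target :=
      (Metric.closedBall_subset_ball (by linarith)).trans hrs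
    set U := e.source ∩ e ⁻¹' Metric.ball (e q) (r / 2) with hU
    have hUo : IsOpen U := e.isOpen_inter_preimage Metric.isOpen_ball
    refine ⟨U, hUo.mem_nhds ⟨hq, Metric.mem_ball_self (by linarith)⟩, ?_⟩
    rw [show U = U ∩ e.source from (inter_eq_self_of_subset_left inter_subset_left).symm,
      ← Measure.restrict_apply hUo.measurableSet, riemVolume_restrict_source he,
      ← lintegral_indicator_one hUo.measurableSet,
      lintegral_chartVolume he (measurable_one.indicator hUo.measurableSet)]
    obtain ⟨C, hC⟩ := (isCompact_closedBall (e q) (r / 2)).bddAbove_image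
      ((continuousOn_volDensity (g := g) he).mono hsub)
    refine lt_of_le_of_lt (setLIntegral_mono' (g := (Metric.closedBall (e q) (r / 2)).indicator
      fun _ => ENNReal.ofReal C) e.open_target.measurableSet fun x hx => ?_) (lt_of_le_of_lt
        (setLIntegral_le_lintegral _ _) ?_)
    · by_cases hU' : e.symm x ∈ U
      · have hx' : x ∈ Metric.closedBall (e q) (r / 2) := by
          have := hU'.2
          rw [mem_preimage, e.right_inv hx] at this
          exact Metric.ball_subset_closedBall this
        rw [indicator_of_mem hU', indicator_of_mem hx', Pi.one_apply, mul_one]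
        exact ENNReal.ofReal_le_ofReal (hC ⟨x, hx', rfl⟩)
      · rw [indicator_of_notMem hU', mul_zero]
        exact zero_le
    · rw [lintegral_indicator Metric.isClosed_closedBall.measurableSet, setLIntegral_const]
      exact ENNReal.mul_lt_top ENNReal.ofReal_lt_top measure_closedBall_lt_top⟩
  exact CompactSpace.isFiniteMeasure

/-- The integral over the domain of a chart, in the coordinates of the chart. -/
lemma setIntegral_riemVolume_source [CompactSpace M] (he : e ∈ IsManifold.maximalAtlas (𝓡 n) ∞ M)
    {F : M → ℝ} (hF : Continuous F) :
    ∫ q in e.source, F q ∂(riemVolume g)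
      = ∫ x in e.target, F (e.symm x) * Real.sqrt (metricCoord g e x).det := by
  rw [riemVolume_restrict_source he, chartVolume,
    integral_map aemeasurable_symm_withDensity hF.aestronglyMeasurable,
    integral_withDensity_eq_integral_toReal_smul₀ (aemeasurable_volDensity he)
      (Filter.Eventually.of_forall fun _ => ENNReal.ofReal_lt_top)]
  refine integral_congr_ae (Filter.Eventually.of_forall fun x => ?_)
  simp only [ENNReal.toReal_ofReal (Real.sqrt_nonneg _), smul_eq_mul, mul_comm]

/-- The integral of a function supported in a chart, in the coordinates of the chart. -/
lemma integral_riemVolume_eq [CompactSpace M] (he : e ∈ IsManifold.maximalAtlas (𝓡 n) ∞ M)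
    {F : M → ℝ} (hF : Continuous F) (h0 : ∀ q ∉ e.source, F q = 0) :
    ∫ q, F q ∂(riemVolume g) = ∫ x in e.target, F (e.symm x) * Real.sqrt (metricCoord g e x).det := by
  rw [← setIntegral_eq_integral_of_forall_compl_eq_zero h0, setIntegral_riemVolume_source he hF]

lemma integrable_riemVolume [CompactSpace M] {F : M → ℝ} (hF : Continuous F) :
    Integrable F (riemVolume g) := by
  have := isFiniteMeasure_riemVolume g
  exact hF.integrable_of_hasCompactSupport (HasCompactSupport.of_compactSpace F)

lemma integrableOn_chart [CompactSpace M] (he : e ∈ IsManifold.maximalAtlas (𝓡 n) ∞ M)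
    {F : M → ℝ} (hF : Continuous F) :
    IntegrableOn (fun x => F (e.symm x) * Real.sqrt (metricCoord g e x).det) e.target := by
  have h1 : Integrable F (chartVolume g e) := by
    rw [← riemVolume_restrict_source he]
    exact (integrable_riemVolume hF).restrict
  rw [chartVolume, integrable_map_measure hF.aestronglyMeasurable aemeasurable_symm_withDensity,
    integrable_withDensity_iff_integrable_smul₀' (aemeasurable_volDensity he)
      (Filter.Eventually.of_forall fun _ => ENNReal.ofReal_lt_top)] at h1
  refine h1.congr (Filter.Eventually.of_forall fun x => ?_)
  simp only [ENNReal.toReal_ofReal (Real.sqrt_nonneg _), smul_eq_mul, mul_comm, Function.comp_apply]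

end Volume

/-! ### Time-dependent fields and integrals depending on time -/

namespace Coord

section TimeDependent

variable {n : ℕ} {Ω : Set (Eu n)} {T t : ℝ} {x : Eu n}

/-- Smoothness of a time-dependent function on `Ω × [0, T)`, up to the initial time. -/
def TimeSmooth (T : ℝ) (Ω : Set (Eu n)) (F : ℝ → Eu n → ℝ) : Prop :=
  ContDiffOn ℝ ∞ (fun z : Eu n × ℝ => F z.2 z.1) (Ω ×ˢ Ico 0 T)

/-- Entrywise smoothness of a time-dependent matrix-valued function on `Ω × [0, T)`. -/
def MatTimeSmooth (T : ℝ) (Ω : Set (Eu n)) (A : ℝ → Eu n → Mat n) : Prop :=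
  ∀ i j, TimeSmooth T Ω fun s z => A s z i j

lemma timeSmooth_of_contDiffOn {f : Eu n → ℝ} (hf : ContDiffOn ℝ ∞ f Ω) :
    TimeSmooth T Ω fun _ => f :=
  hf.comp contDiff_fst.contDiffOn fun _ hz => hz.1

lemma TimeSmooth.slice {F : ℝ → Eu n → ℝ} (hF : TimeSmooth T Ω F) (ht : t ∈ Ico 0 T) :
    ContDiffOn ℝ ∞ (F t) Ω :=
  ContDiffOn.comp (g := fun z : Eu n × ℝ => F z.2 z.1) (f := fun x => (x, t)) hF
    (contDiff_id.prodMk contDiff_const).contDiffOn fun _ hx => ⟨hx, ht⟩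

lemma TimeSmooth.add {F G : ℝ → Eu n → ℝ} (hF : TimeSmooth T Ω F) (hG : TimeSmooth T Ω G) :
    TimeSmooth T Ω fun s z => F s z + G s z := ContDiffOn.add hF hG

lemma TimeSmooth.sub {F G : ℝ → Eu n → ℝ} (hF : TimeSmooth T Ω F) (hG : TimeSmooth T Ω G) :
    TimeSmooth T Ω fun s z => F s z - G s z := ContDiffOn.sub hF hG

lemma TimeSmooth.mul {F G : ℝ → Eu n → ℝ} (hF : TimeSmooth T Ω F) (hG : TimeSmooth T Ω G) :
    TimeSmooth T Ω fun s z => F s z * G s z := ContDiffOn.mul hF hG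

lemma TimeSmooth.sum {ι : Type*} (s : Finset ι) {F : ι → ℝ → Eu n → ℝ}
    (hF : ∀ i ∈ s, TimeSmooth T Ω (F i)) : TimeSmooth T Ω fun r z => ∑ i ∈ s, F i r z :=
  ContDiffOn.sum hF

lemma TimeSmooth.continuousOn {F : ℝ → Eu n → ℝ} (hF : TimeSmooth T Ω F) :
    ContinuousOn (fun z : Eu n × ℝ => F z.2 z.1) (Ω ×ˢ Ico 0 T) := ContDiffOn.continuousOn hF

lemma TimeSmooth.hasFDerivAt_slice {F : ℝ → Eu n → ℝ} (hF : TimeSmooth T Ω F) (hΩ : IsOpen Ω)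
    (hx : x ∈ Ω) (ht : t ∈ Ico 0 T) :
    HasFDerivAt (F t) ((fderivWithin ℝ (fun z : Eu n × ℝ => F z.2 z.1) (Ω ×ˢ Ico 0 T) (x, t)).comp
      (ContinuousLinearMap.inl ℝ (Eu n) ℝ)) x := by
  have h1 := ((ContDiffOn.differentiableOn hF (by simp)) (x, t) ⟨hx, ht⟩).hasFDerivWithinAt
  have h2 : HasFDerivWithinAt (fun y : Eu n => (y, t)) (ContinuousLinearMap.inl ℝ (Eu n) ℝ) Ω x :=
    (hasFDerivAt_prodMk_left x t).hasFDerivWithinAt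
  have h3 : MapsTo (fun y : Eu n => (y, t)) Ω (Ω ×ˢ Ico 0 T) := fun y hy => ⟨hy, ht⟩
  exact (h1.comp x h2 h3).hasFDerivAt (hΩ.mem_nhds hx)

lemma TimeSmooth.partialDeriv {F : ℝ → Eu n → ℝ} (hF : TimeSmooth T Ω F) (hΩ : IsOpen Ω) (p : Fin n) :
    TimeSmooth T Ω fun s => partialDeriv p (F s) := by
  have h1 : ContDiffOn ℝ ∞ (fun z : Eu n × ℝ => fderivWithin ℝ (fun z : Eu n × ℝ => F z.2 z.1)
      (Ω ×ˢ Ico 0 T) z (EuclideanSpace.single p 1, 0)) (Ω ×ˢ Ico 0 T) :=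
    (ContDiffOn.fderivWithin (m := ∞) hF (hΩ.uniqueDiffOn.prod (uniqueDiffOn_Ico 0 T))
      (by simp)).clm_apply contDiffOn_const
  refine ContDiffOn.congr h1 fun z hz => ?_
  simp only [Coord.partialDeriv]
  rw [(hF.hasFDerivAt_slice hΩ hz.1 hz.2).fderiv]
  simp

/-- The time derivative commutes with the partial derivatives at positive times. -/
lemma TimeSmooth.hasDerivAt_partialDeriv {F F' : ℝ → Eu n → ℝ} (hF : TimeSmooth T Ω F)
    (hΩ : IsOpen Ω)
    (hF' : ∀ y ∈ Ω, ∀ s ∈ Ico 0 T, HasDerivWithinAt (fun r => F r y) (F' s y) (Ico 0 T) s)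
    (hx : x ∈ Ω) (ht : t ∈ Ioo 0 T) (p : Fin n) :
    HasDerivAt (fun s => Coord.partialDeriv p (F s) x) (Coord.partialDeriv p (F' t) x) t := by
  set f : Eu n × ℝ → ℝ := fun z => F z.2 z.1 with hf
  have hO : IsOpen (Ω ×ˢ Ioo 0 T) := hΩ.prod isOpen_Ioo
  have hfs : ∀ z ∈ Ω ×ˢ Ioo 0 T, ContDiffAt ℝ ∞ f z := fun z hz =>
    (ContDiffOn.mono hF (prod_mono subset_rfl Ioo_subset_Ico_self)).contDiffAt (hO.mem_nhds hz)
  have hc := hfs (x, t) ⟨hx, ht⟩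
  have hd : DifferentiableAt ℝ (fderiv ℝ f) (x, t) :=
    (hc.fderiv_right (m := 1) (by norm_cast)).differentiableAt (by norm_num)
  have hsymm : IsSymmSndFDerivAt ℝ f (x, t) := hc.isSymmSndFDerivAt (by simpa using ENat.LEInfty.out)
  have e1 : ∀ z ∈ Ω ×ˢ Ioo 0 T, Coord.partialDeriv p (F z.2) z.1
      = fderiv ℝ f z (EuclideanSpace.single p 1, 0) := by
    intro z hz
    have h1 := ((hfs z hz).differentiableAt (by simp)).hasFDerivAt
    have h2 : HasFDerivAt (fun y : Eu n => (y, z.2)) (ContinuousLinearMap.inl ℝ (Eu n) ℝ) z.1 :=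
      hasFDerivAt_prodMk_left z.1 z.2
    have h3 : HasFDerivAt (F z.2) _ z.1 := HasFDerivAt.comp (g := f) z.1 h1 h2
    rw [Coord.partialDeriv, h3.fderiv]
    simp
  have e2 : ∀ z ∈ Ω ×ˢ Ioo 0 T, F' z.2 z.1 = fderiv ℝ f z (0, 1) := by
    intro z hz
    have h1 := ((hfs z hz).differentiableAt (by simp)).hasFDerivAt
    have h2 : HasDerivAt (fun r : ℝ => (z.1, r)) ((0 : Eu n), (1 : ℝ)) z.2 :=
      (hasDerivAt_const _ _).prodMk (hasDerivAt_id _)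
    have h3 : HasDerivAt (fun r => F r z.1) _ z.2 := HasFDerivAt.comp_hasDerivAt (l := f) z.2 h1 h2
    exact ((hF' z.1 hz.1 z.2 (Ioo_subset_Ico_self hz.2)).hasDerivAt
      (Ico_mem_nhds hz.2.1 hz.2.2)).unique h3
  -- both sides are values of the symmetric second derivative of `f` at `(x, t)`
  have h4 : HasDerivAt (fun s => fderiv ℝ f (x, s) (EuclideanSpace.single p 1, 0))
      (fderiv ℝ (fderiv ℝ f) (x, t) (0, 1) (EuclideanSpace.single p 1, 0)) t := by
    have h2 : HasDerivAt (fun r : ℝ => (x, r)) ((0 : Eu n), (1 : ℝ)) t :=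
      (hasDerivAt_const _ _).prodMk (hasDerivAt_id _)
    have h5 : HasDerivAt (fun s => fderiv ℝ f (x, s)) _ t :=
      HasFDerivAt.comp_hasDerivAt (l := fderiv ℝ f) t hd.hasFDerivAt h2
    simpa using h5.clm_apply (hasDerivAt_const t ((EuclideanSpace.single p 1 : Eu n), (0 : ℝ)))
  have h6 : Coord.partialDeriv p (F' t) x
      = fderiv ℝ (fderiv ℝ f) (x, t) (EuclideanSpace.single p 1, 0) (0, 1) := by
    have h7 : Coord.partialDeriv p (F' t) x
        = Coord.partialDeriv p (fun y => fderiv ℝ f (y, t) (0, 1)) x :=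
      partialDeriv_congr p (Filter.eventually_of_mem (hΩ.mem_nhds hx) fun y hy => e2 (y, t) ⟨hy, ht⟩)
    have h8 : HasFDerivAt (fun y : Eu n => fderiv ℝ f (y, t)) _ x :=
      HasFDerivAt.comp (g := fderiv ℝ f) x hd.hasFDerivAt (hasFDerivAt_prodMk_left x t)
    have h9 := h8.clm_apply (hasFDerivAt_const ((0 : Eu n), (1 : ℝ)) x)
    rw [h7, Coord.partialDeriv, h9.fderiv]
    simp
  rw [h6, hsymm]
  exact h4.congr_of_eventuallyEq (Filter.eventually_of_mem (isOpen_Ioo.mem_nhds ht)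
    fun s hs => e1 (x, s) ⟨hx, hs⟩)

lemma matTimeSmooth_of_matSmoothOn {A : Eu n → Mat n} (hA : MatSmoothOn A Ω) :
    MatTimeSmooth T Ω fun _ => A := fun i j => timeSmooth_of_contDiffOn (hA i j)

variable {A B : ℝ → Eu n → Mat n}

lemma MatTimeSmooth.slice (hA : MatTimeSmooth T Ω A) (ht : t ∈ Ico 0 T) : MatSmoothOn (A t) Ω :=
  fun i j => (hA i j).slice ht

lemma MatTimeSmooth.add (hA : MatTimeSmooth T Ω A) (hB : MatTimeSmooth T Ω B) :
    MatTimeSmooth T Ω fun s z => A s z + B s z := fun i j => (hA i j).add (hB i j)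

lemma MatTimeSmooth.sub (hA : MatTimeSmooth T Ω A) (hB : MatTimeSmooth T Ω B) :
    MatTimeSmooth T Ω fun s z => A s z - B s z := fun i j => (hA i j).sub (hB i j)

lemma MatTimeSmooth.transpose (hA : MatTimeSmooth T Ω A) :
    MatTimeSmooth T Ω fun s z => (A s z).transpose := fun i j => hA j i

lemma MatTimeSmooth.mul (hA : MatTimeSmooth T Ω A) (hB : MatTimeSmooth T Ω B) :
    MatTimeSmooth T Ω fun s z => A s z * B s z := fun i j => by
  simp only [Matrix.mul_apply]
  exact TimeSmooth.sum _ fun l _ => (hA i l).mul (hB l j)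

lemma MatTimeSmooth.smul {f : ℝ → Eu n → ℝ} (hf : TimeSmooth T Ω f) (hB : MatTimeSmooth T Ω B) :
    MatTimeSmooth T Ω fun s z => f s z • B s z := fun i j => by
  simp only [Matrix.smul_apply, smul_eq_mul]
  exact hf.mul (hB i j)

lemma MatTimeSmooth.sum {ι : Type*} (s : Finset ι) {F : ι → ℝ → Eu n → Mat n}
    (hF : ∀ i ∈ s, MatTimeSmooth T Ω (F i)) : MatTimeSmooth T Ω fun r z => ∑ i ∈ s, F i r z :=
  fun i j => by
  simp only [Matrix.sum_apply]
  exact TimeSmooth.sum s fun l hl => hF l hl i j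

lemma MatTimeSmooth.trace (hA : MatTimeSmooth T Ω A) : TimeSmooth T Ω fun s z => (A s z).trace :=
  TimeSmooth.sum _ fun l _ => hA l l

variable {h : Eu n → Mat n}

lemma MatTimeSmooth.cd (H : IsMetricOn h Ω) (hA : MatTimeSmooth T Ω A) (p : Fin n) :
    MatTimeSmooth T Ω fun s => cd h p (A s) := by
  have hG := matTimeSmooth_of_matSmoothOn (T := T) (connMat_smooth H p)
  have h1 : MatTimeSmooth T Ω fun s => pd p (A s) := fun i j => (hA i j).partialDeriv H.isOpen p
  have := (h1.add (hG.mul hA)).sub (hA.mul hG)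
  simpa only [← cd_eq] using this

lemma MatTimeSmooth.tpair (H : IsMetricOn h Ω) (hA : MatTimeSmooth T Ω A)
    (hB : MatTimeSmooth T Ω B) : TimeSmooth T Ω fun s z => tpair (h z) (A s z) (B s z) :=
  (((hA.mul (matTimeSmooth_of_matSmoothOn H.inv_smooth)).mul hB.transpose).mul
    (matTimeSmooth_of_matSmoothOn H.smooth)).trace

lemma MatTimeSmooth.fpair (H : IsMetricOn h Ω) {D E : Fin n → ℝ → Eu n → Mat n}
    (hD : ∀ p, MatTimeSmooth T Ω (D p)) (hE : ∀ p, MatTimeSmooth T Ω (E p)) :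
    TimeSmooth T Ω fun s z => fpair (h z) (fun p => D p s z) (fun p => E p s z) := by
  simp only [Coord.fpair, contr, Matrix.of_apply]
  exact TimeSmooth.sum _ fun p _ => TimeSmooth.sum _ fun q _ =>
    (timeSmooth_of_contDiffOn (H.inv_smooth p q)).mul ((hD p).tpair H (hE q))

end TimeDependent

section MatDeriv

variable {n : ℕ} {s : Set ℝ} {t : ℝ} {A B : ℝ → Mat n} {A' B' : Mat n}

/-- Entrywise derivative of a curve of matrices. -/
def HasMatDeriv (A : ℝ → Mat n) (A' : Mat n) (s : Set ℝ) (t : ℝ) : Prop :=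
  ∀ i j, HasDerivWithinAt (fun r => A r i j) (A' i j) s t

lemma hasMatDeriv_const (C : Mat n) : HasMatDeriv (fun _ => C) 0 s t := fun _ _ =>
  hasDerivWithinAt_const _ _ _

lemma HasMatDeriv.add (hA : HasMatDeriv A A' s t) (hB : HasMatDeriv B B' s t) :
    HasMatDeriv (fun r => A r + B r) (A' + B') s t := fun i j => (hA i j).add (hB i j)

lemma HasMatDeriv.sub (hA : HasMatDeriv A A' s t) (hB : HasMatDeriv B B' s t) :
    HasMatDeriv (fun r => A r - B r) (A' - B') s t := fun i j => (hA i j).sub (hB i j)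

lemma HasMatDeriv.transpose (hA : HasMatDeriv A A' s t) :
    HasMatDeriv (fun r => (A r).transpose) A'.transpose s t := fun i j => hA j i

lemma HasMatDeriv.mul (hA : HasMatDeriv A A' s t) (hB : HasMatDeriv B B' s t) :
    HasMatDeriv (fun r => A r * B r) (A' * B t + A t * B') s t := fun i j => by
  simp only [Matrix.mul_apply, Matrix.add_apply, ← Finset.sum_add_distrib]
  exact HasDerivWithinAt.fun_sum fun l _ => (hA i l).fun_mul (hB l j)

lemma HasMatDeriv.trace (hA : HasMatDeriv A A' s t) :
    HasDerivWithinAt (fun r => (A r).trace) A'.trace s t :=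
  HasDerivWithinAt.fun_sum fun l _ => hA l l

lemma HasMatDeriv.tpair (k : Mat n) (hA : HasMatDeriv A A' s t) (hB : HasMatDeriv B B' s t) :
    HasDerivWithinAt (fun r => tpair k (A r) (B r)) (tpair k A' (B t) + tpair k (A t) B') s t := by
  have := (((hA.mul (hasMatDeriv_const k⁻¹)).mul hB.transpose).mul (hasMatDeriv_const k)).trace
  refine this.congr_deriv ?_
  simp only [Coord.tpair, Matrix.mul_zero, add_zero, Matrix.add_mul, Matrix.trace_add]

lemma HasMatDeriv.fpair (k : Mat n) {D E : ℝ → Fin n → Mat n} {D' E' : Fin n → Mat n}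
    (hD : ∀ p, HasMatDeriv (fun r => D r p) (D' p) s t)
    (hE : ∀ p, HasMatDeriv (fun r => E r p) (E' p) s t) :
    HasDerivWithinAt (fun r => fpair k (D r) (E r)) (fpair k D' (E t) + fpair k (D t) E') s t := by
  have := HasDerivWithinAt.fun_sum fun p (_ : p ∈ Finset.univ) =>
    HasDerivWithinAt.fun_sum fun q (_ : q ∈ Finset.univ) =>
      ((hD p).tpair k (hE q)).const_mul (k⁻¹ p q)
  refine HasDerivWithinAt.congr_deriv (f := fun r => Coord.fpair k (D r) (E r)) this ?_
  simp only [Coord.fpair, contr, Matrix.of_apply, mul_add, Finset.sum_add_distrib]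

/-- The time derivative commutes with the covariant derivative at positive times. -/
lemma MatTimeSmooth.hasMatDeriv_cd {Ω : Set (Eu n)} {h : Eu n → Mat n} {T : ℝ}
    {A A' : ℝ → Eu n → Mat n} (H : IsMetricOn h Ω) (hA : MatTimeSmooth T Ω A)
    (hA' : ∀ y ∈ Ω, ∀ s ∈ Ico 0 T, HasMatDeriv (fun r => A r y) (A' s y) (Ico 0 T) s)
    {x : Eu n} (hx : x ∈ Ω) (ht : t ∈ Ioo 0 T) (p : Fin n) :
    HasMatDeriv (fun r => Coord.cd h p (A r) x) (Coord.cd h p (A' t) x) univ t := by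
  have h1 : HasMatDeriv (fun r => pd p (A r) x) (pd p (A' t) x) univ t := fun i j =>
    ((hA i j).hasDerivAt_partialDeriv (F' := fun r y => A' r y i j) H.isOpen
      (fun y hy s hs => hA' y hy s hs i j) hx ht p).hasDerivWithinAt
  have h2 : HasMatDeriv (fun r => A r x) (A' t x) univ t := fun i j =>
    ((hA' x hx t (Ioo_subset_Ico_self ht) i j).hasDerivAt
      (Ico_mem_nhds ht.1 ht.2)).hasDerivWithinAt
  have h3 := (h1.add ((hasMatDeriv_const (connMat h p x)).mul h2)).sub
    (h2.mul (hasMatDeriv_const (connMat h p x)))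
  simp only [Matrix.zero_mul, Matrix.mul_zero, zero_add, add_zero] at h3
  simpa only [← cd_eq] using h3

end MatDeriv

section Integrals

variable {n : ℕ} {Ω K : Set (Eu n)}

lemma contDiff_of_support {f : Eu n → ℝ} (hΩ : IsOpen Ω) (hK : IsCompact K) (hKΩ : K ⊆ Ω)
    (hf : ContDiffOn ℝ ∞ f Ω) (h0 : ∀ x ∉ K, f x = 0) : ContDiff ℝ ∞ f := by
  rw [contDiff_iff_contDiffAt]
  intro x
  by_cases hx : x ∈ K
  · exact hf.contDiffAt (hΩ.mem_nhds (hKΩ hx))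
  · exact contDiffAt_const.congr_of_eventuallyEq
      (Filter.eventually_of_mem (hK.isClosed.isOpen_compl.mem_nhds hx) h0)

/-- The divergence theorem for compactly supported functions. -/
lemma integral_partialDeriv_eq_zero {f : Eu n → ℝ} (hΩ : IsOpen Ω) (hK : IsCompact K) (hKΩ : K ⊆ Ω)
    (hf : ContDiffOn ℝ ∞ f Ω) (h0 : ∀ x ∉ K, f x = 0) (p : Fin n) :
    ∫ x in K, partialDeriv p f x = 0 := by
  have hc := contDiff_of_support hΩ hK hKΩ hf h0
  have hs : HasCompactSupport f := HasCompactSupport.intro hK h0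
  have h0' : ∀ x ∉ K, partialDeriv p f x = 0 := fun x hx => by
    rw [partialDeriv_congr p (g := fun _ => (0 : ℝ))
      (Filter.eventually_of_mem (hK.isClosed.isOpen_compl.mem_nhds hx) h0), partialDeriv_const]
  have hs' : HasCompactSupport (partialDeriv p f) := HasCompactSupport.intro hK h0'
  have hc' : Continuous (partialDeriv p f) :=
    (hc.continuous_fderiv (by simp)).clm_apply continuous_const
  rw [setIntegral_eq_integral_of_forall_compl_eq_zero h0']
  have := integral_mul_fderiv_eq_neg_fderiv_mul_of_integrable (μ := (volume : Measure (Eu n)))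
    (f := fun _ : Eu n => (1 : ℝ)) (g := f) (v := EuclideanSpace.single p 1) (by simp)
    (by simpa only [one_mul] using! hc'.integrable_of_hasCompactSupport hs')
    (by simpa using hc.continuous.integrable_of_hasCompactSupport hs)
    (fun _ _ => differentiableAt_const _) (fun x _ => hc.differentiable (by simp) x)
  simpa [partialDeriv] using this

lemma continuousOn_setIntegral {T : ℝ} {G : ℝ → Eu n → ℝ} (hK : IsCompact K)
    (hG : ContinuousOn (fun z : Eu n × ℝ => G z.2 z.1) (K ×ˢ Ico 0 T)) :
    ContinuousOn (fun t => ∫ x in K, G t x) (Ico 0 T) := by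
  intro t ht
  set b := (t + T) / 2
  have hb : t < b ∧ b < T := ⟨by simp only [b]; linarith [ht.2], by simp only [b]; linarith [ht.2]⟩
  have hsub : K ×ˢ Icc 0 b ⊆ K ×ˢ Ico 0 T :=
    prod_mono subset_rfl fun s hs => ⟨hs.1, hs.2.trans_lt hb.2⟩
  obtain ⟨C, hC⟩ := (hK.prod isCompact_Icc).exists_bound_of_continuousOn (hG.mono hsub)
  have hev : ∀ᶠ s in nhdsWithin t (Ico 0 T), s ∈ Icc 0 b := by
    filter_upwards [self_mem_nhdsWithin, mem_nhdsWithin_of_mem_nhds (Iio_mem_nhds hb.1)] with s h1 h2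
    exact ⟨h1.1, le_of_lt h2⟩
  have hslice : ∀ s ∈ Ico 0 T, ContinuousOn (G s) K := fun s hs =>
    ContinuousOn.comp (g := fun z : Eu n × ℝ => G z.2 z.1) (f := fun x => (x, s)) hG
      (by fun_prop) fun x hx => ⟨hx, hs⟩
  refine continuousWithinAt_of_dominated (bound := fun _ => C) ?_ ?_ ?_ ?_
  · filter_upwards [self_mem_nhdsWithin] with s hs
    exact (hslice s hs).aestronglyMeasurable hK.measurableSet
  · filter_upwards [hev] with s hs
    exact (ae_restrict_iff' hK.measurableSet).2 (Filter.Eventually.of_forall fun x hx =>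
      hC (x, s) ⟨hx, hs⟩)
  · exact integrableOn_const hK.measure_lt_top.ne
  · refine (ae_restrict_iff' hK.measurableSet).2 (Filter.Eventually.of_forall fun x hx => ?_)
    exact ContinuousWithinAt.comp (g := fun z : Eu n × ℝ => G z.2 z.1) (f := fun s => (x, s))
      (hG (x, t) ⟨hx, ht⟩) (by fun_prop) fun s hs => ⟨hx, hs⟩

lemma hasDerivAt_setIntegral {a b t : ℝ} {G G' : ℝ → Eu n → ℝ} (hK : IsCompact K)
    (hG : ∀ s ∈ Ioo a b, ContinuousOn (G s) K)
    (hG' : ContinuousOn (fun z : Eu n × ℝ => G' z.2 z.1) (K ×ˢ Ioo a b))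
    (hd : ∀ x ∈ K, ∀ s ∈ Ioo a b, HasDerivAt (fun r => G r x) (G' s x) s) (ht : t ∈ Ioo a b) :
    HasDerivAt (fun s => ∫ x in K, G s x) (∫ x in K, G' t x) t := by
  set c := (a + t) / 2
  set d := (t + b) / 2
  have hc : a < c ∧ c < t := ⟨by simp only [c]; linarith [ht.1], by simp only [c]; linarith [ht.1]⟩
  have hd' : t < d ∧ d < b := ⟨by simp only [d]; linarith [ht.2], by simp only [d]; linarith [ht.2]⟩
  have hcd : Icc c d ⊆ Ioo a b := fun s hs => ⟨hc.1.trans_le hs.1, hs.2.trans_lt hd'.2⟩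
  obtain ⟨C, hC⟩ := (hK.prod isCompact_Icc).exists_bound_of_continuousOn
    (hG'.mono (prod_mono subset_rfl hcd))
  have hslice : ContinuousOn (G' t) K :=
    ContinuousOn.comp (g := fun z : Eu n × ℝ => G' z.2 z.1) (f := fun x => (x, t)) hG'
      (by fun_prop) fun x hx => ⟨hx, ht⟩
  refine (hasDerivAt_integral_of_dominated_loc_of_deriv_le (bound := fun _ => C) (s := Icc c d)
    (Icc_mem_nhds hc.2 hd'.1) ?_ ((hG t ht).integrableOn_compact hK)
    (hslice.aestronglyMeasurable hK.measurableSet) ?_ (integrableOn_const hK.measure_lt_top.ne) ?_).2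
  · filter_upwards [isOpen_Ioo.mem_nhds ht] with s hs
    exact (hG s hs).aestronglyMeasurable hK.measurableSet
  · exact (ae_restrict_iff' hK.measurableSet).2 (Filter.Eventually.of_forall fun x hx s hs =>
      hC (x, s) ⟨hx, hs⟩)
  · exact (ae_restrict_iff' hK.measurableSet).2 (Filter.Eventually.of_forall fun x hx s hs =>
      hd x hx s (hcd hs))

end Integrals

end Coord

/-! ### Pointwise norms and the rough Laplacian -/

namespace Coord

section Contraction

variable {n : ℕ} {k : Mat n}

/-- The adjoint of an endomorphism with respect to the inner product `k`. -/
def madj (k Y : Mat n) : Mat n := k⁻¹ * Y.transpose * k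

lemma tpair_eq_trace (X Y : Mat n) : tpair k X Y = (X * madj k Y).trace := by
  simp only [tpair, madj, Matrix.mul_assoc]

/-- The contraction of an endomorphism-valued covariant `2`-tensor with the inverse of `k`. -/
def mcontr (k : Mat n) (S : Fin n → Fin n → Mat n) : Mat n := ∑ p, ∑ q, k⁻¹ p q • S p q

lemma mcontr_add (S S' : Fin n → Fin n → Mat n) :
    mcontr k (fun p q => S p q + S' p q) = mcontr k S + mcontr k S' := by
  simp [mcontr, Finset.sum_add_distrib]

lemma mcontr_sub (S S' : Fin n → Fin n → Mat n) :
    mcontr k (fun p q => S p q - S' p q) = mcontr k S - mcontr k S' := by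
  simp [mcontr, smul_sub, Finset.sum_sub_distrib]

lemma mcontr_mul_left (X : Mat n) (S : Fin n → Fin n → Mat n) :
    mcontr k (fun p q => X * S p q) = X * mcontr k S := by
  simp [mcontr, Finset.mul_sum]

lemma mcontr_mul_right (X : Mat n) (S : Fin n → Fin n → Mat n) :
    mcontr k (fun p q => S p q * X) = mcontr k S * X := by
  simp [mcontr, Finset.sum_mul]

lemma mcontr_swap (hk : ∀ i j, k⁻¹ i j = k⁻¹ j i) (S : Fin n → Fin n → Mat n) :
    mcontr k (fun p q => S q p) = mcontr k S := by
  rw [mcontr, Finset.sum_comm]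
  exact Finset.sum_congr rfl fun p _ => Finset.sum_congr rfl fun q _ => by rw [hk]

lemma trace_mcontr (S : Fin n → Fin n → Mat n) :
    (mcontr k S).trace = contr k (Matrix.of fun p q => (S p q).trace) := by
  simp [mcontr, contr, Matrix.trace_sum, Matrix.trace_smul]

open Matrix in
lemma mcontr_frame {R : Mat n} (h1 : k⁻¹ = R * Rᵀ) (D E : Fin n → Mat n) :
    mcontr k (fun p q => D p * E q) = ∑ c, frameForm R D c * frameForm R E c := by
  simp only [mcontr, h1, Matrix.mul_apply, Matrix.transpose_apply, Finset.sum_smul, frameForm,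
    Finset.sum_mul_sum, Matrix.smul_mul, Matrix.mul_smul, smul_smul]
  rw [Finset.sum_congr rfl fun p _ => Finset.sum_comm, Finset.sum_comm]
  exact Finset.sum_congr rfl fun c _ => Finset.sum_congr rfl fun p _ =>
    Finset.sum_congr rfl fun q _ => by rw [mul_comm]

/-- The norm of an endomorphism. -/
def tnorm (k X : Mat n) : ℝ := Real.sqrt (tpair k X X)

/-- The norm of an endomorphism-valued form. -/
def fnorm (k : Mat n) (D : Fin n → Mat n) : ℝ := Real.sqrt (fpair k D D)

lemma tnorm_nonneg (X : Mat n) : 0 ≤ tnorm k X := Real.sqrt_nonneg _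

lemma fnorm_nonneg (D : Fin n → Mat n) : 0 ≤ fnorm k D := Real.sqrt_nonneg _

lemma tnorm_sq (hk : k.PosDef) (X : Mat n) : tnorm k X ^ 2 = tpair k X X :=
  Real.sq_sqrt (tpair_self_nonneg hk X)

lemma fnorm_sq (hk : k.PosDef) (D : Fin n → Mat n) : fnorm k D ^ 2 = fpair k D D :=
  Real.sq_sqrt (fpair_self_nonneg hk D)

lemma abs_tpair_le (hk : k.PosDef) (X Y : Mat n) : |tpair k X Y| ≤ tnorm k X * tnorm k Y := by
  rw [tnorm, tnorm, ← Real.sqrt_mul (tpair_self_nonneg hk X)]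
  exact Real.abs_le_sqrt (tpair_sq_le hk X Y)

lemma abs_fpair_le (hk : k.PosDef) (D E : Fin n → Mat n) :
    |fpair k D E| ≤ fnorm k D * fnorm k E := by
  rw [fnorm, fnorm, ← Real.sqrt_mul (fpair_self_nonneg hk D)]
  exact Real.abs_le_sqrt (fpair_sq_le hk D E)

lemma tnorm_mul_le (hk : k.PosDef) (X Y : Mat n) : tnorm k (X * Y) ≤ tnorm k X * tnorm k Y := by
  rw [tnorm, tnorm, tnorm, ← Real.sqrt_mul (tpair_self_nonneg hk X)]
  exact Real.sqrt_le_sqrt (tpair_mul_self_le hk X Y)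

/-- In an orthonormal frame the contraction is a sum of products, and the Cauchy–Schwarz inequality
applies. -/
lemma tnorm_mcontr_le (hk : k.PosDef) (D E : Fin n → Mat n) :
    tnorm k (mcontr k fun p q => D p * E q) ≤ fnorm k D * fnorm k E := by
  obtain ⟨R, -, h1, -⟩ := exists_frame hk
  obtain ⟨V, hV⟩ : ∃ V, V = mcontr k fun p q => D p * E q := ⟨_, rfl⟩
  rw [← hV]
  have h4 : ∑ c, tnorm k (frameForm R D c) * tnorm k (frameForm R E c) ≤ fnorm k D * fnorm k E := by
    have h3 := Real.sum_mul_le_sqrt_mul_sqrt Finset.univ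
      (fun c => tnorm k (frameForm R D c)) (fun c => tnorm k (frameForm R E c))
    simp only [tnorm_sq hk, ← fpair_frame h1] at h3
    exact h3
  have h2 : tpair k V V ≤ (fnorm k D * fnorm k E) * tnorm k V := by
    have h5 : tpair k V V = ∑ c, tpair k (frameForm R D c * frameForm R E c) V := by
      rw [← tpair_sum_left, ← mcontr_frame h1, ← hV]
    rw [h5]
    refine le_trans (Finset.sum_le_sum fun c _ => ((le_abs_self _).trans (abs_tpair_le hk _ _)).trans
      (mul_le_mul_of_nonneg_right (tnorm_mul_le hk _ _) (tnorm_nonneg _))) ?_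
    rw [← Finset.sum_mul]
    exact mul_le_mul_of_nonneg_right h4 (tnorm_nonneg _)
  rw [← tnorm_sq hk, sq] at h2
  rcases (tnorm_nonneg (k := k) V).eq_or_lt with h0 | h0
  · rw [← h0]
    exact mul_nonneg (fnorm_nonneg _) (fnorm_nonneg _)
  · exact le_of_mul_le_mul_right h2 h0

end Contraction

section Laplacian

variable {n : ℕ} {h : Eu n → Mat n} {Ω : Set (Eu n)} {A B : Eu n → Mat n} {x : Eu n}

/-- The trace `g^{pq} Γ^l_{pq}` of the Christoffel symbols. -/
def tension (h : Eu n → Mat n) (x : Eu n) (l : Fin n) : ℝ :=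
  ∑ p, ∑ q, (h x)⁻¹ p q * christoffel h x l q p

/-- The rough Laplacian as a matrix. -/
def lap (h A : Eu n → Mat n) (x : Eu n) : Mat n :=
  mcontr (h x) (fun p q => cd h p (cd h q A) x) - ∑ l, tension h x l • cd h l A x

/-- The Laplace–Beltrami operator on functions. -/
def slap (h : Eu n → Mat n) (f : Eu n → ℝ) (x : Eu n) : ℝ :=
  contr (h x) (Matrix.of fun p q => partialDeriv p (partialDeriv q f) x)
    - ∑ l, tension h x l * partialDeriv l f x

/-- The quadratic gradient term `g^{pq} ∇_p A ∇_q A`. -/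
def gradSq (h A : Eu n → Mat n) (x : Eu n) : Mat n :=
  mcontr (h x) fun p q => cd h p A x * cd h q A x

lemma roughLaplacian_eq (k j : Fin n) : roughLaplacian h A x k j = lap h A x k j := by
  have e : ∀ p q, covDeriv₂ h A x p q k j
      = cd h p (cd h q A) x k j - ∑ l, christoffel h x l q p * cd h l A x k j := by
    intro p q
    simp only [covDeriv₂, cd, Matrix.of_apply]
    rfl
  simp only [roughLaplacian, e, lap, mcontr, tension, Matrix.sub_apply, Matrix.sum_apply,
    Matrix.smul_apply, smul_eq_mul, mul_sub, Finset.sum_sub_distrib, Finset.mul_sum, Finset.sum_mul]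
  congr 1
  rw [Finset.sum_congr rfl fun p _ => Finset.sum_comm, Finset.sum_comm]
  exact Finset.sum_congr rfl fun l _ => Finset.sum_congr rfl fun p _ =>
    Finset.sum_congr rfl fun q _ => by ring

lemma cubicTerm_eq (H : IsMetricOn h Ω) (k j : Fin n) :
    cubicTerm h A x k j = (gradSq h A x * A x) k j := by
  have e : gradSq h A x * A x
      = ∑ p, ∑ q, (h x)⁻¹ p q • (cd h q A x * (cd h p A x * A x)) := by
    rw [gradSq, ← mcontr_swap (H.inv_symm x)]
    simp only [mcontr, Finset.sum_mul, Matrix.smul_mul, Matrix.mul_assoc]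
  rw [e]
  simp only [cubicTerm, Matrix.sum_apply, Matrix.smul_apply, smul_eq_mul, Matrix.mul_apply,
    Finset.mul_sum, cd, Matrix.of_apply]
  refine Finset.sum_congr rfl fun p _ => Finset.sum_congr rfl fun q _ => ?_
  rw [Finset.sum_comm]
  exact Finset.sum_congr rfl fun b _ => Finset.sum_congr rfl fun a _ => by ring

lemma cd_cd_mul (H : IsMetricOn h Ω) (hA : MatSmoothOn A Ω) (hB : MatSmoothOn B Ω) (hx : x ∈ Ω)
    (p q : Fin n) :
    cd h p (cd h q fun z => A z * B z) x
      = cd h p (cd h q A) x * B x + cd h q A x * cd h p B x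
        + (cd h p A x * cd h q B x + A x * cd h p (cd h q B) x) := by
  have dA : ∀ z ∈ Ω, MatDiffAt A z := fun z hz => hA.matDiffAt H.isOpen hz
  have dB : ∀ z ∈ Ω, MatDiffAt B z := fun z hz => hB.matDiffAt H.isOpen hz
  have dA' := (cd_smooth H hA q).matDiffAt H.isOpen hx
  have dB' := (cd_smooth H hB q).matDiffAt H.isOpen hx
  rw [cd_congr p (B := fun z => cd h q A z * B z + A z * cd h q B z)
    (Filter.eventually_of_mem (H.isOpen.mem_nhds hx) fun z hz => cd_mul q (dA z hz) (dB z hz)),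
    cd_add p (dA'.mul (dB x hx)) ((dA x hx).mul dB'), cd_mul p dA' (dB x hx), cd_mul p (dA x hx) dB']

lemma lap_mul (H : IsMetricOn h Ω) (hA : MatSmoothOn A Ω) (hB : MatSmoothOn B Ω) (hx : x ∈ Ω) :
    lap h (fun z => A z * B z) x = lap h A x * B x + A x * lap h B x
      + (2 : ℝ) • mcontr (h x) fun p q => cd h p A x * cd h q B x := by
  have e1 : ∀ l, cd h l (fun z => A z * B z) x = cd h l A x * B x + A x * cd h l B x := fun l =>
    cd_mul l (hA.matDiffAt H.isOpen hx) (hB.matDiffAt H.isOpen hx)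
  have e2 := mcontr_swap (H.inv_symm x) fun p q => cd h p A x * cd h q B x
  simp only [lap, cd_cd_mul H hA hB hx, e1, mcontr_add, mcontr_mul_left, mcontr_mul_right, e2,
    smul_add, Finset.sum_add_distrib, Matrix.sub_mul, Matrix.mul_sub, Finset.sum_mul,
    Finset.mul_sum, Matrix.smul_mul, Matrix.mul_smul, two_smul]
  abel

lemma lap_add (H : IsMetricOn h Ω) (hA : MatSmoothOn A Ω) (hB : MatSmoothOn B Ω) (hx : x ∈ Ω) :
    lap h (fun z => A z + B z) x = lap h A x + lap h B x := by
  have e1 : ∀ z ∈ Ω, ∀ l, cd h l (fun z => A z + B z) z = cd h l A z + cd h l B z := fun z hz l =>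
    cd_add l (hA.matDiffAt H.isOpen hz) (hB.matDiffAt H.isOpen hz)
  have e2 : ∀ p q, cd h p (cd h q fun z => A z + B z) x = cd h p (cd h q A) x + cd h p (cd h q B) x := by
    intro p q
    rw [cd_congr p (B := fun z => cd h q A z + cd h q B z)
      (Filter.eventually_of_mem (H.isOpen.mem_nhds hx) fun z hz => e1 z hz q),
      cd_add p ((cd_smooth H hA q).matDiffAt H.isOpen hx) ((cd_smooth H hB q).matDiffAt H.isOpen hx)]
  simp only [lap, e1 x hx, e2, mcontr_add, smul_add, Finset.sum_add_distrib]
  abel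

lemma lap_one : lap h (fun _ => (1 : Mat n)) x = 0 := by
  have e1 : ∀ q, cd h q (fun _ => (1 : Mat n)) = fun _ => 0 := fun q => funext fun z => cd_one q
  simp [lap, e1, cd_zero, mcontr]

lemma adj_eq_madj : adj h A x = madj (h x) (A x) := rfl

lemma madj_mcontr (k : Mat n) (S : Fin n → Fin n → Mat n) :
    madj k (mcontr k S) = mcontr k fun p q => madj k (S p q) := by
  simp [madj, mcontr, Matrix.transpose_sum, Finset.mul_sum, Finset.sum_mul]

lemma lap_adj (H : IsMetricOn h Ω) (hA : MatSmoothOn A Ω) (hx : x ∈ Ω) :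
    lap h (adj h A) x = madj (h x) (lap h A x) := by
  have e1 : ∀ z ∈ Ω, ∀ l, cd h l (adj h A) z = adj h (cd h l A) z := fun z hz l => cd_adj H hA hz l
  have e2 : ∀ p q, cd h p (cd h q (adj h A)) x = madj (h x) (cd h p (cd h q A) x) := by
    intro p q
    rw [cd_congr p (B := adj h (cd h q A))
      (Filter.eventually_of_mem (H.isOpen.mem_nhds hx) fun z hz => e1 z hz q),
      cd_adj H (cd_smooth H hA q) hx, adj_eq_madj]
  rw [lap, lap]
  simp only [e1 x hx, e2, adj_eq_madj]
  rw [← madj_mcontr]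
  simp only [madj, Matrix.transpose_sub, Matrix.mul_sub, Matrix.sub_mul, Matrix.transpose_sum,
    Finset.mul_sum, Finset.sum_mul, Matrix.transpose_smul, Matrix.mul_smul, Matrix.smul_mul]

lemma slap_trace (H : IsMetricOn h Ω) (hA : MatSmoothOn A Ω) (hx : x ∈ Ω) :
    slap h (fun z => (A z).trace) x = (lap h A x).trace := by
  have e1 : ∀ z ∈ Ω, ∀ l, partialDeriv l (fun z => (A z).trace) z = (cd h l A z).trace :=
    fun z hz l => partialDeriv_trace_eq l (hA.matDiffAt H.isOpen hz)
  have e2 : ∀ p q, partialDeriv p (partialDeriv q fun z => (A z).trace) x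
      = (cd h p (cd h q A) x).trace := by
    intro p q
    rw [partialDeriv_congr p (Filter.eventually_of_mem (H.isOpen.mem_nhds hx) fun z hz => e1 z hz q),
      partialDeriv_trace_eq p ((cd_smooth H hA q).matDiffAt H.isOpen hx)]
  simp only [slap, e1 x hx, e2, lap, Matrix.trace_sub, trace_mcontr, Matrix.trace_sum,
    Matrix.trace_smul, smul_eq_mul]

/-- The Bochner-type formula for the norm of an endomorphism field. -/
lemma slap_tpair_self (H : IsMetricOn h Ω) (hA : MatSmoothOn A Ω) (hx : x ∈ Ω) :
    slap h (fun z => tpair (h z) (A z) (A z)) x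
      = 2 * tpair (h x) (lap h A x) (A x)
        + 2 * fpair (h x) (fun p => cd h p A x) (fun p => cd h p A x) := by
  have hs := adj_smooth H hA
  have e1 : (fun z => tpair (h z) (A z) (A z)) = fun z => (A z * adj h A z).trace := by
    funext z
    rw [tpair_eq_trace]
    rfl
  rw [e1, slap_trace H (hA.mul hs) hx, lap_mul H hA hs hx, lap_adj H hA hx, Matrix.trace_add,
    Matrix.trace_add, Matrix.trace_smul, trace_mcontr, adj_eq_madj, ← tpair_eq_trace,
    ← tpair_eq_trace, tpair_comm (H.posDef x hx) (A x)]
  simp only [cd_adj H hA hx, adj_eq_madj, ← tpair_eq_trace, fpair, smul_eq_mul]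
  ring

end Laplacian

end Coord

/-! ### Evolution of the defects of an almost complex structure -/

namespace Coord

section Evolution

variable {n : ℕ} {h : Eu n → Mat n} {Ω : Set (Eu n)} {T t : ℝ} {A : ℝ → Eu n → Mat n} {x : Eu n}

/-- A solution of the harmonic heat flow in coordinates. -/
structure FlowOn (h : Eu n → Mat n) (Ω : Set (Eu n)) (T : ℝ) (A : ℝ → Eu n → Mat n) : Prop where
  metric : IsMetricOn h Ω
  smooth : MatTimeSmooth T Ω A
  flow : ∀ x ∈ Ω, ∀ t ∈ Ico 0 T,
    HasMatDeriv (fun s => A s x) (lap h (A t) x - gradSq h (A t) x * A t x) (Ico 0 T) t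

/-- The differential inequality for the norm of a solution of a semilinear heat equation. -/
lemma exists_deriv_tpair_le (H : IsMetricOn h Ω) {S : ℝ → Eu n → Mat n} (hS : MatTimeSmooth T Ω S)
    (hx : x ∈ Ω) (ht : t ∈ Ico 0 T) {R : Mat n} {C : ℝ}
    (hd : HasMatDeriv (fun s => S s x) (lap h (S t) x + R) (Ico 0 T) t)
    (hR : tpair (h x) R (S t x) ≤ fnorm (h x) (fun p => cd h p (S t) x) ^ 2
      + C * tnorm (h x) (S t x) ^ 2) :
    ∃ u', HasDerivWithinAt (fun s => tpair (h x) (S s x) (S s x)) u' (Ico 0 T) t ∧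
      u' ≤ slap h (fun z => tpair (h z) (S t z) (S t z)) x
        + 2 * C * tpair (h x) (S t x) (S t x) := by
  have hk := H.posDef x hx
  refine ⟨_, hd.tpair (h x) hd, ?_⟩
  rw [slap_tpair_self H (hS.slice ht) hx, tpair_comm hk (S t x), tpair_add_left]
  rw [fnorm_sq hk, tnorm_sq hk] at hR
  linarith

lemma mul_le_sq_add {a d y s : ℝ} : 2 * (a * (d * y) * s) ≤ y ^ 2 + (a * d) ^ 2 * s ^ 2 := by
  nlinarith [sq_nonneg (y - a * d * s)]

namespace FlowOn

variable (F : FlowOn h Ω T A)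
include F

lemma smooth_sq_add_one : MatTimeSmooth T Ω fun s z => A s z * A s z + 1 :=
  (F.smooth.mul F.smooth).add (matTimeSmooth_of_matSmoothOn (matSmoothOn_const 1))

/-- With `Q = g^{pq} ∇_p J ∇_q J`, the defect `S = J² + 1` satisfies the equation
`∂_t S = ΔS - Q S - S Q - J [Q, J]`. This is homogeneous and linear in `S`, because the commutator
`[Q, J]` is a contraction of `∇J` with `∇S`; hence `|S|²` is a subsolution of a linear heat
equation. -/
lemma sq_add_one_evolution (hx : x ∈ Ω) (ht : t ∈ Ico 0 T) :
    ∃ u', HasDerivWithinAt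
      (fun s => tpair (h x) (A s x * A s x + 1) (A s x * A s x + 1)) u' (Ico 0 T) t ∧
      u' ≤ slap h (fun z => tpair (h z) (A t z * A t z + 1) (A t z * A t z + 1)) x
        + 2 * (2 * fnorm (h x) (fun p => cd h p (A t) x) ^ 2
          + (tnorm (h x) (A t x) * fnorm (h x) (fun p => cd h p (A t) x)) ^ 2)
          * tpair (h x) (A t x * A t x + 1) (A t x * A t x + 1) := by
  have H := F.metric
  have hk := H.posDef x hx
  have hAs := F.smooth.slice ht
  have hone : MatSmoothOn (fun _ : Eu n => (1 : Mat n)) Ω := matSmoothOn_const 1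
  have dA := hAs.matDiffAt H.isOpen hx
  set D : Fin n → Mat n := fun p => cd h p (A t) x with hD
  set B := A t x with hB
  set S := B * B + 1 with hS
  set Q := gradSq h (A t) x with hQ
  have hDS : ∀ p, cd h p (fun z => A t z * A t z + 1) x = D p * B + B * D p := by
    intro p
    rw [cd_add p (dA.mul dA) (hone.matDiffAt H.isOpen hx), cd_one, cd_mul p dA dA, add_zero]
  set V := (mcontr (h x) fun p q => D q * (D p * B + B * D p))
    - mcontr (h x) fun p q => (D q * B + B * D q) * D p with hV
  -- the commutator `[Q, J]` in terms of `∇S`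
  have hVe : V = Q * B - B * Q := by
    have h1 := mcontr_swap (H.inv_symm x) fun p q => D p * D q
    rw [hV, ← mcontr_sub, show (fun p q => D q * (D p * B + B * D p) - (D q * B + B * D q) * D p)
      = fun p q => D q * D p * B - B * (D q * D p) from by funext p q; noncomm_ring, mcontr_sub,
      mcontr_mul_left, mcontr_mul_right, h1]
    rfl
  have hder : HasMatDeriv (fun s => A s x * A s x + 1)
      (lap h (fun z => A t z * A t z + 1) x + (-(Q * S) - S * Q - B * V)) (Ico 0 T) t := by
    have h1 := ((F.flow x hx t ht).mul (F.flow x hx t ht)).add (hasMatDeriv_const (s := Ico 0 T)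
      (t := t) (1 : Mat n))
    have h2 : lap h (fun z => A t z * A t z + 1) x
        = lap h (A t) x * B + B * lap h (A t) x + (2 : ℝ) • Q := by
      rw [lap_add H (hAs.mul hAs) hone hx, lap_one, add_zero, lap_mul H hAs hAs hx]
      rfl
    have h3 : (lap h (A t) x - Q * B) * B + B * (lap h (A t) x - Q * B) + 0
        = lap h (fun z => A t z * A t z + 1) x + (-(Q * S) - S * Q - B * V) := by
      rw [h2, hVe, hS, two_smul]
      noncomm_ring
    rw [← h3]
    exact h1
  refine exists_deriv_tpair_le H F.smooth_sq_add_one hx ht hder ?_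
  simp only [hDS]
  set DS : Fin n → Mat n := fun p => D p * B + B * D p with hDSd
  have hQn : tnorm (h x) Q ≤ fnorm (h x) D ^ 2 := by
    rw [sq]
    exact tnorm_mcontr_le hk D D
  have nS := tnorm_nonneg (k := h x) S
  have b1 : tpair (h x) (-(Q * S)) S ≤ fnorm (h x) D ^ 2 * tnorm (h x) S ^ 2 := by
    rw [tpair_neg_left]
    have := (abs_le.1 (abs_tpair_le hk (Q * S) S)).1
    have h2 := mul_le_mul_of_nonneg_right (tnorm_mul_le hk Q S) nS
    have h3 := mul_le_mul_of_nonneg_right hQn (sq_nonneg (tnorm (h x) S))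
    nlinarith
  have b2 : tpair (h x) (S * Q) S ≥ -(fnorm (h x) D ^ 2 * tnorm (h x) S ^ 2) := by
    have := (abs_le.1 (abs_tpair_le hk (S * Q) S)).1
    have h2 := mul_le_mul_of_nonneg_right (tnorm_mul_le hk S Q) nS
    have h3 := mul_le_mul_of_nonneg_right hQn (sq_nonneg (tnorm (h x) S))
    nlinarith
  have b3 : tpair (h x) (B * V) S
      ≥ -(2 * (tnorm (h x) B * (fnorm (h x) D * fnorm (h x) DS) * tnorm (h x) S)) := by
    have e1 := mcontr_swap (H.inv_symm x) fun p q => D p * DS q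
    have e2 := mcontr_swap (H.inv_symm x) fun p q => DS p * D q
    have hV' : V = (mcontr (h x) fun p q => D p * DS q) - mcontr (h x) fun p q => DS p * D q := by
      rw [← e1, ← e2]
    have c1 := tnorm_mcontr_le hk D DS
    have c2 := tnorm_mcontr_le hk DS D
    have nB := tnorm_nonneg (k := h x) B
    rw [hV', Matrix.mul_sub, tpair_sub_left]
    have d1 := (abs_le.1 (abs_tpair_le hk (B * mcontr (h x) fun p q => D p * DS q) S)).1
    have d2 := (abs_le.1 (abs_tpair_le hk (B * mcontr (h x) fun p q => DS p * D q) S)).2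
    have f1 := mul_le_mul_of_nonneg_right ((tnorm_mul_le hk B _).trans
      (mul_le_mul_of_nonneg_left c1 nB)) nS
    have f2 := mul_le_mul_of_nonneg_right ((tnorm_mul_le hk B _).trans
      (mul_le_mul_of_nonneg_left c2 nB)) nS
    nlinarith
  have b4 := mul_le_sq_add (a := tnorm (h x) B) (d := fnorm (h x) D) (y := fnorm (h x) DS)
    (s := tnorm (h x) S)
  rw [tpair_sub_left, tpair_sub_left]
  linarith

lemma smooth_add_adj : MatTimeSmooth T Ω fun s z => A s z + adj h (A s) z :=
  F.smooth.add (((matTimeSmooth_of_matSmoothOn F.metric.inv_smooth).mul F.smooth.transpose).mul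
    (matTimeSmooth_of_matSmoothOn F.metric.smooth))

end FlowOn

lemma madj_mul {k : Mat n} (hk : IsUnit k.det) (X Y : Mat n) :
    madj k (X * Y) = madj k Y * madj k X := by
  simp only [madj, Matrix.transpose_mul, Matrix.mul_assoc, Matrix.mul_nonsing_inv_cancel_left _ _ hk]

lemma madj_sub (k X Y : Mat n) : madj k (X - Y) = madj k X - madj k Y := by
  simp only [madj, Matrix.transpose_sub, Matrix.mul_sub, Matrix.sub_mul]

lemma madj_neg (k X : Mat n) : madj k (-X) = -madj k X := by
  simp only [madj, Matrix.transpose_neg, Matrix.mul_neg, Matrix.neg_mul]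

lemma tnorm_madj {k : Mat n} (hk : k.PosDef) (hs : k.transpose = k) (X : Mat n) :
    tnorm k (madj k X) = tnorm k X := by
  have hu : IsUnit k.det := isUnit_iff_ne_zero.2 hk.det_pos.ne'
  have h2 : madj k (madj k X) = X := by
    simp only [madj, Matrix.transpose_mul, Matrix.transpose_nonsing_inv, hs, Matrix.transpose_transpose,
      Matrix.mul_assoc, Matrix.nonsing_inv_mul _ hu, Matrix.mul_one,
      Matrix.nonsing_inv_mul_cancel_left _ _ hu]
  rw [tnorm, tnorm, tpair_eq_trace, tpair_eq_trace, h2, Matrix.trace_mul_comm]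

lemma fnorm_madj {k : Mat n} (hk : k.PosDef) (hs : k.transpose = k) (D : Fin n → Mat n) :
    fnorm k (fun p => madj k (D p)) = fnorm k D := by
  obtain ⟨R, -, h1, -⟩ := exists_frame hk
  rw [fnorm, fnorm, fpair_frame h1, fpair_frame h1]
  congr 1
  refine Finset.sum_congr rfl fun c _ => ?_
  have e : frameForm R (fun p => madj k (D p)) c = madj k (frameForm R D c) := by
    simp only [frameForm, madj, Matrix.transpose_sum, Matrix.transpose_smul, Finset.mul_sum,
      Finset.sum_mul, Matrix.mul_smul, Matrix.smul_mul]
  rw [e, ← tnorm_sq hk, ← tnorm_sq hk, tnorm_madj hk hs]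

lemma HasMatDeriv.madj (k : Mat n) {B : ℝ → Mat n} {B' : Mat n} {s : Set ℝ}
    (hB : HasMatDeriv B B' s t) : HasMatDeriv (fun r => madj k (B r)) (madj k B') s t := by
  have := ((hasMatDeriv_const (s := s) (t := t) k⁻¹).mul hB.transpose).mul
    (hasMatDeriv_const (s := s) (t := t) k)
  simpa [Coord.madj] using this

namespace FlowOn

variable (F : FlowOn h Ω T A)
include F

/-- On solutions with `J² = -1` the defect `W = J + J^*` satisfies the equation
`∂_t W = ΔW - Q W + (Q - Q^*) J^*`, where `Q = g^{pq} ∇_p J ∇_q J`, and `Q - Q^*` is linear in `∇W`;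
hence `|W|²` is a subsolution of a linear heat equation. -/
lemma add_adj_evolution (hx : x ∈ Ω) (ht : t ∈ Ico 0 T) (hsq : ∀ z ∈ Ω, A t z * A t z = -1) :
    ∃ u', HasDerivWithinAt
      (fun s => tpair (h x) (A s x + adj h (A s) x) (A s x + adj h (A s) x)) u' (Ico 0 T) t ∧
      u' ≤ slap h (fun z => tpair (h z) (A t z + adj h (A t) z) (A t z + adj h (A t) z)) x
        + 2 * (2 * fnorm (h x) (fun p => cd h p (A t) x) ^ 2
          + (tnorm (h x) (A t x) * fnorm (h x) (fun p => cd h p (A t) x)) ^ 2)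
          * tpair (h x) (A t x + adj h (A t) x) (A t x + adj h (A t) x) := by
  have H := F.metric
  have hk := H.posDef x hx
  have hu : IsUnit (h x).det := isUnit_iff_ne_zero.2 hk.det_pos.ne'
  have hAs := F.smooth.slice ht
  have hadj := adj_smooth H hAs
  have dA := hAs.matDiffAt H.isOpen hx
  have da := hadj.matDiffAt H.isOpen hx
  set D : Fin n → Mat n := fun p => cd h p (A t) x with hD
  set B := A t x with hB
  set Bs := adj h (A t) x with hBs
  set Ds : Fin n → Mat n := fun p => madj (h x) (D p) with hDs
  have hcd : ∀ p, cd h p (adj h (A t)) x = Ds p := fun p => cd_adj H hAs hx p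
  set W := B + Bs with hW
  set Q := gradSq h (A t) x with hQ
  have hDW : ∀ p, cd h p (fun z => A t z + adj h (A t) z) x = D p + Ds p := by
    intro p
    rw [cd_add p dA da, hcd]
  set DW : Fin n → Mat n := fun p => D p + Ds p with hDWd
  set Qs := mcontr (h x) fun p q => Ds p * Ds q with hQs
  have hQs' : madj (h x) Q = Qs := by
    rw [hQ, gradSq, madj_mcontr, ← mcontr_swap (H.inv_symm x)]
    simp only [madj_mul hu]
    rfl
  -- `J^*` anticommutes with its covariant derivatives, since `(J^*)² = -1`
  have hanti : ∀ p, Ds p * Bs = -(Bs * Ds p) := by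
    intro p
    have h1 : cd h p (fun z => A t z * A t z) x = 0 := by
      rw [cd_congr p (B := fun z => -(fun _ => (1 : Mat n)) z)
        (Filter.eventually_of_mem (H.isOpen.mem_nhds hx) fun z hz => hsq z hz), cd_neg, cd_one, neg_zero]
    rw [cd_mul p dA dA] at h1
    have h2 : D p * B = -(B * D p) := eq_neg_of_add_eq_zero_left h1
    have h3 := congrArg (madj (h x)) h2
    rw [madj_neg, madj_mul hu, madj_mul hu] at h3
    rw [eq_neg_iff_add_eq_zero, ← neg_eq_zero, neg_add_rev]
    change -(madj (h x) B * Ds p) + -(Ds p * madj (h x) B) = 0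
    rw [show madj (h x) B * Ds p = -(Ds p * madj (h x) B) from h3]
    abel
  have hcomm : Bs * Qs = Qs * Bs := by
    rw [hQs, ← mcontr_mul_left, ← mcontr_mul_right]
    congr 1
    funext p q
    rw [Matrix.mul_assoc (Ds p), hanti q, Matrix.mul_neg, ← Matrix.mul_assoc (Ds p), hanti p,
      Matrix.neg_mul, neg_neg, Matrix.mul_assoc]
  set V := (mcontr (h x) fun p q => D q * DW p) - mcontr (h x) fun p q => DW q * Ds p with hV
  -- the antisymmetric part of `Q` in terms of `∇W`
  have hVe : V = Q - Qs := by
    have h1 := mcontr_swap (H.inv_symm x) fun p q => D p * D q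
    have h2 := mcontr_swap (H.inv_symm x) fun p q => Ds p * Ds q
    rw [hV, ← mcontr_sub, show (fun p q => D q * DW p - DW q * Ds p)
      = fun p q => D q * D p - Ds q * Ds p from by funext p q; simp only [hDWd]; noncomm_ring,
      mcontr_sub, h1, h2]
    rfl
  have hder : HasMatDeriv (fun s => A s x + adj h (A s) x)
      (lap h (fun z => A t z + adj h (A t) z) x + (V * Bs - Q * W)) (Ico 0 T) t := by
    have h1 := (F.flow x hx t ht).add ((F.flow x hx t ht).madj (h x))
    have h2 : lap h (fun z => A t z + adj h (A t) z) x
        = lap h (A t) x + madj (h x) (lap h (A t) x) := by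
      rw [lap_add H hAs hadj hx, lap_adj H hAs hx]
    have h3 : lap h (A t) x - Q * B + madj (h x) (lap h (A t) x - Q * B)
        = lap h (fun z => A t z + adj h (A t) z) x + (V * Bs - Q * W) := by
      rw [h2, hVe, hW, madj_sub, madj_mul hu, hQs', show madj (h x) B = Bs from rfl, hcomm]
      noncomm_ring
    rw [← h3]
    exact h1
  refine exists_deriv_tpair_le H F.smooth_add_adj hx ht hder ?_
  simp only [hDW]
  have hQn : tnorm (h x) Q ≤ fnorm (h x) D ^ 2 := by
    rw [sq]
    exact tnorm_mcontr_le hk D D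
  have hfs : fnorm (h x) Ds = fnorm (h x) D := fnorm_madj hk (H.transpose_eq x) D
  have hts : tnorm (h x) Bs = tnorm (h x) B := tnorm_madj hk (H.transpose_eq x) B
  have nW := tnorm_nonneg (k := h x) W
  have b1 : tpair (h x) (Q * W) W ≥ -(fnorm (h x) D ^ 2 * tnorm (h x) W ^ 2) := by
    have := (abs_le.1 (abs_tpair_le hk (Q * W) W)).1
    have h2 := mul_le_mul_of_nonneg_right (tnorm_mul_le hk Q W) nW
    have h3 := mul_le_mul_of_nonneg_right hQn (sq_nonneg (tnorm (h x) W))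
    nlinarith
  have b3 : tpair (h x) (V * Bs) W
      ≤ 2 * (tnorm (h x) B * (fnorm (h x) D * fnorm (h x) DW) * tnorm (h x) W) := by
    have e1 := mcontr_swap (H.inv_symm x) fun p q => D p * DW q
    have e2 := mcontr_swap (H.inv_symm x) fun p q => DW p * Ds q
    have hV' : V = (mcontr (h x) fun p q => D p * DW q) - mcontr (h x) fun p q => DW p * Ds q := by
      rw [← e1, ← e2]
    have c1 := tnorm_mcontr_le hk D DW
    have c2 := tnorm_mcontr_le hk DW Ds
    rw [hfs] at c2
    have nB := tnorm_nonneg (k := h x) B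
    rw [hV', Matrix.sub_mul, tpair_sub_left]
    have d1 := (abs_le.1 (abs_tpair_le hk ((mcontr (h x) fun p q => D p * DW q) * Bs) W)).2
    have d2 := (abs_le.1 (abs_tpair_le hk ((mcontr (h x) fun p q => DW p * Ds q) * Bs) W)).1
    have f1 := mul_le_mul_of_nonneg_right ((tnorm_mul_le hk _ Bs).trans
      (mul_le_mul_of_nonneg_right c1 (tnorm_nonneg Bs))) nW
    have f2 := mul_le_mul_of_nonneg_right ((tnorm_mul_le hk _ Bs).trans
      (mul_le_mul_of_nonneg_right c2 (tnorm_nonneg Bs))) nW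
    rw [hts] at f1 f2
    nlinarith
  have b4 := mul_le_sq_add (a := tnorm (h x) B) (d := fnorm (h x) D) (y := fnorm (h x) DW)
    (s := tnorm (h x) W)
  have b5 : 0 ≤ fnorm (h x) D ^ 2 * tnorm (h x) W ^ 2 := by positivity
  rw [tpair_sub_left]
  linarith

end FlowOn

end Evolution

section SecondDerivativeTest

variable {n : ℕ} {h : Eu n → Mat n} {Ω : Set (Eu n)} {x : Eu n}

/-- The Hessian is nonpositive at a local maximum. -/
lemma hessian_nonpos {f : Eu n → ℝ} (hΩ : IsOpen Ω) (hf : ContDiffOn ℝ ∞ f Ω) (hx : x ∈ Ω)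
    (hmax : IsLocalMax f x) (v : Eu n) :
    ∑ p, ∑ q, v p * v q * partialDeriv p (partialDeriv q f) x ≤ 0 := by
  set g : ℝ → ℝ := fun s => f (x + s • v) with hg
  have hline : ∀ s : ℝ, HasDerivAt (fun r : ℝ => x + r • v) v s := fun s => by
    simpa using ((hasDerivAt_id s).smul_const v).const_add x
  have hcont : Continuous fun r : ℝ => x + r • v := by fun_prop
  have hev : ∀ᶠ s in nhds (0 : ℝ), x + s • v ∈ Ω :=
    hcont.continuousAt.preimage_mem_nhds (by simpa using hΩ.mem_nhds hx)
  have hder : ∀ f : Eu n → ℝ, ContDiffOn ℝ ∞ f Ω → ∀ s : ℝ, x + s • v ∈ Ω →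
      HasDerivAt (fun r : ℝ => f (x + r • v)) (∑ p, v p * partialDeriv p f (x + s • v)) s := by
    intro f hf s hs
    have h1 := ((hf.contDiffAt (hΩ.mem_nhds hs)).differentiableAt (by simp)).hasFDerivAt
    have h2 := h1.comp_hasDerivAt s (hline s)
    rwa [fderiv_eq_sum_partialDeriv] at h2
  have hd1 : deriv g =ᶠ[nhds 0] fun s => ∑ p, v p * partialDeriv p f (x + s • v) :=
    hev.mono fun s hs => (hder f hf s hs).deriv
  have hd2 : HasDerivAt (fun s : ℝ => ∑ p, v p * partialDeriv p f (x + s • v))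
      (∑ q, v q * ∑ p, v p * partialDeriv p (partialDeriv q f) (x + (0 : ℝ) • v)) 0 :=
    HasDerivAt.fun_sum fun q _ => (hder _ (contDiffOn_partialDeriv hΩ hf q) 0
      (by simpa using hx)).const_mul (v q)
  have hval : deriv (deriv g) 0 = ∑ p, ∑ q, v p * v q * partialDeriv p (partialDeriv q f) x := by
    rw [hd1.deriv_eq, hd2.deriv, Finset.sum_comm]
    simp only [zero_smul, add_zero, Finset.mul_sum]
    exact Finset.sum_congr rfl fun q _ => Finset.sum_congr rfl fun p _ => by ring
  rw [← hval]
  -- otherwise `g` would have a strict local minimum at its local maximum, and so be constant nearby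
  by_contra! hpos
  have hgmax : IsLocalMax g 0 := by
    have : Filter.Tendsto (fun r : ℝ => x + r • v) (nhds 0) (nhds x) := by
      simpa using hcont.tendsto 0
    have h3 := this.eventually hmax
    simpa [IsLocalMax, IsMaxFilter, hg] using h3
  have hg0 : deriv g 0 = 0 := hgmax.deriv_eq_zero
  have hgc : ContinuousAt g 0 := (hder f hf 0 (by simpa using hx)).continuousAt
  have hgmin := isLocalMin_of_deriv_deriv_pos hpos hg0 hgc
  have hconst : g =ᶠ[nhds 0] fun _ => g 0 := by
    filter_upwards [hgmax, hgmin] with s h1 h2 using le_antisymm h1 h2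
  have : deriv (deriv g) 0 = 0 := by
    have h4 : deriv g =ᶠ[nhds 0] deriv fun _ => g 0 := hconst.deriv
    rw [h4.deriv_eq]
    simp
  exact hpos.ne' this

lemma slap_nonpos_of_isLocalMax {f : Eu n → ℝ} (H : IsMetricOn h Ω) (hf : ContDiffOn ℝ ∞ f Ω)
    (hx : x ∈ Ω) (hmax : IsLocalMax f x) : slap h f x ≤ 0 := by
  obtain ⟨R, -, h1, -⟩ := exists_frame (H.posDef x hx)
  have e : ∀ l, partialDeriv l f x = 0 := fun l => by
    rw [partialDeriv, hmax.fderiv_eq_zero]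
    rfl
  simp only [slap, e, mul_zero, Finset.sum_const_zero, sub_zero]
  rw [contr_frame h1]
  exact Finset.sum_nonpos fun c _ => hessian_nonpos H.isOpen hf hx hmax (WithLp.toLp 2 fun p => R p c)

end SecondDerivativeTest

end Coord

/-! ### The maximum principle and preservation of the almost complex structure -/

namespace Coord

lemma similar_madj {n : ℕ} {L k k' A A' : Mat n} (hL : IsUnit L.det) (hk : k = L.transpose * k' * L)
    (hA : Similar L A A') : Similar L (madj k A) (madj k' A') := by
  have e1 : ∀ M : Mat n, L * (L⁻¹ * M) = M := fun M => Matrix.mul_nonsing_inv_cancel_left L M hL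
  have e2 : L⁻¹.transpose * L.transpose = 1 := by
    rw [← Matrix.transpose_mul, Matrix.mul_nonsing_inv _ hL, Matrix.transpose_one]
  have e3 : ∀ M : Mat n, L⁻¹.transpose * (L.transpose * M) = M := fun M => by
    rw [← Matrix.mul_assoc, e2, Matrix.one_mul]
  rw [Similar, madj, madj, inv_congr hk, hA.eq hL, hk]
  simp only [Matrix.transpose_mul, Matrix.mul_assoc, e1, e3]

end Coord

section MaximumPrinciple

open Coord

variable {n : ℕ} {M : Type*} [TopologicalSpace M] [ChartedSpace (EuclideanSpace ℝ (Fin n)) M]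
  [IsManifold (𝓡 n) ∞ M] {g : RiemMetric n M} {T : ℝ}

/-- A time-dependent scalar on the manifold, given in all charts and smooth up to the initial
time. -/
structure TimeScalar (T : ℝ) (u : OpenPartialHomeomorph M (EuclideanSpace ℝ (Fin n)) → ℝ → Eu n → ℝ) :
    Prop where
  invariant : ∀ t ∈ Ico 0 T, ChartInvariant fun e => u e t
  smooth : ∀ e ∈ IsManifold.maximalAtlas (𝓡 n) ∞ M, TimeSmooth T e.target (u e)

variable {u : OpenPartialHomeomorph M (EuclideanSpace ℝ (Fin n)) → ℝ → Eu n → ℝ}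

lemma TimeScalar.continuousOn_glue (hu : TimeScalar T u) :
    ContinuousOn (fun z : M × ℝ => chartGlue (fun e => u e z.2) z.1) (univ ×ˢ Ico 0 T) := by
  rintro ⟨q, t⟩ ⟨-, ht⟩
  have he := IsManifold.chart_mem_maximalAtlas (I := 𝓡 n) (n := ∞) q
  set e := chartAt (EuclideanSpace ℝ (Fin n)) q
  have hq : q ∈ e.source := mem_chart_source _ q
  have h1 : ContinuousWithinAt (fun z : M × ℝ => u e z.2 (e z.1)) (e.source ×ˢ Ico 0 T) (q, t) := by
    refine ContinuousWithinAt.comp (g := fun z : Eu n × ℝ => u e z.2 z.1) (f := fun z : M × ℝ => (e z.1, z.2))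
      ((hu.smooth e he).continuousOn (e q, t) ⟨e.map_source hq, ht⟩) ?_
      fun z hz => ⟨e.map_source hz.1, hz.2⟩
    exact ((e.continuousAt hq).comp continuousAt_fst).continuousWithinAt.prodMk
      continuousWithinAt_snd
  have h2 : ContinuousWithinAt (fun z : M × ℝ => chartGlue (fun e => u e z.2) z.1)
      (e.source ×ˢ Ico 0 T) (q, t) :=
    h1.congr (fun z hz => (hu.invariant z.2 hz.2).glue_eq he hz.1)
      ((hu.invariant t ht).glue_eq he hq)
  have h3 : (univ : Set M) ×ˢ Ico 0 T ∩ (e.source ×ˢ univ) ⊆ e.source ×ˢ Ico 0 T :=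
    fun z hz => ⟨hz.2.1, hz.1.2⟩
  exact (continuousWithinAt_inter ((e.open_source.prod isOpen_univ).mem_nhds ⟨hq, mem_univ _⟩)).1
    (h2.mono h3)

lemma TimeScalar.exists_bound [CompactSpace M] (hu : TimeScalar T u) {b : ℝ} (hb : b < T) :
    ∃ C : ℝ, 0 ≤ C ∧ ∀ e ∈ IsManifold.maximalAtlas (𝓡 n) ∞ M, ∀ t ∈ Icc 0 b, ∀ x ∈ e.target,
      u e t x ≤ C := by
  have hsub : (univ : Set M) ×ˢ Icc 0 b ⊆ univ ×ˢ Ico 0 T :=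
    prod_mono subset_rfl fun s hs => ⟨hs.1, hs.2.trans_lt hb⟩
  obtain ⟨C, hC⟩ := ((isCompact_univ (X := M)).prod (isCompact_Icc (a := (0 : ℝ)) (b := b))).bddAbove_image
    (hu.continuousOn_glue.mono hsub)
  refine ⟨|C|, abs_nonneg _, fun e he t ht x hx => ?_⟩
  rw [← (hu.invariant t ⟨ht.1, ht.2.trans_lt hb⟩).glue_symm he hx]
  exact (hC ⟨(e.symm x, t), ⟨mem_univ _, ht⟩, rfl⟩).trans (le_abs_self C)

/-- The parabolic maximum principle: a subsolution of a linear heat equation on a compact manifold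
which is nonpositive initially stays nonpositive. -/
lemma TimeScalar.nonpos [CompactSpace M] (g : RiemMetric n M) (hu : TimeScalar T u)
    (h0 : ∀ e ∈ IsManifold.maximalAtlas (𝓡 n) ∞ M, ∀ x ∈ e.target, u e 0 x ≤ 0) {b C : ℝ} (hb : b < T)
    (hle : ∀ e ∈ IsManifold.maximalAtlas (𝓡 n) ∞ M, ∀ x ∈ e.target, ∀ t ∈ Icc 0 b, 0 < u e t x →
      ∃ u', HasDerivWithinAt (fun s => u e s x) u' (Ico 0 T) t ∧
        u' ≤ slap (metricCoord g e) (u e t) x + C * u e t x)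
    {e : OpenPartialHomeomorph M (Eu n)} (he : e ∈ IsManifold.maximalAtlas (𝓡 n) ∞ M) {x : Eu n}
    (hx : x ∈ e.target) {t : ℝ} (ht : t ∈ Icc 0 b) : u e t x ≤ 0 := by
  by_contra! hpos
  have hT : ∀ s ∈ Icc 0 b, s ∈ Ico 0 T := fun s hs => ⟨hs.1, hs.2.trans_lt hb⟩
  set v : M × ℝ → ℝ := fun z => Real.exp (-(C + 1) * z.2) * chartGlue (fun e => u e z.2) z.1 with hv
  have hvc : ContinuousOn v (univ ×ˢ Icc 0 b) :=
    ContinuousOn.mul (by fun_prop) (hu.continuousOn_glue.mono (prod_mono subset_rfl hT))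
  -- a positive maximum in space-time of `exp (-(C + 1) t) u`, whose equation has a strict sign
  obtain ⟨⟨q, t₀⟩, ⟨-, ht₀⟩, hmax⟩ := ((isCompact_univ (X := M)).prod
    (isCompact_Icc (a := (0 : ℝ)) (b := b))).exists_isMaxOn ⟨(e.symm x, t), mem_univ _, ht⟩ hvc
  replace ht₀ : t₀ ∈ Icc 0 b := ht₀
  have hvpos : 0 < v (q, t₀) := by
    refine lt_of_lt_of_le ?_ (hmax (show (e.symm x, t) ∈ _ from ⟨mem_univ _, ht⟩))
    simp only [hv, (hu.invariant t (hT t ht)).glue_symm he hx]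
    positivity
  have he' := IsManifold.chart_mem_maximalAtlas (I := 𝓡 n) (n := ∞) q
  set e' := chartAt (EuclideanSpace ℝ (Fin n)) q
  have hq : q ∈ e'.source := mem_chart_source _ q
  set y := e' q with hy
  have hyt : y ∈ e'.target := e'.map_source hq
  have hvu : ∀ s ∈ Icc 0 b, ∀ z ∈ e'.target, v (e'.symm z, s) = Real.exp (-(C + 1) * s) * u e' s z :=
    fun s hs z hz => by simp only [hv, (hu.invariant s (hT s hs)).glue_symm he' hz]
  have hqy : e'.symm y = q := e'.left_inv hq
  have hupos : 0 < u e' t₀ y := by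
    have := hvu t₀ ht₀ y hyt
    rw [hqy] at this
    rw [this] at hvpos
    exact (mul_pos_iff_of_pos_left (Real.exp_pos _)).1 hvpos
  have hcmp : ∀ s ∈ Icc 0 b, ∀ z ∈ e'.target, Real.exp (-(C + 1) * s) * u e' s z
      ≤ Real.exp (-(C + 1) * t₀) * u e' t₀ y := by
    intro s hs z hz
    rw [← hvu s hs z hz, ← hvu t₀ ht₀ y hyt, hqy]
    exact hmax (show (e'.symm z, s) ∈ _ from ⟨mem_univ _, hs⟩)
  -- in space, `u` has a local maximum
  have hslap : slap (metricCoord g e') (u e' t₀) y ≤ 0 := by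
    refine slap_nonpos_of_isLocalMax (isMetricOn_metricCoord he')
      ((hu.smooth e' he').slice (hT t₀ ht₀)) hyt ?_
    filter_upwards [e'.open_target.mem_nhds hyt] with z hz
    exact le_of_mul_le_mul_left (hcmp t₀ ht₀ z hz) (Real.exp_pos _)
  have ht₀pos : 0 < t₀ := by
    rcases ht₀.1.eq_or_lt with h | h
    · rw [← h] at hupos
      exact absurd (h0 e' he' y hyt) (not_le.2 hupos)
    · exact h
  obtain ⟨u', hu', hule⟩ := hle e' he' y hyt t₀ ht₀ hupos
  -- in time, `exp (-(C + 1) t) u` is maximal at the right end point of `[0, t₀]`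
  have hsubT : Icc 0 t₀ ⊆ Ico 0 T := fun s hs => hT s ⟨hs.1, hs.2.trans ht₀.2⟩
  have hd : HasDerivWithinAt (fun s => Real.exp (-(C + 1) * s) * u e' s y)
      (Real.exp (-(C + 1) * t₀) * (-(C + 1)) * u e' t₀ y + Real.exp (-(C + 1) * t₀) * u')
      (Icc 0 t₀) t₀ := by
    have h1 : HasDerivAt (fun s : ℝ => Real.exp (-(C + 1) * s)) (Real.exp (-(C + 1) * t₀) * (-(C + 1))) t₀ := by
      simpa using ((hasDerivAt_id t₀).const_mul (-(C + 1))).exp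
    exact h1.hasDerivWithinAt.fun_mul (hu'.mono hsubT)
  have hlm : IsLocalMaxOn (fun s => Real.exp (-(C + 1) * s) * u e' s y) (Icc 0 t₀) t₀ :=
    Filter.eventually_of_mem self_mem_nhdsWithin fun s hs => hcmp s ⟨hs.1, hs.2.trans ht₀.2⟩ y hyt
  have hcone : (0 : ℝ) - t₀ ∈ posTangentConeAt (Icc 0 t₀) t₀ :=
    sub_mem_posTangentConeAt_of_segment_subset (by
      rw [segment_symm, segment_eq_Icc ht₀.1])
  have h5 := hlm.hasFDerivWithinAt_nonpos hd.hasFDerivWithinAt hcone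
  simp only [ContinuousLinearMap.toSpanSingleton_apply, zero_sub, smul_eq_mul] at h5
  have h6 : 0 ≤ Real.exp (-(C + 1) * t₀) * (u' - (C + 1) * u e' t₀ y) := by nlinarith
  have h7 := (mul_nonneg_iff_of_pos_left (Real.exp_pos _)).1 h6
  linarith

end MaximumPrinciple

section Constraint

open Coord

variable {n : ℕ} {M : Type*} [TopologicalSpace M] [ChartedSpace (EuclideanSpace ℝ (Fin n)) M]
  [IsManifold (𝓡 n) ∞ M] {g : RiemMetric n M} {T : ℝ} {J : ℝ → EndoField n M}
  {e e' : OpenPartialHomeomorph M (EuclideanSpace ℝ (Fin n))}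

lemma IsHarmonicHeatFlow.flowOn (hJ : IsHarmonicHeatFlow g T J)
    (he : e ∈ IsManifold.maximalAtlas (𝓡 n) ∞ M) :
    FlowOn (metricCoord g e) e.target T fun t => endoCoord (J t) e where
  metric := isMetricOn_metricCoord he
  smooth := hJ.smooth e he
  flow := fun x hx t ht k j => by
    have := hJ.flow e he x hx t ht k j
    rwa [roughLaplacian_eq, cubicTerm_eq (isMetricOn_metricCoord (g := g) he)] at this

namespace IsHarmonicHeatFlow

variable (hJ : IsHarmonicHeatFlow g T J)
include hJ

lemma similarForm_cd (he : e ∈ IsManifold.maximalAtlas (𝓡 n) ∞ M)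
    (he' : e' ∈ IsManifold.maximalAtlas (𝓡 n) ∞ M) {t : ℝ} (ht : t ∈ Ico 0 T) {x : Eu n}
    (hx : x ∈ chartTransDom e e') :
    SimilarForm (jac (chartTrans e e') x) (fun p => cd (metricCoord g e) p (endoCoord (J t) e) x)
      (fun p => cd (metricCoord g e') p (endoCoord (J t) e') (chartTrans e e' x)) := by
  have Ψ := coordChange_trans (g := g) he he'
  exact Ψ.similarForm_cd hx
    (fun i j => ((hJ.flowOn he).smooth.slice ht i j).mono fun _ h => (mem_chartTransDom.1 h).1)
    ((hJ.flowOn he').smooth.slice ht) fun z hz => similar_endoCoord he he' (J t) hz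

lemma timeScalar_tpair : TimeScalar (M := M) T fun e t x =>
    tpair (metricCoord g e x) (endoCoord (J t) e x) (endoCoord (J t) e x) where
  invariant := fun t ht e he e' he' x hx => by
    have Ψ := coordChange_trans (g := g) he he'
    have hs := similar_endoCoord he he' (J t) hx
    exact tpair_congr (Ψ.isUnit_jac hx) (Ψ.pullback x hx) hs hs
  smooth := fun e he => (hJ.flowOn he).smooth.tpair (isMetricOn_metricCoord he) (hJ.flowOn he).smooth

lemma timeScalar_fpair : TimeScalar (M := M) T fun e t x =>
    fpair (metricCoord g e x) (fun p => cd (metricCoord g e) p (endoCoord (J t) e) x)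
      (fun p => cd (metricCoord g e) p (endoCoord (J t) e) x) where
  invariant := fun t ht e he e' he' x hx => by
    have Ψ := coordChange_trans (g := g) he he'
    have hs := hJ.similarForm_cd he he' ht hx
    exact fpair_congr (Ψ.isUnit_jac hx) (Ψ.pullback x hx) hs hs
  smooth := fun e he => MatTimeSmooth.fpair (isMetricOn_metricCoord he)
    (fun p => (hJ.flowOn he).smooth.cd (isMetricOn_metricCoord he) p)
    (fun p => (hJ.flowOn he).smooth.cd (isMetricOn_metricCoord he) p)

/-- The coefficients of the evolution equations of the defects are bounded on compact time
intervals. -/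
lemma exists_coeff_bound [CompactSpace M] {b : ℝ} (hb : b < T) :
    ∃ C : ℝ, ∀ e ∈ IsManifold.maximalAtlas (𝓡 n) ∞ M, ∀ t ∈ Icc 0 b, ∀ x ∈ e.target,
      2 * (2 * fnorm (metricCoord g e x) (fun p => cd (metricCoord g e) p (endoCoord (J t) e) x) ^ 2
        + (tnorm (metricCoord g e x) (endoCoord (J t) e x)
          * fnorm (metricCoord g e x) (fun p => cd (metricCoord g e) p (endoCoord (J t) e) x)) ^ 2)
      ≤ C := by
  obtain ⟨a, ha0, ha⟩ := hJ.timeScalar_tpair.exists_bound hb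
  obtain ⟨d, hd0, hd⟩ := hJ.timeScalar_fpair.exists_bound hb
  refine ⟨2 * (2 * d + a * d), fun e he t ht x hx => ?_⟩
  have hk := metricCoord_posDef (g := g) he hx
  rw [mul_pow, fnorm_sq hk, tnorm_sq hk]
  have h1 := ha e he t ht x hx
  have h2 := hd e he t ht x hx
  have h3 := mul_le_mul h1 h2 (fpair_self_nonneg hk _) ha0
  linarith

/-- The flow preserves the condition `J² = -1`. -/
theorem endoCoord_mul_self [CompactSpace M] {t : ℝ} (ht : t ∈ Ico 0 T)
    (he : e ∈ IsManifold.maximalAtlas (𝓡 n) ∞ M) {x : Eu n} (hx : x ∈ e.target) :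
    endoCoord (J t) e x * endoCoord (J t) e x = -1 := by
  obtain ⟨C, hC⟩ := hJ.exists_coeff_bound (b := t) ht.2
  have hu : TimeScalar (M := M) T fun e t x =>
      tpair (metricCoord g e x) (endoCoord (J t) e x * endoCoord (J t) e x + 1)
        (endoCoord (J t) e x * endoCoord (J t) e x + 1) :=
    { invariant := fun t ht e he e' he' x hx => by
        have Ψ := coordChange_trans (g := g) he he'
        have hs := similar_endoCoord he he' (J t) hx
        have hs' := (hs.mul hs).add similar_one
        exact tpair_congr (Ψ.isUnit_jac hx) (Ψ.pullback x hx) hs' hs'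
      smooth := fun e he => (hJ.flowOn he).smooth_sq_add_one.tpair (isMetricOn_metricCoord he)
        (hJ.flowOn he).smooth_sq_add_one }
  have key := hu.nonpos g (b := t) (C := C) (fun e he x hx => by
      simp [_root_.endoCoord_mul_self he hJ.initial hx, tpair]) ht.2
    (fun e he x hx s hs hpos => by
      obtain ⟨u', h1, h2⟩ := (hJ.flowOn he).sq_add_one_evolution hx ⟨hs.1, hs.2.trans_lt ht.2⟩
      exact ⟨u', h1, h2.trans (add_le_add le_rfl
        (mul_le_mul_of_nonneg_right (hC e he s hs x hx) hpos.le))⟩) he hx ⟨ht.1, le_rfl⟩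
  have hk := metricCoord_posDef (g := g) he hx
  exact eq_neg_of_add_eq_zero_left
    (eq_zero_of_tpair_self hk (le_antisymm key (tpair_self_nonneg hk _)))

/-- The flow preserves the skew-symmetry of `J` with respect to `g`. -/
theorem endoCoord_adj [CompactSpace M] {t : ℝ} (ht : t ∈ Ico 0 T)
    (he : e ∈ IsManifold.maximalAtlas (𝓡 n) ∞ M) {x : Eu n} (hx : x ∈ e.target) :
    adj (metricCoord g e) (endoCoord (J t) e) x = -endoCoord (J t) e x := by
  obtain ⟨C, hC⟩ := hJ.exists_coeff_bound (b := t) ht.2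
  have hu : TimeScalar (M := M) T fun e t x =>
      tpair (metricCoord g e x) (endoCoord (J t) e x + adj (metricCoord g e) (endoCoord (J t) e) x)
        (endoCoord (J t) e x + adj (metricCoord g e) (endoCoord (J t) e) x) :=
    { invariant := fun t ht e he e' he' x hx => by
        have Ψ := coordChange_trans (g := g) he he'
        have hs := similar_endoCoord he he' (J t) hx
        have hs' := hs.add (similar_madj (Ψ.isUnit_jac hx) (Ψ.pullback x hx) hs)
        exact tpair_congr (Ψ.isUnit_jac hx) (Ψ.pullback x hx) hs' hs'
      smooth := fun e he => (hJ.flowOn he).smooth_add_adj.tpair (isMetricOn_metricCoord he)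
        (hJ.flowOn he).smooth_add_adj }
  have key := hu.nonpos g (b := t) (C := C) (fun e he x hx => by
      have H := isMetricOn_metricCoord (g := g) he
      have h1 := endoCoord_skew he hJ.initial hx
      have h2 : adj (metricCoord g e) (endoCoord (J 0) e) x = -endoCoord (J 0) e x := by
        rw [adj, Matrix.mul_assoc, eq_neg_of_add_eq_zero_right h1, Matrix.mul_neg,
          ← Matrix.mul_assoc, H.inv_mul hx, Matrix.one_mul]
      simp [h2, tpair]) ht.2
    (fun e he x hx s hs hpos => by
      have hs' : s ∈ Ico 0 T := ⟨hs.1, hs.2.trans_lt ht.2⟩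
      obtain ⟨u', h1, h2⟩ := (hJ.flowOn he).add_adj_evolution hx hs'
        fun z hz => hJ.endoCoord_mul_self hs' he hz
      exact ⟨u', h1, h2.trans (add_le_add le_rfl
        (mul_le_mul_of_nonneg_right (hC e he s hs x hx) hpos.le))⟩) he hx ⟨ht.1, le_rfl⟩
  have hk := metricCoord_posDef (g := g) he hx
  exact eq_neg_of_add_eq_zero_right
    (eq_zero_of_tpair_self hk (le_antisymm key (tpair_self_nonneg hk _)))

end IsHarmonicHeatFlow

end Constraint

/-! ### Integration by parts, and flows of almost complex structures -/

namespace Coord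

section Divergence

variable {n : ℕ} {h : Eu n → Mat n} {Ω K : Set (Eu n)} {A Y : Eu n → Mat n} {x : Eu n}

/-- The density of the Riemannian volume in coordinates. -/
def volDens (h : Eu n → Mat n) (x : Eu n) : ℝ := Real.sqrt (h x).det

lemma volDens_nonneg : 0 ≤ volDens h x := Real.sqrt_nonneg _

lemma volDens_smooth (H : IsMetricOn h Ω) : ContDiffOn ℝ ∞ (volDens h) Ω :=
  H.smooth.det.sqrt H.det_ne_zero

lemma partialDeriv_volDens (H : IsMetricOn h Ω) (hx : x ∈ Ω) (p : Fin n) :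
    partialDeriv p (volDens h) x = volDens h x * (connMat h p x).trace := partialDeriv_sqrt_det H hx p

lemma partialDeriv_tpair (H : IsMetricOn h Ω) (hA : MatSmoothOn A Ω) (hY : MatSmoothOn Y Ω)
    (hx : x ∈ Ω) (p : Fin n) :
    partialDeriv p (fun z => tpair (h z) (A z) (Y z)) x
      = tpair (h x) (cd h p A x) (Y x) + tpair (h x) (A x) (cd h p Y x) := by
  have hs := adj_smooth H hY
  have e1 : (fun z => tpair (h z) (A z) (Y z)) = fun z => (A z * adj h Y z).trace := by
    funext z
    rw [tpair_eq_trace]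
    rfl
  rw [e1, partialDeriv_trace_eq p ((hA.mul hs).matDiffAt H.isOpen hx),
    cd_mul p (hA.matDiffAt H.isOpen hx) (hs.matDiffAt H.isOpen hx), cd_adj H hY hx, Matrix.trace_add,
    tpair_eq_trace, tpair_eq_trace]
  rfl

lemma _root_.ContDiffOn.differentiableAt_of_isOpen {f : Eu n → ℝ} (hf : ContDiffOn ℝ ∞ f Ω)
    (hΩ : IsOpen Ω) (hx : x ∈ Ω) : DifferentiableAt ℝ f x :=
  (hf.contDiffAt (hΩ.mem_nhds hx)).differentiableAt (by simp)

/-- The derivative of the energy density. -/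
lemma partialDeriv_fpair_self (H : IsMetricOn h Ω) {D : Fin n → Eu n → Mat n}
    (hD : ∀ p, MatSmoothOn (D p) Ω) (hx : x ∈ Ω) (l : Fin n) :
    partialDeriv l (fun z => fpair (h z) (fun p => D p z) (fun p => D p z)) x
      = 2 * fpair (h x) (fun p => cd h l (D p) x) (fun p => D p x)
        + ∑ p, ∑ q, pd l (fun z => (h z)⁻¹) x p q * tpair (h x) (D p x) (D q x) := by
  have hk := H.posDef x hx
  have d1 : ∀ p q, DifferentiableAt ℝ (fun z => (h z)⁻¹ p q) x := fun p q =>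
    (H.inv_smooth p q).differentiableAt_of_isOpen H.isOpen hx
  have d2 : ∀ p q, DifferentiableAt ℝ (fun z => tpair (h z) (D p z) (D q z)) x := fun p q =>
    (H.tpair_smooth (hD p) (hD q)).differentiableAt_of_isOpen H.isOpen hx
  have e1 : partialDeriv l (fun z => fpair (h z) (fun p => D p z) (fun p => D p z)) x
      = ∑ p, ∑ q, (pd l (fun z => (h z)⁻¹) x p q * tpair (h x) (D p x) (D q x)
        + (h x)⁻¹ p q * (tpair (h x) (cd h l (D p) x) (D q x)
          + tpair (h x) (D p x) (cd h l (D q) x))) := by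
    simp only [fpair, contr, Matrix.of_apply]
    rw [partialDeriv_sum _ (fun p z => ∑ q, (h z)⁻¹ p q * tpair (h z) (D p z) (D q z)) l
      fun p _ => DifferentiableAt.fun_sum fun q _ => (d1 p q).fun_mul (d2 p q)]
    refine Finset.sum_congr rfl fun p _ => ?_
    rw [partialDeriv_sum _ (fun q z => (h z)⁻¹ p q * tpair (h z) (D p z) (D q z)) l
      fun q _ => (d1 p q).fun_mul (d2 p q)]
    refine Finset.sum_congr rfl fun q _ => ?_
    rw [partialDeriv_mul l (d1 p q) (d2 p q), partialDeriv_tpair H (hD p) (hD q) hx]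
    rfl
  have e2 : ∑ p, ∑ q, (h x)⁻¹ p q * tpair (h x) (D p x) (cd h l (D q) x)
      = fpair (h x) (fun p => cd h l (D p) x) (fun p => D p x) := by
    rw [Finset.sum_comm]
    simp only [fpair, contr, Matrix.of_apply]
    exact Finset.sum_congr rfl fun q _ => Finset.sum_congr rfl fun p _ => by
      rw [H.inv_symm x p q, tpair_comm hk]
  rw [e1]
  simp only [mul_add, Finset.sum_add_distrib, e2]
  simp only [fpair, contr, Matrix.of_apply]
  ring

/-- The divergence of a covector field in terms of partial derivatives. -/
lemma sum_partialDeriv_raise (H : IsMetricOn h Ω) {c : Fin n → Eu n → ℝ}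
    (hc : ∀ q, ContDiffOn ℝ ∞ (c q) Ω) (hx : x ∈ Ω) :
    ∑ p, partialDeriv p (fun z => volDens h z * ∑ q, (h z)⁻¹ p q * c q z) x
      = volDens h x * (∑ p, ∑ q, (h x)⁻¹ p q * partialDeriv p (c q) x
        - ∑ l, tension h x l * c l x) := by
  have dw := (volDens_smooth H).differentiableAt_of_isOpen H.isOpen hx
  have d1 : ∀ p q, DifferentiableAt ℝ (fun z => (h z)⁻¹ p q) x := fun p q =>
    (H.inv_smooth p q).differentiableAt_of_isOpen H.isOpen hx
  have dc : ∀ q, DifferentiableAt ℝ (c q) x := fun q => (hc q).differentiableAt_of_isOpen H.isOpen hx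
  have e1 : ∀ p, partialDeriv p (fun z => volDens h z * ∑ q, (h z)⁻¹ p q * c q z) x
      = volDens h x * ∑ q, ((connMat h p x).trace * (h x)⁻¹ p q * c q x
        + pd p (fun z => (h z)⁻¹) x p q * c q x + (h x)⁻¹ p q * partialDeriv p (c q) x) := by
    intro p
    rw [partialDeriv_mul p dw (DifferentiableAt.fun_sum fun q _ => (d1 p q).fun_mul (dc q)),
      partialDeriv_volDens H hx, partialDeriv_sum _ (fun q z => (h z)⁻¹ p q * c q z) p
        fun q _ => (d1 p q).fun_mul (dc q), mul_assoc, ← mul_add, Finset.mul_sum,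
      ← Finset.sum_add_distrib]
    congr 1
    refine Finset.sum_congr rfl fun q _ => ?_
    rw [partialDeriv_mul p (d1 p q) (dc q), pd_apply]
    ring
  have e2 : ∀ q, ∑ p, ((connMat h p x).trace * (h x)⁻¹ p q + pd p (fun z => (h z)⁻¹) x p q)
      = -tension h x q := by
    intro q
    have e3 : ∑ p, (connMat h p x).trace * (h x)⁻¹ p q
        = ∑ p, ∑ l, connMat h p x p l * (h x)⁻¹ l q := by
      rw [Finset.sum_comm]
      refine Finset.sum_congr rfl fun l _ => ?_
      rw [Matrix.trace, Finset.sum_mul]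
      refine Finset.sum_congr rfl fun p _ => ?_
      rw [Matrix.diag_apply, connMat_symm H l p p]
    have e4 : ∀ p, pd p (fun z => (h z)⁻¹) x p q
        = -(∑ l, connMat h p x p l * (h x)⁻¹ l q) - ∑ l, (h x)⁻¹ p l * christoffel h x q l p := by
      intro p
      rw [pd_metric_inv H hx, Matrix.neg_apply, Matrix.add_apply, Matrix.mul_apply, Matrix.mul_apply,
        neg_add, sub_eq_add_neg]
      rfl
    simp only [e4, Finset.sum_add_distrib, Finset.sum_sub_distrib, Finset.sum_neg_distrib]
    rw [e3, tension]
    ring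
  simp only [e1]
  rw [← Finset.mul_sum]
  congr 1
  have e5 : ∑ l, tension h x l * c l x
      = -∑ p, ∑ q, ((connMat h p x).trace * (h x)⁻¹ p q * c q x
        + pd p (fun z => (h z)⁻¹) x p q * c q x) := by
    rw [Finset.sum_comm, ← Finset.sum_neg_distrib]
    refine Finset.sum_congr rfl fun q _ => ?_
    simp only [← add_mul]
    rw [← Finset.sum_mul, e2 q]
    ring
  rw [e5, sub_neg_eq_add, ← Finset.sum_add_distrib]
  refine Finset.sum_congr rfl fun p _ => ?_
  rw [← Finset.sum_add_distrib]
  exact Finset.sum_congr rfl fun q _ => by ring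

/-- The integrand obtained by pairing `∇_p (η Y)` with `∇_p A` and integrating by parts. -/
def ibpIntegrand (h A Y : Eu n → Mat n) (η : Eu n → ℝ) (x : Eu n) : ℝ :=
  (η x * fpair (h x) (fun p => cd h p Y x) (fun p => cd h p A x) + η x * tpair (h x) (Y x) (lap h A x)
    + ∑ p, ∑ q, (h x)⁻¹ p q * (partialDeriv p η x * tpair (h x) (Y x) (cd h q A x))) * volDens h x

/-- Integration by parts against the covariant derivative of `A`. -/
lemma integral_ibpIntegrand (H : IsMetricOn h Ω) (hA : MatSmoothOn A Ω) (hY : MatSmoothOn Y Ω)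
    {η : Eu n → ℝ} (hη : ContDiffOn ℝ ∞ η Ω) (hK : IsCompact K) (hKΩ : K ⊆ Ω)
    (h0 : ∀ x ∉ K, η x = 0) :
    IntegrableOn (ibpIntegrand h A Y η) K ∧ ∫ x in K, ibpIntegrand h A Y η x = 0 := by
  set c : Fin n → Eu n → ℝ := fun q z => η z * tpair (h z) (Y z) (cd h q A z) with hc
  have hcs : ∀ q, ContDiffOn ℝ ∞ (c q) Ω := fun q => hη.mul (H.tpair_smooth hY (cd_smooth H hA q))
  set U : Fin n → Eu n → ℝ := fun p z => volDens h z * ∑ q, (h z)⁻¹ p q * c q z with hU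
  have hUs : ∀ p, ContDiffOn ℝ ∞ (U p) Ω := fun p =>
    (volDens_smooth H).mul (ContDiffOn.sum fun q _ => (H.inv_smooth p q).mul (hcs q))
  have hU0 : ∀ p, ∀ z ∉ K, U p z = 0 := fun p z hz => by simp [hU, hc, h0 z hz]
  have hint : ∀ p, IntegrableOn (partialDeriv p (U p)) K := fun p =>
    ((contDiffOn_partialDeriv H.isOpen (hUs p) p).continuousOn.mono hKΩ).integrableOn_compact hK
  have heq : ∀ z ∈ K, ∑ p, partialDeriv p (U p) z = ibpIntegrand h A Y η z := by
    intro z hz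
    have hz' := hKΩ hz
    rw [sum_partialDeriv_raise H hcs hz']
    have e1 : ∀ p q, partialDeriv p (c q) z = partialDeriv p η z * tpair (h z) (Y z) (cd h q A z)
        + η z * (tpair (h z) (cd h p Y z) (cd h q A z) + tpair (h z) (Y z) (cd h p (cd h q A) z)) := by
      intro p q
      rw [hc, partialDeriv_mul p (hη.differentiableAt_of_isOpen H.isOpen hz')
        ((H.tpair_smooth hY (cd_smooth H hA q)).differentiableAt_of_isOpen H.isOpen hz'),
        partialDeriv_tpair H hY (cd_smooth H hA q) hz']
    have e2 : tpair (h z) (Y z) (lap h A z)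
        = ∑ p, ∑ q, (h z)⁻¹ p q * tpair (h z) (Y z) (cd h p (cd h q A) z)
          - ∑ l, tension h z l * tpair (h z) (Y z) (cd h l A z) := by
      simp only [lap, mcontr, tpair_sub_right, tpair_sum_right, tpair_smul_right]
    rw [ibpIntegrand, mul_comm, e2]
    congr 1
    simp only [e1]
    simp only [mul_add, Finset.sum_add_distrib, fpair, contr, Matrix.of_apply, mul_sub,
      Finset.mul_sum, hc, mul_left_comm _ (η z)]
    ring
  constructor
  · exact (integrable_finsetSum _ fun p _ => hint p).congr
      ((ae_restrict_iff' hK.measurableSet).2 (Filter.Eventually.of_forall heq))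
  · rw [← setIntegral_congr_fun hK.measurableSet heq, integral_finsetSum _ fun p _ => hint p]
    exact Finset.sum_eq_zero fun p _ => integral_partialDeriv_eq_zero H.isOpen hK hKΩ (hUs p) (hU0 p) p

/-- The integrand of the divergence of the radial field `x f`. -/
def radialIntegrand (h : Eu n → Mat n) (f : Eu n → ℝ) (x : Eu n) : ℝ :=
  ((n + (radConn h x).trace) * f x + ∑ l, x l * partialDeriv l f x) * volDens h x

/-- The divergence theorem for the radial field `x f`. -/
lemma integral_radialIntegrand (H : IsMetricOn h Ω) {f : Eu n → ℝ} (hf : ContDiffOn ℝ ∞ f Ω)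
    (hK : IsCompact K) (hKΩ : K ⊆ Ω) (h0 : ∀ x ∉ K, f x = 0) :
    IntegrableOn (radialIntegrand h f) K ∧ ∫ x in K, radialIntegrand h f x = 0 := by
  set U : Fin n → Eu n → ℝ := fun p z => z p * (f z * volDens h z) with hU
  have hco : ∀ p : Fin n, ContDiff ℝ ∞ fun z : Eu n => z p := fun p =>
    (EuclideanSpace.proj p : Eu n →L[ℝ] ℝ).contDiff
  have hUs : ∀ p, ContDiffOn ℝ ∞ (U p) Ω := fun p =>
    (hco p).contDiffOn.mul (hf.mul (volDens_smooth H))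
  have hU0 : ∀ p, ∀ z ∉ K, U p z = 0 := fun p z hz => by simp [hU, h0 z hz]
  have hint : ∀ p, IntegrableOn (partialDeriv p (U p)) K := fun p =>
    ((contDiffOn_partialDeriv H.isOpen (hUs p) p).continuousOn.mono hKΩ).integrableOn_compact hK
  have heq : ∀ z ∈ K, ∑ p, partialDeriv p (U p) z = radialIntegrand h f z := by
    intro z hz
    have hz' := hKΩ hz
    have df := hf.differentiableAt_of_isOpen H.isOpen hz'
    have dw := (volDens_smooth H).differentiableAt_of_isOpen H.isOpen hz'
    have e1 : ∀ p, partialDeriv p (U p) z = f z * volDens h z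
        + (z p * (connMat h p z).trace) * (f z * volDens h z)
        + z p * partialDeriv p f z * volDens h z := by
      intro p
      rw [hU, partialDeriv_mul p ((hco p).differentiable (by simp) z) (df.fun_mul dw),
        partialDeriv_mul p df dw, partialDeriv_volDens H hz', partialDeriv_coord, if_pos rfl]
      ring
    simp only [e1, Finset.sum_add_distrib, radialIntegrand, radConn, Matrix.trace_sum,
      Matrix.trace_smul, smul_eq_mul, Finset.sum_const, Finset.card_univ, Fintype.card_fin,
      nsmul_eq_mul, ← Finset.sum_mul]
    ring
  constructor
  · exact (integrable_finsetSum _ fun p _ => hint p).congr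
      ((ae_restrict_iff' hK.measurableSet).2 (Filter.Eventually.of_forall heq))
  · rw [← setIntegral_congr_fun hK.measurableSet heq, integral_finsetSum _ fun p _ => hint p]
    exact Finset.sum_eq_zero fun p _ => integral_partialDeriv_eq_zero H.isOpen hK hKΩ (hUs p) (hU0 p) p

end Divergence

section ComplexFlow

variable {n : ℕ} {h : Eu n → Mat n} {Ω K : Set (Eu n)} {T t : ℝ} {A : ℝ → Eu n → Mat n} {x : Eu n}

/-- A solution of the harmonic heat flow in coordinates consisting of compatible almost complex
structures. -/
structure ComplexFlowOn (h : Eu n → Mat n) (Ω : Set (Eu n)) (T : ℝ) (A : ℝ → Eu n → Mat n) : Prop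
    extends FlowOn h Ω T A where
  sq : ∀ t ∈ Ico 0 T, ∀ x ∈ Ω, A t x * A t x = -1
  skew : ∀ t ∈ Ico 0 T, ∀ x ∈ Ω, adj h (A t) x = -A t x

/-- The velocity `∂_t J` of the flow. -/
def vel (h : Eu n → Mat n) (A : ℝ → Eu n → Mat n) (t : ℝ) (x : Eu n) : Mat n :=
  lap h (A t) x - gradSq h (A t) x * A t x

namespace ComplexFlowOn

variable (F : ComplexFlowOn h Ω T A)
include F

lemma cd_time_smooth (p : Fin n) : MatTimeSmooth T Ω fun s => cd h p (A s) :=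
  F.smooth.cd F.metric p

lemma vel_smooth : MatTimeSmooth T Ω (vel h A) := by
  have H := F.metric
  have hs : ∀ p q, TimeSmooth T Ω fun _ z => (h z)⁻¹ p q := fun p q =>
    timeSmooth_of_contDiffOn (H.inv_smooth p q)
  have h1 : MatTimeSmooth T Ω fun s => lap h (A s) := by
    refine MatTimeSmooth.sub (MatTimeSmooth.sum _ fun p _ => MatTimeSmooth.sum _ fun q _ =>
      MatTimeSmooth.smul (hs p q) ((F.cd_time_smooth q).cd H p)) ?_
    refine MatTimeSmooth.sum _ fun l _ => MatTimeSmooth.smul (timeSmooth_of_contDiffOn ?_)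
      (F.cd_time_smooth l)
    exact ContDiffOn.sum fun p _ => ContDiffOn.sum fun q _ =>
      (H.inv_smooth p q).mul (contDiffOn_christoffel H l q p)
  have h2 : MatTimeSmooth T Ω fun s z => mcontr (h z) fun p q => cd h p (A s) z * cd h q (A s) z := by
    simp only [mcontr]
    exact MatTimeSmooth.sum _ fun p _ => MatTimeSmooth.sum _ fun q _ =>
      MatTimeSmooth.smul (hs p q) ((F.cd_time_smooth p).mul (F.cd_time_smooth q))
  exact h1.sub (h2.mul F.smooth)

lemma cd_anticomm (ht : t ∈ Ico 0 T) (hx : x ∈ Ω) (p : Fin n) :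
    cd h p (A t) x * A t x = -(A t x * cd h p (A t) x) := by
  have H := F.metric
  have dA := (F.smooth.slice ht).matDiffAt H.isOpen hx
  have h1 : cd h p (fun z => A t z * A t z) x = 0 := by
    rw [cd_congr p (B := fun z => -(fun _ => (1 : Mat n)) z)
      (Filter.eventually_of_mem (H.isOpen.mem_nhds hx) fun z hz => F.sq t ht z hz), cd_neg, cd_one,
      neg_zero]
  rw [cd_mul p dA dA] at h1
  exact eq_neg_of_add_eq_zero_left h1

lemma gradSq_comm (ht : t ∈ Ico 0 T) (hx : x ∈ Ω) :
    gradSq h (A t) x * A t x = A t x * gradSq h (A t) x := by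
  rw [gradSq, ← mcontr_mul_left, ← mcontr_mul_right]
  congr 1
  funext p q
  rw [Matrix.mul_assoc, F.cd_anticomm ht hx q, Matrix.mul_neg, ← Matrix.mul_assoc,
    F.cd_anticomm ht hx p, Matrix.neg_mul, neg_neg, Matrix.mul_assoc]

lemma cd_skew (ht : t ∈ Ico 0 T) (hx : x ∈ Ω) (p : Fin n) :
    madj (h x) (cd h p (A t) x) = -cd h p (A t) x := by
  have H := F.metric
  have h1 := cd_adj H (F.smooth.slice ht) hx p
  rw [cd_congr p (B := fun z => -A t z)
    (Filter.eventually_of_mem (H.isOpen.mem_nhds hx) fun z hz => F.skew t ht z hz), cd_neg] at h1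
  exact h1.symm

lemma madj_gradSq (ht : t ∈ Ico 0 T) (hx : x ∈ Ω) :
    madj (h x) (gradSq h (A t) x) = gradSq h (A t) x := by
  have H := F.metric
  have hu : IsUnit (h x).det := isUnit_iff_ne_zero.2 (H.det_ne_zero x hx)
  rw [gradSq, madj_mcontr, ← mcontr_swap (H.inv_symm x)]
  simp only [madj_mul hu, F.cd_skew ht hx, Matrix.neg_mul, Matrix.mul_neg, neg_neg]

/-- The cubic term is orthogonal to the directions anticommuting with `J`. -/
lemma tpair_cubic (ht : t ∈ Ico 0 T) (hx : x ∈ Ω) {X : Mat n} (hX : X * A t x = -(A t x * X)) :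
    tpair (h x) X (gradSq h (A t) x * A t x) = 0 := by
  have hu : IsUnit (h x).det := isUnit_iff_ne_zero.2 (F.metric.det_ne_zero x hx)
  have e1 : madj (h x) (A t x) = -A t x := F.skew t ht x hx
  set Q := gradSq h (A t) x
  have e2 : tpair (h x) X (Q * A t x) = -(X * A t x * Q).trace := by
    rw [tpair_eq_trace, madj_mul hu, F.madj_gradSq ht hx, e1, Matrix.neg_mul, Matrix.mul_neg,
      Matrix.trace_neg, Matrix.mul_assoc]
  have e3 : (X * A t x * Q).trace = -(X * A t x * Q).trace := by
    conv_lhs => rw [hX, Matrix.neg_mul, Matrix.trace_neg, Matrix.mul_assoc, Matrix.trace_mul_comm,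
      Matrix.mul_assoc, F.gradSq_comm ht hx, ← Matrix.mul_assoc]
  rw [e2]
  linarith

lemma tpair_lap (ht : t ∈ Ico 0 T) (hx : x ∈ Ω) {X : Mat n} (hX : X * A t x = -(A t x * X)) :
    tpair (h x) X (lap h (A t) x) = tpair (h x) X (vel h A t x) := by
  rw [vel, tpair_sub_right, F.tpair_cubic ht hx hX, sub_zero]

lemma vel_anticomm (ht : t ∈ Ico 0 T) (hx : x ∈ Ω) :
    vel h A t x * A t x = -(A t x * vel h A t x) := by
  have H := F.metric
  have hAs := F.smooth.slice ht
  have h1 := lap_mul H hAs hAs hx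
  have h2 : lap h (fun z => A t z * A t z) x = 0 := by
    have e1 : ∀ z ∈ Ω, ∀ l, cd h l (fun z => A t z * A t z) z = 0 := by
      intro z hz l
      rw [cd_mul l (hAs.matDiffAt H.isOpen hz) (hAs.matDiffAt H.isOpen hz), F.cd_anticomm ht hz,
        neg_add_cancel]
    have e2 : ∀ p q, cd h p (cd h q fun z => A t z * A t z) x = 0 := by
      intro p q
      rw [cd_congr p (B := fun _ => 0) (Filter.eventually_of_mem (H.isOpen.mem_nhds hx)
        fun z hz => e1 z hz q), cd_zero]
    simp [lap, e1 x hx, e2, mcontr]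
  rw [h2, two_smul] at h1
  change 0 = _ + (gradSq h (A t) x + gradSq h (A t) x) at h1
  have h3 := F.gradSq_comm ht hx
  have h4 := F.sq t ht x hx
  rw [eq_neg_iff_add_eq_zero, vel]
  calc _ = lap h (A t) x * A t x + A t x * lap h (A t) x
        - gradSq h (A t) x * (A t x * A t x) - A t x * (gradSq h (A t) x * A t x) := by noncomm_ring
    _ = lap h (A t) x * A t x + A t x * lap h (A t) x
        + (gradSq h (A t) x + gradSq h (A t) x) := by
      rw [h3, ← Matrix.mul_assoc (A t x), h4]
      noncomm_ring
    _ = 0 := h1.symm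

/-- The derivative of the energy density in time. -/
lemma hasDerivAt_energyDensity (ht : t ∈ Ioo 0 T) (hx : x ∈ Ω) :
    HasDerivAt (fun s => fpair (h x) (fun p => cd h p (A s) x) (fun p => cd h p (A s) x))
      (2 * fpair (h x) (fun p => cd h p (vel h A t) x) (fun p => cd h p (A t) x)) t := by
  have h1 : ∀ p, HasMatDeriv (fun r => cd h p (A r) x) (cd h p (vel h A t) x) univ t := fun p =>
    F.smooth.hasMatDeriv_cd F.metric F.flow hx ht p
  have h2 := HasMatDeriv.fpair (h x) h1 h1
  rw [hasDerivWithinAt_univ] at h2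
  refine h2.congr_deriv ?_
  have hk := F.metric.posDef x hx
  have : fpair (h x) (fun p => cd h p (A t) x) (fun p => cd h p (vel h A t) x)
      = fpair (h x) (fun p => cd h p (vel h A t) x) (fun p => cd h p (A t) x) := by
    obtain ⟨R, -, h1, -⟩ := exists_frame hk
    rw [fpair_frame h1, fpair_frame h1]
    exact Finset.sum_congr rfl fun c _ => tpair_comm hk _ _
  rw [this]
  ring

end ComplexFlowOn

end ComplexFlow

end Coord

/-! ### Monotonicity of the energy -/

namespace Coord

lemma HasMatDeriv.unique {n : ℕ} {A : ℝ → Mat n} {A₁ A₂ : Mat n} {T t : ℝ} (ht : t ∈ Ico 0 T)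
    (h₁ : HasMatDeriv A A₁ (Ico 0 T) t) (h₂ : HasMatDeriv A A₂ (Ico 0 T) t) : A₁ = A₂ := by
  ext i j
  exact (uniqueDiffOn_Ico 0 T t ht).eq_deriv _ (h₁ i j) (h₂ i j)

end Coord

section Energy

open Coord

variable {n : ℕ} {M : Type*} [TopologicalSpace M] [ChartedSpace (EuclideanSpace ℝ (Fin n)) M]
  [IsManifold (𝓡 n) ∞ M] {g : RiemMetric n M} {T : ℝ} {J : ℝ → EndoField n M}
  {e e' : OpenPartialHomeomorph M (EuclideanSpace ℝ (Fin n))} {ρ : M → ℝ}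

/-- A function on the manifold in the coordinates of a chart, extended by zero. -/
def cutoffCoord (ρ : M → ℝ) (e : OpenPartialHomeomorph M (EuclideanSpace ℝ (Fin n))) : Eu n → ℝ :=
  e.target.indicator fun x => ρ (e.symm x)

omit [IsManifold (𝓡 n) ∞ M] [ChartedSpace (EuclideanSpace ℝ (Fin n)) M] in
lemma cutoffCoord_of_mem {x : Eu n} (hx : x ∈ e.target) : cutoffCoord ρ e x = ρ (e.symm x) :=
  indicator_of_mem hx _

omit [IsManifold (𝓡 n) ∞ M] [ChartedSpace (EuclideanSpace ℝ (Fin n)) M] in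
lemma cutoffCoord_eq_zero {x : Eu n} (hx : x ∉ e '' tsupport ρ) : cutoffCoord ρ e x = 0 := by
  by_cases h : x ∈ e.target
  · rw [cutoffCoord_of_mem h]
    by_contra h0
    exact hx ⟨e.symm x, subset_tsupport _ h0, e.right_inv h⟩
  · exact indicator_of_notMem h _

omit [IsManifold (𝓡 n) ∞ M] in
lemma contDiffOn_chart_symm (he : e ∈ IsManifold.maximalAtlas (𝓡 n) ∞ M)
    (hρ : ContMDiff (𝓡 n) (modelWithCornersSelf ℝ ℝ) ∞ ρ) :
    ContDiffOn ℝ ∞ (fun x => ρ (e.symm x)) e.target :=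
  contMDiffOn_iff_contDiffOn.1
    (hρ.comp_contMDiffOn (contMDiffOn_symm_of_mem_maximalAtlas he))

omit [IsManifold (𝓡 n) ∞ M] in
lemma contDiffOn_cutoffCoord (he : e ∈ IsManifold.maximalAtlas (𝓡 n) ∞ M)
    (hρ : ContMDiff (𝓡 n) (modelWithCornersSelf ℝ ℝ) ∞ ρ) :
    ContDiffOn ℝ ∞ (cutoffCoord ρ e) e.target :=
  (contDiffOn_chart_symm he hρ).congr fun _ hx => cutoffCoord_of_mem hx

omit [IsManifold (𝓡 n) ∞ M] [ChartedSpace (EuclideanSpace ℝ (Fin n)) M] in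
lemma partialDeriv_cutoffCoord {x : Eu n} (hx : x ∈ e.target) (p : Fin n) :
    partialDeriv p (cutoffCoord ρ e) x = partialDeriv p (fun z => ρ (e.symm z)) x :=
  partialDeriv_congr p (Filter.eventually_of_mem (e.open_target.mem_nhds hx)
    fun _ hz => cutoffCoord_of_mem hz)

/-- The velocity of the flow in the chart `e`. -/
def chartVel (g : RiemMetric n M) (J : ℝ → EndoField n M) (t : ℝ)
    (e : OpenPartialHomeomorph M (EuclideanSpace ℝ (Fin n))) (x : Eu n) : Mat n :=
  vel (metricCoord g e) (fun s => endoCoord (J s) e) t x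

/-- The pairing `g^{pq} ∂_p ρ ⟨∂_t J, ∇_q J⟩`. -/
def fluxDensity (g : RiemMetric n M) (J : ℝ → EndoField n M) (ρ : M → ℝ) (t : ℝ)
    (e : OpenPartialHomeomorph M (EuclideanSpace ℝ (Fin n))) (x : Eu n) : ℝ :=
  fpair (metricCoord g e x) (fun p => partialDeriv p (fun z => ρ (e.symm z)) x • chartVel g J t e x)
    (fun p => cd (metricCoord g e) p (endoCoord (J t) e) x)

namespace IsHarmonicHeatFlow

variable (hJ : IsHarmonicHeatFlow g T J)
include hJ

lemma complexFlowOn [CompactSpace M] (he : e ∈ IsManifold.maximalAtlas (𝓡 n) ∞ M) :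
    ComplexFlowOn (metricCoord g e) e.target T fun t => endoCoord (J t) e where
  toFlowOn := hJ.flowOn he
  sq := fun _ ht _ hx => hJ.endoCoord_mul_self ht he hx
  skew := fun _ ht _ hx => hJ.endoCoord_adj ht he hx

lemma similar_vel (he : e ∈ IsManifold.maximalAtlas (𝓡 n) ∞ M)
    (he' : e' ∈ IsManifold.maximalAtlas (𝓡 n) ∞ M) {t : ℝ} (ht : t ∈ Ico 0 T) {x : Eu n}
    (hx : x ∈ chartTransDom e e') :
    Similar (jac (chartTrans e e') x) (chartVel g J t e x)
      (chartVel g J t e' (chartTrans e e' x)) := by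
  set L := jac (chartTrans e e') x
  have h1 := (hasMatDeriv_const (s := Ico 0 T) (t := t) L).mul
    ((hJ.flowOn he).flow x (mem_chartTransDom.1 hx).1 t ht)
  have h2 := ((hJ.flowOn he').flow _ (trans_mem_target hx) t ht).mul
    (hasMatDeriv_const (s := Ico 0 T) (t := t) L)
  have h3 : (fun s => L * endoCoord (J s) e x)
      = fun s => endoCoord (J s) e' (chartTrans e e' x) * L :=
    funext fun s => similar_endoCoord he he' (J s) hx
  rw [← h3] at h2
  have := h1.unique ht h2
  simpa only [Matrix.zero_mul, Matrix.mul_zero, zero_add, add_zero] using! this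

lemma chartInvariant_vel {t : ℝ} (ht : t ∈ Ico 0 T) : ChartInvariant (M := M) fun e x =>
    tpair (metricCoord g e x) (chartVel g J t e x) (chartVel g J t e x) := by
  intro e he e' he' x hx
  have Ψ := coordChange_trans (g := g) he he'
  have hs := hJ.similar_vel he he' ht hx
  exact tpair_congr (Ψ.isUnit_jac hx) (Ψ.pullback x hx) hs hs

lemma chartInvariant_flux (hρ : ContMDiff (𝓡 n) (modelWithCornersSelf ℝ ℝ) ∞ ρ) {t : ℝ}
    (ht : t ∈ Ico 0 T) : ChartInvariant (M := M) (fluxDensity g J ρ t) := by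
  intro e he e' he' x hx
  have Ψ := coordChange_trans (g := g) he he'
  refine fpair_congr (Ψ.isUnit_jac hx) (Ψ.pullback x hx) ?_ (hJ.similarForm_cd he he' ht hx)
  intro p
  have hs : jac (chartTrans e e') x * chartVel g J t e x
      = chartVel g J t e' (chartTrans e e' x) * jac (chartTrans e e') x :=
    hJ.similar_vel he he' ht hx
  have h1 : partialDeriv p (fun z => ρ (e.symm z)) x
      = ∑ a, jac (chartTrans e e') x a p
        * partialDeriv a (fun z => ρ (e'.symm z)) (chartTrans e e' x) := by
    rw [← Ψ.partialDeriv_comp hx (f := fun z => ρ (e'.symm z))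
      ((contDiffOn_chart_symm he' hρ).differentiableAt_of_isOpen e'.open_target (trans_mem_target hx))]
    exact partialDeriv_congr p (Filter.eventually_of_mem (isOpen_chartTransDom.mem_nhds hx)
      fun z hz => by simp only [symm_trans_eq hz])
  change _ * (_ • _) = _ * _
  rw [Matrix.mul_smul, hs, h1, Finset.sum_smul, Finset.sum_mul]
  exact Finset.sum_congr rfl fun a _ => by rw [smul_smul, Matrix.smul_mul]

variable [CompactSpace M]

lemma continuous_vel_glue {t : ℝ} (ht : t ∈ Ico 0 T) : Continuous (chartGlue (M := M) fun e x =>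
    tpair (metricCoord g e x) (chartVel g J t e x) (chartVel g J t e x)) :=
  (hJ.chartInvariant_vel ht).continuous_glue fun _ he =>
    ((isMetricOn_metricCoord he).tpair_smooth ((hJ.complexFlowOn he).vel_smooth.slice ht)
      ((hJ.complexFlowOn he).vel_smooth.slice ht)).continuousOn

lemma continuous_flux_glue (hρ : ContMDiff (𝓡 n) (modelWithCornersSelf ℝ ℝ) ∞ ρ) {t : ℝ}
    (ht : t ∈ Ico 0 T) : Continuous (chartGlue (M := M) (fluxDensity g J ρ t)) :=
  (hJ.chartInvariant_flux hρ ht).continuous_glue fun e he =>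
    ((isMetricOn_metricCoord he).fpair_smooth
      (fun p => MatSmoothOn.smul (contDiffOn_partialDeriv e.open_target (contDiffOn_chart_symm he hρ) p)
        ((hJ.complexFlowOn he).vel_smooth.slice ht))
      (fun p => cd_smooth (isMetricOn_metricCoord he) ((hJ.flowOn he).smooth.slice ht) p)).continuousOn

omit [CompactSpace M] in
lemma gradNormSq_symm {t : ℝ} (ht : t ∈ Ico 0 T) (he : e ∈ IsManifold.maximalAtlas (𝓡 n) ∞ M)
    {x : Eu n} (hx : x ∈ e.target) :
    gradNormSq g (J t) (e.symm x)
      = fpair (metricCoord g e x) (fun p => cd (metricCoord g e) p (endoCoord (J t) e) x)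
        (fun p => cd (metricCoord g e) p (endoCoord (J t) e) x) := by
  have h1 := (hJ.timeScalar_fpair.invariant t ht).glue_symm he hx
  rw [← h1, _root_.gradNormSq, gradNormSq_eq_fpair _ _ _ (metricCoord_symm _), chartGlue]

omit [CompactSpace M] in
lemma continuous_gradNormSq {t : ℝ} (ht : t ∈ Ico 0 T) : Continuous (gradNormSq g (J t)) := by
  have h1 : gradNormSq g (J t) = chartGlue (M := M) fun e x =>
      fpair (metricCoord g e x) (fun p => cd (metricCoord g e) p (endoCoord (J t) e) x)
        (fun p => cd (metricCoord g e) p (endoCoord (J t) e) x) := by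
    funext q
    rw [_root_.gradNormSq, gradNormSq_eq_fpair _ _ _ (metricCoord_symm _), chartGlue]
  rw [h1]
  exact (hJ.timeScalar_fpair.invariant t ht).continuous_glue fun e he =>
    ((hJ.timeScalar_fpair.smooth e he).slice ht).continuousOn

variable [MeasurableSpace M] [BorelSpace M]

omit hJ in
/-- The integral of a function with compact support in a chart. -/
lemma _root_.integral_eq_of_tsupport (he : e ∈ IsManifold.maximalAtlas (𝓡 n) ∞ M)
    (hs : tsupport ρ ⊆ e.source) {F : M → ℝ} (hF : Continuous F) (h0 : ∀ q ∉ tsupport ρ, F q = 0) :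
    ∫ q, F q ∂(riemVolume g)
      = ∫ x in e '' tsupport ρ, F (e.symm x) * volDens (metricCoord g e) x := by
  rw [integral_riemVolume_eq he hF fun q hq => h0 q fun h => hq (hs h)]
  refine setIntegral_eq_of_subset_of_forall_sdiff_eq_zero e.open_target.measurableSet
    (by rintro _ ⟨q, hq, rfl⟩; exact e.map_source (hs hq)) fun x hx => ?_
  rw [h0 _ fun h => hx.2 ⟨_, h, e.right_inv hx.1⟩, zero_mul]

/-- The evolution of the energy localized by a cutoff function supported in a chart. Integration by
parts turns `⟨∇V, ∇J⟩` into `-⟨V, ΔJ⟩ = -|V|²` for `V = ∂_t J`, and the derivative of the cutoff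
function leaves the flux. -/
lemma localEnergy [T2Space M] (he : e ∈ IsManifold.maximalAtlas (𝓡 n) ∞ M)
    (hρ : ContMDiff (𝓡 n) (modelWithCornersSelf ℝ ℝ) ∞ ρ) (hs : tsupport ρ ⊆ e.source) :
    ContinuousOn (fun t => ∫ q, ρ q * gradNormSq g (J t) q ∂(riemVolume g)) (Ico 0 T) ∧
    ∀ t ∈ Ioo 0 T, HasDerivAt (fun t => ∫ q, ρ q * gradNormSq g (J t) q ∂(riemVolume g))
      (-2 * ∫ q, (ρ q * chartGlue (fun e x =>
          tpair (metricCoord g e x) (chartVel g J t e x) (chartVel g J t e x)) q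
        + chartGlue (fluxDensity g J ρ t) q) ∂(riemVolume g)) t := by
  set h := metricCoord g e
  set A : ℝ → Eu n → Mat n := fun t => endoCoord (J t) e
  set K := e '' tsupport ρ with hKdef
  set η := cutoffCoord ρ e
  have H : IsMetricOn h e.target := isMetricOn_metricCoord he
  have F : ComplexFlowOn h e.target T A := hJ.complexFlowOn he
  have hK : IsCompact K := (isClosed_tsupport ρ).isCompact.image_of_continuousOn (e.continuousOn.mono hs)
  have hKt : K ⊆ e.target := by rintro _ ⟨q, hq, rfl⟩; exact e.map_source (hs hq)
  have hη : ContDiffOn ℝ ∞ η e.target := contDiffOn_cutoffCoord he hρ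
  have hη0 : ∀ x ∉ K, η x = 0 := fun x hx => cutoffCoord_eq_zero hx
  set G : ℝ → Eu n → ℝ := fun t x =>
    η x * fpair (h x) (fun p => cd h p (A t) x) (fun p => cd h p (A t) x) * volDens h x with hG
  set G' : ℝ → Eu n → ℝ := fun t x =>
    η x * (2 * fpair (h x) (fun p => cd h p (vel h A t) x) (fun p => cd h p (A t) x)) * volDens h x
    with hG'
  have hGs : TimeSmooth T e.target G :=
    ((timeSmooth_of_contDiffOn hη).mul (MatTimeSmooth.fpair H F.cd_time_smooth F.cd_time_smooth)).mul
      (timeSmooth_of_contDiffOn (volDens_smooth H))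
  have hG's : TimeSmooth T e.target G' :=
    ((timeSmooth_of_contDiffOn hη).mul ((timeSmooth_of_contDiffOn contDiffOn_const).mul
      (MatTimeSmooth.fpair H (fun p => F.vel_smooth.cd H p) F.cd_time_smooth))).mul
      (timeSmooth_of_contDiffOn (volDens_smooth H))
  have hE : ∀ t ∈ Ico 0 T, ∫ q, ρ q * gradNormSq g (J t) q ∂(riemVolume g) = ∫ x in K, G t x := by
    intro t ht
    rw [integral_eq_of_tsupport he hs (F := fun q => ρ q * _root_.gradNormSq g (J t) q)
      (hρ.continuous.mul (hJ.continuous_gradNormSq ht)) fun q hq => by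
        simp only [image_eq_zero_of_notMem_tsupport hq, zero_mul]]
    refine setIntegral_congr_fun hK.measurableSet fun x hx => ?_
    simp only [hG, hJ.gradNormSq_symm ht he (hKt hx), η, cutoffCoord_of_mem (hKt hx), h, A]
  refine ⟨(continuousOn_setIntegral hK (hGs.continuousOn.mono (prod_mono hKt subset_rfl))).congr hE,
    fun t ht => ?_⟩
  have ht' : t ∈ Ico 0 T := Ioo_subset_Ico_self ht
  have hd := hasDerivAt_setIntegral (G := G) (G' := G') hK
    (fun s hs => (hGs.slice (Ioo_subset_Ico_self hs)).continuousOn.mono hKt)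
    (hG's.continuousOn.mono (prod_mono hKt Ioo_subset_Ico_self))
    (fun x hx s hs => ((F.hasDerivAt_energyDensity hs (hKt hx)).const_mul (η x)).mul_const _) ht
  have hd' := hd.congr_of_eventuallyEq (Filter.eventually_of_mem (isOpen_Ioo.mem_nhds ht)
    fun s hs => hE s (Ioo_subset_Ico_self hs))
  refine hd'.congr_deriv ?_
  obtain ⟨i1, i2⟩ := integral_ibpIntegrand H (F.smooth.slice ht') (F.vel_smooth.slice ht') hη hK hKt hη0
  have hfl : ∀ x ∈ K, chartGlue (fluxDensity g J ρ t) (e.symm x)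
      = ∑ p, ∑ q, (h x)⁻¹ p q
        * (partialDeriv p η x * tpair (h x) (vel h A t x) (cd h q (A t) x)) := by
    intro x hx
    rw [(hJ.chartInvariant_flux hρ ht').glue_symm he (hKt hx)]
    simp only [fluxDensity, fpair, contr, Matrix.of_apply, tpair_smul_left, η,
      partialDeriv_cutoffCoord (hKt hx)]
    rfl
  have hW : ∫ q, (ρ q * chartGlue (fun e x =>
          tpair (metricCoord g e x) (chartVel g J t e x) (chartVel g J t e x)) q
        + chartGlue (fluxDensity g J ρ t) q) ∂(riemVolume g)
      = ∫ x in K, (η x * tpair (h x) (vel h A t x) (vel h A t x)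
        + ∑ p, ∑ q, (h x)⁻¹ p q
          * (partialDeriv p η x * tpair (h x) (vel h A t x) (cd h q (A t) x))) * volDens h x := by
    rw [integral_eq_of_tsupport he hs (F := fun q => ρ q * chartGlue (fun e x =>
          tpair (metricCoord g e x) (chartVel g J t e x) (chartVel g J t e x)) q
        + chartGlue (fluxDensity g J ρ t) q) ((hρ.continuous.mul (hJ.continuous_vel_glue ht')).add
      (hJ.continuous_flux_glue hρ ht'))]
    · refine setIntegral_congr_fun hK.measurableSet fun x hx => ?_
      rw [hfl x hx, (hJ.chartInvariant_vel ht').glue_symm he (hKt hx), ← cutoffCoord_of_mem (ρ := ρ) (hKt hx)]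
      rfl
    · intro q hq
      have hz : ∀ᶠ z in nhds (chartAt (EuclideanSpace ℝ (Fin n)) q q),
          ρ ((chartAt (EuclideanSpace ℝ (Fin n)) q).symm z) = 0 := by
        have hc : ContinuousAt (chartAt (EuclideanSpace ℝ (Fin n)) q).symm
            (chartAt (EuclideanSpace ℝ (Fin n)) q q) :=
          (chartAt (EuclideanSpace ℝ (Fin n)) q).continuousAt_symm (mem_chart_target _ q)
        have h1 : (tsupport ρ)ᶜ ∈ nhds ((chartAt (EuclideanSpace ℝ (Fin n)) q).symm
            (chartAt (EuclideanSpace ℝ (Fin n)) q q)) := by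
          rw [(chartAt (EuclideanSpace ℝ (Fin n)) q).left_inv (mem_chart_source _ q)]
          exact (isClosed_tsupport ρ).isOpen_compl.mem_nhds hq
        exact (hc.eventually h1).mono fun z hz => image_eq_zero_of_notMem_tsupport hz
      have h2 : ∀ p, partialDeriv p
          (fun z => ρ ((chartAt (EuclideanSpace ℝ (Fin n)) q).symm z))
          (chartAt (EuclideanSpace ℝ (Fin n)) q q) = 0 := fun p => by
        rw [partialDeriv_congr p (g := fun _ => (0 : ℝ)) hz, partialDeriv_const]
      have h3 : chartGlue (fluxDensity g J ρ t) q = 0 := by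
        simp [chartGlue, fluxDensity, h2, fpair, contr, tpair]
      rw [h3, image_eq_zero_of_notMem_tsupport hq, zero_mul, add_zero]
  rw [hW, ← integral_const_mul]
  have h5 : ∀ x ∈ K, G' t x = 2 * ibpIntegrand h (A t) (vel h A t) η x
      + -2 * ((η x * tpair (h x) (vel h A t x) (vel h A t x)
        + ∑ p, ∑ q, (h x)⁻¹ p q
          * (partialDeriv p η x * tpair (h x) (vel h A t x) (cd h q (A t) x))) * volDens h x) := by
    intro x hx
    rw [ibpIntegrand, F.tpair_lap ht' (hKt hx) (F.vel_anticomm ht' (hKt hx))]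
    ring
  have i3 : IntegrableOn (fun x => G' t x - 2 * ibpIntegrand h (A t) (vel h A t) η x) K :=
    (((hG's.slice ht').continuousOn.mono hKt).integrableOn_compact hK).sub (i1.const_mul 2)
  have h6 : ∫ x in K, G' t x = ∫ x in K, (2 * ibpIntegrand h (A t) (vel h A t) η x
      + (G' t x - 2 * ibpIntegrand h (A t) (vel h A t) η x)) := by
    congr 1
    funext x
    ring
  rw [h6, integral_add (i1.const_mul 2) i3, integral_const_mul, i2, mul_zero, zero_add]
  refine setIntegral_congr_fun hK.measurableSet fun x hx => ?_
  rw [h5 x hx]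
  ring

/-- The energy is nonincreasing along the flow. -/
theorem energy_le [T2Space M] {t : ℝ} (ht : t ∈ Ico 0 T) : energy g (J t) ≤ energy g (J 0) := by
  obtain ⟨c, hc⟩ := CompactSpace.elim_nhds_subcover
    (fun q : M => (chartAt (EuclideanSpace ℝ (Fin n)) q).source) fun q => chart_source_mem_nhds _ q
  obtain ⟨f, hf⟩ := SmoothPartitionOfUnity.exists_isSubordinate (𝓡 n) (M := M) isClosed_univ
    (fun i : c => (chartAt (EuclideanSpace ℝ (Fin n)) (i : M)).source)
    (fun i => (chartAt (EuclideanSpace ℝ (Fin n)) (i : M)).open_source) (by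
      intro q _
      have : q ∈ ⋃ x ∈ c, (chartAt (EuclideanSpace ℝ (Fin n)) x).source := by rw [hc]; trivial
      simp only [mem_iUnion] at this ⊢
      obtain ⟨x, hx, hq⟩ := this
      exact ⟨⟨x, hx⟩, hq⟩)
  have hsum : ∀ q, ∑ i, f i q = 1 := fun q => by
    rw [← finsum_eq_sum_of_fintype]
    exact f.sum_eq_one (mem_univ q)
  have hρ : ∀ i, ContMDiff (𝓡 n) (modelWithCornersSelf ℝ ℝ) ∞ (f i) := fun i => (f i).contMDiff
  have hloc := fun i : c => hJ.localEnergy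
    (IsManifold.chart_mem_maximalAtlas (I := 𝓡 n) (n := ∞) (i : M)) (hρ i) (hf i)
  have hEs : ∀ s ∈ Ico 0 T, energy g (J s) = ∑ i, ∫ q, f i q * gradNormSq g (J s) q ∂(riemVolume g) := by
    intro s hs
    rw [energy, ← integral_finsetSum (f := fun i q => f i q * _root_.gradNormSq g (J s) q) _
      fun i _ => integrable_riemVolume ((hρ i).continuous.mul (hJ.continuous_gradNormSq hs))]
    congr 1
    funext q
    rw [← Finset.sum_mul, hsum, one_mul]
  set E' : ℝ → ℝ := fun s => ∑ i : c, -2 * ∫ q, (f i q * chartGlue (fun e x =>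
      tpair (metricCoord g e x) (chartVel g J s e x) (chartVel g J s e x)) q
    + chartGlue (fluxDensity g J (f i) s) q) ∂(riemVolume g) with hE'
  have hE'nonpos : ∀ s ∈ Ioo 0 T, E' s ≤ 0 := by
    intro s hs
    have hs' := Ioo_subset_Ico_self hs
    have h1 : ∀ q, ∑ i : c, (f i q * chartGlue (fun e x =>
          tpair (metricCoord g e x) (chartVel g J s e x) (chartVel g J s e x)) q
        + chartGlue (fluxDensity g J (f i) s) q)
        = chartGlue (fun e x =>
          tpair (metricCoord g e x) (chartVel g J s e x) (chartVel g J s e x)) q := by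
      intro q
      set e := chartAt (EuclideanSpace ℝ (Fin n)) q
      have he : e ∈ IsManifold.maximalAtlas (𝓡 n) ∞ M := IsManifold.chart_mem_maximalAtlas q
      have hd : ∀ i : c, DifferentiableAt ℝ (fun z => f i (e.symm z)) (e q) := fun i =>
        (contDiffOn_chart_symm he (hρ i)).differentiableAt_of_isOpen e.open_target (mem_chart_target _ q)
      have h2 : ∀ p, ∑ i : c, partialDeriv p (fun z => f i (e.symm z)) (e q) = 0 := by
        intro p
        rw [← partialDeriv_sum _ (fun i z => f i (e.symm z)) p fun i _ => hd i]
        simp only [hsum, partialDeriv_const]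
      -- the fluxes cancel, as the derivatives of a partition of unity add up to zero
      have h3 : ∑ i : c, chartGlue (fluxDensity g J (f i) s) q = 0 := by
        simp only [chartGlue, fluxDensity]
        rw [← fpair_sum_left (D := fun i p => partialDeriv p (fun z => f i (e.symm z)) (e q)
          • chartVel g J s e (e q))]
        simp only [← Finset.sum_smul, h2, zero_smul]
        simp [fpair, contr, tpair]
      rw [Finset.sum_add_distrib, h3, add_zero, ← Finset.sum_mul, hsum, one_mul]
    rw [hE']
    simp only
    rw [← Finset.mul_sum, ← integral_finsetSum (f := fun i q => f i q * chartGlue (fun e x =>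
      tpair (metricCoord g e x) (chartVel g J s e x) (chartVel g J s e x)) q
        + chartGlue (fluxDensity g J (f i) s) q) _ fun i _ => integrable_riemVolume
      (((hρ i).continuous.mul (hJ.continuous_vel_glue hs')).add (hJ.continuous_flux_glue (hρ i) hs'))]
    simp only [h1]
    have : 0 ≤ ∫ q, chartGlue (fun e x =>
        tpair (metricCoord g e x) (chartVel g J s e x) (chartVel g J s e x)) q ∂(riemVolume g) :=
      integral_nonneg fun q => tpair_self_nonneg (metricCoord_posDef
        (IsManifold.chart_mem_maximalAtlas q) (mem_chart_target _ q)) _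
    linarith
  have hanti : AntitoneOn (fun s => energy g (J s)) (Ico 0 T) := by
    refine antitoneOn_of_hasDerivWithinAt_nonpos (f' := E') (convex_Ico 0 T) ?_ ?_ ?_
    · exact (continuousOn_finsetSum _ fun i _ => (hloc i).1).congr hEs
    · rw [interior_Ico]
      intro s hs
      have h1 : HasDerivAt _ (E' s) s := HasDerivAt.fun_sum fun i (_ : i ∈ Finset.univ) => (hloc i).2 s hs
      exact (h1.congr_of_eventuallyEq (Filter.eventually_of_mem (isOpen_Ioo.mem_nhds hs)
        fun r hr => hEs r (Ioo_subset_Ico_self hr))).hasDerivWithinAt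
    · rw [interior_Ico]
      exact hE'nonpos
  exact hanti ⟨le_rfl, ht.1.trans_lt ht.2⟩ ht ht.1

/-- The energy in a chart is bounded by the initial energy. -/
theorem setIntegral_chart_le [T2Space M] {t : ℝ} (ht : t ∈ Ico 0 T)
    (he : e ∈ IsManifold.maximalAtlas (𝓡 n) ∞ M) {K : Set (Eu n)} (hKm : MeasurableSet K)
    (hK : K ⊆ e.target) :
    ∫ x in K, fpair (metricCoord g e x) (fun p => cd (metricCoord g e) p (endoCoord (J t) e) x)
        (fun p => cd (metricCoord g e) p (endoCoord (J t) e) x) * volDens (metricCoord g e) x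
      ≤ energy g (J 0) := by
  have hc := hJ.continuous_gradNormSq ht
  have h0 : ∀ q, 0 ≤ gradNormSq g (J t) q := fun q => by
    rw [_root_.gradNormSq, gradNormSq_eq_fpair _ _ _ (metricCoord_symm _)]
    exact fpair_self_nonneg (metricCoord_posDef (IsManifold.chart_mem_maximalAtlas q)
      (mem_chart_target _ q)) _
  calc _ = ∫ x in K, gradNormSq g (J t) (e.symm x) * Real.sqrt (metricCoord g e x).det :=
        setIntegral_congr_fun hKm fun x hx => by
          simp only [hJ.gradNormSq_symm ht he (hK hx)]
          rfl
    _ ≤ ∫ x in e.target, gradNormSq g (J t) (e.symm x) * Real.sqrt (metricCoord g e x).det :=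
        setIntegral_mono_set (integrableOn_chart he hc)
          (Filter.Eventually.of_forall fun x => mul_nonneg (h0 _) (Real.sqrt_nonneg _))
          hK.eventuallyLE
    _ = ∫ q in e.source, gradNormSq g (J t) q ∂(riemVolume g) :=
        (setIntegral_riemVolume_source he hc).symm
    _ ≤ energy g (J t) := setIntegral_le_integral (integrable_riemVolume hc)
        (Filter.Eventually.of_forall h0)
    _ ≤ energy g (J 0) := hJ.energy_le ht

end IsHarmonicHeatFlow

end Energy

/-! ### The derivative of the localized energy -/

namespace Coord

section HeatKernel

variable {n : ℕ} {T₀ t : ℝ} {x : Eu n}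

lemma backwardHeatKernel_pos (ht : t < T₀) : 0 < backwardHeatKernel T₀ t x := by
  have : 0 < 4 * Real.pi * (T₀ - t) := mul_pos (by positivity) (sub_pos.2 ht)
  exact mul_pos (one_div_pos.2 (Real.rpow_pos_of_pos this _)) (Real.exp_pos _)

lemma contDiffOn_backwardHeatKernel :
    ContDiffOn ℝ ∞ (fun z : Eu n × ℝ => backwardHeatKernel T₀ z.2 z.1) (univ ×ˢ Iio T₀) := by
  have h0 : ∀ z ∈ (univ : Set (Eu n)) ×ˢ Iio T₀, 4 * Real.pi * (T₀ - z.2) ≠ 0 := fun z hz =>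
    (mul_pos (by positivity) (sub_pos.2 hz.2)).ne'
  have h1 : ∀ z ∈ (univ : Set (Eu n)) ×ˢ Iio T₀, 4 * (T₀ - z.2) ≠ 0 := fun z hz =>
    (mul_pos (by positivity) (sub_pos.2 hz.2)).ne'
  have d : ContDiffOn ℝ ∞ (fun z : Eu n × ℝ => 4 * Real.pi * (T₀ - z.2)) (univ ×ˢ Iio T₀) := by
    fun_prop
  refine ContDiffOn.mul (contDiffOn_const.div (d.rpow_const_of_ne h0) fun z hz => ?_) ?_
  · exact (Real.rpow_pos_of_pos (mul_pos (by positivity) (sub_pos.2 hz.2)) _).ne'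
  · refine ContDiffOn.exp (ContDiffOn.div ?_ (by fun_prop) h1)
    exact ((contDiff_norm_sq ℝ).comp contDiff_fst).neg.contDiffOn

lemma timeSmooth_backwardHeatKernel (Ω : Set (Eu n)) : TimeSmooth T₀ Ω (backwardHeatKernel T₀) :=
  contDiffOn_backwardHeatKernel.mono (prod_mono (subset_univ _) fun _ h => h.2)

lemma contDiff_backwardHeatKernel (ht : t < T₀) :
    ContDiff ℝ ∞ fun z : Eu n => backwardHeatKernel T₀ t z := by
  rw [← contDiffOn_univ]
  exact ContDiffOn.comp (g := fun z : Eu n × ℝ => backwardHeatKernel T₀ z.2 z.1)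
    (f := fun x => (x, t)) contDiffOn_backwardHeatKernel
    (contDiff_id.prodMk contDiff_const).contDiffOn fun _ hx => ⟨hx, ht⟩

lemma hasDerivAt_backwardHeatKernel (ht : t < T₀) :
    HasDerivAt (fun s => backwardHeatKernel T₀ s x)
      (backwardHeatKernel T₀ t x * (n / (2 * (T₀ - t)) - ‖x‖ ^ 2 / (4 * (T₀ - t) ^ 2))) t := by
  have hτ : 0 < T₀ - t := sub_pos.2 ht
  have h0 : 0 < 4 * Real.pi * (T₀ - t) := mul_pos (by positivity) hτ
  have d0 : HasDerivAt (fun s => T₀ - s) (-1) t := by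
    simpa using (hasDerivAt_id t).const_sub T₀
  have d1 := ((d0.const_mul (4 * Real.pi)).rpow_const (p := (n : ℝ) / 2) (Or.inl h0.ne'))
  have hp := Real.rpow_pos_of_pos h0 ((n : ℝ) / 2)
  have d2 := (hasDerivAt_const t (1 : ℝ)).div d1 hp.ne'
  have d3 := ((hasDerivAt_const t (-‖x‖ ^ 2)).div (d0.const_mul 4) (by positivity)).exp
  have d4 := d2.mul d3
  refine d4.congr_deriv ?_
  rw [Real.rpow_sub_one h0.ne']
  simp only [backwardHeatKernel, Pi.div_apply]
  field_simp
  ring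

lemma partialDeriv_backwardHeatKernel (ht : t < T₀) (p : Fin n) :
    partialDeriv p (fun z => backwardHeatKernel T₀ t z) x
      = -(x p / (2 * (T₀ - t))) * backwardHeatKernel T₀ t x := by
  have hτ : 0 < T₀ - t := sub_pos.2 ht
  have d1 : HasFDerivAt (fun z : Eu n => ‖z‖ ^ 2) (2 • innerSL ℝ x) x :=
    (hasStrictFDerivAt_norm_sq x).hasFDerivAt
  have d1' : HasFDerivAt (fun z : Eu n => -‖z‖ ^ 2) (-(2 • innerSL ℝ x)) x := d1.neg
  have d2 := ((d1'.mul_const (4 * (T₀ - t))⁻¹).exp.const_mul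
    (1 / (4 * Real.pi * (T₀ - t)) ^ ((n : ℝ) / 2)))
  have e1 : (fun z : Eu n => backwardHeatKernel T₀ t z) = fun z =>
      1 / (4 * Real.pi * (T₀ - t)) ^ ((n : ℝ) / 2) * Real.exp (-‖z‖ ^ 2 * (4 * (T₀ - t))⁻¹) := by
    funext z
    rw [backwardHeatKernel, div_eq_mul_inv (-‖z‖ ^ 2)]
  rw [partialDeriv, e1, HasFDerivAt.fderiv d2]
  have e2 : inner ℝ x (EuclideanSpace.single p (1 : ℝ)) = x p := by
    simp [EuclideanSpace.inner_single_right]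
  simp only [_root_.smul_apply, _root_.neg_apply, innerSL_apply_apply, e2,
    smul_eq_mul, backwardHeatKernel, nsmul_eq_mul, div_eq_mul_inv, mul_inv]
  push_cast
  ring

end HeatKernel

section Localized

variable {n : ℕ} {h : Eu n → Mat n} {T₀ t : ℝ} {A : ℝ → Eu n → Mat n} {B : Eu n → Mat n} {x : Eu n}
  {φ : Eu n → ℝ}

/-- The radial derivative `x^q ∇_q A`. -/
def radDeriv (h B : Eu n → Mat n) (x : Eu n) : Mat n := ∑ q, x q • cd h q B x

/-- The energy density `|∇A|²`. -/
def enDens (h B : Eu n → Mat n) (x : Eu n) : ℝ :=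
  fpair (h x) (fun p => cd h p B x) (fun p => cd h p B x)

/-- The commutator `[x^q F_{pq}, A]`. -/
def radCurv (h B : Eu n → Mat n) (x : Eu n) (p : Fin n) : Mat n :=
  (∑ q, x q • curv h p q x) * B x - B x * ∑ q, x q • curv h p q x

/-- The derivative `v^q ∇_q A` in the direction dual to a covector `c`. -/
def dualDeriv (h B : Eu n → Mat n) (c : Fin n → ℝ) (x : Eu n) : Mat n :=
  ∑ q, (∑ p, (h x)⁻¹ p q * c p) • cd h q B x

/-- The defect `∂_t J - x^q ∇_q J / (2 (T₀ - t))` of the equation of shrinking self-similar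
solutions. -/
def shrinkDefect (h : Eu n → Mat n) (A : ℝ → Eu n → Mat n) (T₀ t : ℝ) (x : Eu n) : Mat n :=
  vel h A t x - (2 * (T₀ - t))⁻¹ • radDeriv h (A t) x

/-- The part of the derivative of the localized energy that is not a divergence. -/
def weightDens (h : Eu n → Mat n) (A : ℝ → Eu n → Mat n) (φ : Eu n → ℝ) (T₀ t : ℝ) (x : Eu n) : ℝ :=
  (backwardHeatKernel T₀ t x * φ x ^ 2
      * (-2 * (T₀ - t) * tpair (h x) (shrinkDefect h A T₀ t x) (shrinkDefect h A T₀ t x)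
        + fpair (h x) (radCurv h (A t) x) (fun p => cd h p (A t) x)
        - (radConn h x).trace / 2 * enDens h (A t) x
        - (∑ p, ∑ q, rad (fun z => (h z)⁻¹) x p q
            * tpair (h x) (cd h p (A t) x) (cd h q (A t) x)) / 2)
    + backwardHeatKernel T₀ t x * φ x
      * (-4 * (T₀ - t) * tpair (h x) (shrinkDefect h A T₀ t x)
            (dualDeriv h (A t) (fun p => partialDeriv p φ x) x)
        - enDens h (A t) x * ∑ p, x p * partialDeriv p φ x)) * volDens h x

lemma cd_radDeriv {Ω : Set (Eu n)} (H : IsMetricOn h Ω) (hB : MatSmoothOn B Ω) (hx : x ∈ Ω)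
    (p : Fin n) :
    cd h p (radDeriv h B) x = cd h p B x + ∑ q, x q • cd h q (cd h p B) x + radCurv h B x p := by
  have hco : ∀ q : Fin n, DifferentiableAt ℝ (fun z : Eu n => z q) x := fun q =>
    (EuclideanSpace.proj q : Eu n →L[ℝ] ℝ).differentiableAt
  have hs : ∀ q, MatDiffAt (cd h q B) x := fun q => (cd_smooth H hB q).matDiffAt H.isOpen hx
  have hs' : ∀ q, MatDiffAt (fun z => z q • cd h q B z) x := fun q i j =>
    (hco q).fun_mul (hs q i j)
  have e1 : radDeriv h B = fun z => ∑ q, z q • cd h q B z := rfl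
  rw [e1, cd_sum _ (fun q z => z q • cd h q B z) p fun q _ => hs' q]
  have e2 : ∀ q, cd h p (fun z => z q • cd h q B z) x
      = (if q = p then (1 : ℝ) else 0) • cd h q B x + x q • cd h q (cd h p B) x
        + x q • (curv h p q x * B x - B x * curv h p q x) := by
    intro q
    rw [cd_smul p (hco q) (hs q), partialDeriv_coord, ← cd_comm H hB hx p q, smul_sub]
    by_cases hpq : q = p
    · subst hpq; simp
    · simp [hpq]
  simp only [e2, Finset.sum_add_distrib]
  congr 1
  · congr 1
    simp
  · simp only [radCurv, Finset.sum_mul, Finset.mul_sum, smul_sub, Finset.sum_sub_distrib,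
      Matrix.smul_mul, Matrix.mul_smul]

lemma IsNormal.inv_gauss (N : IsNormal h) (hx : x ∈ Metric.ball (0 : Eu n) 1) (q : Fin n) :
    ∑ p, (h x)⁻¹ p q * x p = x q := by
  have h1 : (h x).mulVec x = x := funext fun j => N.gauss hx j
  have h2 : (h x)⁻¹.mulVec ((h x).mulVec x) = (h x)⁻¹.mulVec x := by rw [h1]
  rw [Matrix.mulVec_mulVec, N.metric.inv_mul hx, Matrix.one_mulVec] at h2
  have h3 := congrFun h2 q
  rw [h3]
  exact Finset.sum_congr rfl fun p _ => by rw [N.metric.inv_symm x p q]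

/-- The term of `ibpIntegrand` with the derivative of a weight whose logarithmic derivative is that
of the heat kernel up to a covector. -/
lemma IsNormal.sum_weight_deriv (N : IsNormal h) (hx : x ∈ Metric.ball (0 : Eu n) 1) (X : Mat n)
    (a : ℝ) (d c : Fin n → ℝ) (hd : ∀ p, d p = a * x p + c p) :
    ∑ p, ∑ q, (h x)⁻¹ p q * (d p * tpair (h x) X (cd h q B x))
      = a * tpair (h x) X (radDeriv h B x) + tpair (h x) X (dualDeriv h B c x) := by
  have e1 : ∀ q, ∑ p, (h x)⁻¹ p q * d p = a * x q + ∑ p, (h x)⁻¹ p q * c p := by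
    intro q
    rw [← N.inv_gauss hx q, Finset.mul_sum, ← Finset.sum_add_distrib]
    exact Finset.sum_congr rfl fun p _ => by rw [hd]; ring
  rw [Finset.sum_comm]
  simp only [← mul_assoc, ← Finset.sum_mul, e1]
  simp only [radDeriv, dualDeriv, tpair_sum_right, tpair_smul_right, Finset.mul_sum]
  rw [← Finset.sum_add_distrib]
  exact Finset.sum_congr rfl fun q _ => by ring

/-- The radial derivative of the energy density. -/
lemma sum_partialDeriv_enDens {Ω : Set (Eu n)} (H : IsMetricOn h Ω) (hB : MatSmoothOn B Ω)
    (hx : x ∈ Ω) :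
    ∑ l, x l * partialDeriv l (enDens h B) x
      = 2 * fpair (h x) (fun p => ∑ l, x l • cd h l (cd h p B) x) (fun p => cd h p B x)
        + ∑ p, ∑ q, rad (fun z => (h z)⁻¹) x p q * tpair (h x) (cd h p B x) (cd h q B x) := by
  have e0 : ∀ l, partialDeriv l (enDens h B) x = _ := fun l =>
    partialDeriv_fpair_self H (fun p => cd_smooth H hB p) hx l
  simp only [e0, mul_add, Finset.sum_add_distrib]
  congr 1
  · have e1 : ∀ l, fpair (h x) (fun p => x l • cd h l (cd h p B) x) (fun p => cd h p B x)
        = x l * fpair (h x) (fun p => cd h l (cd h p B) x) (fun p => cd h p B x) :=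
      fun l => fpair_smul_left _ _ _
    rw [fpair_sum_left _ (fun l p => x l • cd h l (cd h p B) x), Finset.mul_sum]
    refine Finset.sum_congr rfl fun l _ => ?_
    rw [e1]
    ring
  · simp only [rad, Matrix.sum_apply, Matrix.smul_apply, smul_eq_mul, Finset.sum_mul, Finset.mul_sum]
    rw [Finset.sum_comm]
    refine Finset.sum_congr rfl fun p _ => ?_
    rw [Finset.sum_comm]
    exact Finset.sum_congr rfl fun q _ => Finset.sum_congr rfl fun l _ => by ring

lemma ComplexFlowOn.radDeriv_anticomm {Ω : Set (Eu n)} (F : ComplexFlowOn h Ω T₀ A)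
    (ht : t ∈ Ico 0 T₀) (hx : x ∈ Ω) :
    radDeriv h (A t) x * A t x = -(A t x * radDeriv h (A t) x) := by
  simp only [radDeriv, Finset.sum_mul, Finset.mul_sum, Matrix.smul_mul, Matrix.mul_smul,
    F.cd_anticomm ht hx, smul_neg, Finset.sum_neg_distrib]

/-- The derivative of the localized energy density is the sum of three divergences and of
`weightDens`. -/
lemma ComplexFlowOn.deriv_localized_eq (F : ComplexFlowOn h (Metric.ball 0 1) T₀ A) (N : IsNormal h)
    (hφ : ContDiffOn ℝ ∞ φ (Metric.ball 0 1)) (ht : t ∈ Ioo 0 T₀)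
    (hx : x ∈ Metric.ball (0 : Eu n) 1) {ρ : Eu n → ℝ}
    (hρ : ρ = fun z => backwardHeatKernel T₀ t z * φ z ^ 2) :
    (-1 * (enDens h (A t) x * ρ x)
        + (T₀ - t) * (2 * fpair (h x) (fun p => cd h p (vel h A t) x) (fun p => cd h p (A t) x) * ρ x
          + enDens h (A t) x * (backwardHeatKernel T₀ t x
            * (n / (2 * (T₀ - t)) - ‖x‖ ^ 2 / (4 * (T₀ - t) ^ 2)) * φ x ^ 2))) * volDens h x
      = 2 * (T₀ - t) * ibpIntegrand h (A t) (vel h A t) ρ x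
        - ibpIntegrand h (A t) (radDeriv h (A t)) ρ x
        + 1 / 2 * radialIntegrand h (fun z => enDens h (A t) z * ρ z) x
        + weightDens h A φ T₀ t x := by
  have ht' : t ∈ Ico 0 T₀ := Ioo_subset_Ico_self ht
  have H := F.metric
  have hk := H.posDef x hx
  have hA := F.smooth.slice ht'
  have hτ : T₀ - t ≠ 0 := (sub_pos.2 ht.2).ne'
  set τ := T₀ - t with hτdef
  set G := backwardHeatKernel T₀ t x with hG
  have dφ : DifferentiableAt ℝ φ x := hφ.differentiableAt_of_isOpen H.isOpen hx
  have dG : DifferentiableAt ℝ (fun z => backwardHeatKernel T₀ t z) x :=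
    (contDiff_backwardHeatKernel ht.2).differentiable (by simp) x
  have dρ : DifferentiableAt ℝ ρ x := hρ ▸ dG.fun_mul (dφ.fun_pow 2)
  have de : DifferentiableAt ℝ (enDens h (A t)) x :=
    (H.fpair_smooth (fun p => cd_smooth H hA p)
      fun p => cd_smooth H hA p).differentiableAt_of_isOpen H.isOpen hx
  have hρx : ρ x = G * φ x ^ 2 := by rw [hρ]
  set c : Fin n → ℝ := fun p => partialDeriv p φ x with hc
  have hd : ∀ p, partialDeriv p ρ x = -(2 * τ)⁻¹ * ρ x * x p + 2 * G * φ x * c p := by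
    intro p
    have e1 : ρ = fun z => backwardHeatKernel T₀ t z * (φ z * φ z) := by
      rw [hρ]; funext z; ring
    rw [hρx, e1, partialDeriv_mul p dG (dφ.fun_mul dφ), partialDeriv_mul p dφ dφ,
      partialDeriv_backwardHeatKernel ht.2]
    simp only [← hG, ← hτdef, hc]
    field_simp
    ring
  have hcs : ∀ X : Mat n, tpair (h x) X (dualDeriv h (A t) (fun p => 2 * G * φ x * c p) x)
      = 2 * G * φ x * tpair (h x) X (dualDeriv h (A t) c x) := by
    intro X
    simp only [dualDeriv, tpair_sum_right, tpair_smul_right, Finset.mul_sum]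
    refine Finset.sum_congr rfl fun q _ => ?_
    rw [Finset.sum_mul, Finset.sum_mul, Finset.mul_sum]
    exact Finset.sum_congr rfl fun p _ => by ring
  have i1 := N.sum_weight_deriv (B := A t) hx (vel h A t x) _ _ _ hd
  have i2 := N.sum_weight_deriv (B := A t) hx (radDeriv h (A t) x) _ _ _ hd
  rw [hcs] at i1 i2
  have l1 := F.tpair_lap ht' hx (F.vel_anticomm ht' hx)
  have l2 := F.tpair_lap ht' hx (F.radDeriv_anticomm ht' hx)
  set S := fpair (h x) (fun p => ∑ l, x l • cd h l (cd h p (A t)) x) (fun p => cd h p (A t) x) with hS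
  have f2 : fpair (h x) (fun p => cd h p (radDeriv h (A t)) x) (fun p => cd h p (A t) x)
      = enDens h (A t) x + S + fpair (h x) (radCurv h (A t) x) (fun p => cd h p (A t) x) := by
    simp only [cd_radDeriv H hA hx]
    rw [fpair_add_left (fun p => cd h p (A t) x + ∑ q, x q • cd h q (cd h p (A t)) x),
      fpair_add_left (fun p => cd h p (A t) x)]
    rfl
  have r1 : ∑ l, x l * partialDeriv l (fun z => enDens h (A t) z * ρ z) x
      = (∑ l, x l * partialDeriv l (enDens h (A t)) x) * ρ x
        + enDens h (A t) x * (-(2 * τ)⁻¹ * ρ x * ‖x‖ ^ 2 + 2 * G * φ x * ∑ p, x p * c p) := by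
    rw [EuclideanSpace.real_norm_sq_eq, Finset.sum_mul, Finset.mul_sum, Finset.mul_sum,
      ← Finset.sum_add_distrib, Finset.mul_sum, ← Finset.sum_add_distrib]
    refine Finset.sum_congr rfl fun l _ => ?_
    rw [partialDeriv_mul l de dρ, hd]
    ring
  have b1 : tpair (h x) (shrinkDefect h A T₀ t x) (shrinkDefect h A T₀ t x)
      = tpair (h x) (vel h A t x) (vel h A t x)
        - 2 * (2 * τ)⁻¹ * tpair (h x) (radDeriv h (A t) x) (vel h A t x)
        + (2 * τ)⁻¹ ^ 2 * tpair (h x) (radDeriv h (A t) x) (radDeriv h (A t) x) := by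
    simp only [shrinkDefect, tpair_sub_left, tpair_sub_right, tpair_smul_left, tpair_smul_right,
      tpair_comm hk (vel h A t x) (radDeriv h (A t) x), ← hτdef]
    ring
  have b2 : tpair (h x) (shrinkDefect h A T₀ t x) (dualDeriv h (A t) c x)
      = tpair (h x) (vel h A t x) (dualDeriv h (A t) c x)
        - (2 * τ)⁻¹ * tpair (h x) (radDeriv h (A t) x) (dualDeriv h (A t) c x) := by
    simp only [shrinkDefect, tpair_sub_left, tpair_smul_left, ← hτdef]
  rw [ibpIntegrand, ibpIntegrand, radialIntegrand, weightDens, i1, i2, l1, l2, f2, r1,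
    sum_partialDeriv_enDens H hA hx, b1, b2, tpair_comm hk (vel h A t x) (radDeriv h (A t) x)]
  simp only [← hS, hρx, ← hτdef, ← hG]
  field_simp
  ring

/-- The derivative of the localized energy. -/
theorem ComplexFlowOn.hasDerivAt_localized (F : ComplexFlowOn h (Metric.ball 0 1) T₀ A)
    (N : IsNormal h) (hφ : ContDiffOn ℝ ∞ φ (Metric.ball 0 1)) {K : Set (Eu n)} (hK : IsCompact K)
    (hKb : K ⊆ Metric.ball 0 1) (h0 : ∀ z ∉ K, φ z = 0) (ht : t ∈ Ioo 0 T₀) :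
    IntegrableOn (weightDens h A φ T₀ t) K ∧
    HasDerivAt (fun s => (T₀ - s) * ∫ z in K, enDens h (A s) z * (backwardHeatKernel T₀ s z * φ z ^ 2)
        * volDens h z) (∫ z in K, weightDens h A φ T₀ t z) t := by
  have H := F.metric
  set Ω := Metric.ball (0 : Eu n) 1
  set e : ℝ → Eu n → ℝ := fun s => enDens h (A s) with he
  set e' : ℝ → Eu n → ℝ := fun s z =>
    2 * fpair (h z) (fun p => cd h p (vel h A s) z) (fun p => cd h p (A s) z) with he'
  set κ : ℝ → Eu n → ℝ := fun s z => n / (2 * (T₀ - s)) - ‖z‖ ^ 2 / (4 * (T₀ - s) ^ 2) with hκ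
  set D : ℝ → Eu n → ℝ := fun s z => (T₀ - s) * (e s z * (backwardHeatKernel T₀ s z * φ z ^ 2)
    * volDens h z) with hD
  set D' : ℝ → Eu n → ℝ := fun s z => (-1 * (e s z * (backwardHeatKernel T₀ s z * φ z ^ 2))
    + (T₀ - s) * (e' s z * (backwardHeatKernel T₀ s z * φ z ^ 2)
      + e s z * (backwardHeatKernel T₀ s z * κ s z * φ z ^ 2))) * volDens h z with hD'
  have se : TimeSmooth T₀ Ω e := MatTimeSmooth.fpair H F.cd_time_smooth F.cd_time_smooth
  have sG : TimeSmooth T₀ Ω (backwardHeatKernel T₀) := timeSmooth_backwardHeatKernel Ω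
  have sφ : TimeSmooth T₀ Ω fun _ z => φ z ^ 2 := timeSmooth_of_contDiffOn (hφ.pow 2)
  have sw : TimeSmooth T₀ Ω fun _ => volDens h := timeSmooth_of_contDiffOn (volDens_smooth H)
  have sτ : TimeSmooth T₀ Ω fun s _ => T₀ - s :=
    (contDiff_const.sub contDiff_snd).contDiffOn
  have se' : TimeSmooth T₀ Ω e' := (timeSmooth_of_contDiffOn contDiffOn_const).mul
    (MatTimeSmooth.fpair H (fun p => F.vel_smooth.cd H p) F.cd_time_smooth)
  have sD : TimeSmooth T₀ Ω D := sτ.mul ((se.mul (sG.mul sφ)).mul sw)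
  have cκ : ContinuousOn (fun z : Eu n × ℝ => κ z.2 z.1) (Ω ×ˢ Ico 0 T₀) := by
    have hn : ∀ z ∈ Ω ×ˢ Ico 0 T₀, T₀ - z.2 ≠ 0 := fun z hz => (sub_pos.2 hz.2.2).ne'
    refine ContinuousOn.sub (ContinuousOn.div (by fun_prop) (by fun_prop) fun z hz => ?_)
      (ContinuousOn.div (by fun_prop) (by fun_prop) fun z hz => ?_)
    · exact mul_ne_zero two_ne_zero (hn z hz)
    · exact mul_ne_zero four_ne_zero (pow_ne_zero 2 (hn z hz))
  have cD' : ContinuousOn (fun z : Eu n × ℝ => D' z.2 z.1) (Ω ×ˢ Ico 0 T₀) :=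
    ((continuousOn_const.mul (se.mul (sG.mul sφ)).continuousOn).add (sτ.continuousOn.mul
      ((se'.mul (sG.mul sφ)).continuousOn.add
        (se.continuousOn.mul ((sG.continuousOn.mul cκ).mul sφ.continuousOn))))).mul sw.continuousOn
  have hd : ∀ z ∈ K, ∀ s ∈ Ioo 0 T₀, HasDerivAt (fun r => D r z) (D' s z) s := by
    intro z hz s hs
    have d0 : HasDerivAt (fun r => T₀ - r) (-1) s := by simpa using (hasDerivAt_id s).const_sub T₀
    have d1 := F.hasDerivAt_energyDensity hs (hKb hz)
    have d2 := (hasDerivAt_backwardHeatKernel (x := z) hs.2).mul_const (φ z ^ 2)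
    refine (d0.mul ((d1.mul d2).mul_const (volDens h z))).congr_deriv ?_
    simp only [hD', he, he', hκ, enDens, Pi.mul_apply]
    ring
  have ht' : t ∈ Ico 0 T₀ := Ioo_subset_Ico_self ht
  have hA := F.smooth.slice ht'
  have h1 := hasDerivAt_setIntegral (G := D) (G' := D') hK
    (fun s hs => (sD.slice (Ioo_subset_Ico_self hs)).continuousOn.mono hKb)
    (cD'.mono (prod_mono hKb Ioo_subset_Ico_self)) hd ht
  simp only [hD, integral_const_mul] at h1
  set ρ : Eu n → ℝ := fun z => backwardHeatKernel T₀ t z * φ z ^ 2 with hρ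
  have sρ : ContDiffOn ℝ ∞ ρ Ω := (sG.mul sφ).slice ht'
  have hρ0 : ∀ z ∉ K, ρ z = 0 := fun z hz => by simp [hρ, h0 z hz]
  have sX : MatSmoothOn (radDeriv h (A t)) Ω := MatSmoothOn.sum _ _ fun q _ =>
    MatSmoothOn.smul (EuclideanSpace.proj q : Eu n →L[ℝ] ℝ).contDiff.contDiffOn (cd_smooth H hA q)
  obtain ⟨i1, j1⟩ := integral_ibpIntegrand H hA (F.vel_smooth.slice ht') sρ hK hKb hρ0
  obtain ⟨i2, j2⟩ := integral_ibpIntegrand H hA sX sρ hK hKb hρ0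
  obtain ⟨i3, j3⟩ := integral_radialIntegrand H ((se.slice ht').mul sρ) hK hKb
    fun z hz => by rw [hρ0 z hz, mul_zero]
  have i4 : IntegrableOn (D' t) K :=
    ContinuousOn.integrableOn_compact hK (ContinuousOn.comp (g := fun z : Eu n × ℝ => D' z.2 z.1)
      (f := fun x => (x, t)) (cD'.mono (prod_mono hKb subset_rfl)) (by fun_prop)
      fun x hx => ⟨hx, ht'⟩)
  have i5 := (i1.const_mul (2 * (T₀ - t))).sub i2
  have i6 := i5.add (i3.const_mul (1 / 2))
  have key : ∀ z ∈ K, weightDens h A φ T₀ t z = D' t z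
      - ((2 * (T₀ - t) * ibpIntegrand h (A t) (vel h A t) ρ z
        - ibpIntegrand h (A t) (radDeriv h (A t)) ρ z)
        + 1 / 2 * radialIntegrand h (fun z => enDens h (A t) z * ρ z) z) := by
    intro z hz
    rw [show D' t z = _ from F.deriv_localized_eq N hφ ht (hKb hz) hρ]
    ring
  constructor
  · exact (i4.sub i6).congr ((ae_restrict_iff' hK.measurableSet).2
      (Filter.Eventually.of_forall fun z hz => (key z hz).symm))
  · refine h1.congr_deriv ?_
    rw [setIntegral_congr_fun hK.measurableSet key]
    have e1 := integral_sub i4 i6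
    have e2 := integral_add i5 (i3.const_mul (1 / 2))
    have e3 := integral_sub (i1.const_mul (2 * (T₀ - t))) i2
    simp only [integral_const_mul, Pi.sub_apply, Pi.add_apply] at e1 e2 e3
    rw [e1, e2, e3, j1, j2, j3]
    ring

end Localized

end Coord

/-! ### Bounds of the heat kernel and of the error terms -/

namespace Coord

section KernelBounds

variable {n : ℕ} {T₀ t : ℝ} {x : Eu n}

/-- Where `|x|²` exceeds `n τ (1 + ln² τ)`, the heat kernel is at most `1`. -/
lemma sq_norm_mul_backwardHeatKernel_le (ht : t < T₀) (hx : ‖x‖ ≤ 1) :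
    ‖x‖ ^ 2 * backwardHeatKernel T₀ t x
      ≤ n * (1 + Real.log (T₀ - t) ^ 2) * ((T₀ - t) * backwardHeatKernel T₀ t x) + 1 := by
  have hτ : 0 < T₀ - t := sub_pos.2 ht
  have hG := (backwardHeatKernel_pos (x := x) ht).le
  set τ := T₀ - t with hτdef
  set L := Real.log τ with hL
  by_cases hc : ‖x‖ ^ 2 ≤ n * (1 + L ^ 2) * τ
  · nlinarith [mul_le_mul_of_nonneg_right hc hG]
  · have h1 : backwardHeatKernel T₀ t x ≤ 1 := by
      have hp := Real.rpow_pos_of_pos hτ ((n : ℝ) / 2)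
      have e1 : τ ^ ((n : ℝ) / 2) ≤ (4 * Real.pi * τ) ^ ((n : ℝ) / 2) :=
        Real.rpow_le_rpow hτ.le (by nlinarith [Real.pi_gt_three]) (by positivity)
      have e2 : Real.exp (-‖x‖ ^ 2 / (4 * τ)) ≤ τ ^ ((n : ℝ) / 2) := by
        rw [Real.rpow_def_of_pos hτ]
        refine Real.exp_le_exp.2 ?_
        rw [div_le_iff₀ (by positivity), ← hL]
        have h2 : (0 : ℝ) ≤ n * τ * (1 + L) ^ 2 := by positivity
        nlinarith
      rw [backwardHeatKernel, ← hτdef, one_div_mul_eq_div, div_le_one (hp.trans_le e1)]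
      exact e2.trans e1
    have h2 : ‖x‖ ^ 2 ≤ 1 := by nlinarith [norm_nonneg x]
    have h3 : 0 ≤ n * (1 + L ^ 2) * (τ * backwardHeatKernel T₀ t x) := by positivity
    nlinarith [sq_nonneg ‖x‖]

lemma backwardHeatKernel_le_of_half_le (ht : t < T₀) (h1 : T₀ - t < 1) (hx : 1 / 2 ≤ ‖x‖) :
    backwardHeatKernel T₀ t x ≤ n.factorial * 16 ^ n := by
  have hτ : 0 < T₀ - t := sub_pos.2 ht
  set τ := T₀ - t with hτdef
  have hn : (0 : ℝ) < n.factorial := by exact_mod_cast n.factorial_pos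
  have e1 : τ ^ n ≤ (4 * Real.pi * τ) ^ ((n : ℝ) / 2) := by
    calc τ ^ n = τ ^ (n : ℝ) := (Real.rpow_natCast _ _).symm
      _ ≤ τ ^ ((n : ℝ) / 2) := Real.rpow_le_rpow_of_exponent_ge hτ h1.le
          (by linarith [(Nat.cast_nonneg n : (0 : ℝ) ≤ n)])
      _ ≤ _ := Real.rpow_le_rpow hτ.le (by nlinarith [Real.pi_gt_three]) (by positivity)
  have e2 : Real.exp (-‖x‖ ^ 2 / (4 * τ)) ≤ n.factorial * 16 ^ n * τ ^ n := by
    have h2 : -‖x‖ ^ 2 / (4 * τ) ≤ -(1 / (16 * τ)) := by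
      rw [neg_div, neg_le_neg_iff, div_le_div_iff₀ (by positivity) (by positivity)]
      have hq : 1 / 4 ≤ ‖x‖ ^ 2 := by nlinarith
      linarith [mul_le_mul_of_nonneg_right hq (by positivity : 0 ≤ 16 * τ)]
    refine (Real.exp_le_exp.2 h2).trans ?_
    have h3 := Real.pow_div_factorial_le_exp (1 / (16 * τ)) (by positivity) n
    rw [Real.exp_neg]
    refine inv_le_of_inv_le₀ (by positivity) (le_trans (le_of_eq ?_) h3)
    rw [one_div, inv_pow, mul_pow]
    field_simp
  rw [backwardHeatKernel, ← hτdef, one_div_mul_eq_div,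
    div_le_iff₀ ((pow_pos hτ n).trans_le e1)]
  exact e2.trans (mul_le_mul_of_nonneg_left e1 (by positivity))

lemma backwardHeatKernel_le_rpow (ht : t < T₀) {N : ℝ} (hN : 0 < N) (hNt : 1 / N ≤ T₀ - t) :
    backwardHeatKernel T₀ t x ≤ N ^ ((n : ℝ) / 2) := by
  have hτ : 0 < T₀ - t := sub_pos.2 ht
  have e1 : (1 / N) ^ ((n : ℝ) / 2) ≤ (4 * Real.pi * (T₀ - t)) ^ ((n : ℝ) / 2) :=
    Real.rpow_le_rpow (by positivity) (by nlinarith [Real.pi_gt_three]) (by positivity)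
  have e2 : Real.exp (-‖x‖ ^ 2 / (4 * (T₀ - t))) ≤ 1 := by
    rw [Real.exp_le_one_iff, neg_div]
    exact neg_nonpos.2 (by positivity)
  have e3 : (0 : ℝ) < (1 / N) ^ ((n : ℝ) / 2) := Real.rpow_pos_of_pos (by positivity) _
  rw [backwardHeatKernel, one_div_mul_eq_div, div_le_iff₀ (e3.trans_le e1)]
  refine e2.trans (le_trans (le_of_eq ?_) (mul_le_mul_of_nonneg_left e1 (by positivity)))
  rw [← Real.mul_rpow hN.le (by positivity), mul_one_div_cancel hN.ne', Real.one_rpow]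

/-- The second moment of the heat kernel, over any set, is at most a multiple of the time. -/
lemma setIntegral_sq_norm_mul_kernel_le (ht : t < T₀) (K : Set (Eu n)) :
    ∫ z in K, ‖z‖ ^ 2 / (T₀ - t) * backwardHeatKernel T₀ t z ≤ 8 * 2 ^ ((n : ℝ) / 2) := by
  have hτ : 0 < T₀ - t := sub_pos.2 ht
  set τ := T₀ - t with hτdef
  set a : ℝ := 8 * (1 / (4 * Real.pi * τ) ^ ((n : ℝ) / 2)) with ha
  have ha0 : 0 ≤ a := by positivity
  have hb : 0 < 1 / (8 * τ) := by positivity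
  -- half of the exponent absorbs the factor `‖z‖² / τ`, since `u exp (-u) ≤ 1`; what remains is a
  -- Gaussian of twice the variance
  have hint : ∫ z : Eu n, Real.exp (-(1 / (8 * τ)) * ‖z‖ ^ 2) = (8 * Real.pi * τ) ^ ((n : ℝ) / 2) := by
    rw [GaussianFourier.integral_rexp_neg_mul_sq_norm hb, finrank_euclideanSpace_fin]
    congr 1
    field_simp
  have hI : Integrable fun z : Eu n => a * Real.exp (-(1 / (8 * τ)) * ‖z‖ ^ 2) := by
    refine Integrable.const_mul (Integrable.of_integral_ne_zero ?_) a
    rw [hint]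
    positivity
  have hle : ∀ z : Eu n, ‖z‖ ^ 2 / τ * backwardHeatKernel T₀ t z
      ≤ a * Real.exp (-(1 / (8 * τ)) * ‖z‖ ^ 2) := by
    intro z
    set u := ‖z‖ ^ 2 / (8 * τ) with hu
    have h1 : -‖z‖ ^ 2 / (4 * τ) = -u + -u := by rw [hu]; field_simp; ring
    have h2 : -(1 / (8 * τ)) * ‖z‖ ^ 2 = -u := by rw [hu]; ring
    have h3 : ‖z‖ ^ 2 / τ = 8 * u := by rw [hu]; field_simp
    have h4 : u * Real.exp (-u) ≤ 1 := by
      rw [Real.exp_neg, ← div_eq_mul_inv, div_le_one (Real.exp_pos u)]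
      linarith [Real.add_one_le_exp u]
    rw [backwardHeatKernel, ← hτdef, h1, h2, h3, Real.exp_add, ha]
    have h5 : 0 ≤ 8 * (1 / (4 * Real.pi * τ) ^ ((n : ℝ) / 2)) * Real.exp (-u) := by positivity
    nlinarith [mul_le_mul_of_nonneg_left h4 h5]
  have hnn : ∀ z : Eu n, 0 ≤ ‖z‖ ^ 2 / τ * backwardHeatKernel T₀ t z := fun z =>
    mul_nonneg (by positivity) (backwardHeatKernel_pos ht).le
  have hI' : Integrable fun z : Eu n => ‖z‖ ^ 2 / τ * backwardHeatKernel T₀ t z := by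
    refine hI.mono ?_ (Filter.Eventually.of_forall fun z => ?_)
    · exact (((continuous_norm.pow 2).div_const _).mul
        (contDiff_backwardHeatKernel ht).continuous).aestronglyMeasurable
    · rw [Real.norm_of_nonneg (hnn z)]
      exact (hle z).trans (le_abs_self _)
  calc _ ≤ ∫ z : Eu n, ‖z‖ ^ 2 / τ * backwardHeatKernel T₀ t z :=
        setIntegral_le_integral hI' (Filter.Eventually.of_forall hnn)
    _ ≤ ∫ z : Eu n, a * Real.exp (-(1 / (8 * τ)) * ‖z‖ ^ 2) := integral_mono hI' hI hle
    _ = 8 * 2 ^ ((n : ℝ) / 2) := by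
        rw [integral_const_mul, hint, ha,
          show 8 * Real.pi * τ = 2 * (4 * Real.pi * τ) by ring,
          Real.mul_rpow zero_le_two (by positivity)]
        have : (0 : ℝ) < (4 * Real.pi * τ) ^ ((n : ℝ) / 2) := by positivity
        field_simp

end KernelBounds

section TensorBounds

variable {n : ℕ} {h : Eu n → Mat n} {k : Mat n} {x : Eu n} {c : ℝ}

open Matrix in
lemma fpair_commutator_le (hk : k.PosDef) (Y : Mat n) (M : Fin n → Mat n) :
    fpair k (fun p => M p * Y - Y * M p) (fun p => M p * Y - Y * M p)
      ≤ 4 * tpair k Y Y * fpair k M M := by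
  obtain ⟨R, -, h1, -⟩ := exists_frame hk
  rw [fpair_frame h1, fpair_frame h1, Finset.mul_sum]
  refine Finset.sum_le_sum fun c _ => ?_
  set m := frameForm R M c with hm
  have e1 : frameForm R (fun p => M p * Y - Y * M p) c = m * Y - Y * m := by
    simp only [hm, frameForm, Finset.sum_mul, Finset.mul_sum, smul_sub, Finset.sum_sub_distrib,
      Matrix.smul_mul, Matrix.mul_smul]
  rw [e1]
  have h2 := tpair_self_nonneg hk (m * Y + Y * m)
  have h3 := tpair_mul_self_le hk m Y
  have h4 := tpair_mul_self_le hk Y m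
  simp only [tpair_add_left, tpair_add_right] at h2
  simp only [tpair_sub_left, tpair_sub_right]
  nlinarith

lemma vpair_conj (hk : k.transpose = k) (m : Mat n) (d : Fin n → ℝ) :
    vpair (k * m * k) d d = vpair m (k.mulVec d) (k.mulVec d) := by
  rw [vpair_eq_dotProduct, vpair_eq_dotProduct, ← Matrix.mulVec_mulVec, ← Matrix.mulVec_mulVec,
    Matrix.dotProduct_mulVec, ← Matrix.mulVec_transpose, hk]

variable {r : ℝ}

/-- The divergence of the radial field is at least `n (1 - c)`. -/
lemma trace_radConn_ge (hk : (h x).PosDef) (hb : ∀ w : Fin n → ℝ,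
      |vpair (h x * radConn h x) w w| ≤ c * vpair (h x) w w) :
    -(radConn h x).trace ≤ n * c := by
  have hu : IsUnit (h x).det := isUnit_iff_ne_zero.2 hk.det_pos.ne'
  have h1 := contr_le hk (-(h x * radConn h x)) c fun v => by
    rw [vpair_neg_mat]
    exact (neg_le_abs _).trans (hb v)
  refine le_trans (le_of_eq ?_) h1
  have h2 : radConn h x = (h x)⁻¹ * (h x * radConn h x) := by
    rw [← Matrix.mul_assoc, Matrix.nonsing_inv_mul _ hu, Matrix.one_mul]
  have hs : ∀ p q, (h x)⁻¹ p q = (h x)⁻¹ q p := fun p q => by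
    have := hk.isHermitian.inv.apply p q
    simpa using this.symm
  conv_lhs => rw [h2]
  simp only [Matrix.trace, Matrix.diag_apply, Matrix.mul_apply (M := (h x)⁻¹), contr,
    Matrix.neg_apply, mul_neg, Finset.sum_neg_distrib]
  rw [Finset.sum_comm]
  exact congrArg _ (Finset.sum_congr rfl fun p _ => Finset.sum_congr rfl fun q _ => by rw [hs])

lemma IsNormal.sum_rad_inv_mul_tpair_ge (N : IsNormal h) (hx : x ∈ Metric.ball (0 : Eu n) 1)
    (hb : ∀ w : Fin n → ℝ, |vpair (h x * radConn h x) w w| ≤ c * vpair (h x) w w)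
    (D : Fin n → Mat n) :
    -(∑ p, ∑ q, rad (fun z => (h z)⁻¹) x p q * tpair (h x) (D p) (D q))
      ≤ 2 * c * fpair (h x) D D := by
  have H := N.metric
  have e1 : rad (fun z => (h z)⁻¹) x = -((h x)⁻¹ * rad h x * (h x)⁻¹) := by
    simp only [rad, pd_inv H.isOpen H.smooth H.det_ne_zero hx, smul_neg, Finset.sum_neg_distrib,
      Finset.mul_sum, Finset.sum_mul, Matrix.mul_smul, Matrix.smul_mul]
  have h1 := sum_mul_tpair_le (H.posDef x hx) (-rad (fun z => (h z)⁻¹) x) (2 * c) (fun d => by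
    rw [e1, neg_neg, N.rad_metric hx, vpair_conj (H.inv_transpose x), vpair_smul_mat]
    have h2 := (le_abs_self _).trans (hb ((h x)⁻¹.mulVec d))
    have h3 : vpair (h x) ((h x)⁻¹.mulVec d) ((h x)⁻¹.mulVec d) = vpair (h x)⁻¹ d d := by
      rw [← vpair_conj (H.inv_transpose x), H.inv_mul hx, Matrix.one_mul]
    rw [h3] at h2
    linarith) D
  simpa only [Matrix.neg_apply, neg_mul, Finset.sum_neg_distrib] using h1

lemma fpair_radCurv_le (hk : (h x).PosDef) {B : Eu n → Mat n} {K : ℝ} (hK0 : 0 ≤ K)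
    (hB : tpair (h x) (B x) (B x) = n) (hn : vpair (h x) x x = ‖x‖ ^ 2)
    (hK : curvNormSq (h x) (fun p q => curv h p q x) ≤ K ^ 2) (D : Fin n → Mat n) :
    fpair (h x) (radCurv h B x) D ≤ 2 * Real.sqrt n * K * (‖x‖ * Real.sqrt (fpair (h x) D D)) := by
  have h1 := fpair_commutator_le hk (B x) fun p => ∑ q, x q • curv h p q x
  have h2 := fpair_contract_le hk x fun p q => curv h p q x
  rw [hn] at h2
  rw [hB] at h1
  have h3 : fpair (h x) (radCurv h B x) (radCurv h B x) ≤ (2 * Real.sqrt n * K * ‖x‖) ^ 2 := by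
    refine h1.trans ?_
    have h4 := h2.trans (mul_le_mul_of_nonneg_left hK (sq_nonneg _))
    have h5 := mul_le_mul_of_nonneg_left h4 (by positivity : (0 : ℝ) ≤ 4 * n)
    refine h5.trans (le_of_eq ?_)
    rw [mul_pow, mul_pow, mul_pow, Real.sq_sqrt (Nat.cast_nonneg n)]
    ring
  have h6 : fnorm (h x) (radCurv h B x) ≤ 2 * Real.sqrt n * K * ‖x‖ :=
    Real.sqrt_le_iff.2 ⟨by positivity, h3⟩
  calc _ ≤ fnorm (h x) (radCurv h B x) * fnorm (h x) D := (le_abs_self _).trans (abs_fpair_le hk _ _)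
    _ ≤ (2 * Real.sqrt n * K * ‖x‖) * fnorm (h x) D :=
        mul_le_mul_of_nonneg_right h6 (fnorm_nonneg _)
    _ = _ := by rw [fnorm, mul_assoc]

lemma tpair_dualDeriv_le (hk : (h x).PosDef) {B : Eu n → Mat n} {b : ℝ} (hb0 : 0 < b)
    (hb : ∀ w : Fin n → ℝ, b⁻¹ * ∑ i, w i ^ 2 ≤ vpair (h x) w w) (d : Fin n → ℝ) :
    tpair (h x) (dualDeriv h B d x) (dualDeriv h B d x) ≤ b * (∑ p, d p ^ 2) * enDens h B x := by
  set v : Fin n → ℝ := fun q => ∑ p, (h x)⁻¹ p q * d p with hv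
  have hu : IsUnit (h x).det := isUnit_iff_ne_zero.2 hk.det_pos.ne'
  have h1 := tpair_sum_smul_le hk v fun q => cd h q B x
  refine h1.trans (mul_le_mul_of_nonneg_right ?_ (fpair_self_nonneg hk _))
  have hs : ∀ p q, (h x)⁻¹ p q = (h x)⁻¹ q p := fun p q => by
    have := hk.isHermitian.inv.apply p q
    simpa using this.symm
  have hvd : (h x).mulVec v = d := by
    have : v = (h x)⁻¹.mulVec d := funext fun q => Finset.sum_congr rfl fun p _ => by rw [hs p q]
    rw [this, Matrix.mulVec_mulVec, Matrix.mul_nonsing_inv _ hu, Matrix.one_mulVec]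
  have h2 : vpair (h x) v v = ∑ q, v q * d q := by
    rw [vpair_eq_dotProduct, hvd]
    rfl
  have h3 := Finset.sum_mul_sq_le_sq_mul_sq Finset.univ v d
  have h4 := hb v
  rw [← h2] at h3
  set V := vpair (h x) v v
  set S := ∑ i, v i ^ 2
  have hV : 0 ≤ V := vpair_self_nonneg hk v
  have hd : 0 ≤ ∑ p, d p ^ 2 := Finset.sum_nonneg fun p _ => sq_nonneg _
  have h5 : S ≤ b * V := by
    rwa [inv_mul_le_iff₀ hb0] at h4
  rcases hV.eq_or_lt with h6 | h6
  · rw [← h6]; positivity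
  · have h7 := mul_le_mul_of_nonneg_right h5 hd
    nlinarith

lemma volDens_le (hk : (h x).PosDef) {b : ℝ}
    (hb : ∀ w : Fin n → ℝ, vpair (h x) w w ≤ b * ∑ i, w i ^ 2) :
    volDens h x ≤ Real.sqrt (b ^ n) := by
  refine Real.sqrt_le_sqrt ?_
  have hH := hk.isHermitian
  rw [hH.det_eq_prod_eigenvalues]
  have h1 : ∀ i, hH.eigenvalues i ≤ b := by
    intro i
    have h2 := hb (hH.eigenvectorBasis i).ofLp
    have h3 : ‖hH.eigenvectorBasis i‖ ^ 2 = 1 := by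
      rw [hH.eigenvectorBasis.orthonormal.1 i, one_pow]
    rw [EuclideanSpace.real_norm_sq_eq] at h3
    rw [h3, mul_one, vpair_eq_dotProduct] at h2
    rw [hH.eigenvalues_eq i]
    simpa using h2
  have h4 := Finset.prod_le_prod (s := Finset.univ) (fun i _ => (hk.eigenvalues_pos i).le)
    fun i _ => h1 i
  simpa using h4

end TensorBounds

section WeightBounds

variable {n : ℕ} {h : Eu n → Mat n} {T₀ t : ℝ} {A : ℝ → Eu n → Mat n} {x : Eu n} {φ : Eu n → ℝ}

/-- Bounds, with constants `c`, `κ` and `b`, for the geometry of the metric and for a cutoff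
function at a point. -/
structure BoundedAt (h : Eu n → Mat n) (φ : Eu n → ℝ) (c κ b : ℝ) (x : Eu n) : Prop where
  norm_lt : ‖x‖ < 1
  radConn : ∀ w : Fin n → ℝ, |vpair (h x * radConn h x) w w| ≤ c * ‖x‖ ^ 2 * vpair (h x) w w
  curv : curvNormSq (h x) (fun p q => curv h p q x) ≤ κ ^ 2
  metric : ∀ w : Fin n → ℝ, (Real.exp c)⁻¹ * ∑ i, w i ^ 2 ≤ vpair (h x) w w
  metric' : ∀ w : Fin n → ℝ, vpair (h x) w w ≤ Real.exp c * ∑ i, w i ^ 2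
  cutoff : φ x ^ 2 ≤ b
  cutoff_deriv : 2 * (Real.exp c * ∑ p, partialDeriv p φ x ^ 2)
    + |φ x * ∑ p, x p * partialDeriv p φ x| ≤ b
  cutoff_const : ‖x‖ < 1 / 2 → ∀ p, partialDeriv p φ x = 0

/-- The three error terms: the geometric one is of order `|x|² e`, and `|x|² G` is bounded in terms of
the weight of the localized energy; the terms with derivatives of the cutoff live away from the
centre, where `G` is bounded; the curvature term is of order `|x| √e`. -/
lemma ComplexFlowOn.weightDens_le (F : ComplexFlowOn h (Metric.ball 0 1) T₀ A) (N : IsNormal h)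
    {c κ b : ℝ} (hc : 0 ≤ c) (hκ : 0 ≤ κ) (hb : BoundedAt h φ c κ b x) (ht : t ∈ Ico 0 T₀)
    (ht1 : T₀ - t < 1) :
    weightDens h A φ T₀ t x
      ≤ (n / 2 + 1) * c * n * (1 + Real.log (T₀ - t) ^ 2)
          * ((T₀ - t) * (enDens h (A t) x * (backwardHeatKernel T₀ t x * φ x ^ 2) * volDens h x))
        + ((n / 2 + 1) * c * b + b * (n.factorial * 16 ^ n)) * (enDens h (A t) x * volDens h x)
        + 2 * Real.sqrt n * κ * (‖x‖ * Real.sqrt (enDens h (A t) x)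
          * (backwardHeatKernel T₀ t x * φ x ^ 2) * volDens h x) := by
  have hx : x ∈ Metric.ball (0 : Eu n) 1 := mem_ball_zero_iff.2 hb.norm_lt
  have hk := N.metric.posDef x hx
  have hτ : 0 < T₀ - t := sub_pos.2 ht.2
  have hG := (backwardHeatKernel_pos (x := x) ht.2).le
  have hG1 := sq_norm_mul_backwardHeatKernel_le ht.2 hb.norm_lt.le
  have hG2 := backwardHeatKernel_le_of_half_le (x := x) ht.2 ht1
  have he : 0 ≤ enDens h (A t) x := fpair_self_nonneg hk _
  have hA : tpair (h x) (A t x) (A t x) = n := by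
    have e1 : madj (h x) (A t x) = -A t x := F.skew t ht x hx
    rw [tpair_eq_trace, e1, Matrix.mul_neg, F.sq t ht x hx, neg_neg, Matrix.trace_one,
      Fintype.card_fin]
  have hR := fpair_radCurv_le hk hκ hA (N.vpair_eq_norm hx) hb.curv fun p => cd h p (A t) x
  have hP := trace_radConn_ge hk hb.radConn
  have hS := N.sum_rad_inv_mul_tpair_ge hx hb.radConn fun p => cd h p (A t) x
  have hY := tpair_dualDeriv_le hk (Real.exp_pos c) hb.metric (B := A t)
    fun p => partialDeriv p φ x
  have hBY := tpair_self_nonneg hk (φ x • shrinkDefect h A T₀ t x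
    + dualDeriv h (A t) (fun p => partialDeriv p φ x) x)
  simp only [tpair_add_left, tpair_add_right, tpair_smul_left, tpair_smul_right,
    tpair_comm hk (dualDeriv h (A t) (fun p => partialDeriv p φ x) x)
      (shrinkDefect h A T₀ t x)] at hBY
  have hw : 0 ≤ volDens h x := volDens_nonneg
  have hd := hb.cutoff_deriv
  have hφ := hb.cutoff
  have h0 := hb.cutoff_const
  change fpair (h x) (radCurv h (A t) x) (fun p => cd h p (A t) x)
    ≤ 2 * Real.sqrt n * κ * (‖x‖ * Real.sqrt (enDens h (A t) x)) at hR
  change _ ≤ 2 * (c * ‖x‖ ^ 2) * enDens h (A t) x at hS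
  rw [weightDens]
  set τ := T₀ - t
  set G := backwardHeatKernel T₀ t x
  set e := enDens h (A t) x
  set Y := tpair (h x) (dualDeriv h (A t) (fun p => partialDeriv p φ x) x)
    (dualDeriv h (A t) (fun p => partialDeriv p φ x) x)
  set β := tpair (h x) (shrinkDefect h A T₀ t x) (shrinkDefect h A T₀ t x)
  set γ := tpair (h x) (shrinkDefect h A T₀ t x)
    (dualDeriv h (A t) (fun p => partialDeriv p φ x) x)
  set s := ∑ p, x p * partialDeriv p φ x with hs
  set S := ∑ p, ∑ q, rad (fun z => (h z)⁻¹) x p q * tpair (h x) (cd h p (A t) x) (cd h q (A t) x)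
  set R := fpair (h x) (radCurv h (A t) x) (fun p => cd h p (A t) x)
  set P := (Coord.radConn h x).trace
  set L := Real.log τ
  -- completing the square in the defect leaves a term supported where the cutoff is not constant
  have b1 : G * φ x ^ 2 * (-2 * τ * β) + G * φ x * (-4 * τ * γ - e * s)
      ≤ b * (n.factorial * 16 ^ n) * e := by
    have s1 : G * φ x ^ 2 * (-2 * τ * β) + G * φ x * (-4 * τ * γ) ≤ 2 * τ * G * Y := by
      have := mul_nonneg (by positivity : 0 ≤ 2 * τ * G) hBY
      linarith
    have hYn : 0 ≤ Y := tpair_self_nonneg hk _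
    rcases lt_or_ge ‖x‖ (1 / 2) with h1 | h1
    · have hz := h0 h1
      have hs0 : s = 0 := by simp [hs, hz]
      have hY0 : Y ≤ 0 := hY.trans_eq (by simp [hz])
      have hb0 : 0 ≤ b := (sq_nonneg _).trans hφ
      rw [hs0]
      have := mul_nonneg (mul_nonneg hb0 (by positivity : (0 : ℝ) ≤ n.factorial * 16 ^ n)) he
      nlinarith [mul_nonneg hτ.le hG]
    · have s2 : 2 * τ * G * Y ≤ G * (2 * (Real.exp c * ∑ p, partialDeriv p φ x ^ 2)) * e := by
        have h2 := mul_le_mul_of_nonneg_left hY (by positivity : 0 ≤ 2 * G)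
        have h3 : 2 * τ * G * Y ≤ 2 * G * Y := by
          have : 0 ≤ G * Y := mul_nonneg hG hYn
          nlinarith
        linarith
      have s3 : -(G * φ x * (e * s)) ≤ G * |φ x * s| * e := by
        have := mul_le_mul_of_nonneg_left (neg_abs_le (φ x * s)) (mul_nonneg hG he)
        linarith
      have s4 := mul_le_mul_of_nonneg_left hd (mul_nonneg hG he)
      have s5 := mul_le_mul_of_nonneg_right (hG2 h1)
        (mul_nonneg ((sq_nonneg _).trans hφ) he)
      linarith
  -- the deviation of the metric from the Euclidean one, of order `|x|²`
  have b2 : G * φ x ^ 2 * (-(P / 2 * e) - S / 2)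
      ≤ (n / 2 + 1) * c * n * (1 + L ^ 2) * (τ * (e * (G * φ x ^ 2)))
        + (n / 2 + 1) * c * b * e := by
    have s1 := mul_le_mul_of_nonneg_right hP he
    have s2 : -(P / 2 * e) - S / 2 ≤ (n / 2 + 1) * c * ‖x‖ ^ 2 * e := by linarith
    have s3 := mul_le_mul_of_nonneg_left s2 (mul_nonneg hG (sq_nonneg (φ x)))
    have hq : 0 ≤ (n / 2 + 1) * c * e := by positivity
    have s4 := mul_le_mul_of_nonneg_left hG1 (mul_nonneg hq (sq_nonneg (φ x)))
    have s5 := mul_le_mul_of_nonneg_left hφ hq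
    linarith
  have b3 := mul_le_mul_of_nonneg_left hR (mul_nonneg hG (sq_nonneg (φ x)))
  have key : G * φ x ^ 2 * (-2 * τ * β + R - P / 2 * e - S / 2) + G * φ x * (-4 * τ * γ - e * s)
      ≤ (n / 2 + 1) * c * n * (1 + L ^ 2) * (τ * (e * (G * φ x ^ 2)))
        + ((n / 2 + 1) * c * b + b * (n.factorial * 16 ^ n)) * e
        + 2 * Real.sqrt n * κ * (‖x‖ * Real.sqrt e * (G * φ x ^ 2)) := by linarith
  refine (mul_le_mul_of_nonneg_right key hw).trans (le_of_eq (by ring))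

end WeightBounds

end Coord

/-! ### The differential inequality, and Gronwall's inequality -/

namespace Coord

section Gronwall

/-- The constant in the differential inequality for the localized energy, in terms of the bounds
`c`, `κ`, `b` of `BoundedAt`, of a bound `W` of the volume density and of the volume `v` of the
support of the cutoff function. -/
def weightConst (n : ℕ) (c κ b W v : ℝ) : ℝ :=
  (n / 2 + 1) * c * n + ((n / 2 + 1) * c * b + b * (n.factorial * 16 ^ n))
    + 2 * Real.sqrt n * κ * (1 / 2 + 4 * (b * W) * 2 ^ ((n : ℝ) / 2) + b * Real.sqrt (W * v))

variable {n : ℕ} {h : Eu n → Mat n} {T₀ t : ℝ} {A : ℝ → Eu n → Mat n} {x : Eu n} {φ : Eu n → ℝ}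

/-- The lower order term `|x| |∇J|`. For small times it is absorbed by means of the second moment of
the heat kernel, and for large times the heat kernel is bounded. -/
lemma setIntegral_norm_mul_sqrt_le {K : Set (Eu n)} (hK : IsCompact K) (hKx : ∀ z ∈ K, ‖z‖ < 1)
    {e w : Eu n → ℝ} {b W E N : ℝ} (hec : ContinuousOn e K) (hwc : ContinuousOn w K)
    (hφc : ContinuousOn φ K) (he : ∀ z ∈ K, 0 ≤ e z) (hw : ∀ z ∈ K, 0 ≤ w z)
    (hwW : ∀ z ∈ K, w z ≤ W) (hφ : ∀ z ∈ K, φ z ^ 2 ≤ b) (hb : 0 ≤ b) (hW : 0 ≤ W)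
    (hE : ∫ z in K, e z * w z ≤ E) (ht : t < T₀) (ht1 : T₀ - t < 1) (hN : 1 < N) :
    ∫ z in K, ‖z‖ * Real.sqrt (e z) * (backwardHeatKernel T₀ t z * φ z ^ 2) * w z
      ≤ (1 / 2 + 4 * (b * W) * 2 ^ ((n : ℝ) / 2) + b * Real.sqrt (W * (volume K).toReal))
        * ((1 + Real.log (T₀ - t) ^ 2)
            * ((T₀ - t) * ∫ z in K, e z * (backwardHeatKernel T₀ t z * φ z ^ 2) * w z)
          + N ^ ((n : ℝ) / 2) * Real.sqrt E + 1 / Real.log N ^ 2) := by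
  have hτ : 0 < T₀ - t := sub_pos.2 ht
  set τ := T₀ - t with hτdef
  set L := Real.log τ with hL
  set G : Eu n → ℝ := fun z => backwardHeatKernel T₀ t z with hG
  have hGp : ∀ z, 0 < G z := fun z => backwardHeatKernel_pos ht
  have hGc : ContinuousOn G K := (contDiff_backwardHeatKernel ht).continuous.continuousOn
  set I := ∫ z in K, e z * (G z * φ z ^ 2) * w z with hI
  have hI0 : 0 ≤ I := setIntegral_nonneg hK.measurableSet fun z hz =>
    mul_nonneg (mul_nonneg (he z hz) (mul_nonneg (hGp z).le (sq_nonneg _))) (hw z hz)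
  have hlogN : 0 < Real.log N := Real.log_pos hN
  have hN0 : 0 < N := zero_lt_one.trans hN
  have cse : ContinuousOn (fun z => Real.sqrt (e z)) K := hec.sqrt
  have cLHS : ContinuousOn (fun z => ‖z‖ * Real.sqrt (e z) * (G z * φ z ^ 2) * w z) K :=
    ((continuous_norm.continuousOn.mul cse).mul (hGc.mul (hφc.pow 2))).mul hwc
  have hc1 : 0 ≤ 4 * (b * W) * 2 ^ ((n : ℝ) / 2) := by positivity
  have hc2 : 0 ≤ b * Real.sqrt (W * (volume K).toReal) := by positivity
  have hNn : 0 ≤ N ^ ((n : ℝ) / 2) * Real.sqrt E := by positivity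
  have hlN : 0 ≤ 1 / Real.log N ^ 2 := by positivity
  have hZ0 : 0 ≤ (1 + L ^ 2) * (τ * I) := by positivity
  rcases le_total τ (1 / N) with hc | hc
  -- small times: the inequality of the means, with weight `τ ln² τ`
  · have hLN : Real.log N ≤ -L := by
      have := Real.log_le_log hτ hc
      rw [one_div, Real.log_inv] at this
      linarith
    have hL2 : Real.log N ^ 2 ≤ L ^ 2 := by nlinarith
    have hLp : 0 < L ^ 2 := (pow_pos hlogN 2).trans_le hL2
    have hL0 : L ≠ 0 := pow_ne_zero_iff two_ne_zero |>.1 hLp.ne'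
    have c1 : ContinuousOn (fun z => e z * (G z * φ z ^ 2) * w z) K :=
      (hec.mul (hGc.mul (hφc.pow 2))).mul hwc
    have c2 : ContinuousOn (fun z : Eu n => ‖z‖ ^ 2 / τ * G z) K :=
      ((continuous_norm.pow 2).div_const _).continuousOn.mul hGc
    have hpt : ∀ z ∈ K, ‖z‖ * Real.sqrt (e z) * (G z * φ z ^ 2) * w z
        ≤ L ^ 2 * τ / 2 * (e z * (G z * φ z ^ 2) * w z)
          + b * W / (2 * L ^ 2) * (‖z‖ ^ 2 / τ * G z) := by
      intro z hz
      have s1 : ‖z‖ * Real.sqrt (e z) ≤ L ^ 2 * τ / 2 * e z + ‖z‖ ^ 2 / (2 * L ^ 2 * τ) := by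
        have hp : 0 < L ^ 2 * τ := by positivity
        have h1 := sq_nonneg (L ^ 2 * τ * Real.sqrt (e z) - ‖z‖)
        have h2 := Real.sq_sqrt (he z hz)
        have h3 : L ^ 2 * τ / 2 * e z + ‖z‖ ^ 2 / (2 * L ^ 2 * τ) - ‖z‖ * Real.sqrt (e z)
            = (L ^ 2 * τ * Real.sqrt (e z) - ‖z‖) ^ 2 / (2 * (L ^ 2 * τ)) := by
          rw [← h2, Real.sqrt_sq (Real.sqrt_nonneg _)]
          field_simp
          ring
        have h4 : 0 ≤ (L ^ 2 * τ * Real.sqrt (e z) - ‖z‖) ^ 2 / (2 * (L ^ 2 * τ)) := by positivity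
        linarith
      have s2 : φ z ^ 2 * w z ≤ b * W := mul_le_mul (hφ z hz) (hwW z hz) (hw z hz) hb
      have s3 := mul_le_mul_of_nonneg_right s1
        (mul_nonneg (mul_nonneg (hGp z).le (sq_nonneg (φ z))) (hw z hz))
      have s4 := mul_le_mul_of_nonneg_left s2
        (by have := (hGp z).le; positivity : 0 ≤ ‖z‖ ^ 2 / (2 * L ^ 2 * τ) * G z)
      have s5 : b * W / (2 * L ^ 2) * (‖z‖ ^ 2 / τ * G z)
          = ‖z‖ ^ 2 / (2 * L ^ 2 * τ) * G z * (b * W) := by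
        field_simp
      rw [s5]
      linarith
    have hint := setIntegral_mono_on (cLHS.integrableOn_compact (μ := volume) hK)
      (((c1.integrableOn_compact (μ := volume) hK).const_mul (L ^ 2 * τ / 2)).add
        ((c2.integrableOn_compact (μ := volume) hK).const_mul (b * W / (2 * L ^ 2)))) hK.measurableSet hpt
    have e1 := integral_add ((c1.integrableOn_compact (μ := volume) hK).const_mul (L ^ 2 * τ / 2))
      ((c2.integrableOn_compact (μ := volume) hK).const_mul (b * W / (2 * L ^ 2)))
    simp only [integral_const_mul] at e1
    refine hint.trans (e1.trans_le ?_)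
    have hg := setIntegral_sq_norm_mul_kernel_le ht K
    have s1 : b * W / (2 * L ^ 2) * ∫ z in K, ‖z‖ ^ 2 / τ * G z
        ≤ 4 * (b * W) * 2 ^ ((n : ℝ) / 2) * (1 / Real.log N ^ 2) := by
      have h1 := mul_le_mul_of_nonneg_left hg (by positivity : 0 ≤ b * W / (2 * L ^ 2))
      have h2 := mul_le_mul_of_nonneg_left (one_div_le_one_div_of_le (by positivity) hL2) hc1
      refine h1.trans (le_trans (le_of_eq ?_) h2)
      field_simp
      ring
    have s2 : L ^ 2 * τ / 2 * I ≤ 1 / 2 * ((1 + L ^ 2) * (τ * I)) := by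
      have : 0 ≤ τ * I := by positivity
      linarith
    have p1 := mul_nonneg hc1 hZ0
    have p2 := mul_nonneg hc1 hNn
    have p3 := mul_nonneg hc2 (add_nonneg (add_nonneg hZ0 hNn) hlN)
    linarith
  -- large times: the heat kernel is at most `N^{n/2}`
  · have cew : ContinuousOn (fun z => e z * w z) K := hec.mul hwc
    have csw : ContinuousOn (fun z => Real.sqrt (e z) * w z) K := cse.mul hwc
    have hGN : ∀ z, G z ≤ N ^ ((n : ℝ) / 2) := fun z => backwardHeatKernel_le_rpow ht hN0 hc
    have hpt : ∀ z ∈ K, ‖z‖ * Real.sqrt (e z) * (G z * φ z ^ 2) * w z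
        ≤ b * N ^ ((n : ℝ) / 2) * (Real.sqrt (e z) * w z) := by
      intro z hz
      have s1 : ‖z‖ * (G z * φ z ^ 2) ≤ 1 * (N ^ ((n : ℝ) / 2) * b) :=
        mul_le_mul (hKx z hz).le (mul_le_mul (hGN z) (hφ z hz) (sq_nonneg _) (by positivity))
          (mul_nonneg (hGp z).le (sq_nonneg _)) zero_le_one
      have s2 := mul_le_mul_of_nonneg_right s1 (mul_nonneg (Real.sqrt_nonneg (e z)) (hw z hz))
      linarith
    have hint := setIntegral_mono_on (cLHS.integrableOn_compact (μ := volume) hK)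
      ((csw.integrableOn_compact (μ := volume) hK).const_mul (b * N ^ ((n : ℝ) / 2))) hK.measurableSet hpt
    rw [integral_const_mul] at hint
    have hwv : ∫ z in K, w z ≤ W * (volume K).toReal := by
      have := setIntegral_mono_on (hwc.integrableOn_compact (μ := volume) hK)
        (integrableOn_const (C := W) hK.measure_lt_top.ne) hK.measurableSet hwW
      rw [setIntegral_const, smul_eq_mul, mul_comm] at this
      exact this
    -- the Cauchy–Schwarz inequality for the measure with density `w`
    have hcs : (∫ z in K, Real.sqrt (e z) * w z) ^ 2 ≤ (∫ z in K, e z * w z) * ∫ z in K, w z := by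
      apply sq_le_mul_of_forall_quadratic_nonneg
      intro u
      have i1 := (cew.integrableOn_compact (μ := volume) hK).mul_const (u ^ 2)
      have i2 := ((csw.integrableOn_compact (μ := volume) hK).const_mul 2).mul_const u
      have i3 := hwc.integrableOn_compact (μ := volume) hK
      have e1 := integral_add (i1.add i2) i3
      have e2 := integral_add i1 i2
      simp only [integral_const_mul, integral_mul_const, Pi.add_apply] at e1 e2
      rw [← e2, ← e1]
      refine setIntegral_nonneg hK.measurableSet fun z hz => ?_
      have h2 := Real.sq_sqrt (he z hz)
      have h3 := mul_nonneg (sq_nonneg (u * Real.sqrt (e z) + 1)) (hw z hz)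
      have h4 : (u * Real.sqrt (e z) + 1) ^ 2 * w z = e z * w z * u ^ 2
          + 2 * (Real.sqrt (e z) * w z) * u + w z := by
        conv_rhs => rw [← h2]
        rw [Real.sqrt_sq (Real.sqrt_nonneg _)]
        ring
      rw [← h4]
      exact h3
    have hew0 : 0 ≤ ∫ z in K, e z * w z := setIntegral_nonneg hK.measurableSet fun z hz =>
      mul_nonneg (he z hz) (hw z hz)
    have hS : ∫ z in K, Real.sqrt (e z) * w z
        ≤ Real.sqrt E * Real.sqrt (W * (volume K).toReal) := by
      rw [← Real.sqrt_mul (hew0.trans hE)]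
      refine Real.le_sqrt_of_sq_le (hcs.trans ?_)
      exact mul_le_mul hE hwv (setIntegral_nonneg hK.measurableSet hw) (hew0.trans hE)
    have s1 := mul_le_mul_of_nonneg_left hS (by positivity : 0 ≤ b * N ^ ((n : ℝ) / 2))
    have p1 := mul_nonneg (add_nonneg (by norm_num : (0 : ℝ) ≤ 1 / 2) hc1)
      (add_nonneg (add_nonneg hZ0 hNn) hlN)
    have p2 := mul_nonneg hc2 (add_nonneg hZ0 hlN)
    linarith

/-- The differential inequality for the localized energy. -/
lemma ComplexFlowOn.setIntegral_weightDens_le (F : ComplexFlowOn h (Metric.ball 0 1) T₀ A)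
    (N : IsNormal h) (hφs : ContDiffOn ℝ ∞ φ (Metric.ball 0 1)) {K : Set (Eu n)} (hK : IsCompact K)
    (hKb : K ⊆ Metric.ball 0 1) {c κ b E P : ℝ} (hc : 0 ≤ c) (hκ : 0 ≤ κ) (hb0 : 0 ≤ b)
    (hb : ∀ z ∈ K, BoundedAt h φ c κ b z) (ht : t ∈ Ico 0 T₀) (ht1 : T₀ - t < 1)
    (hi : IntegrableOn (weightDens h A φ T₀ t) K)
    (hE : ∫ z in K, enDens h (A t) z * volDens h z ≤ E) (hP : 1 < P) :
    ∫ z in K, weightDens h A φ T₀ t z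
      ≤ weightConst n c κ b (Real.sqrt (Real.exp c ^ n)) (volume K).toReal
        * ((1 + Real.log (T₀ - t) ^ 2) * ((T₀ - t) * ∫ z in K, enDens h (A t) z
            * (backwardHeatKernel T₀ t z * φ z ^ 2) * volDens h z)
          + (P ^ ((n : ℝ) / 2) * (E + Real.sqrt E) + 1 / Real.log P ^ 2)) := by
  have H := F.metric
  have hA := F.smooth.slice ht
  have hτ : 0 < T₀ - t := sub_pos.2 ht.2
  have ce : ContinuousOn (enDens h (A t)) K :=
    (H.fpair_smooth (fun p => cd_smooth H hA p) fun p => cd_smooth H hA p).continuousOn.mono hKb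
  have cw : ContinuousOn (volDens h) K := (volDens_smooth H).continuousOn.mono hKb
  have cφ : ContinuousOn φ K := hφs.continuousOn.mono hKb
  have cG : ContinuousOn (fun z : Eu n => backwardHeatKernel T₀ t z) K :=
    (contDiff_backwardHeatKernel ht.2).continuous.continuousOn
  have he : ∀ z ∈ K, 0 ≤ enDens h (A t) z := fun z hz => fpair_self_nonneg (H.posDef z (hKb hz)) _
  have h3 := setIntegral_norm_mul_sqrt_le hK (fun z hz => (hb z hz).norm_lt) ce cw cφ he
    (fun z _ => volDens_nonneg) (fun z hz => volDens_le (H.posDef z (hKb hz)) (hb z hz).metric')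
    (fun z hz => (hb z hz).cutoff) hb0 (Real.sqrt_nonneg _) hE ht.2 ht1 hP
  have i1 : IntegrableOn (fun z => enDens h (A t) z * (backwardHeatKernel T₀ t z * φ z ^ 2)
      * volDens h z) K := ((ce.mul (cG.mul (cφ.pow 2))).mul cw).integrableOn_compact hK
  have i2 : IntegrableOn (fun z => enDens h (A t) z * volDens h z) K :=
    (ce.mul cw).integrableOn_compact hK
  have i3 : IntegrableOn (fun z => ‖z‖ * Real.sqrt (enDens h (A t) z)
      * (backwardHeatKernel T₀ t z * φ z ^ 2) * volDens h z) K :=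
    ((((continuous_norm.continuousOn (s := K)).mul ce.sqrt).mul
      (cG.mul (cφ.pow 2))).mul cw).integrableOn_compact hK
  set L := Real.log (T₀ - t) with hL
  set a₁ := (n / 2 + 1) * c * n with ha₁
  set a₂ := (n / 2 + 1) * c * b + b * (n.factorial * 16 ^ n) with ha₂
  set a₃ := 2 * Real.sqrt n * κ with ha₃
  have j1 := (i1.const_mul (T₀ - t)).const_mul (a₁ * (1 + L ^ 2))
  have j2 := i2.const_mul a₂
  have j3 := i3.const_mul a₃
  have hint := setIntegral_mono_on hi ((j1.add j2).add j3) hK.measurableSet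
    fun z hz => F.weightDens_le N hc hκ (hb z hz) ht ht1
  have e1 := integral_add (j1.add j2) j3
  have e2 := integral_add j1 j2
  simp only [integral_const_mul, Pi.add_apply] at e1 e2
  refine hint.trans (e1.trans_le ?_)
  rw [e2]
  have hI0 : 0 ≤ ∫ z in K, enDens h (A t) z * (backwardHeatKernel T₀ t z * φ z ^ 2) * volDens h z :=
    setIntegral_nonneg hK.measurableSet fun z hz => mul_nonneg (mul_nonneg (he z hz)
      (mul_nonneg (backwardHeatKernel_pos ht.2).le (sq_nonneg _))) volDens_nonneg
  set I := ∫ z in K, enDens h (A t) z * (backwardHeatKernel T₀ t z * φ z ^ 2) * volDens h z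
  have hE0 : 0 ≤ E := le_trans (setIntegral_nonneg hK.measurableSet fun z hz =>
    mul_nonneg (he z hz) volDens_nonneg) hE
  have hP1 : 1 ≤ P ^ ((n : ℝ) / 2) := Real.one_le_rpow hP.le (by positivity)
  set W := Real.sqrt (Real.exp c ^ n)
  set d := 1 / 2 + 4 * (b * W) * 2 ^ ((n : ℝ) / 2) + b * Real.sqrt (W * (volume K).toReal) with hd
  have hd0 : 0 ≤ d := by positivity
  have ha1 : 0 ≤ a₁ := by positivity
  have ha2 : 0 ≤ a₂ := by positivity
  have ha3 : 0 ≤ a₃ := by positivity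
  set Q := P ^ ((n : ℝ) / 2)
  set l := 1 / Real.log P ^ 2 with hl
  have hl0 : 0 ≤ l := by positivity
  have hQE : E ≤ Q * E := le_mul_of_one_le_left hE0 hP1
  have hZ0 : 0 ≤ (1 + L ^ 2) * ((T₀ - t) * I) := by positivity
  have hs : 0 ≤ Q * Real.sqrt E := by positivity
  have s2 := mul_le_mul_of_nonneg_left hE ha2
  have s2' := mul_le_mul_of_nonneg_left hQE ha2
  have s3 := mul_le_mul_of_nonneg_left h3 ha3
  have p1 : 0 ≤ a₁ * (Q * (E + Real.sqrt E) + l) := by positivity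
  have p2 : 0 ≤ a₂ * ((1 + L ^ 2) * ((T₀ - t) * I) + Q * Real.sqrt E + l) := by positivity
  have p3 : 0 ≤ a₃ * (d * (Q * E)) := by positivity
  have hwc : weightConst n c κ b W (volume K).toReal = a₁ + a₂ + a₃ * d := rfl
  rw [hwc]
  linarith

/-- The weight `f` satisfies `f' = 1 + ln² (T₀ - t)`. -/
lemma hasDerivAt_monotonicityWeight (ht : t < T₀) :
    HasDerivAt (monotonicityWeight T₀) (1 + Real.log (T₀ - t) ^ 2) t := by
  have hτ : T₀ - t ≠ 0 := (sub_pos.2 ht).ne'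
  have d0 : HasDerivAt (fun s => T₀ - s) (-1) t := by simpa using (hasDerivAt_id t).const_sub T₀
  have d1 := d0.log hτ
  refine (((d0.fun_neg.fun_mul (d1.fun_pow 2)).fun_add ((d0.const_mul 2).fun_mul d1)).fun_sub
    (d0.const_mul 3)).congr_deriv ?_
  field_simp
  ring

lemma neg_three_le_monotonicityWeight (ht : t < T₀) (ht1 : T₀ - t < 1) :
    -3 ≤ monotonicityWeight T₀ t := by
  have hτ : 0 < T₀ - t := sub_pos.2 ht
  have hl : 0 ≤ -Real.log (T₀ - t) := neg_nonneg.2 (Real.log_nonpos hτ.le ht1.le)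
  have h1 := Real.quadratic_le_exp_of_nonneg hl
  rw [Real.exp_neg, Real.exp_log hτ] at h1
  have h2 := mul_le_mul_of_nonneg_left h1 hτ.le
  rw [mul_inv_cancel₀ hτ.ne'] at h2
  rw [monotonicityWeight]
  linarith

lemma monotonicityWeight_nonpos (ht : t < T₀) (ht1 : T₀ - t < 1) : monotonicityWeight T₀ t ≤ 0 := by
  have hτ : 0 < T₀ - t := sub_pos.2 ht
  have hl := mul_nonneg hτ.le (neg_nonneg.2 (Real.log_nonpos hτ.le ht1.le))
  have h2 := mul_nonneg hτ.le (sq_nonneg (Real.log (T₀ - t)))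
  rw [monotonicityWeight]
  linarith

lemma monotonicityWeight_mono {t₁ t₂ : ℝ} (h12 : t₁ ≤ t₂) (h2 : t₂ < T₀) :
    monotonicityWeight T₀ t₁ ≤ monotonicityWeight T₀ t₂ := by
  refine monotoneOn_of_hasDerivWithinAt_nonneg (f' := fun s => 1 + Real.log (T₀ - s) ^ 2)
    (convex_Icc t₁ t₂) (fun s hs => ?_) (fun s hs => ?_) (fun s _ => by positivity)
    (left_mem_Icc.2 h12) (right_mem_Icc.2 h12) h12
  · exact (hasDerivAt_monotonicityWeight (hs.2.trans_lt h2)).continuousAt.continuousWithinAt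
  · exact (hasDerivAt_monotonicityWeight ((interior_subset hs).2.trans_lt h2)).hasDerivWithinAt

/-- Gronwall's inequality with the integrating factor `exp (-C f)`, which stays between `1` and
`exp (3 C)`. -/
lemma gronwall_monotonicityWeight {Z Z' : ℝ → ℝ} {C B t₁ t₂ : ℝ} (hC : 0 ≤ C) (hB : 0 ≤ B)
    (h12 : t₁ ≤ t₂) (h1 : T₀ - 1 < t₁) (h2 : t₂ < T₀)
    (hZ : ∀ s ∈ Icc t₁ t₂, HasDerivAt Z (Z' s) s)
    (hle : ∀ s ∈ Icc t₁ t₂, Z' s ≤ C * (1 + Real.log (T₀ - s) ^ 2) * Z s + B) :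
    Z t₂ ≤ Real.exp (C * (monotonicityWeight T₀ t₂ - monotonicityWeight T₀ t₁)) * Z t₁
      + B * Real.exp (3 * C) * (t₂ - t₁) := by
  set f := monotonicityWeight T₀ with hf
  set u : ℝ → ℝ := fun s => Real.exp (-(C * f s)) * Z s - B * Real.exp (3 * C) * s with hu
  have hd : ∀ s ∈ Icc t₁ t₂, HasDerivAt u (Real.exp (-(C * f s))
      * (Z' s - C * (1 + Real.log (T₀ - s) ^ 2) * Z s) - B * Real.exp (3 * C)) s := by
    intro s hs
    have d1 := ((hasDerivAt_monotonicityWeight (hs.2.trans_lt h2)).const_mul C).fun_neg.exp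
    refine ((d1.fun_mul (hZ s hs)).fun_sub ((hasDerivAt_id s).const_mul _)).congr_deriv ?_
    simp only [hf]
    ring
  have hanti : AntitoneOn u (Icc t₁ t₂) := by
    refine antitoneOn_of_hasDerivWithinAt_nonpos (convex_Icc t₁ t₂)
      (fun s hs => (hd s hs).continuousAt.continuousWithinAt)
      (fun s hs => (hd s (interior_subset hs)).hasDerivWithinAt) fun s hs => ?_
    have hs' := interior_subset hs
    have h3 := neg_three_le_monotonicityWeight (hs'.2.trans_lt h2) (by linarith [hs'.1])
    have h4 : Real.exp (-(C * f s)) ≤ Real.exp (3 * C) := Real.exp_le_exp.2 (by nlinarith)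
    have h5 := hle s hs'
    have h6 := Real.exp_pos (-(C * f s))
    have h7 := mul_le_mul_of_nonneg_left
      (by linarith : Z' s - C * (1 + Real.log (T₀ - s) ^ 2) * Z s ≤ B) h6.le
    have h8 := mul_le_mul_of_nonneg_left h4 hB
    linarith
  have h3 := hanti (left_mem_Icc.2 h12) (right_mem_Icc.2 h12) h12
  simp only [hu] at h3
  have h4 : Real.exp (C * f t₂) * Real.exp (-(C * f t₂)) = 1 := by
    rw [← Real.exp_add, add_neg_cancel, Real.exp_zero]
  have h5 : Real.exp (C * f t₂) ≤ 1 := Real.exp_le_one_iff.2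
    (mul_nonpos_of_nonneg_of_nonpos hC (monotonicityWeight_nonpos h2 (by linarith)))
  have h6 : Real.exp (C * (f t₂ - f t₁)) = Real.exp (C * f t₂) * Real.exp (-(C * f t₁)) := by
    rw [← Real.exp_add]; ring_nf
  have h7 : 0 ≤ B * Real.exp (3 * C) * (t₂ - t₁) :=
    mul_nonneg (mul_nonneg hB (Real.exp_pos _).le) (sub_nonneg.2 h12)
  have h8 : Real.exp (-(C * f t₂)) * Z t₂
      ≤ Real.exp (-(C * f t₁)) * Z t₁ + B * Real.exp (3 * C) * (t₂ - t₁) := by linarith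
  have h9 := mul_le_mul_of_nonneg_left h8 (Real.exp_pos (C * f t₂)).le
  have h10 := mul_le_mul_of_nonneg_right h5 h7
  rw [h6]
  calc Z t₂ = Real.exp (C * f t₂) * (Real.exp (-(C * f t₂)) * Z t₂) := by
        rw [← mul_assoc, h4, one_mul]
    _ ≤ _ := by linarith

end Gronwall

section Cutoff

variable {n : ℕ} {φ : Eu n → ℝ} {h : Eu n → Mat n}

lemma partialDeriv_eq_zero_of_eqOn_ball {r : ℝ} {a : ℝ} (h1 : ∀ z ∈ Metric.ball (0 : Eu n) r, φ z = a)
    {x : Eu n} (hx : ‖x‖ < r) (p : Fin n) : partialDeriv p φ x = 0 := by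
  rw [partialDeriv_congr p (g := fun _ => a) (Filter.eventually_of_mem
    (Metric.isOpen_ball.mem_nhds (mem_ball_zero_iff.2 hx)) h1), partialDeriv_const]

lemma exists_cutoff_bound (hφ : ContDiff ℝ ∞ φ) {K : Set (Eu n)} (hK : IsCompact K) (c : ℝ) :
    ∃ b, 0 ≤ b ∧ ∀ z ∈ K, φ z ^ 2 ≤ b ∧ 2 * (Real.exp c * ∑ p, partialDeriv p φ z ^ 2)
      + |φ z * ∑ p, z p * partialDeriv p φ z| ≤ b := by
  have hd : ∀ p, Continuous (partialDeriv p φ) := fun p => by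
    have := contDiffOn_partialDeriv isOpen_univ hφ.contDiffOn p
    exact (contDiffOn_univ.1 this).continuous
  have hc := hφ.continuous
  have hcont : Continuous fun z : Eu n => 2 * (Real.exp c * ∑ p, partialDeriv p φ z ^ 2)
      + |φ z * ∑ p, z p * partialDeriv p φ z| := by fun_prop
  obtain ⟨b₁, hb₁⟩ := hK.exists_bound_of_continuousOn (hc.pow 2).continuousOn
  obtain ⟨b₂, hb₂⟩ := hK.exists_bound_of_continuousOn hcont.continuousOn
  refine ⟨max 0 (max b₁ b₂), le_max_left _ _, fun z hz => ⟨?_, ?_⟩⟩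
  · exact ((le_abs_self _).trans (hb₁ z hz)).trans ((le_max_left _ _).trans (le_max_right _ _))
  · exact ((le_abs_self _).trans (hb₂ z hz)).trans ((le_max_right _ _).trans (le_max_right _ _))

/-- The constant `c` of `BoundedAt` in terms of a bound `κ` of the curvature, on a ball of radius
`r < 1`. -/
def radBound (κ r : ℝ) : ℝ := κ + (κ + 2 + 2 / (1 - r)) * (4 * κ)

lemma IsNormal.boundedAt (N : IsNormal h) {κ r b : ℝ} (hκ : 0 ≤ κ) (hr : r < 1)
    (hK : ∀ z ∈ Metric.ball (0 : Eu n) 1, curvNormSq (h z) (fun p q => Coord.curv h p q z) ≤ κ ^ 2)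
    (h1 : ∀ z ∈ Metric.ball (0 : Eu n) (1 / 2), φ z = 1) {x : Eu n} (hx : ‖x‖ ≤ r)
    (hb : φ x ^ 2 ≤ b ∧ 2 * (Real.exp (radBound κ r) * ∑ p, partialDeriv p φ x ^ 2)
      + |φ x * ∑ p, x p * partialDeriv p φ x| ≤ b) : BoundedAt h φ (radBound κ r) κ b x := by
  have hr' : 0 < 1 - r := sub_pos.2 hr
  have hc : 0 ≤ radBound κ r := by rw [radBound]; positivity
  have hP : ∀ z : Eu n, ‖z‖ ≤ r → ∀ w : Fin n → ℝ, |vpair (h z * Coord.radConn h z) w w|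
      ≤ radBound κ r * ‖z‖ ^ 2 * vpair (h z) w w := fun z hz w =>
    N.abs_vpair_radConn_le hκ hr hK hz w
  have hm := fun w => N.vpair_metric_bounds hr hc hP hx w
  exact
    { norm_lt := hx.trans_lt hr
      radConn := hP x hx
      curv := hK x (mem_ball_zero_iff.2 (hx.trans_lt hr))
      metric := fun w => by rw [← Real.exp_neg]; exact (hm w).1
      metric' := fun w => (hm w).2
      cutoff := hb.1
      cutoff_deriv := hb.2
      cutoff_const := fun hx' p => partialDeriv_eq_zero_of_eqOn_ball h1 hx' p }

lemma ComplexFlowOn.mono {Ω : Set (Eu n)} {T T₀ : ℝ} {A : ℝ → Eu n → Mat n}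
    (F : ComplexFlowOn h Ω T A) (hT : T₀ ≤ T) : ComplexFlowOn h Ω T₀ A where
  metric := F.metric
  smooth := fun i j => (F.smooth i j).mono (prod_mono subset_rfl (Ico_subset_Ico_right hT))
  flow := fun x hx t ht i j => (F.flow x hx t ⟨ht.1, ht.2.trans_le hT⟩ i j).mono
    (Ico_subset_Ico_right hT)
  sq := fun t ht => F.sq t ⟨ht.1, ht.2.trans_le hT⟩
  skew := fun t ht => F.skew t ⟨ht.1, ht.2.trans_le hT⟩

end Cutoff

end Coord

section LocalZ

open Coord

variable {n : ℕ} {M : Type*} [TopologicalSpace M] [ChartedSpace (EuclideanSpace ℝ (Fin n)) M]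
  [IsManifold (𝓡 n) ∞ M]

lemma localZ_eq (g : RiemMetric n M) (J : ℝ → EndoField n M)
    (e : OpenPartialHomeomorph M (EuclideanSpace ℝ (Fin n))) (φ : Eu n → ℝ) (T₀ t : ℝ) :
    localZ g J e φ T₀ t = (T₀ - t) * ∫ z in tsupport φ, enDens (metricCoord g e) (endoCoord (J t) e) z
      * (backwardHeatKernel T₀ t z * φ z ^ 2) * volDens (metricCoord g e) z := by
  rw [localZ, setIntegral_eq_integral_of_forall_compl_eq_zero fun z hz => by
    rw [image_eq_zero_of_notMem_tsupport hz]; ring]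
  congr 2
  funext z
  rw [gradNormSq_eq_fpair _ _ _ (metricCoord_symm _), enDens, volDens]
  ring

end LocalZ

end

open Coord in
theorem mainTheorem5 {n : ℕ} {M : Type*} [TopologicalSpace M] [T2Space M] [CompactSpace M]
    [ChartedSpace (EuclideanSpace ℝ (Fin n)) M] [IsManifold (𝓡 n) ∞ M]
    [MeasurableSpace M] [BorelSpace M]
    (g : RiemMetric n M) (hinj : 1 < injectivityRadius g)
    (φ : EuclideanSpace ℝ (Fin n) → ℝ) (hφ : ContDiff ℝ ∞ φ)
    (hφ_supp : tsupport φ ⊆ Metric.ball 0 1) (hφ_one : ∀ x ∈ Metric.ball 0 (1 / 2), φ x = 1) :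
    ∃ C : ℝ, 0 < C ∧
      ∀ (T : ℝ) (J : ℝ → EndoField n M), IsHarmonicHeatFlow g T J →
      ∀ (y : M) (e : OpenPartialHomeomorph M (EuclideanSpace ℝ (Fin n))),
        IsNormalCoordinates g y 1 e →
      ∀ T₀ : ℝ, 0 < T₀ → T₀ ≤ T →
      ∀ t₁ t₂ : ℝ, T₀ - min T₀ 1 < t₁ → t₁ ≤ t₂ → t₂ < T₀ →
      ∀ N : ℝ, 1 < N →
        localZ g J e φ T₀ t₂ ≤
          Real.exp (C * (monotonicityWeight T₀ t₂ - monotonicityWeight T₀ t₁))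
              * localZ g J e φ T₀ t₁
            + C * (N ^ ((n : ℝ) / 2) * (energy g (J 0) + Real.sqrt (energy g (J 0)))
                + 1 / Real.log N ^ 2) * (t₂ - t₁) := by
  obtain ⟨κ, hκ, hcurv⟩ := exists_curvature_bound g
  -- the support of `φ` keeps a distance from the boundary, on which the bounds in normal coordinates
  -- depend
  obtain ⟨r, hr, hrK⟩ := exists_lt_subset_ball (isClosed_tsupport φ) hφ_supp
  have hK : IsCompact (tsupport φ) := (isCompact_closedBall 0 1).of_isClosed_subset
    (isClosed_tsupport φ) (hφ_supp.trans Metric.ball_subset_closedBall)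
  obtain ⟨b, hb0, hb⟩ := exists_cutoff_bound hφ hK (radBound κ r)
  have hc : 0 ≤ radBound κ r := by
    have := sub_pos.2 hr
    rw [radBound]
    positivity
  set C₀ := weightConst n (radBound κ r) κ b (Real.sqrt (Real.exp (radBound κ r) ^ n))
    (volume (tsupport φ)).toReal with hC₀
  have hC₀0 : 0 ≤ C₀ := by
    rw [hC₀, weightConst]
    positivity
  -- Gronwall's inequality multiplies the error by `exp (3 C₀)`, since `f ≥ -3`; adding `1` makes the
  -- constant positive
  refine ⟨C₀ * Real.exp (3 * C₀) + 1, by positivity, ?_⟩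
  intro T J hJ y e he T₀ hT₀ hT t₁ t₂ ht₁ h12 ht₂ N hN
  have hem := he.mem_maximalAtlas
  have hnor := he.isNormal
  have hF : ComplexFlowOn (metricCoord g e) (Metric.ball 0 1) T₀ fun t => endoCoord (J t) e :=
    (he.target_eq ▸ hJ.complexFlowOn hem).mono hT
  have hbd : ∀ z ∈ tsupport φ, BoundedAt (metricCoord g e) φ (radBound κ r) κ b z := fun z hz =>
    hnor.boundedAt hκ hr (fun w hw => hcurv e hem w (he.target_eq ▸ hw)) hφ_one
      (mem_ball_zero_iff.1 (hrK hz)).le (hb z hz)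
  have ht₁0 : 0 < t₁ := by linarith [min_le_left T₀ 1]
  have ht₁1 : T₀ - 1 < t₁ := by linarith [min_le_right T₀ 1]
  have hE0 : 0 ≤ energy g (J 0) := by
    have := hJ.setIntegral_chart_le (t := 0) ⟨le_rfl, hT₀.trans_le hT⟩ hem MeasurableSet.empty
      (empty_subset _)
    simpa using this
  set B := N ^ ((n : ℝ) / 2) * (energy g (J 0) + Real.sqrt (energy g (J 0))) + 1 / Real.log N ^ 2
    with hB
  have hB0 : 0 ≤ B := by
    have : 0 ≤ N := zero_le_one.trans hN.le
    positivity
  have hder : ∀ s ∈ Icc t₁ t₂, IntegrableOn _ (tsupport φ) ∧ HasDerivAt _ _ s := fun s hs =>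
    hF.hasDerivAt_localized hnor hφ.contDiffOn hK hφ_supp
      (fun z hz => image_eq_zero_of_notMem_tsupport hz) ⟨ht₁0.trans_le hs.1, hs.2.trans_lt ht₂⟩
  have hZ := funext fun s => localZ_eq g J e φ T₀ s
  have hG := gronwall_monotonicityWeight (Z := fun s => localZ g J e φ T₀ s) (C := C₀)
    (B := C₀ * B) hC₀0 (mul_nonneg hC₀0 hB0) h12 ht₁1 ht₂ (fun s hs => hZ ▸ (hder s hs).2)
    fun s hs => by
      have hs' : s ∈ Ico 0 T₀ := ⟨(ht₁0.trans_le hs.1).le, hs.2.trans_lt ht₂⟩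
      have := hF.setIntegral_weightDens_le hnor hφ.contDiffOn hK hφ_supp hc hκ hb0 hbd hs'
        (by linarith [hs.1]) (hder s hs).1
        (hJ.setIntegral_chart_le ⟨hs'.1, hs'.2.trans_le hT⟩ hem (isClosed_tsupport φ).measurableSet
          (he.target_eq ▸ hφ_supp)) hN
      rw [← localZ_eq, ← hB, ← hC₀] at this
      linarith
  have hZ0 : 0 ≤ localZ g J e φ T₀ t₁ := by
    rw [localZ_eq]
    have h1 : t₁ < T₀ := h12.trans_lt ht₂
    exact mul_nonneg (sub_pos.2 h1).le (setIntegral_nonneg (isClosed_tsupport φ).measurableSet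
      fun z hz => mul_nonneg (mul_nonneg (fpair_self_nonneg (hnor.metric.posDef z (hφ_supp hz)) _)
        (mul_nonneg (backwardHeatKernel_pos h1).le (sq_nonneg _))) volDens_nonneg)
  have hf := monotonicityWeight_mono h12 ht₂
  have hC1 : C₀ ≤ C₀ * Real.exp (3 * C₀) + 1 := by
    have := le_mul_of_one_le_right hC₀0 (Real.one_le_exp (by positivity : 0 ≤ 3 * C₀))
    linarith
  refine hG.trans (add_le_add (mul_le_mul_of_nonneg_right (Real.exp_le_exp.2
    (mul_le_mul_of_nonneg_right hC1 (sub_nonneg.2 hf))) hZ0) ?_)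
  refine mul_le_mul_of_nonneg_right ?_ (sub_nonneg.2 h12)
  linarith
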